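/- Let $\zeta=x+iy$ be the stereographic coordinate on $S^2\setminus\{\infty\}=\mathbb C$, so that $g_{S^2}=4(dx^2+dy^2)/(1+|\zeta|^2)^2$ and $\mathrm{vol}_{S^2}=4\,dx\wedge dy/(1+|\zeta|^2)^2$. A Weyl structure is given by a metric $g$ and a $1$-form $\omega$; its Weyl connection is the torsion-free connection $D$ with $Dg=-2\omega\otimes g$. It is Einstein-Weyl if the symmetric part of the Ricci tensor of $D$ is pointwise a multiple of $g$. A three-dimensional Einstein-Weyl space is Toda (respectively hyperCR) if it has a weightless unit vector field $\chi$ with $D\chi=\tau(\mathrm{id}-\chi\otimes\chi)+\kappa\,{*\chi}$ and $\kappa=0$ (respectively $\tau=0$). Let $h$ be a holomorphic function on an open set $U\subseteq\mathbb C$, and let $\theta$ be a smooth $1$-form on $U$ with $d\theta=\frac12(h+\bar h)\mathrm{vol}_{S^2}$; put $\beta=dt+\theta$. (If $0\notin U$, one may take $\theta=\frac{i}{1+\zeta\bar\zeta}\bigl(\frac{h\,d\zeta}{\zeta}-\frac{\bar h\,d\bar\zeta}{\bar\zeta}\bigr)$.) On $B_h=\{(\zeta,z):\zeta\in U,\ z+h(\zeta)\neq0\}$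 let $$g=(z+h)(z+\bar h)g_{S^2}+dz^2,\qquad \omega=-\frac{2z+h+\bar h}{(z+h)(z+\bar h)}dz,$$ $$w=\frac{\frac12(h+\bar h)z+h\bar h}{(z+h)(z+\bar h)},\qquad \kappa=\frac{i(h-\bar h)}{2(z+h)(z+\bar h)}.$$ Let $D_h=\{(\zeta,z,t): (\zeta,z)\in B_h,\ w>0\}$ and $M_h=D_h\cap\{z\ne0\}$. Then: 1. $(B_h,g,\omega)$ is an Einstein-Weyl space which is both Toda and hyperCR. The function $w$ is a monopole on it: with $\Theta=\theta-\kappa z\,dz$ one has ${*(dw-\omega w)}=d\Theta$, so this form is closed. 2. The metric $g_K=w\,g+w^{-1}(\beta-\kappa z\,dz)^2$ on $D_h$ is Kähler for some complex structure, its scalar curvature is $0$, and $\partial/\partial t$ is a Killing field preserving the complex structure. 3. On $M_h$ the metric $$g_E=\frac1{z^2}\left[\frac{\frac12(h+\bar h)z+h\bar h}{(z+h)(z+\bar h)}dz^2+\bigl(\tfrac12(h+\bar h)z+h\bar h\bigr)g_{S^2}+\frac{(z+h)(z+\bar h)}{\frac12(h+\bar h)z+h\bar h}(\beta-\kappa z\,dz)^2\right]$$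 equals $z^{-2}g_K$. It is Einstein with $\mathrm{Ric}=-3g_E$, hence has scalar curvature $-12<0$, and it is selfdual for the orientation $dt\wedge dx\wedge dy\wedge dz$. 4. $\partial/\partial t$ is a Killing field of $g_E$. There is a hypercomplex structure on $M_h$, compatible with the conformal class of $g_E$, for which $\partial/\partial t$ is triholomorphic. For generic $h$ the symmetry group is one-dimensional: if $U$ is connected and nonempty, there is a set of holomorphic functions on $U$, open and dense for uniform convergence on compact subsets, such that for every $h$ in it, every admissible $\theta$ and every nonempty connected open $V\subseteq M_h$, each Killing field of $g_E$ on $V$ is a constant multiple of $\partial/\partial t$. 5. On the part of $\{z=0\}$ where $h\ne0$, $g_E$ has a conformal infinity with defining function $z$: there $z^2g_E$ extends smoothly and nondegenerately across $z=0$, and its restriction to $z=0$ is conformal to $|h|^2g_{S^2}+\beta^2$. With the $1$-form $\frac i2(H-\bar H)\beta$, $H=1/h$, this metric is an Einstein-Weyl structure, and $\partial/\partial t$ is a geodesic symmetry of it, i.e. a nowhere zero conformal vector field which preserves the Weyl connection and has geodesic orbits. 6. Let $h=l(1+im)$ be constant with $l,m\in\mathbb R$, $l\neq0$, and $\theta=l\cos\vartheta\,d\varphi$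 on $U=\mathbb C\setminus\{0\}$, where $\zeta=\cot(\vartheta/2)e^{i\varphi}$. The substitution $z=l(1-\rho^2)/\rho^2$, $t=l\psi-\mathrm{Im}\bigl(h\log(\rho^{-2}+im)\bigr)$ maps $\{0<\rho<1,\ 0<\vartheta<\pi\}$ onto $M_h\cap\{lz>0\}$ and pulls $g_E$ back to $4$ times the Pedersen metric $$\frac1{(1-\rho^2)^2}\left[\frac{1+m^2\rho^2}{1+m^2\rho^4}d\rho^2+\frac14\rho^2\left((1+m^2\rho^2)(\sigma_1^2+\sigma_2^2)+\frac{1+m^2\rho^4}{1+m^2\rho^2}\sigma_3^2\right)\right],$$ where $\sigma_1^2+\sigma_2^2=d\vartheta^2+\sin^2\vartheta\,d\varphi^2$ and $\sigma_3=d\psi+\cos\vartheta\,d\varphi$. On the boundary, $\zeta=\cot(\vartheta/2)e^{i\varphi}$, $t=l\psi$ maps $\{0<\vartheta<\pi\}$ onto the whole boundary and pulls the Weyl structure in 5 back to the Berger sphere $l^2(1+m^2)\bigl(\sigma_1^2+\sigma_2^2+a^2\sigma_3^2\bigr)$, $a^2=1/(1+m^2)$, with $1$-form $\frac m{1+m^2}\sigma_3$.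 -/

import Mathlib

noncomputable section

namespace HyperCRToda

open scoped ContDiff

/-! ### Tensor calculus on open subsets of coordinate space -/

/-- Points of coordinate space. -/
abbrev Pt (n : ℕ) := Fin n → ℝ

/-- Symmetric bilinear forms depending on a point, through their component matrices. -/
abbrev Metric (n : ℕ) := Pt n → Matrix (Fin n) (Fin n) ℝ

/-- Vector fields, or 1-forms, through their components. -/
abbrev Field (n : ℕ) := Pt n → Fin n → ℝ

/-- Connection coefficients: `Γ x k i j` is the `k`-th component of `D_{∂_i} ∂_j`. -/
abbrev Conn (n : ℕ) := Pt n → Fin n → Fin n → Fin n → ℝ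

/-- Endomorphism fields: `J x k i` is the `k`-th component of `J ∂_i`. -/
abbrev EndField (n : ℕ) := Pt n → Matrix (Fin n) (Fin n) ℝ

variable {n m : ℕ}

/-- Partial derivative in the `i`-th coordinate direction. -/
def pd (i : Fin n) (f : Pt n → ℝ) (x : Pt n) : ℝ := fderiv ℝ f x (Pi.single i 1)

/-- Smoothness of a vector field or 1-form on `S`. -/
def SmoothField (X : Field n) (S : Set (Pt n)) : Prop :=
  ∀ i, ContDiffOn ℝ ∞ (fun x => X x i) S

/-- Smoothness of a matrix-valued tensor field on `S`. -/
def SmoothMatrix (A : Pt n → Matrix (Fin n) (Fin n) ℝ) (S : Set (Pt n)) : Prop :=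
  ∀ i j, ContDiffOn ℝ ∞ (fun x => A x i j) S

/-- `g` is a smooth Riemannian metric on `S`. -/
def IsRiemannianOn (g : Metric n) (S : Set (Pt n)) : Prop :=
  SmoothMatrix g S ∧ ∀ x ∈ S, (g x).PosDef

/-- Pullback of a bilinear form along a map. -/
def pullback (φ : Pt m → Pt n) (g : Metric n) : Metric m := fun x i j =>
  ∑ k, ∑ l, g (φ x) k l * pd i (fun y => φ y k) x * pd j (fun y => φ y l) x

/-- Pullback of a 1-form along a map. -/
def pullbackForm (φ : Pt m → Pt n) (α : Field n) : Field m := fun x i =>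
  ∑ k, α (φ x) k * pd i (fun y => φ y k) x

/-- Exterior derivative of a 1-form. -/
def extDeriv₁ (α : Field n) (x : Pt n) (i j : Fin n) : ℝ :=
  pd i (fun y => α y j) x - pd j (fun y => α y i) x

/-- Exterior derivative of a 2-form. -/
def extDeriv₂ (F : Pt n → Fin n → Fin n → ℝ) (x : Pt n) (i j k : Fin n) : ℝ :=
  pd i (fun y => F y j k) x + pd j (fun y => F y k i) x + pd k (fun y => F y i j) x

/-- Christoffel symbols of the Levi-Civita connection. -/
def leviCivita (g : Metric n) : Conn n := fun x k i j =>
  (1 / 2) * ∑ l, (g x)⁻¹ k l * (pd i (fun y => g y j l) x + pd j (fun y => g y i l) x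
    - pd l (fun y => g y i j) x)

/-- Curvature of a connection: `R(∂_i, ∂_j) ∂_k = ∑ l, (curvature Γ x l k i j) ∂_l`. -/
def curvature (Γ : Conn n) (x : Pt n) (l k i j : Fin n) : ℝ :=
  pd i (fun y => Γ y l j k) x - pd j (fun y => Γ y l i k) x
    + ∑ r, (Γ x l i r * Γ x r j k - Γ x l j r * Γ x r i k)

/-- Ricci tensor of a connection: the trace of `X ↦ R(X, ∂_j) ∂_k`. -/
def ricci (Γ : Conn n) (x : Pt n) (j k : Fin n) : ℝ := ∑ i, curvature Γ x i k i j

/-- Scalar curvature of a metric. -/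
def scalarCurv (g : Metric n) (x : Pt n) : ℝ :=
  ∑ j, ∑ k, (g x)⁻¹ j k * ricci (leviCivita g) x j k

/-- The Einstein equation `Ric = c g` on `S`. -/
def IsEinsteinOn (g : Metric n) (c : ℝ) (S : Set (Pt n)) : Prop :=
  ∀ x ∈ S, ∀ j k, ricci (leviCivita g) x j k = c * g x j k

/-- The alternating symbol. -/
def altSymbol (f : Fin n → Fin n) : ℝ :=
  Matrix.det (Matrix.of fun a b => if f a = b then (1 : ℝ) else 0)

/-- Riemannian volume form for the orientation in which the coordinates are a positive frame. -/
def volForm (g : Metric n) (x : Pt n) (f : Fin n → Fin n) : ℝ :=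
  √((g x).det) * altSymbol f

/-- Weyl curvature `W(∂_i, ∂_j, ∂_k, ∂_l)` in dimension four, where the first term
is `g(R(∂_i, ∂_j) ∂_k, ∂_l)`. -/
def weyl (g : Metric 4) (x : Pt 4) (i j k l : Fin 4) : ℝ :=
  (∑ r, g x l r * curvature (leviCivita g) x r k i j)
    - (1 / 2) * (ricci (leviCivita g) x j k * g x i l - ricci (leviCivita g) x i k * g x j l
        + g x j k * ricci (leviCivita g) x i l - g x i k * ricci (leviCivita g) x j l)
    + (1 / 6) * scalarCurv g x * (g x j k * g x i l - g x i k * g x j l)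

/-- Selfduality `*W = W` on `S`. For `o = 1` the coordinates are a positive frame, for
`o = -1` a negative one. -/
def IsSelfDualOn (g : Metric 4) (o : ℤˣ) (S : Set (Pt 4)) : Prop :=
  ∀ x ∈ S, ∀ i j k l, weyl g x i j k l = ((o : ℤ) : ℝ) * ((1 / 2) * ∑ p, ∑ q, ∑ r, ∑ s,
    volForm g x ![i, j, p, q] * (g x)⁻¹ p r * (g x)⁻¹ q s * weyl g x r s k l)

/-- Lie derivative of a bilinear form. -/
def lieMetric (X : Field n) (g : Metric n) (x : Pt n) (i j : Fin n) : ℝ :=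
  ∑ k, (X x k * pd k (fun y => g y i j) x + g x k j * pd i (fun y => X y k) x
    + g x i k * pd j (fun y => X y k) x)

/-- `X` is a (smooth) Killing field of `g` on `S`. -/
def IsKillingOn (g : Metric n) (X : Field n) (S : Set (Pt n)) : Prop :=
  SmoothField X S ∧ ∀ x ∈ S, ∀ i j, lieMetric X g x i j = 0

/-- Lie derivative of an endomorphism field. -/
def lieEnd (X : Field n) (J : EndField n) (x : Pt n) (k i : Fin n) : ℝ :=
  ∑ l, (X x l * pd l (fun y => J y k i) x - J x l i * pd l (fun y => X y k) x
    + J x k l * pd i (fun y => X y l) x)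

/-- Nijenhuis tensor. -/
def nijenhuis (J : EndField n) (x : Pt n) (k i j : Fin n) : ℝ :=
  ∑ l, (J x l i * pd l (fun y => J y k j) x - J x l j * pd l (fun y => J y k i) x
    - J x k l * (pd i (fun y => J y l j) x - pd j (fun y => J y l i) x))

/-- `J` is an integrable almost complex structure on `S`. -/
def IsComplexStructureOn (J : EndField n) (S : Set (Pt n)) : Prop :=
  SmoothMatrix J S ∧ (∀ x ∈ S, J x * J x = -1) ∧ ∀ x ∈ S, ∀ k i j, nijenhuis J x k i j = 0

/-- `J` is orthogonal with respect to `g`. -/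
def IsOrthogonalOn (g : Metric n) (J : EndField n) (S : Set (Pt n)) : Prop :=
  ∀ x ∈ S, (J x).transpose * g x * J x = g x

/-- The 2-form `g(J ∂_i, ∂_j)`. -/
def hermitianForm (g : Metric n) (J : EndField n) (x : Pt n) (i j : Fin n) : ℝ :=
  ∑ k, J x k i * g x k j

/-- `(g, J)` is a Kähler structure on `S`. -/
def IsKahlerOn (g : Metric n) (J : EndField n) (S : Set (Pt n)) : Prop :=
  IsRiemannianOn g S ∧ IsComplexStructureOn J S ∧ IsOrthogonalOn g J S ∧
    ∀ x ∈ S, ∀ i j k, extDeriv₂ (hermitianForm g J) x i j k = 0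

/-- `(I₁, I₂, I₃)` is a hypercomplex structure on `S` compatible with the conformal
class of `g`. -/
def IsCompatibleHypercomplexOn (g : Metric n) (I₁ I₂ I₃ : EndField n) (S : Set (Pt n)) : Prop :=
  IsComplexStructureOn I₁ S ∧ IsComplexStructureOn I₂ S ∧ IsComplexStructureOn I₃ S ∧
    (∀ x ∈ S, I₁ x * I₂ x = I₃ x) ∧
    IsOrthogonalOn g I₁ S ∧ IsOrthogonalOn g I₂ S ∧ IsOrthogonalOn g I₃ S

/-- The function `z` cuts out a conformal infinity of `(M, g)`: `z² g` extends to a smooth metric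
`G` on an open set `N` containing `ι '' B`, which is the zero set of the defining function `z`
in `N`, and `G` restricted to this hypersurface is conformal to `γ`. -/
def HasConformalInfinity (g : Metric 4) (M : Set (Pt 4)) (z : Pt 4 → ℝ)
    (ι : Pt 3 → Pt 4) (γ : Metric 3) (B : Set (Pt 3)) : Prop :=
  ∃ (N : Set (Pt 4)) (G : Metric 4), IsOpen N ∧ {p ∈ N | z p ≠ 0} ⊆ M ∧
    ι '' B = {p ∈ N | z p = 0} ∧ Set.InjOn ι B ∧ ContDiffOn ℝ ∞ ι B ∧
    ContDiffOn ℝ ∞ z N ∧ (∀ p ∈ N, z p = 0 → fderiv ℝ z p ≠ 0) ∧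
    IsRiemannianOn G N ∧ (∀ p ∈ N, z p ≠ 0 → G p = z p ^ 2 • g p) ∧
    ∃ c : Pt 3 → ℝ, ∀ b ∈ B, 0 < c b ∧ pullback ι G b = c b • γ b

/-! ### Weyl structures -/

/-- The Weyl connection of `(g, α)`: the torsion-free connection `D` with `D g = -2 α ⊗ g`. -/
def weylConn (g : Metric n) (α : Field n) : Conn n := fun x k i j =>
  leviCivita g x k i j + (if k = j then α x i else 0) + (if k = i then α x j else 0)
    - g x i j * ∑ l, (g x)⁻¹ k l * α x l

/-- `(g, α)` is an Einstein-Weyl structure on `S`: the symmetrized Ricci tensor of the Weyl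
connection is pointwise a multiple of `g`. -/
def IsEinsteinWeylOn (g : Metric n) (α : Field n) (S : Set (Pt n)) : Prop :=
  IsRiemannianOn g S ∧ SmoothField α S ∧ ∀ x ∈ S, ∃ c : ℝ, ∀ i j,
    ricci (weylConn g α) x i j + ricci (weylConn g α) x j i = c * g x i j

/-- The vector field `χ`, a weightless unit vector field written in the gauge `g`, generates a
shear-free geodesic congruence with divergence `τ` and twist `κ`:
`Dχ = τ (id - χ ⊗ χ) + κ *χ`. The summand `- α x i * χ x k` comes from the weight. -/
def IsShearFreeGeodesicOn (g : Metric 3) (α χ : Field 3) (τ κ : Pt 3 → ℝ)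
    (S : Set (Pt 3)) : Prop :=
  SmoothField χ S ∧ ∀ x ∈ S, (∑ i, ∑ j, g x i j * χ x i * χ x j = 1) ∧ ∀ i k,
    pd i (fun y => χ y k) x + ∑ j, weylConn g α x k i j * χ x j - α x i * χ x k
      = τ x * ((if i = k then 1 else 0) - (∑ j, g x i j * χ x j) * χ x k)
        + κ x * ∑ j, ∑ l, volForm g x ![i, j, l] * (g x)⁻¹ j k * χ x l

/-- Toda: Einstein-Weyl with a twist-free shear-free geodesic congruence. -/
def IsTodaOn (g : Metric 3) (α : Field 3) (S : Set (Pt 3)) : Prop :=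
  IsEinsteinWeylOn g α S ∧ ∃ χ τ, IsShearFreeGeodesicOn g α χ τ (fun _ => 0) S

/-- HyperCR: Einstein-Weyl with a divergence-free shear-free geodesic congruence. -/
def IsHyperCROn (g : Metric 3) (α : Field 3) (S : Set (Pt 3)) : Prop :=
  IsEinsteinWeylOn g α S ∧ ∃ χ κ, IsShearFreeGeodesicOn g α χ (fun _ => 0) κ S

/-- The 2-form `*(dw - α w)`, for the orientation in which the coordinates are a positive
frame. -/
def monopoleFlux (g : Metric 3) (α : Field 3) (w : Pt 3 → ℝ) (x : Pt 3) (i j : Fin 3) : ℝ :=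
  ∑ k, ∑ l, volForm g x ![k, i, j] * (g x)⁻¹ k l * (pd l w x - α x l * w x)

/-- `w` is an abelian monopole on `S`: `*(dw - α w)` is closed. -/
def IsMonopoleOn (g : Metric 3) (α : Field 3) (w : Pt 3 → ℝ) (S : Set (Pt 3)) : Prop :=
  ContDiffOn ℝ ∞ w S ∧ ∀ x ∈ S, ∀ i j k, extDeriv₂ (monopoleFlux g α w) x i j k = 0

/-- The 1-form `Θ` is a potential of the monopole `w`: `dΘ = *(dw - α w)`. -/
def IsMonopolePotentialOn (g : Metric 3) (α : Field 3) (w : Pt 3 → ℝ) (Θ : Field 3)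
    (S : Set (Pt 3)) : Prop :=
  SmoothField Θ S ∧ ∀ x ∈ S, ∀ i j, extDeriv₁ Θ x i j = monopoleFlux g α w x i j

/-- The metric `w γ + w⁻¹ (dt + Θ)²` in the coordinates `(x, y, z, t)`. -/
def monopoleMetric (γ : Metric 3) (w : Pt 3 → ℝ) (Θ : Field 3) : Metric 4 := fun p =>
  let q : Pt 3 := ![p 0, p 1, p 2]
  let η : Fin 4 → ℝ := ![Θ q 0, Θ q 1, Θ q 2, 1]
  w q • !![γ q 0 0, γ q 0 1, γ q 0 2, 0; γ q 1 0, γ q 1 1, γ q 1 2, 0;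
      γ q 2 0, γ q 2 1, γ q 2 2, 0; 0, 0, 0, 0]
    + (w q)⁻¹ • Matrix.vecMulVec η η

/-- Lie derivative of a connection. -/
def lieConn (X : Field n) (Γ : Conn n) (x : Pt n) (k i j : Fin n) : ℝ :=
  pd i (fun y => pd j (fun u => X u k) y) x
    + ∑ l, (X x l * pd l (fun y => Γ y k i j) x - Γ x l i j * pd l (fun y => X y k) x
      + Γ x k l j * pd i (fun y => X y l) x + Γ x k i l * pd j (fun y => X y l) x)

/-- `X` is a nowhere zero conformal vector field of `g` which preserves the Weyl connection of
`(g, α)` and whose integral curves are geodesics of it up to parametrization. -/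
def IsGeodesicSymmetryOn (g : Metric n) (α X : Field n) (S : Set (Pt n)) : Prop :=
  SmoothField X S ∧ (∀ x ∈ S, X x ≠ 0) ∧
    (∀ x ∈ S, ∃ c : ℝ, ∀ i j, lieMetric X g x i j = c * g x i j) ∧
    (∀ x ∈ S, ∀ k i j, lieConn X (weylConn g α) x k i j = 0) ∧
    ∀ x ∈ S, ∃ c : ℝ, ∀ k,
      ∑ i, X x i * (pd i (fun y => X y k) x + ∑ j, weylConn g α x k i j * X x j) = c * X x k

/-! ### The hyperCR Toda spaces and the metrics over them

Coordinates: `ζ = x + i y` is the stereographic coordinate on the sphere; the Toda space has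
coordinates `(x, y, z)`, the four-manifold `(x, y, z, t)`, its boundary `(x, y, t)`. -/

/-- The conformal factor `4 / (1 + |ζ|²)²`, so that the spherical metric is this multiple
of `dx² + dy²` and the area form is this multiple of `dx ∧ dy`. -/
def sphereFactor (ζ : ℂ) : ℝ := 4 / (1 + Complex.normSq ζ) ^ 2

/-- The hyperCR Toda space of `h`: the points over `U` with `z + h ≠ 0`. -/
def todaDomain (U : Set ℂ) (h : ℂ → ℂ) : Set (Pt 3) :=
  {q | (⟨q 0, q 1⟩ : ℂ) ∈ U ∧ (q 2 : ℂ) + h ⟨q 0, q 1⟩ ≠ 0}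

/-- `(z + h)(z + h̄)`. -/
def modSq (h : ℂ → ℂ) (q : Pt 3) : ℝ := Complex.normSq ((q 2 : ℂ) + h ⟨q 0, q 1⟩)

/-- `½ (h + h̄) z + h h̄`. -/
def numer (h : ℂ → ℂ) (q : Pt 3) : ℝ :=
  (h ⟨q 0, q 1⟩).re * q 2 + Complex.normSq (h ⟨q 0, q 1⟩)

/-- The metric `(z + h)(z + h̄) g_{S²} + dz²`. -/
def todaMetric (h : ℂ → ℂ) : Metric 3 := fun q =>
  Matrix.diagonal ![modSq h q * sphereFactor ⟨q 0, q 1⟩, modSq h q * sphereFactor ⟨q 0, q 1⟩, 1]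

/-- The Weyl form `-(2z + h + h̄) / ((z + h)(z + h̄)) dz`. -/
def todaForm (h : ℂ → ℂ) : Field 3 := fun q =>
  ![0, 0, -(2 * q 2 + 2 * (h ⟨q 0, q 1⟩).re) / modSq h q]

/-- The monopole `w = (½ (h + h̄) z + h h̄) / ((z + h)(z + h̄))`. -/
def monopole (h : ℂ → ℂ) (q : Pt 3) : ℝ := numer h q / modSq h q

/-- `κ = i (h - h̄) / (2 (z + h)(z + h̄))`. -/
def kappa (h : ℂ → ℂ) (q : Pt 3) : ℝ := -(h ⟨q 0, q 1⟩).im / modSq h q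

/-- `θ` is a smooth 1-form on `U` with `dθ = ½ (h + h̄) vol_{S²}`, so that `β = dt + θ`
satisfies `dβ = ½ (h + h̄) vol_{S²}`. -/
def IsBetaPotential (U : Set ℂ) (h : ℂ → ℂ) (θ : Field 2) : Prop :=
  SmoothField θ {q | (⟨q 0, q 1⟩ : ℂ) ∈ U} ∧ ∀ q : Pt 2, (⟨q 0, q 1⟩ : ℂ) ∈ U →
    extDeriv₁ θ q 0 1 = (h ⟨q 0, q 1⟩).re * sphereFactor ⟨q 0, q 1⟩

/-- The explicit choice `i (h dζ/ζ - h̄ dζ̄/ζ̄) / (1 + ζ ζ̄)`, which is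
`-2 Im (h dζ/ζ) / (1 + ζ ζ̄)`. -/
def standardTheta (h : ℂ → ℂ) : Field 2 := fun q =>
  let ζ : ℂ := ⟨q 0, q 1⟩
  ![-2 * (h ζ / ζ).im / (1 + Complex.normSq ζ), -2 * (h ζ / ζ).re / (1 + Complex.normSq ζ)]

/-- The 1-form `Θ = θ - κ z dz` on the Toda space, so that `dt + Θ = β - κ z dz`. -/
def totalPotential (h : ℂ → ℂ) (θ : Field 2) : Field 3 := fun q =>
  ![θ ![q 0, q 1] 0, θ ![q 0, q 1] 1, -(kappa h q * q 2)]

/-- The points of the four-manifold where the monopole is positive. -/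
def kahlerDomain (U : Set ℂ) (h : ℂ → ℂ) : Set (Pt 4) :=
  {p | ![p 0, p 1, p 2] ∈ todaDomain U h ∧ 0 < monopole h ![p 0, p 1, p 2]}

/-- The scalar-flat Kähler metric of the monopole `w`. -/
def kahlerMetric (h : ℂ → ℂ) (θ : Field 2) : Metric 4 :=
  monopoleMetric (todaMetric h) (monopole h) (totalPotential h θ)

/-- The domain of the Einstein metric. -/
def einsteinDomain (U : Set ℂ) (h : ℂ → ℂ) : Set (Pt 4) := {p ∈ kahlerDomain U h | p 2 ≠ 0}

/-- The metric `z⁻² [ w dz² + (½ (h + h̄) z + h h̄) g_{S²} + w⁻¹ (β - κ z dz)² ]`. -/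
def einsteinMetric (h : ℂ → ℂ) (θ : Field 2) : Metric 4 := fun p =>
  let q : Pt 3 := ![p 0, p 1, p 2]
  let s : ℝ := numer h q * sphereFactor ⟨p 0, p 1⟩
  let η : Fin 4 → ℝ := ![θ ![p 0, p 1] 0, θ ![p 0, p 1] 1, -(kappa h q * p 2), 1]
  (1 / p 2 ^ 2) • (Matrix.diagonal ![s, s, numer h q / modSq h q, 0]
    + (modSq h q / numer h q) • Matrix.vecMulVec η η)

/-- The vector field `∂/∂t`. -/
def partialT : Field 4 := fun _ => ![0, 0, 0, 1]

/-- The boundary `z = 0`, in the coordinates `(x, y, t)`. -/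
def boundaryDomain (U : Set ℂ) (h : ℂ → ℂ) : Set (Pt 3) :=
  {b | (⟨b 0, b 1⟩ : ℂ) ∈ U ∧ h ⟨b 0, b 1⟩ ≠ 0}

/-- The inclusion of the boundary as `z = 0`. -/
def boundaryMap : Pt 3 → Pt 4 := fun b => ![b 0, b 1, 0, b 2]

/-- The 1-form `β = dt + θ` on the boundary. -/
def beta (θ : Field 2) : Field 3 := fun b => ![θ ![b 0, b 1] 0, θ ![b 0, b 1] 1, 1]

/-- The metric `|h|² g_{S²} + β²` on the boundary. -/
def boundaryMetric (h : ℂ → ℂ) (θ : Field 2) : Metric 3 := fun b =>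
  let s : ℝ := Complex.normSq (h ⟨b 0, b 1⟩) * sphereFactor ⟨b 0, b 1⟩
  Matrix.diagonal ![s, s, 0] + Matrix.vecMulVec (beta θ b) (beta θ b)

/-- The Weyl form `(i/2) (H - H̄) β` on the boundary, where `H = 1 / h`. -/
def boundaryForm (h : ℂ → ℂ) (θ : Field 2) : Field 3 := fun b =>
  (-((h ⟨b 0, b 1⟩)⁻¹).im) • beta θ b

/-- The vector field `∂/∂t` on the boundary. -/
def boundaryPartialT : Field 3 := fun _ => ![0, 0, 1]

/-! ### Genericity of holomorphic functions -/

/-- `𝒪` is an open and dense set of holomorphic functions on `U`, for the topology of uniform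
convergence on compact subsets of `U`. -/
def IsOpenDenseHolomorphic (U : Set ℂ) (𝒪 : Set (ℂ → ℂ)) : Prop :=
  (∀ h ∈ 𝒪, DifferentiableOn ℂ h U) ∧
  (∀ h ∈ 𝒪, ∃ K ⊆ U, IsCompact K ∧ ∃ ε > 0, ∀ f : ℂ → ℂ, DifferentiableOn ℂ f U →
    (∀ ζ ∈ K, ‖f ζ - h ζ‖ < ε) → f ∈ 𝒪) ∧
  ∀ h : ℂ → ℂ, DifferentiableOn ℂ h U → ∀ K ⊆ U, IsCompact K → ∀ ε > 0,
    ∃ f ∈ 𝒪, ∀ ζ ∈ K, ‖f ζ - h ζ‖ < ε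

/-! ### Pedersen metrics and Berger spheres -/

/-- The Pedersen metric in the coordinates `(ρ, ϑ, φ, ψ)`, with
`σ₁² + σ₂² = dϑ² + sin² ϑ dφ²` and `σ₃ = dψ + cos ϑ dφ`. -/
def pedersenMetric (m : ℝ) : Metric 4 := fun p =>
  let ρ : ℝ := p 0
  let A : ℝ := 1 + m ^ 2 * ρ ^ 2
  let B : ℝ := 1 + m ^ 2 * ρ ^ 4
  let σ₃ : Fin 4 → ℝ := ![0, 0, Real.cos (p 1), 1]
  (1 / (1 - ρ ^ 2) ^ 2) • (Matrix.diagonal ![A / B, ρ ^ 2 / 4 * A,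
      ρ ^ 2 / 4 * A * Real.sin (p 1) ^ 2, 0]
    + (ρ ^ 2 / 4 * (B / A)) • Matrix.vecMulVec σ₃ σ₃)

/-- The domain of the coordinates `(ρ, ϑ, φ, ψ)` on the punctured ball. -/
def pedersenDomain : Set (Pt 4) :=
  {p | 0 < p 0 ∧ p 0 < 1 ∧ 0 < p 1 ∧ p 1 < Real.pi}

/-- The form `σ₃ = dψ + cos ϑ dφ` in the coordinates `(ϑ, φ, ψ)`. -/
def sigma₃ : Field 3 := fun b => ![0, Real.cos (b 0), 1]

/-- The Berger metric `σ₁² + σ₂² + a² σ₃²` in the coordinates `(ϑ, φ, ψ)`, as a function of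
`a²`. -/
def bergerMetric (aSq : ℝ) : Metric 3 := fun b =>
  Matrix.diagonal ![1, Real.sin (b 0) ^ 2, 0] + aSq • Matrix.vecMulVec (sigma₃ b) (sigma₃ b)

/-- The domain of the coordinates `(ϑ, φ, ψ)` on the sphere. -/
def bergerDomain : Set (Pt 3) := {b | 0 < b 0 ∧ b 0 < Real.pi}

/-- The point `ζ = cot (ϑ/2) e^{iφ}`. -/
def eulerZeta (ϑ φ : ℝ) : ℂ :=
  ((Real.cos (ϑ / 2) / Real.sin (ϑ / 2) : ℝ) : ℂ) * Complex.exp (φ * Complex.I)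

/-- The form `l cos ϑ dφ` on the punctured plane, where `ζ = cot (ϑ/2) e^{iφ}`. -/
def eulerTheta (l : ℝ) : Field 2 := fun q =>
  let r : ℝ := q 0 ^ 2 + q 1 ^ 2
  ![l * ((r - 1) / (r + 1)) * (-(q 1) / r), l * ((r - 1) / (r + 1)) * (q 0 / r)]

/-- The change of coordinates `ζ = cot (ϑ/2) e^{iφ}`, `z = l (1 - ρ²) / ρ²`,
`t = l ψ - Im (c log (ρ⁻² + i m))`, where `c = l (1 + i m)`. -/
def pedersenMap (l m : ℝ) : Pt 4 → Pt 4 := fun p =>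
  ![(eulerZeta (p 1) (p 2)).re, (eulerZeta (p 1) (p 2)).im, l * ((1 - p 0 ^ 2) / p 0 ^ 2),
    l * p 3 - ((l : ℂ) * (1 + m * Complex.I) *
      Complex.log ((((p 0 ^ 2)⁻¹ : ℝ) : ℂ) + m * Complex.I)).im]

/-- The change of coordinates `ζ = cot (ϑ/2) e^{iφ}`, `t = l ψ` on the boundary. -/
def bergerMap (l : ℝ) : Pt 3 → Pt 3 := fun b =>
  ![(eulerZeta (b 0) (b 1)).re, (eulerZeta (b 0) (b 1)).im, l * b 2]

end HyperCRToda

end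

noncomputable section

namespace HyperCRToda

open scoped ContDiff

open Finset (sum_congr sum_comm sum_add_distrib mul_sum sum_mul sum_sub_distrib sum_eq_zero
  sum_neg_distrib)

variable {n m : ℕ}

/-! ### Partial derivatives -/

/-- `F` is differentiable at `x` and its partial derivatives are `D`. -/
def HasD {E : Type*} [NormedAddCommGroup E] [NormedSpace ℝ E] (F : Pt n → E) (D : Fin n → E)
    (x : Pt n) : Prop :=
  DifferentiableAt ℝ F x ∧ ∀ i, fderiv ℝ F x (Pi.single i 1) = D i

section HasD
variable {E : Type*} [NormedAddCommGroup E] [NormedSpace ℝ E] {x : Pt n}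

theorem HasD.pd {f : Pt n → ℝ} {D : Fin n → ℝ} (h : HasD f D x) (i : Fin n) :
    pd i f x = D i := h.2 i

theorem hasD_pd {f : Pt n → ℝ} (h : DifferentiableAt ℝ f x) : HasD f (fun i => pd i f x) x :=
  ⟨h, fun _ => rfl⟩

theorem HasD.diff {F : Pt n → E} {D : Fin n → E} (h : HasD F D x) : DifferentiableAt ℝ F x := h.1

theorem HasFDerivAt.hasD {F : Pt n → E} {L : Pt n →L[ℝ] E} (h : HasFDerivAt F L x) :
    HasD F (fun i => L (Pi.single i 1)) x :=
  ⟨h.differentiableAt, fun i => by rw [h.fderiv]⟩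

theorem HasD.congr_D {F : Pt n → E} {D D' : Fin n → E} (h : HasD F D x) (e : ∀ i, D i = D' i) :
    HasD F D' x := ⟨h.1, fun i => (h.2 i).trans (e i)⟩

theorem HasD.congr_of_eventuallyEq {F G : Pt n → E} {D : Fin n → E} (h : HasD F D x)
    (e : G =ᶠ[nhds x] F) : HasD G D x :=
  ⟨h.1.congr_of_eventuallyEq e, fun i => by rw [e.fderiv_eq]; exact h.2 i⟩

theorem hasD_const (c : E) : HasD (fun _ : Pt n => c) (fun _ => 0) x :=
  ⟨differentiableAt_const _, fun i => by simp⟩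

theorem hasD_coord (k : Fin n) :
    HasD (fun y : Pt n => y k) (fun i => if i = k then (1 : ℝ) else 0) x := by
  refine (HasFDerivAt.hasD (ContinuousLinearMap.proj (R := ℝ) (φ := fun _ => ℝ) k).hasFDerivAt).congr_D ?_
  intro i
  by_cases h : i = k
  · subst h; simp
  · simp [h]

theorem HasD.add {F G : Pt n → E} {D D' : Fin n → E} (h : HasD F D x) (h' : HasD G D' x) :
    HasD (fun y => F y + G y) (fun i => D i + D' i) x := by
  refine (HasFDerivAt.hasD (h.1.hasFDerivAt.add h'.1.hasFDerivAt)).congr_D fun i => ?_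
  simp [h.2, h'.2]

theorem HasD.neg {F : Pt n → E} {D : Fin n → E} (h : HasD F D x) :
    HasD (fun y => -F y) (fun i => -D i) x := by
  refine (HasFDerivAt.hasD (h.1.hasFDerivAt.neg)).congr_D fun i => ?_
  simp [h.2]

theorem HasD.sub {F G : Pt n → E} {D D' : Fin n → E} (h : HasD F D x) (h' : HasD G D' x) :
    HasD (fun y => F y - G y) (fun i => D i - D' i) x := by
  simpa [sub_eq_add_neg] using h.add h'.neg

theorem HasD.sum {ι : Type*} {s : Finset ι} {F : ι → Pt n → E} {D : ι → Fin n → E}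
    (h : ∀ a ∈ s, HasD (F a) (D a) x) :
    HasD (fun y => ∑ a ∈ s, F a y) (fun i => ∑ a ∈ s, D a i) x := by
  have := HasFDerivAt.fun_sum (u := s) (A := F) (A' := fun a => fderiv ℝ (F a) x) (x := x)
    (fun a ha => (h a ha).1.hasFDerivAt)
  refine (HasFDerivAt.hasD this).congr_D fun i => ?_
  simp only [sum_apply]
  exact sum_congr rfl fun a ha => (h a ha).2 i

theorem HasD.mul {A : Type*} [NormedCommRing A] [NormedAlgebra ℝ A] {F G : Pt n → A}
    {D D' : Fin n → A} (h : HasD F D x) (h' : HasD G D' x) :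
    HasD (fun y => F y * G y) (fun i => D i * G x + F x * D' i) x := by
  refine (HasFDerivAt.hasD (h.1.hasFDerivAt.mul h'.1.hasFDerivAt)).congr_D fun i => ?_
  simp [h.2, h'.2]; ring

theorem HasD.pow {A : Type*} [NormedCommRing A] [NormedAlgebra ℝ A] {F : Pt n → A}
    {D : Fin n → A} (h : HasD F D x) (k : ℕ) :
    HasD (fun y => F y ^ k) (fun i => k * F x ^ (k - 1) * D i) x := by
  refine (HasFDerivAt.hasD (h.1.hasFDerivAt.pow k)).congr_D fun i => ?_
  simp [h.2]

theorem HasD.holo {g : ℂ → ℂ} {g' : ℂ} {F : Pt n → ℂ} {D : Fin n → ℂ} (hg : HasDerivAt g g' (F x))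
    (h : HasD F D x) : HasD (fun y => g (F y)) (fun i => g' * D i) x := by
  have := (hg.hasFDerivAt.restrictScalars ℝ).comp x h.1.hasFDerivAt
  refine (HasFDerivAt.hasD this).congr_D fun i => ?_
  simp [h.2, mul_comm]

theorem HasD.real {g : ℝ → ℝ} {g' : ℝ} {F : Pt n → ℝ} {D : Fin n → ℝ} (hg : HasDerivAt g g' (F x))
    (h : HasD F D x) : HasD (fun y => g (F y)) (fun i => g' * D i) x := by
  have := hg.hasFDerivAt.comp x h.1.hasFDerivAt
  refine (HasFDerivAt.hasD this).congr_D fun i => ?_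
  simp [h.2, mul_comm]

theorem HasD.clm {E' : Type*} [NormedAddCommGroup E'] [NormedSpace ℝ E'] (L : E →L[ℝ] E')
    {F : Pt n → E} {D : Fin n → E} (h : HasD F D x) :
    HasD (fun y => L (F y)) (fun i => L (D i)) x := by
  refine (HasFDerivAt.hasD (L.hasFDerivAt.comp x h.1.hasFDerivAt)).congr_D fun i => ?_
  simp [h.2]

theorem HasD.re {F : Pt n → ℂ} {D : Fin n → ℂ} (h : HasD F D x) :
    HasD (fun y => (F y).re) (fun i => (D i).re) x := h.clm Complex.reCLM

theorem HasD.im {F : Pt n → ℂ} {D : Fin n → ℂ} (h : HasD F D x) :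
    HasD (fun y => (F y).im) (fun i => (D i).im) x := h.clm Complex.imCLM

theorem HasD.ofReal {F : Pt n → ℝ} {D : Fin n → ℝ} (h : HasD F D x) :
    HasD (fun y => (F y : ℂ)) (fun i => (D i : ℂ)) x := h.clm Complex.ofRealCLM

theorem HasD.inv {F : Pt n → ℝ} {D : Fin n → ℝ} (h : HasD F D x) (h0 : F x ≠ 0) :
    HasD (fun y => (F y)⁻¹) (fun i => -D i * ((F x)⁻¹) ^ 2) x := by
  refine (HasD.real (hasDerivAt_inv h0) h).congr_D fun i => ?_
  field_simp

theorem HasD.cinv {F : Pt n → ℂ} {D : Fin n → ℂ} (h : HasD F D x) (h0 : F x ≠ 0) :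
    HasD (fun y => (F y)⁻¹) (fun i => -D i * ((F x)⁻¹) ^ 2) x := by
  refine (HasD.holo (hasDerivAt_inv h0) h).congr_D fun i => ?_
  field_simp

theorem HasD.div {F G : Pt n → ℝ} {D D' : Fin n → ℝ} (h : HasD F D x) (h' : HasD G D' x)
    (h0 : G x ≠ 0) :
    HasD (fun y => F y / G y) (fun i => (D i * G x - F x * D' i) / G x ^ 2) x := by
  simp only [div_eq_mul_inv]
  refine (h.mul (h'.inv h0)).congr_D fun i => ?_
  field_simp
  ring

end HasD

theorem pd_congr {f g : Pt n → ℝ} {x : Pt n} (i : Fin n) (e : f =ᶠ[nhds x] g) :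
    pd i f x = pd i g x := by
  unfold pd; rw [e.fderiv_eq]

theorem pd_const (i : Fin n) (c : ℝ) (x : Pt n) : pd i (fun _ => c) x = 0 := by
  simp [pd]

theorem pd_comm {f : Pt n → ℝ} {x : Pt n} (h : ContDiffAt ℝ 2 f x) (i j : Fin n) :
    pd i (pd j f) x = pd j (pd i f) x := by
  have hs := h.isSymmSndFDerivAt (by simp)
  have hd : DifferentiableAt ℝ (fderiv ℝ f) x :=
    (h.fderiv_right (m := 1) (by norm_num)).differentiableAt (by norm_num)
  have key : ∀ i j : Fin n, pd i (pd j f) x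
      = fderiv ℝ (fderiv ℝ f) x (Pi.single i 1) (Pi.single j 1) := by
    intro i j
    have : HasFDerivAt (pd j f)
        ((ContinuousLinearMap.apply ℝ ℝ (Pi.single j 1 : Pt n)).comp (fderiv ℝ (fderiv ℝ f) x)) x :=
      (ContinuousLinearMap.apply ℝ ℝ (Pi.single j 1 : Pt n)).hasFDerivAt.comp x hd.hasFDerivAt
    unfold pd at this ⊢
    rw [this.fderiv]
    simp
  rw [key, key]
  exact hs _ _

theorem contDiffOn_pd {f : Pt n → ℝ} {S : Set (Pt n)} (hS : IsOpen S) (h : ContDiffOn ℝ ∞ f S)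
    (i : Fin n) : ContDiffOn ℝ ∞ (pd i f) S := by
  have h1 : ContDiffOn ℝ ∞ (fderiv ℝ f) S := h.fderiv_of_isOpen hS (by simp)
  exact h1.clm_apply contDiffOn_const

theorem pd_eq_zero_of_invariant {f : Pt n → ℝ} (k : Fin n)
    (h : ∀ (y : Pt n) (c : ℝ), f (y + c • Pi.single k 1) = f y) (x : Pt n) : pd k f x = 0 := by
  by_cases hd : DifferentiableAt ℝ f x
  · have h1 : HasDerivAt (fun c : ℝ => x + c • (Pi.single k 1 : Pt n)) (Pi.single k 1) 0 := by
      simpa using ((hasDerivAt_id (0 : ℝ)).smul_const (Pi.single k 1 : Pt n)).const_add x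
    have h2 : HasDerivAt (fun c : ℝ => f (x + c • (Pi.single k 1 : Pt n)))
        (fderiv ℝ f x (Pi.single k 1)) 0 := by
      have hd' : HasFDerivAt f (fderiv ℝ f x) (x + (0 : ℝ) • (Pi.single k 1 : Pt n)) := by
        simpa using hd.hasFDerivAt
      exact hd'.comp_hasDerivAt (0 : ℝ) h1
    have h3 : (fun c : ℝ => f (x + c • (Pi.single k 1 : Pt n))) = fun _ => f x := by
      funext c; exact h x c
    rw [h3] at h2
    exact h2.unique (hasDerivAt_const _ _)
  · simp [pd, fderiv_zero_of_not_differentiableAt hd]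

/-! ### Exterior derivatives of combinations of forms -/

/-- The components of `α` are differentiable at `x`. -/
def DiffForm (α : Field n) (x : Pt n) : Prop := ∀ i, DifferentiableAt ℝ (fun y => α y i) x

/-- The coefficient of a wedge product. -/
def wedge (α β : Fin n → ℝ) (i j : Fin n) : ℝ := α i * β j - α j * β i

section forms
variable {α β : Field n} {f : Pt n → ℝ} {df : Fin n → ℝ} {x : Pt n}

theorem DiffForm.add (h : DiffForm α x) (h' : DiffForm β x) :
    DiffForm (fun y i => α y i + β y i) x := fun i => (h i).add (h' i)

theorem DiffForm.sub (h : DiffForm α x) (h' : DiffForm β x) :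
    DiffForm (fun y i => α y i - β y i) x := fun i => (h i).sub (h' i)

theorem DiffForm.neg (h : DiffForm α x) : DiffForm (fun y i => -α y i) x := fun i => (h i).neg

theorem DiffForm.smul (hf : DifferentiableAt ℝ f x) (h : DiffForm α x) :
    DiffForm (fun y i => f y * α y i) x := fun i => hf.mul (h i)

theorem extDeriv₁_add (h : DiffForm α x) (h' : DiffForm β x) (i j : Fin n) :
    extDeriv₁ (fun y i => α y i + β y i) x i j = extDeriv₁ α x i j + extDeriv₁ β x i j := by
  simp only [extDeriv₁]
  rw [((hasD_pd (h j)).add (hasD_pd (h' j))).pd, ((hasD_pd (h i)).add (hasD_pd (h' i))).pd]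
  ring

theorem extDeriv₁_neg (h : DiffForm α x) (i j : Fin n) :
    extDeriv₁ (fun y i => -α y i) x i j = -extDeriv₁ α x i j := by
  simp only [extDeriv₁]
  rw [((hasD_pd (h j)).neg).pd, ((hasD_pd (h i)).neg).pd]
  ring

theorem extDeriv₁_sub (h : DiffForm α x) (h' : DiffForm β x) (i j : Fin n) :
    extDeriv₁ (fun y i => α y i - β y i) x i j = extDeriv₁ α x i j - extDeriv₁ β x i j := by
  simp only [extDeriv₁]
  rw [((hasD_pd (h j)).sub (hasD_pd (h' j))).pd, ((hasD_pd (h i)).sub (hasD_pd (h' i))).pd]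
  ring

theorem extDeriv₁_smul (hf : HasD f df x) (h : DiffForm α x) (i j : Fin n) :
    extDeriv₁ (fun y i => f y * α y i) x i j
      = df i * α x j - df j * α x i + f x * extDeriv₁ α x i j := by
  simp only [extDeriv₁]
  rw [(hf.mul (hasD_pd (h j))).pd, (hf.mul (hasD_pd (h i))).pd]
  ring

theorem extDeriv₁_congr (h : ∀ᶠ y in nhds x, ∀ i, α y i = β y i) (i j : Fin n) :
    extDeriv₁ α x i j = extDeriv₁ β x i j := by
  simp only [extDeriv₁]
  rw [pd_congr i (h.mono fun y hy => hy j), pd_congr j (h.mono fun y hy => hy i)]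

theorem extDeriv₁_swap (i j : Fin n) : extDeriv₁ α x i j = -extDeriv₁ α x j i := by
  simp only [extDeriv₁]; ring

end forms

theorem extDeriv₂_extDeriv₁ {α : Field n} {x : Pt n} (h : ∀ i, ContDiffAt ℝ 2 (fun y => α y i) x)
    (i j k : Fin n) : extDeriv₂ (extDeriv₁ α) x i j k = 0 := by
  have hd : ∀ i j, DifferentiableAt ℝ (pd i (fun y => α y j)) x := by
    intro i j
    have := ((h j).fderiv_right (m := 1) (by norm_num)).differentiableAt (by norm_num)
    exact this.clm_apply (differentiableAt_const _)
  have key : ∀ i j k, pd i (fun y => extDeriv₁ α y j k) x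
      = pd i (pd j (fun y => α y k)) x - pd i (pd k (fun y => α y j)) x := fun i j k =>
    ((hasD_pd (hd j k)).sub (hasD_pd (hd k j))).pd i
  simp only [extDeriv₂, key]
  rw [pd_comm (h k) i j, pd_comm (h j) i k, pd_comm (h i) j k]
  ring

/-! ### Smooth matrix fields -/

section smooth
variable {S : Set (Pt n)} {A B : Pt n → Matrix (Fin n) (Fin n) ℝ}

theorem SmoothMatrix.diff (hS : IsOpen S) (h : SmoothMatrix A S) {x : Pt n} (hx : x ∈ S)
    (i j : Fin n) : DifferentiableAt ℝ (fun y => A y i j) x :=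
  ((h i j).contDiffAt (hS.mem_nhds hx)).differentiableAt (by simp)

theorem SmoothMatrix.mul (h : SmoothMatrix A S) (h' : SmoothMatrix B S) :
    SmoothMatrix (fun x => A x * B x) S := fun i j => by
  simp only [Matrix.mul_apply]
  exact ContDiffOn.sum fun k _ => (h i k).mul (h' k j)

theorem SmoothMatrix.det (h : SmoothMatrix A S) : ContDiffOn ℝ ∞ (fun x => (A x).det) S := by
  simp only [Matrix.det_apply']
  exact ContDiffOn.sum fun σ _ => contDiffOn_const.mul (contDiffOn_prod fun i _ => h _ _)

theorem SmoothMatrix.inv (h : SmoothMatrix A S) (hd : ∀ x ∈ S, (A x).det ≠ 0) :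
    SmoothMatrix (fun x => (A x)⁻¹) S := fun i j => by
  have h1 : ContDiffOn ℝ ∞ (fun x => (A x).adjugate i j) S := by
    simp only [Matrix.adjugate_apply]
    refine SmoothMatrix.det fun k l => ?_
    by_cases hk : k = j
    · subst hk; simp only [Matrix.updateRow_self]; exact contDiffOn_const
    · simp only [Matrix.updateRow_ne hk]; exact h k l
  have h2 : ∀ x, (A x)⁻¹ i j = ((A x).det)⁻¹ * (A x).adjugate i j := by
    intro x; rw [Matrix.inv_def]; simp [Ring.inverse_eq_inv']
  simp only [h2]
  exact (h.det.inv hd).mul h1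

theorem contDiffOn_leviCivita {g : Metric n} (hS : IsOpen S) (h : SmoothMatrix g S)
    (hd : ∀ x ∈ S, (g x).det ≠ 0) (k i j : Fin n) :
    ContDiffOn ℝ ∞ (fun x => leviCivita g x k i j) S := by
  unfold leviCivita
  refine contDiffOn_const.mul (ContDiffOn.sum fun l _ => ((h.inv hd) k l).mul ?_)
  exact ((contDiffOn_pd hS (h j l) i).add (contDiffOn_pd hS (h i l) j)).sub
    (contDiffOn_pd hS (h i j) l)

theorem contDiffOn_weylConn {g : Metric n} {α : Field n} (hS : IsOpen S) (h : SmoothMatrix g S)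
    (hα : SmoothField α S) (hd : ∀ x ∈ S, (g x).det ≠ 0) (k i j : Fin n) :
    ContDiffOn ℝ ∞ (fun x => weylConn g α x k i j) S := by
  unfold weylConn
  refine ((((contDiffOn_leviCivita hS h hd k i j).add ?_).add ?_).sub ?_)
  · split_ifs
    exacts [hα i, contDiffOn_const]
  · split_ifs
    exacts [hα j, contDiffOn_const]
  · exact (h i j).mul (ContDiffOn.sum fun l _ => ((h.inv hd) k l).mul (hα l))

end smooth

theorem two_le_infty : (2 : WithTop ℕ∞) ≤ ∞ := WithTop.coe_le_coe.2 le_top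

/-! ### Moving frames -/

/-- `g = φ ∑ₐ eᵃ ⊗ eᵃ` on the open set `S`, for a positive function `φ` and a coframe `e`. -/
structure IsConformalCoframe (g : Metric n) (φ : Pt n → ℝ)
    (e : Pt n → Matrix (Fin n) (Fin n) ℝ) (S : Set (Pt n)) : Prop where
  isOpen : IsOpen S
  smooth_factor : ContDiffOn ℝ ∞ φ S
  pos : ∀ x ∈ S, 0 < φ x
  smooth : SmoothMatrix e S
  det_ne : ∀ x ∈ S, (e x).det ≠ 0
  eq : ∀ x ∈ S, ∀ i j, g x i j = φ x * ∑ a, e x a i * e x a j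

/-- `Γ` is the connection with connection matrices `Ω` in the coframe `e`. -/
def IsFrameConn (Γ : Conn n) (e : Pt n → Matrix (Fin n) (Fin n) ℝ)
    (Ω : Pt n → Fin n → Matrix (Fin n) (Fin n) ℝ) (S : Set (Pt n)) : Prop :=
  ∀ x ∈ S, ∀ a i j, ∑ l, e x a l * Γ x l i j = pd i (fun y => e y a j) x + ∑ b, Ω x i a b * e x b j

/-- The connection matrices of a Weyl connection: a skew part and a multiple of the identity. -/
def weylMatrix (A : Pt n → Fin n → Matrix (Fin n) (Fin n) ℝ) (β : Field n) (x : Pt n) (i : Fin n) :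
    Matrix (Fin n) (Fin n) ℝ := A x i + β x i • 1

/-- The connection with skew part `A` and trace part `β` is torsion-free. -/
def IsTorsionFree (e : Pt n → Matrix (Fin n) (Fin n) ℝ)
    (A : Pt n → Fin n → Matrix (Fin n) (Fin n) ℝ) (β : Field n) (S : Set (Pt n)) : Prop :=
  ∀ x ∈ S, ∀ a i j, extDeriv₁ (fun y => e y a) x i j
    + ∑ b, (A x i a b * e x b j - A x j a b * e x b i) + (β x i * e x a j - β x j * e x a i) = 0

/-- The curvature matrices of the connection matrices `Ω`. -/
def curvMatrix (Ω : Pt n → Fin n → Matrix (Fin n) (Fin n) ℝ) (x : Pt n) (i j a b : Fin n) : ℝ :=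
  extDeriv₁ (fun y k => Ω y k a b) x i j + ∑ c, (Ω x i a c * Ω x j c b - Ω x j a c * Ω x i c b)

section
variable {S : Set (Pt n)} {g : Metric n} {φ : Pt n → ℝ} {e : Pt n → Matrix (Fin n) (Fin n) ℝ}
  {A Ω : Pt n → Fin n → Matrix (Fin n) (Fin n) ℝ} {α β : Field n} {Γ : Conn n} {x : Pt n}

theorem weylMatrix_mul (A : Pt n → Fin n → Matrix (Fin n) (Fin n) ℝ) (β : Field n) (x : Pt n)
    (i a j : Fin n) :
    ∑ b, weylMatrix A β x i a b * e x b j = (∑ b, A x i a b * e x b j) + β x i * e x a j := by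
  simp [weylMatrix, add_mul, sum_add_distrib, Matrix.one_apply]

namespace IsConformalCoframe

theorem smooth_metric (h : IsConformalCoframe g φ e S) : SmoothMatrix g S := fun i j =>
  (h.smooth_factor.mul (ContDiffOn.sum fun a _ => (h.smooth a i).mul (h.smooth a j))).congr
    fun x hx => h.eq x hx i j

theorem metric_eq (h : IsConformalCoframe g φ e S) (hx : x ∈ S) :
    g x = φ x • ((e x).transpose * e x) := by
  ext i j
  simp [h.eq x hx, Matrix.mul_apply]

theorem posDef (h : IsConformalCoframe g φ e S) (hx : x ∈ S) : (g x).PosDef := by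
  rw [h.metric_eq hx]
  have hu : IsUnit (e x) := by
    rw [Matrix.isUnit_iff_isUnit_det]; exact isUnit_iff_ne_zero.mpr (h.det_ne x hx)
  have : ((e x).transpose * e x).PosDef := by
    have := Matrix.PosDef.conjTranspose_mul_self (e x) (Matrix.mulVec_injective_of_isUnit hu)
    rwa [Matrix.conjTranspose_eq_transpose_of_trivial] at this
  exact this.smul (h.pos x hx)

theorem isRiemannianOn (h : IsConformalCoframe g φ e S) : IsRiemannianOn g S :=
  ⟨h.smooth_metric, fun _ hx => h.posDef hx⟩

theorem det_metric_ne (h : IsConformalCoframe g φ e S) (hx : x ∈ S) : (g x).det ≠ 0 :=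
  (h.posDef hx).det_pos.ne'

theorem symm (h : IsConformalCoframe g φ e S) (hx : x ∈ S) (i j : Fin n) : g x i j = g x j i := by
  rw [h.eq x hx, h.eq x hx]
  congr 1
  exact sum_congr rfl fun a _ => mul_comm _ _

theorem inv_metric (h : IsConformalCoframe g φ e S) (hx : x ∈ S) :
    (g x)⁻¹ = (φ x)⁻¹ • ((e x)⁻¹ * ((e x)⁻¹).transpose) := by
  have hu : IsUnit (e x).det := isUnit_iff_ne_zero.mpr (h.det_ne x hx)
  have hp := (h.pos x hx).ne'
  apply Matrix.inv_eq_right_inv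
  rw [h.metric_eq hx, smul_mul_smul_comm, mul_inv_cancel₀ hp, one_smul, Matrix.mul_assoc,
    ← Matrix.mul_assoc (e x), Matrix.mul_nonsing_inv _ hu, Matrix.one_mul, ← Matrix.transpose_mul,
    Matrix.nonsing_inv_mul _ hu, Matrix.transpose_one]

theorem hasD_metric (h : IsConformalCoframe g φ e S) (hx : x ∈ S) (j k : Fin n) :
    HasD (fun y => g y j k) (fun i => pd i φ x * (∑ a, e x a j * e x a k)
      + φ x * ∑ a, (pd i (fun y => e y a j) x * e x a k + e x a j * pd i (fun y => e y a k) x)) x := by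
  have hd := fun a j => hasD_pd (h.smooth.diff h.isOpen hx a j)
  have hf := hasD_pd ((h.smooth_factor.contDiffAt (h.isOpen.mem_nhds hx)).differentiableAt (by simp))
  have := hf.mul (HasD.sum (s := Finset.univ) fun a _ => (hd a j).mul (hd a k))
  refine this.congr_of_eventuallyEq ?_
  filter_upwards [h.isOpen.mem_nhds hx] with y hy using h.eq y hy j k

/-- Compatibility of the connection with the conformal structure, in a coframe. -/
theorem sum_frame_add (h : IsConformalCoframe g φ e S)
    (hA : ∀ x ∈ S, ∀ i a b, A x i a b = -A x i b a)
    (hβ : ∀ x ∈ S, ∀ i, pd i φ x + 2 * φ x * α x i = 2 * φ x * β x i)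
    (hx : x ∈ S) (i j k : Fin n) :
    φ x * ∑ a, (pd i (fun y => e y a j) x + ∑ b, weylMatrix A β x i a b * e x b j) * e x a k
      + φ x * ∑ a, (pd i (fun y => e y a k) x + ∑ b, weylMatrix A β x i a b * e x b k) * e x a j
      = pd i (fun y => g y j k) x + 2 * α x i * g x j k := by
  have h0 : ∑ a, (∑ b, A x i a b * e x b j) * e x a k
      + ∑ a, (∑ b, A x i a b * e x b k) * e x a j = 0 := by
    simp only [sum_mul]
    rw [sum_comm (f := fun a b => A x i a b * e x b k * e x a j),
      ← sum_add_distrib]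
    refine sum_eq_zero fun a _ => ?_
    rw [← sum_add_distrib]
    refine sum_eq_zero fun b _ => ?_
    rw [hA x hx i b a]; ring
  rw [(h.hasD_metric hx j k).pd, h.eq x hx]
  have h1 : ∀ j k, ∑ a, (pd i (fun y => e y a j) x + ∑ b, weylMatrix A β x i a b * e x b j)
      * e x a k = ∑ a, pd i (fun y => e y a j) x * e x a k
      + ∑ a, (∑ b, A x i a b * e x b j) * e x a k + β x i * ∑ a, e x a j * e x a k := by
    intro j k
    simp only [weylMatrix_mul, add_mul, sum_add_distrib, mul_sum]
    rw [← add_assoc]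
    simp only [mul_assoc]
  have h2 : ∑ a, e x a k * e x a j = ∑ a, e x a j * e x a k :=
    sum_congr rfl fun a _ => mul_comm _ _
  have h3 : ∑ a, e x a j * pd i (fun y => e y a k) x
      = ∑ a, pd i (fun y => e y a k) x * e x a j :=
    sum_congr rfl fun a _ => mul_comm _ _
  rw [h1, h1, h2, sum_add_distrib, h3]
  linear_combination φ x * h0 - (∑ a, e x a j * e x a k) * hβ x hx i

/-- The Weyl connection in a conformal coframe. -/
theorem weylConn (h : IsConformalCoframe g φ e S)
    (hA : ∀ x ∈ S, ∀ i a b, A x i a b = -A x i b a)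
    (hβ : ∀ x ∈ S, ∀ i, pd i φ x + 2 * φ x * α x i = 2 * φ x * β x i)
    (hT : IsTorsionFree e A β S) :
    IsFrameConn (weylConn g α) e (weylMatrix A β) S := by
  intro x hx a i j
  set F : Fin n → Fin n → Fin n → ℝ := fun a i j =>
    pd i (fun y => e y a j) x + ∑ b, weylMatrix A β x i a b * e x b j with hF
  have hFs : ∀ a i j, F a i j = F a j i := by
    intro a i j
    have := hT x hx a i j
    simp only [hF, weylMatrix_mul, extDeriv₁, sum_sub_distrib] at this ⊢
    linarith
  have hS : ∀ i j k, φ x * ∑ a, F a i j * e x a k + φ x * ∑ a, F a i k * e x a j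
      = pd i (fun y => g y j k) x + 2 * α x i * g x j k := fun i j k =>
    h.sum_frame_add hA hβ hx i j k
  have hgi : ∀ (k : Fin n) (v : Fin n → ℝ), ∑ l, g x k l * ∑ r, (g x)⁻¹ l r * v r = v k := by
    intro k v
    have := congrFun (congrArg (fun M => Matrix.mulVec M v) (Matrix.mul_nonsing_inv (g x)
      (isUnit_iff_ne_zero.mpr (h.det_metric_ne hx)))) k
    rw [← Matrix.mulVec_mulVec, Matrix.one_mulVec] at this
    exact this
  have hW : ∀ i j k, ∑ l, g x k l * HyperCRToda.weylConn g α x l i j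
      = (1 / 2) * (pd i (fun y => g y j k) x + pd j (fun y => g y i k) x
        - pd k (fun y => g y i j) x) + g x k j * α x i + g x k i * α x j - g x i j * α x k := by
    intro i j k
    have hL : ∑ l, g x k l * HyperCRToda.leviCivita g x l i j
        = (1 / 2) * (pd i (fun y => g y j k) x + pd j (fun y => g y i k) x
          - pd k (fun y => g y i j) x) := by
      rw [← hgi k (fun l => pd i (fun y => g y j l) x + pd j (fun y => g y i l) x
        - pd l (fun y => g y i j) x), mul_sum]
      exact sum_congr rfl fun l _ => by rw [HyperCRToda.leviCivita]; ring
    simp only [HyperCRToda.weylConn, mul_add, mul_sub, sum_add_distrib,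
      sum_sub_distrib, hL]
    congr 1
    · congr 1
      · congr 1
        · simp
      · simp
    · rw [← hgi k (fun l => α x l), mul_sum]
      exact sum_congr rfl fun l _ => by ring
  have hgs := h.symm hx
  have hpg : ∀ k i j, pd k (fun y => g y i j) x = pd k (fun y => g y j i) x := fun k i j =>
    pd_congr k (by filter_upwards [h.isOpen.mem_nhds hx] with y hy using h.symm hy i j)
  have hFsum : ∀ i j k, ∑ a, F a i j * e x a k = ∑ a, F a j i * e x a k := fun i j k =>
    sum_congr rfl fun a _ => by rw [hFs]
  have hST : ∀ k, φ x * ∑ a, F a i j * e x a k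
      = ∑ l, g x k l * HyperCRToda.weylConn g α x l i j := by
    intro k
    rw [hW]
    have h1 := hS i j k
    have h2 := hS j i k
    have h3 := hS k i j
    rw [hFsum j i k] at h2
    rw [hFsum k i j, hFsum k j i] at h3
    rw [hgs k i, hgs k j]
    linarith
  have hv : Matrix.vecMul (fun a => (∑ l, e x a l * HyperCRToda.weylConn g α x l i j) - F a i j) (e x)
      = 0 := by
    funext k
    have hk := hST k
    have : ∑ l, g x k l * HyperCRToda.weylConn g α x l i j
        = φ x * ∑ a, (∑ l, e x a l * HyperCRToda.weylConn g α x l i j) * e x a k := by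
      simp only [h.eq x hx, sum_mul, mul_sum]
      rw [sum_comm]
      exact sum_congr rfl fun a _ => sum_congr rfl fun l _ => by ring
    rw [this] at hk
    have hk' := mul_left_cancel₀ (h.pos x hx).ne' hk
    simp only [Matrix.vecMul, dotProduct, sub_mul, sum_sub_distrib, Pi.zero_apply]
    linarith
  have := congrFun (Matrix.eq_zero_of_vecMul_eq_zero (h.det_ne x hx) hv) a
  simp only [Pi.zero_apply] at this
  linarith

theorem leviCivita (h : IsConformalCoframe g φ e S)
    (hA : ∀ x ∈ S, ∀ i a b, A x i a b = -A x i b a)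
    (hβ : ∀ x ∈ S, ∀ i, pd i φ x = 2 * φ x * β x i)
    (hT : IsTorsionFree e A β S) :
    IsFrameConn (leviCivita g) e (weylMatrix A β) S := by
  have := h.weylConn (α := 0) hA (by simpa using hβ) hT
  have h0 : HyperCRToda.weylConn g 0 = HyperCRToda.leviCivita g := by
    funext x k i j; simp [HyperCRToda.weylConn]
  rwa [h0] at this

end IsConformalCoframe

/-- The components of a vector determine it. -/
theorem frame_ext (hd : (e x).det ≠ 0) {v w : Fin n → ℝ}
    (h : ∀ a, ∑ l, e x a l * v l = ∑ l, e x a l * w l) : v = w := by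
  have : Matrix.mulVec (e x) (v - w) = 0 := by
    funext a
    have := h a
    simp only [Matrix.mulVec, dotProduct, Pi.sub_apply, mul_sub, sum_sub_distrib,
      Pi.zero_apply]
    linarith
  exact sub_eq_zero.mp (Matrix.eq_zero_of_mulVec_eq_zero hd this)

theorem IsFrameConn.symm (h : IsFrameConn Γ e (weylMatrix A β) S) (hT : IsTorsionFree e A β S)
    (hd : ∀ x ∈ S, (e x).det ≠ 0) (hx : x ∈ S) (k i j : Fin n) : Γ x k i j = Γ x k j i := by
  refine congrFun (frame_ext (hd x hx) (v := fun k => Γ x k i j) (w := fun k => Γ x k j i) ?_) k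
  intro a
  rw [h x hx, h x hx]
  have := hT x hx a i j
  simp only [weylMatrix_mul, extDeriv₁, sum_sub_distrib] at this ⊢
  linarith

/-- The curvature of a connection from its connection matrices in a coframe. -/
theorem IsFrameConn.curvature (h : IsFrameConn Γ e Ω S) (hS : IsOpen S) (he : SmoothMatrix e S)
    (hΓ : ∀ k i j, ∀ x ∈ S, DifferentiableAt ℝ (fun y => Γ y k i j) x)
    (hΩ : ∀ i a b, ∀ x ∈ S, DifferentiableAt ℝ (fun y => Ω y i a b) x)
    (hx : x ∈ S) (a i j k : Fin n) :
    ∑ l, e x a l * curvature Γ x l k i j = ∑ b, curvMatrix Ω x i j a b * e x b k := by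
  have hde := fun a j => hasD_pd (he.diff hS hx a j)
  have hdde : ∀ a i j, HasD (fun y => pd i (fun y => e y a j) y)
      (fun k => pd k (fun y => pd i (fun y => e y a j) y) x) x := fun a i j =>
    hasD_pd (((contDiffOn_pd hS (he a j) i).contDiffAt (hS.mem_nhds hx)).differentiableAt
      (by norm_num))
  have hG := fun k i j => hasD_pd (hΓ k i j x hx)
  have hw := fun i a b => hasD_pd (hΩ i a b x hx)
  have hcomm : ∀ a i j k, pd i (fun y => pd j (fun y => e y a k) y) x
      = pd j (fun y => pd i (fun y => e y a k) y) x := fun a i j k =>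
    pd_comm (((he a k).contDiffAt (hS.mem_nhds hx)).of_le two_le_infty) i j
  have hrel : ∀ a i j k, ∑ l, (pd i (fun y => e y a l) x * Γ x l j k
        + e x a l * pd i (fun y => Γ y l j k) x)
      = pd i (fun y => pd j (fun y => e y a k) y) x
        + ∑ b, (pd i (fun y => Ω y j a b) x * e x b k + Ω x j a b * pd i (fun y => e y b k) x) := by
    intro a i j k
    have h1 := HasD.sum (s := Finset.univ) fun l _ => (hde a l).mul (hG l j k)
    have h2 := (hdde a j k).add (HasD.sum (s := Finset.univ) fun b _ => (hw j a b).mul (hde b k))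
    rw [← h1.pd i, ← h2.pd i]
    exact pd_congr i (by filter_upwards [hS.mem_nhds hx] with y hy using h y hy a j k)
  set E : Matrix (Fin n) (Fin n) ℝ := e x
  set dE : Fin n → Matrix (Fin n) (Fin n) ℝ := fun i => Matrix.of fun a k => pd i (fun y => e y a k) x
  set ddE : Fin n → Fin n → Matrix (Fin n) (Fin n) ℝ := fun i j =>
    Matrix.of fun a k => pd i (fun y => pd j (fun y => e y a k) y) x
  set G : Fin n → Matrix (Fin n) (Fin n) ℝ := fun i => Matrix.of fun l k => Γ x l i k
  set dG : Fin n → Fin n → Matrix (Fin n) (Fin n) ℝ := fun i j =>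
    Matrix.of fun l k => pd i (fun y => Γ y l j k) x
  set dW : Fin n → Fin n → Matrix (Fin n) (Fin n) ℝ := fun i j =>
    Matrix.of fun a b => pd i (fun y => Ω y j a b) x
  have r1 : ∀ i, E * G i = dE i + Ω x i * E := by
    intro i; ext a k
    simp only [Matrix.mul_apply, Matrix.add_apply]
    exact h x hx a i k
  have r2 : ∀ i j, dE i * G j + E * dG i j = ddE i j + (dW i j * E + Ω x j * dE i) := by
    intro i j; ext a k
    have := hrel a i j k
    simp only [sum_add_distrib] at this
    simp only [Matrix.mul_apply, Matrix.add_apply]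
    exact this
  have r3 : ddE i j = ddE j i := by ext a k; exact hcomm a i j k
  have key : E * (dG i j - dG j i + (G i * G j - G j * G i))
      = (dW i j - dW j i + (Ω x i * Ω x j - Ω x j * Ω x i)) * E := by
    have t1 : E * (G i * G j) = dE i * G j + Ω x i * (dE j + Ω x j * E) := by
      rw [← Matrix.mul_assoc, r1 i, Matrix.add_mul, Matrix.mul_assoc, r1 j]
    have t2 : E * (G j * G i) = dE j * G i + Ω x j * (dE i + Ω x i * E) := by
      rw [← Matrix.mul_assoc, r1 j, Matrix.add_mul, Matrix.mul_assoc, r1 i]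
    have t3 := r2 i j
    have t4 := r2 j i
    have t3' : E * dG i j = ddE i j + (dW i j * E + Ω x j * dE i) - dE i * G j := by
      rw [← t3]; abel
    have t4' : E * dG j i = ddE j i + (dW j i * E + Ω x i * dE j) - dE j * G i := by
      rw [← t4]; abel
    rw [Matrix.mul_add, Matrix.mul_sub, Matrix.mul_sub, t1, t2, t3', t4', r3]
    noncomm_ring
  have := congrFun (congrFun key a) k
  simp only [Matrix.mul_apply, Matrix.add_apply, Matrix.sub_apply] at this
  simp only [curvMatrix, HyperCRToda.curvature, extDeriv₁, sum_sub_distrib]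
  exact this

/-- The first Bianchi identity. -/
theorem bianchi (hS : IsOpen S) (hs : ∀ x ∈ S, ∀ k i j, Γ x k i j = Γ x k j i)
    (hx : x ∈ S) (l i j k : Fin n) :
    curvature Γ x l k i j + curvature Γ x l i j k + curvature Γ x l j k i = 0 := by
  have hp : ∀ p i j, pd p (fun y => Γ y l i j) x = pd p (fun y => Γ y l j i) x := fun p i j =>
    pd_congr p (by filter_upwards [hS.mem_nhds hx] with y hy using hs y hy l i j)
  simp only [curvature, sum_sub_distrib]
  rw [hp i j k, hp j i k, hp k i j]
  have hq : ∀ i j k, ∑ r, Γ x l i r * Γ x r j k = ∑ r, Γ x l i r * Γ x r k j := fun i j k =>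
    sum_congr rfl fun r _ => by rw [hs x hx r j k]
  rw [hq i j k, hq j i k, hq k i j]
  ring

/-- The Ricci tensor of a connection from the components of its curvature in a coframe. -/
theorem ricci_of_frame {K : Fin n → Fin n → Fin n → Fin n → ℝ} (hd : (e x).det ≠ 0)
    (h : ∀ a i j k, ∑ l, e x a l * curvature Γ x l k i j
      = ∑ b, (∑ c, ∑ d, K a b c d * e x c i * e x d j) * e x b k) (j k : Fin n) :
    ricci Γ x j k = ∑ b, ∑ d, (∑ a, K a b a d) * e x b k * e x d j := by
  have hu : IsUnit (e x).det := isUnit_iff_ne_zero.mpr hd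
  have hE : (e x)⁻¹ * e x = 1 := Matrix.nonsing_inv_mul _ hu
  have hE' : e x * (e x)⁻¹ = 1 := Matrix.mul_nonsing_inv _ hu
  have hc : ∀ i, curvature Γ x i k i j
      = ∑ a, (e x)⁻¹ i a * ∑ b, (∑ c, ∑ d, K a b c d * e x c i * e x d j) * e x b k := by
    intro i
    have : (fun l => curvature Γ x l k i j) = Matrix.mulVec ((e x)⁻¹)
        (Matrix.mulVec (e x) (fun l => curvature Γ x l k i j)) := by
      rw [Matrix.mulVec_mulVec, hE, Matrix.one_mulVec]
    rw [congrFun this i]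
    simp only [Matrix.mulVec, dotProduct, h]
  set f : Matrix (Fin n) (Fin n) ℝ := Matrix.of fun a c => ∑ b, ∑ d, K a b c d * e x b k * e x d j
  have hf : ∀ a i, ∑ b, (∑ c, ∑ d, K a b c d * e x c i * e x d j) * e x b k = (f * e x) a i := by
    intro a i
    simp only [f, Matrix.mul_apply, Matrix.of_apply, sum_mul]
    rw [sum_comm]
    exact sum_congr rfl fun c _ => sum_congr rfl fun b _ =>
      sum_congr rfl fun d _ => by ring
  have ht : ricci Γ x j k = Matrix.trace ((e x)⁻¹ * (f * e x)) := by
    simp only [ricci, hc, hf, Matrix.trace, Matrix.diag, Matrix.mul_apply (M := (e x)⁻¹)]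
  rw [ht, Matrix.trace_mul_comm, Matrix.mul_assoc, hE', Matrix.mul_one]
  simp only [Matrix.trace, Matrix.diag, f, Matrix.of_apply, sum_mul]
  rw [sum_comm]
  exact sum_congr rfl fun b _ => sum_comm

end

/-! ### Parallel endomorphisms -/

/-- The endomorphism field with components `J` in the coframe `e`. -/
def frameEnd (e J : Pt n → Matrix (Fin n) (Fin n) ℝ) : EndField n := fun x => (e x)⁻¹ * J x * e x

/-- The connection with connection matrices `Ω` in the coframe `e`. -/
def frameConn (e : Pt n → Matrix (Fin n) (Fin n) ℝ)
    (Ω : Pt n → Fin n → Matrix (Fin n) (Fin n) ℝ) : Conn n := fun x k i j =>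
  ∑ a, (e x)⁻¹ k a * (pd i (fun y => e y a j) x + ∑ b, Ω x i a b * e x b j)

/-- `J` is parallel for the connection matrices `Ω`. -/
def IsParallel (J : Pt n → Matrix (Fin n) (Fin n) ℝ)
    (Ω : Pt n → Fin n → Matrix (Fin n) (Fin n) ℝ) (S : Set (Pt n)) : Prop :=
  ∀ x ∈ S, ∀ i a b, pd i (fun y => J y a b) x + (Ω x i * J x - J x * Ω x i) a b = 0

section
variable {S : Set (Pt n)} {g : Metric n} {φ : Pt n → ℝ} {e J : Pt n → Matrix (Fin n) (Fin n) ℝ}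
  {A Ω : Pt n → Fin n → Matrix (Fin n) (Fin n) ℝ} {α β : Field n} {Γ : Conn n} {x : Pt n}

theorem isFrameConn_frameConn (hd : ∀ x ∈ S, (e x).det ≠ 0) :
    IsFrameConn (frameConn e Ω) e Ω S := by
  intro x hx a i j
  have hu : IsUnit (e x).det := isUnit_iff_ne_zero.mpr (hd x hx)
  have := congrFun (congrArg (fun M => Matrix.mulVec M
    (fun a => pd i (fun y => e y a j) x + ∑ b, Ω x i a b * e x b j))
    (Matrix.mul_nonsing_inv (e x) hu)) a
  rw [← Matrix.mulVec_mulVec, Matrix.one_mulVec] at this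
  exact this

theorem coframe_mul_frameEnd (hd : (e x).det ≠ 0) : e x * frameEnd e J x = J x * e x := by
  have hu : IsUnit (e x).det := isUnit_iff_ne_zero.mpr hd
  rw [frameEnd, ← Matrix.mul_assoc, ← Matrix.mul_assoc, Matrix.mul_nonsing_inv _ hu, Matrix.one_mul]

theorem smoothMatrix_frameEnd (he : SmoothMatrix e S) (hd : ∀ x ∈ S, (e x).det ≠ 0)
    (hJ : SmoothMatrix J S) : SmoothMatrix (frameEnd e J) S :=
  ((he.inv hd).mul hJ).mul he

theorem frameEnd_mul (J' : Pt n → Matrix (Fin n) (Fin n) ℝ) (hd : (e x).det ≠ 0) :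
    frameEnd e J x * frameEnd e J' x = frameEnd e (fun y => J y * J' y) x := by
  rw [frameEnd, Matrix.mul_assoc, coframe_mul_frameEnd hd, frameEnd]
  simp only [Matrix.mul_assoc]

theorem frameEnd_neg_one (hd : (e x).det ≠ 0) (h : J x = -1) : frameEnd e J x = -1 := by
  have hu : IsUnit (e x).det := isUnit_iff_ne_zero.mpr hd
  simp [frameEnd, h, Matrix.nonsing_inv_mul _ hu]

/-- The covariant derivative of an endomorphism which is parallel in the coframe vanishes. -/
theorem pd_frameEnd (h : IsFrameConn Γ e Ω S) (hS : IsOpen S) (he : SmoothMatrix e S)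
    (hd : ∀ x ∈ S, (e x).det ≠ 0) (hJ : SmoothMatrix J S) (hp : IsParallel J Ω S) (hx : x ∈ S)
    (i k j : Fin n) : pd i (fun y => frameEnd e J y k j) x
      = ∑ l, frameEnd e J x k l * Γ x l i j - ∑ l, Γ x k i l * frameEnd e J x l j := by
  have hu : IsUnit (e x).det := isUnit_iff_ne_zero.mpr (hd x hx)
  have hC := smoothMatrix_frameEnd he hd hJ
  have hde := fun a j => hasD_pd (he.diff hS hx a j)
  have hdC := fun a j => hasD_pd (hC.diff hS hx a j)
  have hdJ := fun a j => hasD_pd (hJ.diff hS hx a j)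
  set E : Matrix (Fin n) (Fin n) ℝ := e x
  set C : Matrix (Fin n) (Fin n) ℝ := frameEnd e J x
  set dE : Matrix (Fin n) (Fin n) ℝ := Matrix.of fun a k => pd i (fun y => e y a k) x
  set dC : Matrix (Fin n) (Fin n) ℝ := Matrix.of fun a k => pd i (fun y => frameEnd e J y a k) x
  set dJ : Matrix (Fin n) (Fin n) ℝ := Matrix.of fun a k => pd i (fun y => J y a k) x
  set G : Matrix (Fin n) (Fin n) ℝ := Matrix.of fun l k => Γ x l i k
  have r1 : dE = E * G - Ω x i * E := by
    ext a k
    have := h x hx a i k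
    simp only [Matrix.sub_apply, Matrix.mul_apply]
    exact eq_sub_of_add_eq this.symm
  have r2 : dJ = J x * Ω x i - Ω x i * J x := by
    ext a b
    have := hp x hx i a b
    simp only [Matrix.sub_apply] at this ⊢
    change pd i (fun y => J y a b) x = _
    linarith
  have r3 : E * C = J x * E := coframe_mul_frameEnd (hd x hx)
  have r4 : dE * C + E * dC = dJ * E + J x * dE := by
    ext a k
    have h1 := HasD.sum (s := Finset.univ) fun l _ => (hde a l).mul (hdC l k)
    have h2 := HasD.sum (s := Finset.univ) fun l _ => (hdJ a l).mul (hde l k)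
    have h3 := h1.pd i
    have h4 := h2.pd i
    have h5 : pd i (fun y => ∑ l, e y a l * frameEnd e J y l k) x
        = pd i (fun y => ∑ l, J y a l * e y l k) x := by
      refine pd_congr i ?_
      filter_upwards [hS.mem_nhds hx] with y hy
      have := congrFun (congrFun (coframe_mul_frameEnd (J := J) (hd y hy)) a) k
      simpa [Matrix.mul_apply] using this
    rw [h3, h4] at h5
    simp only [sum_add_distrib] at h5
    simp only [Matrix.mul_apply, Matrix.add_apply]
    exact h5
  have key : E * dC = E * (C * G - G * C) := by
    have : E * dC = dJ * E + J x * dE - dE * C := by rw [← r4]; abel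
    have t1 : E * (C * G - G * C) = J x * E * G - E * G * C := by
      rw [Matrix.mul_sub, ← Matrix.mul_assoc, ← Matrix.mul_assoc, r3]
    have t2 : (E * G - Ω x i * E) * C = E * G * C - Ω x i * (J x * E) := by
      rw [Matrix.sub_mul, Matrix.mul_assoc (Ω x i), r3]
    rw [this, r1, r2, t1, t2]
    noncomm_ring
  have key2 : dC = C * G - G * C := by
    have := congrArg (fun M => E⁻¹ * M) key
    simpa only [← Matrix.mul_assoc, Matrix.nonsing_inv_mul _ hu, Matrix.one_mul] using this
  have := congrFun (congrFun key2 k) j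
  simp only [Matrix.mul_apply, Matrix.sub_apply] at this
  exact this

theorem nijenhuis_eq_zero {C : EndField n}
    (hC : ∀ i k j, pd i (fun y => C y k j) x
      = ∑ l, C x k l * Γ x l i j - ∑ l, Γ x k i l * C x l j)
    (hs : ∀ k i j, Γ x k i j = Γ x k j i) (k i j : Fin n) : nijenhuis C x k i j = 0 := by
  simp only [nijenhuis, hC, sum_sub_distrib, mul_sum, mul_sub]
  have e1 : ∀ i j, ∑ l, ∑ r, C x l i * (C x k r * Γ x r l j)
      = ∑ l, ∑ r, C x k l * (Γ x l j r * C x r i) := fun i j => by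
    rw [sum_comm]
    exact sum_congr rfl fun l _ => sum_congr rfl fun r _ => by rw [hs l r j]; ring
  have e2 : ∑ l, ∑ r, C x l i * (Γ x k l r * C x r j)
      = ∑ l, ∑ r, C x l j * (Γ x k l r * C x r i) := by
    rw [sum_comm]
    exact sum_congr rfl fun l _ => sum_congr rfl fun r _ => by rw [hs k r l]; ring
  have e3 : ∑ l, ∑ r, C x k l * (C x l r * Γ x r j i)
      = ∑ l, ∑ r, C x k l * (C x l r * Γ x r i j) :=
    sum_congr rfl fun l _ => sum_congr rfl fun r _ => by rw [hs r j i]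
  rw [e1 i j, e1 j i, e2, e3]
  ring

/-- An endomorphism with square `-1` which is parallel for a torsion-free connection is a complex
structure. -/
theorem isComplexStructureOn_frameEnd (hS : IsOpen S) (he : SmoothMatrix e S)
    (hd : ∀ x ∈ S, (e x).det ≠ 0) (hJ : SmoothMatrix J S) (hT : IsTorsionFree e A β S)
    (hp : IsParallel J (weylMatrix A β) S) (hsq : ∀ x ∈ S, J x * J x = -1) :
    IsComplexStructureOn (frameEnd e J) S := by
  have hF := isFrameConn_frameConn (Ω := weylMatrix A β) hd
  refine ⟨smoothMatrix_frameEnd he hd hJ, fun x hx => ?_, fun x hx => ?_⟩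
  · rw [frameEnd_mul _ (hd x hx)]
    exact frameEnd_neg_one (hd x hx) (hsq x hx)
  · exact nijenhuis_eq_zero (fun i k j => pd_frameEnd hF hS he hd hJ hp hx i k j)
      (fun k i j => hF.symm hT hd hx k i j)

theorem isParallel_weylMatrix
    (h : ∀ x ∈ S, ∀ i a b, pd i (fun y => J y a b) x + (A x i * J x - J x * A x i) a b = 0) :
    IsParallel J (weylMatrix A β) S := by
  intro x hx i a b
  have : weylMatrix A β x i * J x - J x * weylMatrix A β x i = A x i * J x - J x * A x i := by
    simp [weylMatrix, Matrix.add_mul, Matrix.mul_add]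
  rw [this]
  exact h x hx i a b

theorem isOrthogonalOn_frameEnd (h : IsConformalCoframe g φ e S)
    (hJ : ∀ x ∈ S, (J x).transpose * J x = 1) : IsOrthogonalOn g (frameEnd e J) S := by
  intro x hx
  have hd := h.det_ne x hx
  have h1 := coframe_mul_frameEnd (J := J) hd
  have h2 : (frameEnd e J x).transpose * (e x).transpose = (e x).transpose * (J x).transpose := by
    rw [← Matrix.transpose_mul, h1, Matrix.transpose_mul]
  rw [h.metric_eq hx, Matrix.mul_smul, Matrix.smul_mul, ← Matrix.mul_assoc, h2, Matrix.mul_assoc,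
    h1, Matrix.mul_assoc, ← Matrix.mul_assoc _ (J x), hJ x hx, Matrix.one_mul]

/-- A skew parallel complex structure is Kähler. -/
theorem isKahlerOn_frameEnd (h : IsConformalCoframe g φ e S)
    (hA : ∀ x ∈ S, ∀ i a b, A x i a b = -A x i b a)
    (hβ : ∀ x ∈ S, ∀ i, pd i φ x = 2 * φ x * β x i)
    (hT : IsTorsionFree e A β S) (hJ : SmoothMatrix J S)
    (hp : IsParallel J (weylMatrix A β) S) (hsq : ∀ x ∈ S, J x * J x = -1)
    (hsk : ∀ x ∈ S, (J x).transpose = -J x) : IsKahlerOn g (frameEnd e J) S := by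
  have hd := h.det_ne
  have hF := h.leviCivita hA hβ hT
  refine ⟨h.isRiemannianOn, isComplexStructureOn_frameEnd h.isOpen h.smooth hd hJ hT hp hsq,
    isOrthogonalOn_frameEnd h fun x hx => by rw [hsk x hx, Matrix.neg_mul, hsq x hx, neg_neg], ?_⟩
  intro x hx
  have hs := fun k i j => hF.symm hT hd hx k i j
  have hC := fun i k j => pd_frameEnd hF h.isOpen h.smooth hd hJ hp hx i k j
  have hg : ∀ i j k, pd i (fun y => g y j k) x
      = ∑ l, leviCivita g x l i j * g x l k + ∑ l, leviCivita g x l i k * g x l j := by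
    intro i j k
    have h1 := h.sum_frame_add (α := 0) hA (by simpa using hβ) hx i j k
    have h2 : ∀ j k, φ x * ∑ a, (pd i (fun y => e y a j) x
        + ∑ b, weylMatrix A β x i a b * e x b j) * e x a k
        = ∑ l, leviCivita g x l i j * g x l k := by
      intro j k
      simp only [← hF x hx _ i j, h.eq x hx, sum_mul, mul_sum]
      rw [sum_comm]
      exact sum_congr rfl fun a _ => sum_congr rfl fun l _ => by ring
    rw [h2, h2] at h1
    simpa using h1.symm
  have hanti : ∀ i j, hermitianForm g (frameEnd e J) x i j
      = -hermitianForm g (frameEnd e J) x j i := by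
    have hm : (frameEnd e J x).transpose * g x = -(φ x • ((e x).transpose * J x * e x)) := by
      rw [h.metric_eq hx, Matrix.mul_smul, ← Matrix.mul_assoc, ← Matrix.transpose_mul,
        coframe_mul_frameEnd (hd x hx), Matrix.transpose_mul, hsk x hx]
      simp [Matrix.mul_assoc]
    have hm2 : ((frameEnd e J x).transpose * g x).transpose
        = -((frameEnd e J x).transpose * g x) := by
      rw [hm]
      simp [Matrix.transpose_mul, hsk x hx, Matrix.mul_assoc]
    intro i j
    have := congrFun (congrFun hm2 j) i
    simpa [Matrix.mul_apply, hermitianForm] using this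
  have hH : ∀ p i j, pd p (fun y => hermitianForm g (frameEnd e J) y i j) x
      = ∑ l, leviCivita g x l p i * hermitianForm g (frameEnd e J) x l j
        + ∑ l, leviCivita g x l p j * hermitianForm g (frameEnd e J) x i l := by
    intro p i j
    have hdC := fun k j => hasD_pd ((smoothMatrix_frameEnd h.smooth hd hJ).diff h.isOpen hx k j)
    have hdg := fun k j => hasD_pd (h.smooth_metric.diff h.isOpen hx k j)
    have := (HasD.sum (s := Finset.univ) fun k _ => (hdC k i).mul (hdg k j)).pd p
    refine Eq.trans this ?_
    simp only [hC, hg, hermitianForm, sub_mul, sum_mul, mul_sum, mul_add,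
      sum_add_distrib, sum_sub_distrib]
    have e1 : ∑ k, ∑ l, frameEnd e J x k l * leviCivita g x l p i * g x k j
        = ∑ l, ∑ k, leviCivita g x l p i * (frameEnd e J x k l * g x k j) := by
      rw [sum_comm]
      exact sum_congr rfl fun l _ => sum_congr rfl fun r _ => by ring
    have e2 : ∑ k, ∑ l, leviCivita g x k p l * frameEnd e J x l i * g x k j
        = ∑ k, ∑ l, frameEnd e J x k i * (leviCivita g x l p k * g x l j) := by
      rw [sum_comm]
      exact sum_congr rfl fun l _ => sum_congr rfl fun r _ => by ring
    have e3 : ∑ k, ∑ l, frameEnd e J x k i * (leviCivita g x l p j * g x l k)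
        = ∑ l, ∑ k, leviCivita g x l p j * (frameEnd e J x k i * g x k l) := by
      rw [sum_comm]
      exact sum_congr rfl fun l _ => sum_congr rfl fun r _ => by
        rw [h.symm hx l r]; ring
    rw [e1, e2, e3]
    ring
  intro i j k
  simp only [extDeriv₂, hH]
  have hc : ∀ i j k, ∑ l, leviCivita g x l i j * hermitianForm g (frameEnd e J) x l k
      = -∑ l, leviCivita g x l j i * hermitianForm g (frameEnd e J) x k l := by
    intro i j k
    rw [← sum_neg_distrib]
    exact sum_congr rfl fun l _ => by rw [hanti l k, hs l i j]; ring
  rw [hc i j k, hc j k i, hc k i j]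
  ring

end

/-! ### Invariance under translations -/

theorem lieEnd_const {J : EndField n} (k : Fin n)
    (h : ∀ (y : Pt n) (c : ℝ), J (y + c • Pi.single k 1) = J y) (x : Pt n) (a b : Fin n) :
    lieEnd (fun _ => Pi.single k 1) J x a b = 0 := by
  simp only [lieEnd, pd_const, mul_zero, sub_zero, add_zero]
  rw [Finset.sum_eq_single k]
  · rw [pd_eq_zero_of_invariant k (fun y c => by rw [h])]; simp
  · intro l _ hl; simp [Pi.single_eq_of_ne hl]
  · simp

theorem lieMetric_const {g : Metric n} (k : Fin n)
    (h : ∀ (y : Pt n) (c : ℝ), g (y + c • Pi.single k 1) = g y) (x : Pt n) (a b : Fin n) :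
    lieMetric (fun _ => Pi.single k 1) g x a b = 0 := by
  simp only [lieMetric, pd_const, mul_zero, add_zero]
  rw [Finset.sum_eq_single k]
  · rw [pd_eq_zero_of_invariant k (fun y c => by rw [h])]; simp
  · intro l _ hl; simp [Pi.single_eq_of_ne hl]
  · simp

theorem lieConn_const {Γ : Conn n} (k : Fin n)
    (h : ∀ (y : Pt n) (c : ℝ), Γ (y + c • Pi.single k 1) = Γ y) (x : Pt n) (a i j : Fin n) :
    lieConn (fun _ => Pi.single k 1) Γ x a i j = 0 := by
  simp only [lieConn, pd_const, mul_zero, add_zero, sub_zero, zero_add]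
  rw [Finset.sum_eq_single k]
  · rw [pd_eq_zero_of_invariant k (fun y c => by rw [h])]; simp
  · intro l _ hl; simp [Pi.single_eq_of_ne hl]
  · simp

theorem pd_translate {f : Pt n → ℝ} {v : Pt n} (h : ∀ y, f (y + v) = f y) (i : Fin n) (x : Pt n) :
    pd i f (x + v) = pd i f x := by
  have h1 : (fun y => f (y + v)) = f := funext h
  unfold pd
  rw [← fderiv_comp_add_right v, h1]

theorem weylConn_translate {g : Metric n} {α : Field n} {v : Pt n} (hg : ∀ y, g (y + v) = g y)
    (hα : ∀ y, α (y + v) = α y) (x : Pt n) : weylConn g α (x + v) = weylConn g α x := by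
  have h := fun i j k => pd_translate (f := fun y => g y j k) (v := v)
    (fun y => by rw [hg]) i x
  funext k i j
  simp only [weylConn, leviCivita, hg, hα, h]

/-! ### The volume form in a coframe -/

theorem altSymbol_mul_det (A : Matrix (Fin n) (Fin n) ℝ) (f : Fin n → Fin n) :
    altSymbol f * A.det = (Matrix.of fun a b => A a (f b)).det := by
  rw [← Matrix.det_transpose (Matrix.of _), ← Matrix.det_transpose A, altSymbol, ← Matrix.det_mul]
  congr 1
  ext a b
  simp [Matrix.mul_apply]

theorem volForm_of_coframe {S : Set (Pt n)} {g : Metric n} {φ : Pt n → ℝ}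
    {e : Pt n → Matrix (Fin n) (Fin n) ℝ} {x : Pt n} (h : IsConformalCoframe g φ e S) (hx : x ∈ S)
    (hpos : 0 < (e x).det) (f : Fin n → Fin n) :
    volForm g x f = √(φ x ^ n) * (Matrix.of fun a b => e x a (f b)).det := by
  have hp := (h.pos x hx).le
  rw [← altSymbol_mul_det, volForm, h.metric_eq hx, Matrix.det_smul, Matrix.det_mul,
    Matrix.det_transpose, Fintype.card_fin, Real.sqrt_mul (pow_nonneg hp n),
    Real.sqrt_mul_self hpos.le]
  ring

/-! ### Criteria in terms of coframes -/

section
variable {S : Set (Pt n)} {g : Metric n} {φ : Pt n → ℝ} {e : Pt n → Matrix (Fin n) (Fin n) ℝ}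
  {A Ω : Pt n → Fin n → Matrix (Fin n) (Fin n) ℝ} {α β : Field n} {x : Pt n}

theorem curvMatrix_weylMatrix (hA : ∀ i a b, DifferentiableAt ℝ (fun y => A y i a b) x)
    (hβ : DiffForm β x) (i j a b : Fin n) :
    curvMatrix (weylMatrix A β) x i j a b
      = curvMatrix A x i j a b + if a = b then extDeriv₁ β x i j else 0 := by
  have h1 : extDeriv₁ (fun y k => weylMatrix A β y k a b) x i j
      = extDeriv₁ (fun y k => A y k a b) x i j + if a = b then extDeriv₁ β x i j else 0 := by
    split_ifs with hab
    · subst hab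
      rw [← extDeriv₁_add (α := fun y k => A y k a a) (fun i => hA i a a) hβ]
      simp [weylMatrix]
    · simp [weylMatrix, hab]
  have h2 : weylMatrix A β x i * weylMatrix A β x j - weylMatrix A β x j * weylMatrix A β x i
      = A x i * A x j - A x j * A x i := by
    simp only [weylMatrix, Matrix.add_mul, Matrix.mul_add, Matrix.smul_mul, Matrix.mul_smul,
      Matrix.one_mul, Matrix.mul_one]
    module
  have h3 := congrFun (congrFun h2 a) b
  simp only [Matrix.sub_apply, Matrix.mul_apply] at h3
  simp only [curvMatrix, h1, sum_sub_distrib, h3]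
  ring

/-- The Einstein-Weyl equation in a coframe. -/
theorem isEinsteinWeylOn_of_frame (h : IsConformalCoframe g φ e S) (hα : SmoothField α S)
    (hA : ∀ x ∈ S, ∀ i a b, A x i a b = -A x i b a)
    (hβ : ∀ x ∈ S, ∀ i, pd i φ x + 2 * φ x * α x i = 2 * φ x * β x i)
    (hT : IsTorsionFree e A β S)
    (hAd : ∀ i a b, ∀ x ∈ S, DifferentiableAt ℝ (fun y => A y i a b) x)
    (hβd : ∀ x ∈ S, DiffForm β x)
    (hK : ∀ x ∈ S, ∃ (K : Fin n → Fin n → Fin n → Fin n → ℝ) (s : ℝ),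
      (∀ i j a b, curvMatrix A x i j a b + (if a = b then extDeriv₁ β x i j else 0)
        = ∑ c, ∑ d, K a b c d * e x c i * e x d j) ∧
      ∀ b d, ∑ a, K a b a d + ∑ a, K a d a b = if b = d then s else 0) :
    IsEinsteinWeylOn g α S := by
  refine ⟨h.isRiemannianOn, hα, fun x hx => ?_⟩
  obtain ⟨K, s, hK, hs⟩ := hK x hx
  have hF := h.weylConn hA hβ hT
  have hΓ : ∀ k i j, ∀ x ∈ S, DifferentiableAt ℝ (fun y => weylConn g α y k i j) x :=
    fun k i j x hx => ((contDiffOn_weylConn h.isOpen h.smooth_metric hα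
      (fun x hx => h.det_metric_ne hx) k i j).contDiffAt (h.isOpen.mem_nhds hx)).differentiableAt
        (by simp)
  have hΩ : ∀ i a b, ∀ x ∈ S, DifferentiableAt ℝ (fun y => weylMatrix A β y i a b) x :=
    fun i a b x hx => (hAd i a b x hx).add
      (((hβd x hx) i).mul_const ((1 : Matrix (Fin n) (Fin n) ℝ) a b))
  have hR := fun j k => ricci_of_frame (Γ := weylConn g α) (K := K) (h.det_ne x hx) (fun a i j k => by
    rw [hF.curvature h.isOpen h.smooth hΓ hΩ hx]
    refine sum_congr rfl fun b _ => ?_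
    rw [curvMatrix_weylMatrix (fun i a b => hAd i a b x hx) (hβd x hx), hK]) j k
  refine ⟨s / φ x, fun i j => ?_⟩
  rw [hR, hR, h.eq x hx, ← mul_assoc, div_mul_cancel₀ _ (h.pos x hx).ne']
  have : ∑ b, ∑ d, (∑ a, K a b a d) * e x b i * e x d j
      = ∑ b, ∑ d, (∑ a, K a d a b) * e x d i * e x b j := sum_comm
  rw [this, ← sum_add_distrib, mul_sum]
  refine sum_congr rfl fun b _ => ?_
  rw [← sum_add_distrib]
  have : ∀ d, (∑ a, K a b a d) * e x b j * e x d i + (∑ a, K a d a b) * e x d i * e x b j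
      = (if b = d then s else 0) * e x b j * e x d i := by
    intro d; rw [← hs]; ring
  rw [sum_congr rfl fun d _ => this d]
  simp
  ring

end

/-! ### Dimension three -/

/-- The coframe with the rows `a`, `b`, `c`. -/
def coframe₃ (a b c : Field 3) (x : Pt 3) : Matrix (Fin 3) (Fin 3) ℝ := Matrix.of ![a x, b x, c x]

/-- The skew connection matrices with the entries `u`, `v`, `w`. -/
def skew₃ (u v w : Field 3) (x : Pt 3) (i : Fin 3) : Matrix (Fin 3) (Fin 3) ℝ :=
  !![0, u x i, v x i; -u x i, 0, w x i; -v x i, -w x i, 0]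

theorem coframe₃_zero (a b c : Field 3) (x : Pt 3) : coframe₃ a b c x 0 = a x := rfl

theorem coframe₃_one (a b c : Field 3) (x : Pt 3) : coframe₃ a b c x 1 = b x := rfl

theorem coframe₃_two (a b c : Field 3) (x : Pt 3) : coframe₃ a b c x 2 = c x := rfl

theorem extDeriv₁_zero (x : Pt n) (i j : Fin n) : extDeriv₁ (fun _ _ => 0) x i j = 0 := by
  simp [extDeriv₁, pd_const]

theorem skew₃_neg (u v w : Field 3) (x : Pt 3) (i a b : Fin 3) :
    skew₃ u v w x i a b = -skew₃ u v w x i b a := by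
  fin_cases a <;> fin_cases b <;> simp [skew₃]

theorem differentiableAt_skew₃ {u v w : Field 3} {x : Pt 3} (hu : DiffForm u x) (hv : DiffForm v x)
    (hw : DiffForm w x) (i a b : Fin 3) : DifferentiableAt ℝ (fun y => skew₃ u v w y i a b) x := by
  fin_cases a <;> fin_cases b <;> simp [skew₃] <;>
    first
    | exact hu i
    | exact hv i
    | exact hw i

theorem isTorsionFree₃ {e₁ e₂ e₃ u v w β : Field 3} {S : Set (Pt 3)}
    (h₁ : ∀ x ∈ S, ∀ i j, extDeriv₁ e₁ x i j + wedge (u x) (e₂ x) i j + wedge (v x) (e₃ x) i j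
      + wedge (β x) (e₁ x) i j = 0)
    (h₂ : ∀ x ∈ S, ∀ i j, extDeriv₁ e₂ x i j - wedge (u x) (e₁ x) i j + wedge (w x) (e₃ x) i j
      + wedge (β x) (e₂ x) i j = 0)
    (h₃ : ∀ x ∈ S, ∀ i j, extDeriv₁ e₃ x i j - wedge (v x) (e₁ x) i j - wedge (w x) (e₂ x) i j
      + wedge (β x) (e₃ x) i j = 0) :
    IsTorsionFree (coframe₃ e₁ e₂ e₃) (skew₃ u v w) β S := by
  intro x hx a i j
  have h₁ := h₁ x hx i j
  have h₂ := h₂ x hx i j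
  have h₃ := h₃ x hx i j
  simp only [wedge] at h₁ h₂ h₃
  fin_cases a
  · simp [skew₃, coframe₃_zero, coframe₃_one, coframe₃_two, Fin.sum_univ_three]
    linear_combination h₁
  · simp [skew₃, coframe₃_zero, coframe₃_one, coframe₃_two, Fin.sum_univ_three]
    linear_combination h₂
  · simp [skew₃, coframe₃_zero, coframe₃_one, coframe₃_two, Fin.sum_univ_three]
    linear_combination h₃

/-- The Einstein-Weyl equation in dimension three. -/
theorem isEinsteinWeylOn₃ {g : Metric 3} {φ : Pt 3 → ℝ} {α β e₁ e₂ e₃ u v w : Field 3}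
    {S : Set (Pt 3)} (h : IsConformalCoframe g φ (coframe₃ e₁ e₂ e₃) S) (hα : SmoothField α S)
    (hβ : ∀ x ∈ S, ∀ i, pd i φ x + 2 * φ x * α x i = 2 * φ x * β x i)
    (hT : IsTorsionFree (coframe₃ e₁ e₂ e₃) (skew₃ u v w) β S)
    (hu : ∀ x ∈ S, DiffForm u x) (hv : ∀ x ∈ S, DiffForm v x) (hw : ∀ x ∈ S, DiffForm w x)
    (hβd : ∀ x ∈ S, DiffForm β x)
    (hK : ∀ x ∈ S, ∃ s b c d f₁ f₂ f₃ : ℝ, ∀ i j,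
      extDeriv₁ u x i j - wedge (v x) (w x) i j = s * wedge (e₁ x) (e₂ x) i j
        + b * wedge (e₁ x) (e₃ x) i j + c * wedge (e₂ x) (e₃ x) i j ∧
      extDeriv₁ v x i j + wedge (u x) (w x) i j = -b * wedge (e₁ x) (e₂ x) i j
        + s * wedge (e₁ x) (e₃ x) i j + d * wedge (e₂ x) (e₃ x) i j ∧
      extDeriv₁ w x i j - wedge (u x) (v x) i j = -c * wedge (e₁ x) (e₂ x) i j
        - d * wedge (e₁ x) (e₃ x) i j + s * wedge (e₂ x) (e₃ x) i j ∧
      extDeriv₁ β x i j = f₁ * wedge (e₁ x) (e₂ x) i j + f₂ * wedge (e₁ x) (e₃ x) i j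
        + f₃ * wedge (e₂ x) (e₃ x) i j) :
    IsEinsteinWeylOn g α S := by
  refine isEinsteinWeylOn_of_frame h hα (fun x _ i a b => skew₃_neg u v w x i a b) hβ hT
    (fun i a b x hx => differentiableAt_skew₃ (hu x hx) (hv x hx) (hw x hx) i a b) hβd ?_
  intro x hx
  obtain ⟨s, b, c, d, f₁, f₂, f₃, hK⟩ := hK x hx
  let F : Fin 3 → Fin 3 → ℝ := !![0, f₁, f₂; -f₁, 0, f₃; -f₂, -f₃, 0]
  let P : Fin 3 → Fin 3 → ℝ := !![0, s, b; -s, 0, c; -b, -c, 0]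
  let Q : Fin 3 → Fin 3 → ℝ := !![0, -b, s; b, 0, d; -s, -d, 0]
  let R : Fin 3 → Fin 3 → ℝ := !![0, -c, -d; c, 0, s; d, -s, 0]
  refine ⟨fun a b c d => !![F c d, P c d, Q c d; -P c d, F c d, R c d; -Q c d, -R c d, F c d] a b,
    4 * s, fun i j a b => ?_, fun b d => ?_⟩
  · obtain ⟨h1, h2, h3, h4⟩ := hK i j
    simp only [wedge] at h1 h2 h3 h4
    fin_cases a <;> fin_cases b <;>
      simp [curvMatrix, skew₃, coframe₃_zero, coframe₃_one, coframe₃_two, Fin.sum_univ_three,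
        F, P, Q, R] <;>
      first
      | linear_combination h4
      | linear_combination h1
      | linear_combination h2
      | linear_combination h3
      | (rw [extDeriv₁_neg (hu x hx)]; linear_combination -h1)
      | (rw [extDeriv₁_neg (hv x hx)]; linear_combination -h2)
      | (rw [extDeriv₁_neg (hw x hx)]; linear_combination -h3)
      | (rw [extDeriv₁_zero]; linear_combination h4)
  · fin_cases b <;> fin_cases d <;> simp [Fin.sum_univ_three, F, P, Q, R] <;> ring

/-- The equation of a shear-free geodesic congruence in an orthonormal coframe. -/
theorem isShearFreeGeodesicOn₃ {g : Metric 3} {α e₁ e₂ e₃ u v w : Field 3} {X₁ X₂ X₃ : Pt 3 → ℝ}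
    {τ κ : Pt 3 → ℝ}
    {S : Set (Pt 3)} (h : IsConformalCoframe g (fun _ => 1) (coframe₃ e₁ e₂ e₃) S)
    (hT : IsTorsionFree (coframe₃ e₁ e₂ e₃) (skew₃ u v w) α S)
    (hpos : ∀ x ∈ S, 0 < (coframe₃ e₁ e₂ e₃ x).det)
    (hs₁ : ContDiffOn ℝ ∞ X₁ S) (hs₂ : ContDiffOn ℝ ∞ X₂ S) (hs₃ : ContDiffOn ℝ ∞ X₃ S)
    (hunit : ∀ x ∈ S, X₁ x ^ 2 + X₂ x ^ 2 + X₃ x ^ 2 = 1)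
    (h₁ : ∀ x ∈ S, ∀ i, pd i X₁ x + u x i * X₂ x + v x i * X₃ x
      = τ x * (e₁ x i - (e₁ x i * X₁ x + e₂ x i * X₂ x + e₃ x i * X₃ x) * X₁ x)
        + κ x * (e₃ x i * X₂ x - e₂ x i * X₃ x))
    (h₂ : ∀ x ∈ S, ∀ i, pd i X₂ x - u x i * X₁ x + w x i * X₃ x
      = τ x * (e₂ x i - (e₁ x i * X₁ x + e₂ x i * X₂ x + e₃ x i * X₃ x) * X₂ x)
        + κ x * (e₁ x i * X₃ x - e₃ x i * X₁ x))
    (h₃ : ∀ x ∈ S, ∀ i, pd i X₃ x - v x i * X₁ x - w x i * X₂ x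
      = τ x * (e₃ x i - (e₁ x i * X₁ x + e₂ x i * X₂ x + e₃ x i * X₃ x) * X₃ x)
        + κ x * (e₂ x i * X₁ x - e₁ x i * X₂ x)) :
    ∃ χ, IsShearFreeGeodesicOn g α χ τ κ S := by
  set e := coframe₃ e₁ e₂ e₃ with he
  let X : Field 3 := fun x => ![X₁ x, X₂ x, X₃ x]
  have hX : ∀ x a, X x a = ![X₁ x, X₂ x, X₃ x] a := fun _ _ => rfl
  have hXs : ∀ a, ContDiffOn ℝ ∞ (fun x => X x a) S := by
    intro a; fin_cases a
    exacts [hs₁, hs₂, hs₃]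
  let χ : Field 3 := fun x => Matrix.mulVec ((e x)⁻¹) (X x)
  have hχs : SmoothField χ S := by
    intro k
    change ContDiffOn ℝ ∞ (fun x => ∑ a, (e x)⁻¹ k a * X x a) S
    exact ContDiffOn.sum fun a _ => (h.smooth.inv h.det_ne k a).mul (hXs a)
  have heχ : ∀ x ∈ S, ∀ a, ∑ l, e x a l * χ x l = X x a := by
    intro x hx a
    have := congrFun (congrArg (fun M => Matrix.mulVec M (X x)) (Matrix.mul_nonsing_inv (e x)
      (isUnit_iff_ne_zero.mpr (h.det_ne x hx)))) a
    rw [← Matrix.mulVec_mulVec, Matrix.one_mulVec] at this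
    exact this
  have hF := h.weylConn (α := α) (β := α) (fun x _ i a b => skew₃_neg u v w x i a b)
    (fun x _ i => by rw [pd_const]; ring) hT
  refine ⟨χ, hχs, fun x hx => ?_⟩
  have hu : IsUnit (e x).det := isUnit_iff_ne_zero.mpr (h.det_ne x hx)
  have hflat : ∀ i, ∑ j, g x i j * χ x j = ∑ a, e x a i * X x a := by
    intro i
    simp only [h.eq x hx, one_mul, ← heχ x hx, sum_mul, mul_sum]
    rw [sum_comm]
    exact sum_congr rfl fun a _ => sum_congr rfl fun l _ => by ring
  refine ⟨?_, fun i k => ?_⟩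
  · have : ∑ i, ∑ j, g x i j * χ x i * χ x j = ∑ a, X x a * X x a := by
      have h1 : ∀ i, ∑ j, g x i j * χ x i * χ x j = χ x i * ∑ a, e x a i * X x a := by
        intro i; rw [← hflat, mul_sum]
        exact sum_congr rfl fun j _ => by ring
      simp only [h1, mul_sum]
      rw [sum_comm]
      refine sum_congr rfl fun a _ => ?_
      rw [← heχ x hx a, sum_mul]
      exact sum_congr rfl fun l _ => by rw [heχ x hx a]; ring
    rw [this, Fin.sum_univ_three]
    simp only [hX]
    simpa [pow_two] using hunit x hx
  · -- compare the components in the coframe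
    refine congrFun (frame_ext (h.det_ne x hx)
      (v := fun k => pd i (fun y => χ y k) x + ∑ j, weylConn g α x k i j * χ x j - α x i * χ x k)
      (w := fun k => τ x * ((if i = k then 1 else 0) - (∑ j, g x i j * χ x j) * χ x k)
        + κ x * ∑ j, ∑ l, volForm g x ![i, j, l] * (g x)⁻¹ j k * χ x l) ?_) k
    intro a
    have hvol : ∀ j l, volForm g x ![i, j, l]
        = (Matrix.of fun a b => e x a (![i, j, l] b)).det := by
      intro j l
      rw [volForm_of_coframe h hx (hpos x hx)]; simp
    have hd1 : ∑ l, e x a l * pd i (fun y => χ y l) x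
        = pd i (fun y => X y a) x - ∑ l, pd i (fun y => e y a l) x * χ x l := by
      have hde := fun l => hasD_pd (h.smooth.diff h.isOpen hx a l)
      have hdχ := fun l => hasD_pd (((hχs l).contDiffAt (h.isOpen.mem_nhds hx)).differentiableAt
        (by simp))
      have h1 := (HasD.sum (s := Finset.univ) fun l _ => (hde l).mul (hdχ l)).pd i
      rw [pd_congr i (g := fun y => X y a) (by
        filter_upwards [h.isOpen.mem_nhds hx] with y hy using heχ y hy a)] at h1
      rw [h1, sum_add_distrib]; ring
    have hd2 : ∑ l, e x a l * ∑ j, weylConn g α x l i j * χ x j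
        = ∑ l, pd i (fun y => e y a l) x * χ x l
          + ∑ b, skew₃ u v w x i a b * X x b + α x i * X x a := by
      have h1 : ∑ l, e x a l * ∑ j, weylConn g α x l i j * χ x j
          = ∑ j, (∑ l, e x a l * weylConn g α x l i j) * χ x j := by
        simp only [mul_sum, sum_mul]
        rw [sum_comm]
        exact sum_congr rfl fun j _ => sum_congr rfl fun l _ => by ring
      rw [h1]
      simp only [hF x hx, weylMatrix_mul, add_mul, sum_add_distrib, ← heχ x hx]
      have h2 : ∑ j, (∑ b, skew₃ u v w x i a b * e x b j) * χ x j
          = ∑ b, skew₃ u v w x i a b * ∑ l, e x b l * χ x l := by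
        simp only [mul_sum, sum_mul]
        rw [sum_comm]
        exact sum_congr rfl fun j _ => sum_congr rfl fun l _ => by ring
      rw [h2, mul_sum]
      simp only [mul_assoc]
      ring
    have hd3 : ∑ k, e x a k * ∑ j, ∑ l, volForm g x ![i, j, l] * (g x)⁻¹ j k * χ x l
        = ∑ j, ∑ l, volForm g x ![i, j, l] * (e x)⁻¹ j a * χ x l := by
      have h1 : ∀ j, ∑ k, e x a k * (g x)⁻¹ j k = (e x)⁻¹ j a := by
        intro j
        have h2 : (g x)⁻¹ * (e x).transpose = (e x)⁻¹ := by
          rw [h.inv_metric hx, inv_one, one_smul, Matrix.mul_assoc, ← Matrix.transpose_mul,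
            Matrix.mul_nonsing_inv _ hu, Matrix.transpose_one, Matrix.mul_one]
        have := congrFun (congrFun h2 j) a
        rw [Matrix.mul_apply] at this
        rw [← this]
        exact sum_congr rfl fun k _ => by rw [Matrix.transpose_apply]; ring
      simp only [mul_sum]
      rw [sum_comm]
      refine sum_congr rfl fun j _ => ?_
      rw [sum_comm]
      refine sum_congr rfl fun l _ => ?_
      rw [← h1, mul_sum, sum_mul]
      exact sum_congr rfl fun k _ => by ring
    have hE : ∀ b c, ∑ j, e x b j * (e x)⁻¹ j c = if b = c then 1 else 0 := by
      intro b c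
      have := congrFun (congrFun (Matrix.mul_nonsing_inv _ hu) b) c
      rwa [Matrix.mul_apply, Matrix.one_apply] at this
    have hd4 : ∑ j, ∑ l, volForm g x ![i, j, l] * (e x)⁻¹ j a * χ x l
        = (Matrix.of fun (b c : Fin 3) => ![e x b i, if b = a then 1 else 0, X x b] c).det := by
      have hdet : ∀ j l, volForm g x ![i, j, l]
          = ∑ b, ∑ c, (!![0, e x 2 i, -e x 1 i; -e x 2 i, 0, e x 0 i; e x 1 i, -e x 0 i, 0] :
            Matrix (Fin 3) (Fin 3) ℝ) b c * e x b j * e x c l := by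
        intro j l
        rw [hvol, Matrix.det_fin_three]
        simp [Fin.sum_univ_three]
        ring
      generalize hD : (!![0, e x 2 i, -e x 1 i; -e x 2 i, 0, e x 0 i; e x 1 i, -e x 0 i, 0] :
            Matrix (Fin 3) (Fin 3) ℝ) = D at hdet
      have h1 : ∑ j, ∑ l, volForm g x ![i, j, l] * (e x)⁻¹ j a * χ x l
          = ∑ b, ∑ c, D b c * (∑ j, e x b j * (e x)⁻¹ j a) * (∑ l, e x c l * χ x l) := by
        simp only [hdet, Fin.sum_univ_three]
        ring
      rw [h1]
      simp only [hE, heχ x hx, ← hD, Matrix.det_fin_three]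
      fin_cases a <;> simp [Fin.sum_univ_three] <;> ring
    have h0 : ∑ l, e x a l * (if i = l then (1 : ℝ) else 0) = e x a i := by simp
    have hR : ∑ l, e x a l * (τ x * ((if i = l then 1 else 0) - (∑ j, g x i j * χ x j) * χ x l)
        + κ x * ∑ j, ∑ r, volForm g x ![i, j, r] * (g x)⁻¹ j l * χ x r)
        = τ x * (e x a i - (∑ b, e x b i * X x b) * X x a)
          + κ x * (Matrix.of fun (b c : Fin 3) => ![e x b i, if b = a then 1 else 0, X x b] c).det := by
      have key : ∀ (c : ℝ) (V : Fin 3 → ℝ),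
          ∑ l, e x a l * (τ x * ((if i = l then 1 else 0) - c * χ x l) + κ x * V l)
            = τ x * (e x a i - c * X x a) + κ x * ∑ l, e x a l * V l := by
        intro c V
        have a1 : ∑ l, e x a l * (τ x * ((if i = l then 1 else 0) - c * χ x l) + κ x * V l)
            = τ x * ∑ l, e x a l * (if i = l then (1 : ℝ) else 0)
              - τ x * c * ∑ l, e x a l * χ x l + κ x * ∑ l, e x a l * V l := by
          simp only [mul_sum, ← sum_sub_distrib, ← sum_add_distrib]
          exact sum_congr rfl fun l _ => by ring
        rw [a1, h0, heχ x hx]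
        ring
      rw [← hd4, ← hd3, ← hflat]
      exact key _ _
    rw [hR]
    simp only [mul_add, mul_sub, sum_add_distrib, sum_sub_distrib, hd1, hd2]
    have h5 : ∑ l, e x a l * (α x i * χ x l) = α x i * X x a := by
      rw [← heχ x hx a, mul_sum]
      exact sum_congr rfl fun l _ => by ring
    rw [h5, Matrix.det_fin_three]
    have h₁ := h₁ x hx i
    have h₂ := h₂ x hx i
    have h₃ := h₃ x hx i
    fin_cases a
    · simp [X, he, coframe₃_zero, coframe₃_one, coframe₃_two, skew₃, Fin.sum_univ_three]
      linear_combination h₁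
    · simp [X, he, coframe₃_zero, coframe₃_one, coframe₃_two, skew₃, Fin.sum_univ_three]
      linear_combination h₂
    · simp [X, he, coframe₃_zero, coframe₃_one, coframe₃_two, skew₃, Fin.sum_univ_three]
      linear_combination h₃

/-! ### Dimension four -/

/-- The coframe with the rows `a`, `b`, `c`, `d`. -/
def coframe₄ (a b c d : Field 4) (x : Pt 4) : Matrix (Fin 4) (Fin 4) ℝ :=
  Matrix.of ![a x, b x, c x, d x]

section
variable (a b c d : Field 4) (x : Pt 4)
theorem coframe₄_zero : coframe₄ a b c d x 0 = a x := rfl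

theorem coframe₄_one : coframe₄ a b c d x 1 = b x := rfl

theorem coframe₄_two : coframe₄ a b c d x 2 = c x := rfl

theorem coframe₄_three : coframe₄ a b c d x 3 = d x := rfl
end

/-- The skew matrix with selfdual part `(p₁, p₂, p₃)` and antiselfdual part `(m₁, m₂, m₃)`. -/
def splitMat (p₁ p₂ p₃ m₁ m₂ m₃ : ℝ) : Matrix (Fin 4) (Fin 4) ℝ :=
  !![0, (p₃ + m₃) / 2, (p₂ + m₂) / 2, (p₁ + m₁) / 2;
    -((p₃ + m₃) / 2), 0, (p₁ - m₁) / 2, (m₂ - p₂) / 2;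
    -((p₂ + m₂) / 2), -((p₁ - m₁) / 2), 0, (p₃ - m₃) / 2;
    -((p₁ + m₁) / 2), -((m₂ - p₂) / 2), -((p₃ - m₃) / 2), 0]

/-- Connection matrices with selfdual part `(α₁, α₂, α₃)` and antiselfdual part
`(B₁, B₂, B₃)`. -/
def splitConn (α₁ α₂ α₃ B₁ B₂ B₃ : Field 4) (x : Pt 4) (i : Fin 4) : Matrix (Fin 4) (Fin 4) ℝ :=
  splitMat (α₁ x i) (α₂ x i) (α₃ x i) (B₁ x i) (B₂ x i) (B₃ x i)

theorem splitMat_neg (p₁ p₂ p₃ m₁ m₂ m₃ : ℝ) (a b : Fin 4) :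
    splitMat p₁ p₂ p₃ m₁ m₂ m₃ a b = -splitMat p₁ p₂ p₃ m₁ m₂ m₃ b a := by
  fin_cases a <;> fin_cases b <;> simp [splitMat]

theorem splitMat_add (p₁ p₂ p₃ m₁ m₂ m₃ q₁ q₂ q₃ n₁ n₂ n₃ : ℝ) :
    splitMat p₁ p₂ p₃ m₁ m₂ m₃ + splitMat q₁ q₂ q₃ n₁ n₂ n₃
      = splitMat (p₁ + q₁) (p₂ + q₂) (p₃ + q₃) (m₁ + n₁) (m₂ + n₂) (m₃ + n₃) := by
  ext a b
  fin_cases a <;> fin_cases b <;> simp [splitMat] <;> ring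

theorem splitMat_sub (p₁ p₂ p₃ m₁ m₂ m₃ q₁ q₂ q₃ n₁ n₂ n₃ : ℝ) :
    splitMat p₁ p₂ p₃ m₁ m₂ m₃ - splitMat q₁ q₂ q₃ n₁ n₂ n₃
      = splitMat (p₁ - q₁) (p₂ - q₂) (p₃ - q₃) (m₁ - n₁) (m₂ - n₂) (m₃ - n₃) := by
  ext a b
  fin_cases a <;> fin_cases b <;> simp [splitMat] <;> ring

set_option maxHeartbeats 1000000 in
theorem splitMat_commutator (p₁ p₂ p₃ m₁ m₂ m₃ q₁ q₂ q₃ n₁ n₂ n₃ : ℝ) :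
    splitMat p₁ p₂ p₃ m₁ m₂ m₃ * splitMat q₁ q₂ q₃ n₁ n₂ n₃
      - splitMat q₁ q₂ q₃ n₁ n₂ n₃ * splitMat p₁ p₂ p₃ m₁ m₂ m₃
      = splitMat (p₂ * q₃ - p₃ * q₂) (p₃ * q₁ - p₁ * q₃) (p₁ * q₂ - p₂ * q₁)
        (m₃ * n₂ - m₂ * n₃) (m₁ * n₃ - m₃ * n₁) (m₂ * n₁ - m₁ * n₂) := by
  have h : ∀ A B : Matrix (Fin 4) (Fin 4) ℝ, A * B = Matrix.of fun a b =>
      A a 0 * B 0 b + A a 1 * B 1 b + A a 2 * B 2 b + A a 3 * B 3 b := by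
    intro A B; ext a b; simp [Matrix.mul_apply, Fin.sum_univ_four]
  rw [h, h]
  ext a b
  rw [Matrix.sub_apply, Matrix.of_apply, Matrix.of_apply]
  fin_cases a <;> fin_cases b <;> (simp only [splitMat]; simp; try ring)

section
variable {α₁ α₂ α₃ B₁ B₂ B₃ : Field 4} {x : Pt 4}

theorem splitMat_apply (p₁ p₂ p₃ m₁ m₂ m₃ : ℝ) (a b : Fin 4) :
    splitMat p₁ p₂ p₃ m₁ m₂ m₃ a b
      = splitMat 1 0 0 0 0 0 a b * p₁ + splitMat 0 1 0 0 0 0 a b * p₂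
        + splitMat 0 0 1 0 0 0 a b * p₃ + splitMat 0 0 0 1 0 0 a b * m₁
        + splitMat 0 0 0 0 1 0 a b * m₂ + splitMat 0 0 0 0 0 1 a b * m₃ := by
  fin_cases a <;> fin_cases b <;> simp [splitMat] <;> ring

theorem differentiableAt_splitConn (h₁ : DiffForm α₁ x) (h₂ : DiffForm α₂ x) (h₃ : DiffForm α₃ x)
    (k₁ : DiffForm B₁ x) (k₂ : DiffForm B₂ x) (k₃ : DiffForm B₃ x) (i a b : Fin 4) :
    DifferentiableAt ℝ (fun y => splitConn α₁ α₂ α₃ B₁ B₂ B₃ y i a b) x := by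
  simp only [splitConn, fun y => splitMat_apply (α₁ y i) (α₂ y i) (α₃ y i) (B₁ y i) (B₂ y i)
    (B₃ y i) a b]
  exact ((((((h₁ i).const_mul _).add ((h₂ i).const_mul _)).add ((h₃ i).const_mul _)).add
    ((k₁ i).const_mul _)).add ((k₂ i).const_mul _)).add ((k₃ i).const_mul _)

theorem extDeriv₁_splitConn (h₁ : DiffForm α₁ x) (h₂ : DiffForm α₂ x) (h₃ : DiffForm α₃ x)
    (k₁ : DiffForm B₁ x) (k₂ : DiffForm B₂ x) (k₃ : DiffForm B₃ x) (i j a b : Fin 4) :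
    extDeriv₁ (fun y k => splitConn α₁ α₂ α₃ B₁ B₂ B₃ y k a b) x i j
      = splitMat (extDeriv₁ α₁ x i j) (extDeriv₁ α₂ x i j) (extDeriv₁ α₃ x i j)
        (extDeriv₁ B₁ x i j) (extDeriv₁ B₂ x i j) (extDeriv₁ B₃ x i j) a b := by
  have key : ∀ i j, pd i (fun y => splitConn α₁ α₂ α₃ B₁ B₂ B₃ y j a b) x
      = splitMat (pd i (fun y => α₁ y j) x) (pd i (fun y => α₂ y j) x) (pd i (fun y => α₃ y j) x)
        (pd i (fun y => B₁ y j) x) (pd i (fun y => B₂ y j) x) (pd i (fun y => B₃ y j) x) a b := by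
    intro i j
    simp only [splitConn, fun y => splitMat_apply (α₁ y j) (α₂ y j) (α₃ y j) (B₁ y j) (B₂ y j)
      (B₃ y j) a b]
    have hc : ∀ c : ℝ, HasD (fun _ : Pt 4 => c) (fun _ => 0) x := hasD_const
    rw [((((((((hc _).mul (hasD_pd (h₁ j))).add ((hc _).mul (hasD_pd (h₂ j)))).add
      ((hc _).mul (hasD_pd (h₃ j)))).add ((hc _).mul (hasD_pd (k₁ j)))).add
      ((hc _).mul (hasD_pd (k₂ j)))).add ((hc _).mul (hasD_pd (k₃ j))))).pd i,
      splitMat_apply (pd i (fun y => α₁ y j) x)]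
    ring
  simp only [extDeriv₁, key]
  rw [← splitMat_sub]
  rfl

theorem curvMatrix_splitConn (h₁ : DiffForm α₁ x) (h₂ : DiffForm α₂ x) (h₃ : DiffForm α₃ x)
    (k₁ : DiffForm B₁ x) (k₂ : DiffForm B₂ x) (k₃ : DiffForm B₃ x) (i j a b : Fin 4) :
    curvMatrix (splitConn α₁ α₂ α₃ B₁ B₂ B₃) x i j a b
      = splitMat (extDeriv₁ α₁ x i j - wedge (α₃ x) (α₂ x) i j)
        (extDeriv₁ α₂ x i j + wedge (α₃ x) (α₁ x) i j)
        (extDeriv₁ α₃ x i j - wedge (α₂ x) (α₁ x) i j)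
        (extDeriv₁ B₁ x i j + wedge (B₃ x) (B₂ x) i j)
        (extDeriv₁ B₂ x i j - wedge (B₃ x) (B₁ x) i j)
        (extDeriv₁ B₃ x i j + wedge (B₂ x) (B₁ x) i j) a b := by
  have h := congrFun (congrFun (splitMat_commutator (α₁ x i) (α₂ x i) (α₃ x i) (B₁ x i) (B₂ x i)
    (B₃ x i) (α₁ x j) (α₂ x j) (α₃ x j) (B₁ x j) (B₂ x j) (B₃ x j)) a) b
  rw [curvMatrix, extDeriv₁_splitConn h₁ h₂ h₃ k₁ k₂ k₃, sum_sub_distrib]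
  simp only [Matrix.sub_apply, Matrix.mul_apply] at h
  simp only [splitConn, h, wedge]
  rw [← Matrix.add_apply, splitMat_add]
  congr 2 <;> ring

end

theorem isTorsionFree₄ {e₁ e₂ e₃ e₄ α₁ α₂ α₃ B₁ B₂ B₃ β : Field 4} {S : Set (Pt 4)}
    (h₁ : ∀ x ∈ S, ∀ i j, 2 * extDeriv₁ e₁ x i j + wedge (α₃ x + B₃ x) (e₂ x) i j
      + wedge (α₂ x + B₂ x) (e₃ x) i j + wedge (α₁ x + B₁ x) (e₄ x) i j
      + 2 * wedge (β x) (e₁ x) i j = 0)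
    (h₂ : ∀ x ∈ S, ∀ i j, 2 * extDeriv₁ e₂ x i j - wedge (α₃ x + B₃ x) (e₁ x) i j
      + wedge (α₁ x - B₁ x) (e₃ x) i j + wedge (B₂ x - α₂ x) (e₄ x) i j
      + 2 * wedge (β x) (e₂ x) i j = 0)
    (h₃ : ∀ x ∈ S, ∀ i j, 2 * extDeriv₁ e₃ x i j - wedge (α₂ x + B₂ x) (e₁ x) i j
      - wedge (α₁ x - B₁ x) (e₂ x) i j + wedge (α₃ x - B₃ x) (e₄ x) i j
      + 2 * wedge (β x) (e₃ x) i j = 0)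
    (h₄ : ∀ x ∈ S, ∀ i j, 2 * extDeriv₁ e₄ x i j - wedge (α₁ x + B₁ x) (e₁ x) i j
      - wedge (B₂ x - α₂ x) (e₂ x) i j - wedge (α₃ x - B₃ x) (e₃ x) i j
      + 2 * wedge (β x) (e₄ x) i j = 0) :
    IsTorsionFree (coframe₄ e₁ e₂ e₃ e₄) (splitConn α₁ α₂ α₃ B₁ B₂ B₃) β S := by
  intro x hx a i j
  have h₁ := h₁ x hx i j
  have h₂ := h₂ x hx i j
  have h₃ := h₃ x hx i j
  have h₄ := h₄ x hx i j
  simp only [wedge, Pi.add_apply, Pi.sub_apply] at h₁ h₂ h₃ h₄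
  fin_cases a
  · simp [splitConn, splitMat, coframe₄_zero, coframe₄_one, coframe₄_two, coframe₄_three,
      Fin.sum_univ_four]
    linear_combination (1 / 2) * h₁
  · simp [splitConn, splitMat, coframe₄_zero, coframe₄_one, coframe₄_two, coframe₄_three,
      Fin.sum_univ_four]
    linear_combination (1 / 2) * h₂
  · simp [splitConn, splitMat, coframe₄_zero, coframe₄_one, coframe₄_two, coframe₄_three,
      Fin.sum_univ_four]
    linear_combination (1 / 2) * h₃
  · simp [splitConn, splitMat, coframe₄_zero, coframe₄_one, coframe₄_two, coframe₄_three,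
      Fin.sum_univ_four]
    linear_combination (1 / 2) * h₄

/-- The value at the coordinate vectors `i`, `j` of the 2-form with the components `N` in the
coframe `e`. -/
def frameForm (e N : Matrix (Fin n) (Fin n) ℝ) (i j : Fin n) : ℝ :=
  ∑ c, ∑ d, N c d * e c i * e d j

/-- The curvature operator of a metric in dimension four in a coframe, with selfdual part
`-φ` and with antiselfdual part `M`. -/
def HasSplitCurvature (g : Metric 4) (φ : ℝ) (e : Matrix (Fin 4) (Fin 4) ℝ)
    (M : Matrix (Fin 3) (Fin 3) ℝ) (x : Pt 4) : Prop :=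
  ∀ a i j k, ∑ l, e a l * curvature (leviCivita g) x l k i j = ∑ b, splitMat
    (-φ * frameForm e (splitMat 2 0 0 0 0 0) i j) (-φ * frameForm e (splitMat 0 2 0 0 0 0) i j)
    (-φ * frameForm e (splitMat 0 0 2 0 0 0) i j)
    (frameForm e (splitMat 0 0 0 (2 * M 0 0) (2 * M 0 1) (2 * M 0 2)) i j)
    (frameForm e (splitMat 0 0 0 (2 * M 1 0) (2 * M 1 1) (2 * M 1 2)) i j)
    (frameForm e (splitMat 0 0 0 (2 * M 2 0) (2 * M 2 1) (2 * M 2 2)) i j) a b * e b k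

theorem frameForm_smul (e N : Matrix (Fin n) (Fin n) ℝ) (r : ℝ) (i j : Fin n) :
    r * frameForm e N i j = frameForm e (r • N) i j := by
  simp only [frameForm, mul_sum, Matrix.smul_apply, smul_eq_mul, mul_assoc]

theorem smul_splitMat (r p₁ p₂ p₃ m₁ m₂ m₃ : ℝ) :
    r • splitMat p₁ p₂ p₃ m₁ m₂ m₃ = splitMat (r * p₁) (r * p₂) (r * p₃) (r * m₁) (r * m₂) (r * m₃) := by
  ext a b
  fin_cases a <;> fin_cases b <;> simp [splitMat] <;> ring

section
variable {g : Metric 4} {φ : ℝ} {e : Matrix (Fin 4) (Fin 4) ℝ}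
  {M : Matrix (Fin 3) (Fin 3) ℝ} {x : Pt 4}

/-- The components of a curvature operator. -/
def splitK (φ : ℝ) (M : Matrix (Fin 3) (Fin 3) ℝ) (a b c d : Fin 4) : ℝ :=
  splitMat (splitMat (-(2 * φ)) 0 0 0 0 0 c d) (splitMat 0 (-(2 * φ)) 0 0 0 0 c d)
    (splitMat 0 0 (-(2 * φ)) 0 0 0 c d)
    (splitMat 0 0 0 (2 * M 0 0) (2 * M 0 1) (2 * M 0 2) c d)
    (splitMat 0 0 0 (2 * M 1 0) (2 * M 1 1) (2 * M 1 2) c d)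
    (splitMat 0 0 0 (2 * M 2 0) (2 * M 2 1) (2 * M 2 2) c d) a b

theorem splitMat_frameForm (N₁ N₂ N₃ N₄ N₅ N₆ : Matrix (Fin 4) (Fin 4) ℝ) (i j a b : Fin 4) :
    splitMat (frameForm e N₁ i j) (frameForm e N₂ i j) (frameForm e N₃ i j) (frameForm e N₄ i j)
      (frameForm e N₅ i j) (frameForm e N₆ i j) a b
      = ∑ c, ∑ d, splitMat (N₁ c d) (N₂ c d) (N₃ c d) (N₄ c d) (N₅ c d) (N₆ c d) a b
        * e c i * e d j := by
  rw [splitMat_apply]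
  simp only [frameForm, mul_sum, ← sum_add_distrib]
  refine sum_congr rfl fun c _ => sum_congr rfl fun d _ => ?_
  rw [splitMat_apply (N₁ c d)]
  ring

theorem HasSplitCurvature.eq (h : HasSplitCurvature g φ e M x) (a i j k : Fin 4) :
    ∑ l, e a l * curvature (leviCivita g) x l k i j
      = ∑ b, (∑ c, ∑ d, splitK φ M a b c d * e c i * e d j) * e b k := by
  rw [h a i j k]
  refine sum_congr rfl fun b _ => ?_
  rw [frameForm_smul, frameForm_smul, frameForm_smul, splitMat_frameForm]
  simp only [smul_splitMat, mul_zero]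
  simp only [splitK, mul_comm (-φ) 2, mul_neg]

theorem splitK_trace (hs : M.transpose = M) (ht : M 0 0 + M 1 1 + M 2 2 = -3 * φ) (b d : Fin 4) :
    ∑ a, splitK φ M a b a d = if b = d then -3 * φ else 0 := by
  have h01 : M 1 0 = M 0 1 := congrFun (congrFun hs 0) 1
  have h02 : M 2 0 = M 0 2 := congrFun (congrFun hs 0) 2
  have h12 : M 2 1 = M 1 2 := congrFun (congrFun hs 1) 2
  fin_cases b <;> fin_cases d <;> simp [splitK, splitMat, Fin.sum_univ_four, h01, h02, h12] <;>
    linarith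

/-- The Ricci tensor of a split curvature. -/
theorem HasSplitCurvature.ricci {e : Pt 4 → Matrix (Fin 4) (Fin 4) ℝ}
    (h : HasSplitCurvature g φ (e x) M x) (hd : (e x).det ≠ 0)
    (hs : M.transpose = M) (ht : M 0 0 + M 1 1 + M 2 2 = -3 * φ) (j k : Fin 4) :
    ricci (leviCivita g) x j k = -3 * (φ * ∑ a, e x a j * e x a k) := by
  rw [ricci_of_frame hd h.eq]
  simp only [splitK_trace hs ht]
  simp [mul_sum]
  exact sum_congr rfl fun a _ => by ring

/-- The part of the volume form with two free arguments. -/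
def starMat (u v : Fin 4 → ℝ) : Matrix (Fin 4) (Fin 4) ℝ :=
  !![0, u 2 * v 3 - u 3 * v 2, u 3 * v 1 - u 1 * v 3, u 1 * v 2 - u 2 * v 1;
    -(u 2 * v 3 - u 3 * v 2), 0, u 0 * v 3 - u 3 * v 0, u 2 * v 0 - u 0 * v 2;
    -(u 3 * v 1 - u 1 * v 3), -(u 0 * v 3 - u 3 * v 0), 0, u 0 * v 1 - u 1 * v 0;
    -(u 1 * v 2 - u 2 * v 1), -(u 2 * v 0 - u 0 * v 2), -(u 0 * v 1 - u 1 * v 0), 0]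

theorem det_eq_starMat (e : Matrix (Fin 4) (Fin 4) ℝ) (i j p q : Fin 4) :
    (Matrix.of fun a b => e a (![i, j, p, q] b)).det
      = frameForm e (starMat (fun a => e a i) (fun a => e a j)) p q := by
  rw [Matrix.det_succ_row_zero]
  simp [Fin.sum_univ_four, Matrix.det_fin_three, Fin.succAbove, frameForm, starMat]
  ring

theorem starMat_trace (u v : Fin 4 → ℝ) (m₁ m₂ m₃ : ℝ) :
    ∑ c, ∑ d, starMat u v c d * splitMat 0 0 0 m₁ m₂ m₃ c d
      = -2 * ∑ c, ∑ d, splitMat 0 0 0 m₁ m₂ m₃ c d * u c * v d := by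
  simp [starMat, splitMat, Fin.sum_univ_four]
  ring

/-- Antiselfdual forms are eigenforms of the Hodge operator. -/
theorem star_frameForm {S : Set (Pt 4)} {φ : Pt 4 → ℝ} {e : Pt 4 → Matrix (Fin 4) (Fin 4) ℝ}
    (h : IsConformalCoframe g φ e S) (hx : x ∈ S) (hpos : 0 < (e x).det) (m₁ m₂ m₃ : ℝ)
    (i j : Fin 4) :
    (1 / 2) * ∑ p, ∑ q, ∑ r, ∑ s, volForm g x ![i, j, p, q] * (g x)⁻¹ p r * (g x)⁻¹ q s
      * frameForm (e x) (splitMat 0 0 0 m₁ m₂ m₃) r s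
      = -frameForm (e x) (splitMat 0 0 0 m₁ m₂ m₃) i j := by
  have hu : IsUnit (e x).det := isUnit_iff_ne_zero.mpr (h.det_ne x hx)
  have hφ := h.pos x hx
  set E := e x
  set N := splitMat 0 0 0 m₁ m₂ m₃
  set D := starMat (fun a => E a i) (fun a => E a j)
  have hform : ∀ (N : Matrix (Fin 4) (Fin 4) ℝ) r s, frameForm E N r s
      = (E.transpose * N * E) r s := by
    intro N r s
    simp only [frameForm, Matrix.mul_apply, sum_mul, Matrix.transpose_apply]
    rw [sum_comm]
    exact sum_congr rfl fun c _ => sum_congr rfl fun d _ => by ring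
  have hvol : ∀ p q, volForm g x ![i, j, p, q] = φ x ^ 2 * (E.transpose * D * E) p q := by
    intro p q
    rw [volForm_of_coframe h hx hpos, det_eq_starMat, hform]
    congr 1
    rw [show φ x ^ 4 = (φ x ^ 2) ^ 2 by ring]
    exact Real.sqrt_sq (by positivity)
  have hsum : ∀ p q, ∑ r, ∑ s, (g x)⁻¹ p r * (g x)⁻¹ q s * frameForm E N r s
      = (φ x ^ 2)⁻¹ * (E⁻¹ * N * (E⁻¹).transpose) p q := by
    intro p q
    have hG : (g x)⁻¹ * (E.transpose * N * E) * ((g x)⁻¹).transpose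
        = (φ x ^ 2)⁻¹ • (E⁻¹ * N * (E⁻¹).transpose) := by
      have e1 : (E⁻¹).transpose * E.transpose = 1 := by
        rw [← Matrix.transpose_mul, Matrix.mul_nonsing_inv _ hu, Matrix.transpose_one]
      have e2 : E * E⁻¹ = 1 := Matrix.mul_nonsing_inv _ hu
      rw [h.inv_metric hx]
      simp only [Matrix.transpose_smul, Matrix.transpose_mul, Matrix.transpose_transpose,
        Matrix.smul_mul, Matrix.mul_smul, smul_smul]
      congr 1
      · rw [pow_two, mul_inv]
      · calc E⁻¹ * (E⁻¹).transpose * (E.transpose * N * E) * (E⁻¹ * (E⁻¹).transpose)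
            = E⁻¹ * ((E⁻¹).transpose * E.transpose) * N * (E * E⁻¹) * (E⁻¹).transpose := by
              simp only [Matrix.mul_assoc]
          _ = _ := by rw [e1, e2, Matrix.mul_one, Matrix.mul_one]
    have := congrFun (congrFun hG p) q
    rw [Matrix.smul_apply, smul_eq_mul] at this
    rw [← this]
    simp only [hform, Matrix.mul_apply (M := (g x)⁻¹ * (E.transpose * N * E)),
      Matrix.mul_apply (M := (g x)⁻¹), sum_mul, Matrix.transpose_apply (M := (g x)⁻¹)]
    rw [sum_comm]
    exact sum_congr rfl fun c _ => sum_congr rfl fun d _ => by ring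
  have h1 : ∀ p q, ∑ r, ∑ s, volForm g x ![i, j, p, q] * (g x)⁻¹ p r * (g x)⁻¹ q s
      * frameForm E N r s = (E.transpose * D * E) p q * (E⁻¹ * N * (E⁻¹).transpose) p q := by
    intro p q
    have : ∑ r, ∑ s, volForm g x ![i, j, p, q] * (g x)⁻¹ p r * (g x)⁻¹ q s * frameForm E N r s
        = volForm g x ![i, j, p, q]
          * ∑ r, ∑ s, (g x)⁻¹ p r * (g x)⁻¹ q s * frameForm E N r s := by
      simp only [mul_sum]
      exact sum_congr rfl fun c _ => sum_congr rfl fun d _ => by ring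
    rw [this, hsum, hvol]
    field_simp
  have h2 : ∑ p, ∑ q, (E.transpose * D * E) p q * (E⁻¹ * N * (E⁻¹).transpose) p q
      = ∑ c, ∑ d, D c d * N c d := by
    have t : ∀ A B : Matrix (Fin 4) (Fin 4) ℝ,
        ∑ p, ∑ q, A p q * B p q = Matrix.trace (A.transpose * B) := by
      intro A B
      simp only [Matrix.trace, Matrix.diag, Matrix.mul_apply, Matrix.transpose_apply]
      exact sum_comm
    have e1 : (E⁻¹).transpose * E.transpose = 1 := by
      rw [← Matrix.transpose_mul, Matrix.mul_nonsing_inv _ hu, Matrix.transpose_one]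
    have e2 : E * E⁻¹ = 1 := Matrix.mul_nonsing_inv _ hu
    rw [t, t]
    simp only [Matrix.transpose_mul, Matrix.transpose_transpose]
    calc (E.transpose * (D.transpose * E) * (E⁻¹ * N * (E⁻¹).transpose)).trace
        = (E.transpose * (D.transpose * (E * E⁻¹) * N * (E⁻¹).transpose)).trace := by
          simp only [Matrix.mul_assoc]
      _ = (D.transpose * N * ((E⁻¹).transpose * E.transpose)).trace := by
          rw [Matrix.trace_mul_comm, e2]; simp only [Matrix.mul_assoc, Matrix.one_mul]
      _ = _ := by rw [e1, Matrix.mul_one]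
  simp only [h1]
  rw [h2, starMat_trace]
  simp only [frameForm]
  ring

theorem splitMat_completeness (u v X Y : Fin 4 → ℝ) :
    (∑ a, u a * X a) * (∑ a, v a * Y a) - (∑ a, v a * X a) * (∑ a, u a * Y a)
      = ∑ a, X a * ∑ b, splitMat (∑ c, ∑ d, splitMat 2 0 0 0 0 0 c d * u c * v d)
          (∑ c, ∑ d, splitMat 0 2 0 0 0 0 c d * u c * v d)
          (∑ c, ∑ d, splitMat 0 0 2 0 0 0 c d * u c * v d)
          (∑ c, ∑ d, splitMat 0 0 0 2 0 0 c d * u c * v d)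
          (∑ c, ∑ d, splitMat 0 0 0 0 2 0 c d * u c * v d)
          (∑ c, ∑ d, splitMat 0 0 0 0 0 2 c d * u c * v d) a b * Y b := by
  simp [Fin.sum_univ_four, splitMat]
  ring

theorem frameForm_splitMat_anti (e : Matrix (Fin 4) (Fin 4) ℝ) (m₁ m₂ m₃ : ℝ) (i j : Fin 4) :
    frameForm e (splitMat 0 0 0 (2 * m₁) (2 * m₂) (2 * m₃)) i j
      = m₁ * frameForm e (splitMat 0 0 0 2 0 0) i j + m₂ * frameForm e (splitMat 0 0 0 0 2 0) i j
        + m₃ * frameForm e (splitMat 0 0 0 0 0 2) i j := by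
  simp only [frameForm_smul, smul_splitMat]
  simp only [frameForm, ← sum_add_distrib]
  refine sum_congr rfl fun c _ => sum_congr rfl fun d _ => ?_
  rw [splitMat_apply, splitMat_apply (m₁ * 0), splitMat_apply (m₂ * 0), splitMat_apply (m₃ * 0)]
  ring

/-- A metric with split curvature is Einstein and antiselfdual for the orientation of the
coframe. -/
theorem weyl_selfDual {S : Set (Pt 4)} {φ : Pt 4 → ℝ} {e : Pt 4 → Matrix (Fin 4) (Fin 4) ℝ}
    (hc : IsConformalCoframe g φ e S) (hx : x ∈ S) (hpos : 0 < (e x).det)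
    (h : HasSplitCurvature g (φ x) (e x) M x)
    (hs : M.transpose = M) (ht : M 0 0 + M 1 1 + M 2 2 = -3 * φ x) (hscal : scalarCurv g x = -12)
    (i j k l : Fin 4) :
    weyl g x i j k l = (((-1 : ℤˣ) : ℤ) : ℝ) * ((1 / 2) * ∑ p, ∑ q, ∑ r, ∑ s,
      volForm g x ![i, j, p, q] * (g x)⁻¹ p r * (g x)⁻¹ q s * weyl g x r s k l) := by
  have hric : ∀ j k, ricci (leviCivita g) x j k = -3 * g x j k := fun j k => by
    rw [h.ricci (hc.det_ne x hx) hs ht, hc.eq x hx]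
  let N : Fin 3 → ℝ := fun t => φ x * ∑ a, e x a l * ∑ b, splitMat 0 0 0
    (M 0 t + if t = 0 then φ x else 0) (M 1 t + if t = 1 then φ x else 0)
    (M 2 t + if t = 2 then φ x else 0) a b * e x b k
  have hW : ∀ i j, weyl g x i j k l
      = frameForm (e x) (splitMat 0 0 0 (2 * N 0) (2 * N 1) (2 * N 2)) i j := by
    intro i j
    have hR : ∑ r, g x l r * curvature (leviCivita g) x r k i j
        = φ x * ∑ a, e x a l * ∑ r, e x a r * curvature (leviCivita g) x r k i j := by
      simp only [hc.eq x hx, mul_sum, sum_mul]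
      rw [sum_comm]
      exact sum_congr rfl fun _ _ => sum_congr rfl fun _ _ => by ring
    have hcomp := splitMat_completeness (fun a => e x a i) (fun a => e x a j)
      (fun a => e x a l) (fun a => e x a k)
    have hw : weyl g x i j k l = (∑ r, g x l r * curvature (leviCivita g) x r k i j)
        + (g x i l * g x j k - g x j l * g x i k) := by
      rw [weyl, hscal]
      simp only [hric]
      ring
    have hg : g x i l * g x j k - g x j l * g x i k = φ x ^ 2 *
        ((∑ a, e x a i * e x a l) * (∑ a, e x a j * e x a k)
          - (∑ a, e x a j * e x a l) * (∑ a, e x a i * e x a k)) := by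
      simp only [hc.eq x hx]
      ring
    rw [hw, hR, hg, hcomp]
    simp only [h _ i j k]
    rw [frameForm_splitMat_anti (e x) (N 0)]
    simp only [frameForm_splitMat_anti (e x) (M _ _)]
    simp only [N, ← frameForm.eq_1]
    generalize frameForm (e x) (splitMat 2 0 0 0 0 0) i j = a₁
    generalize frameForm (e x) (splitMat 0 2 0 0 0 0) i j = a₂
    generalize frameForm (e x) (splitMat 0 0 2 0 0 0) i j = a₃
    generalize frameForm (e x) (splitMat 0 0 0 2 0 0) i j = b₁
    generalize frameForm (e x) (splitMat 0 0 0 0 2 0) i j = b₂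
    generalize frameForm (e x) (splitMat 0 0 0 0 0 2) i j = b₃
    simp only [mul_sum, sum_mul, ← sum_add_distrib]
    refine sum_congr rfl fun a _ => sum_congr rfl fun b _ => ?_
    have hN : ∀ p q r a b, splitMat 0 0 0 p q r a b = splitMat 0 0 0 1 0 0 a b * p
        + splitMat 0 0 0 0 1 0 a b * q + splitMat 0 0 0 0 0 1 a b * r := fun p q r a b => by
      rw [splitMat_apply]; ring
    rw [splitMat_apply (-φ x * a₁), splitMat_apply a₁]
    simp [hN (M 0 _ + _), hN (M 0 _)]
    ring
  have hst := star_frameForm hc hx hpos (2 * N 0) (2 * N 1) (2 * N 2) i j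
  simp only [hW]
  rw [hst]
  simp

theorem scalarCurv_of_einstein (hg : (g x).PosDef) {c : ℝ}
    (h : ∀ j k, ricci (leviCivita g) x j k = c * g x j k) : scalarCurv g x = 4 * c := by
  have h1 : (g x)⁻¹ * g x = 1 := Matrix.nonsing_inv_mul _ (isUnit_iff_ne_zero.mpr hg.det_pos.ne')
  have h2 : ∀ j k, g x j k = g x k j := fun j k => by
    have := congrFun (congrFun hg.1 j) k
    simpa using this.symm
  have h3 : ∑ j, ∑ k, (g x)⁻¹ j k * g x k j = 4 := by
    have := congrArg Matrix.trace h1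
    simpa [Matrix.trace, Matrix.mul_apply] using this
  rw [scalarCurv, ← h3, sum_mul]
  refine sum_congr rfl fun j _ => ?_
  rw [sum_mul]
  exact sum_congr rfl fun k _ => by rw [h, h2 j k]; ring

end

theorem exists_frameForm {e : Matrix (Fin n) (Fin n) ℝ} (hd : e.det ≠ 0) (F : Fin n → Fin n → ℝ)
    (hF : ∀ i j, F i j = -F j i) :
    ∃ N : Matrix (Fin n) (Fin n) ℝ, (∀ c d, N c d = -N d c) ∧ ∀ i j, F i j = frameForm e N i j := by
  have hu : IsUnit e.det := isUnit_iff_ne_zero.mpr hd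
  refine ⟨(e⁻¹).transpose * Matrix.of F * e⁻¹, fun c d => ?_, fun i j => ?_⟩
  · have h1 : ((e⁻¹).transpose * Matrix.of F * e⁻¹).transpose
        = -((e⁻¹).transpose * Matrix.of F * e⁻¹) := by
      have : (Matrix.of F).transpose = -Matrix.of F := by
        ext i j; simpa using hF j i
      rw [Matrix.transpose_mul, Matrix.transpose_mul, this, Matrix.transpose_transpose,
        Matrix.neg_mul, Matrix.mul_neg, Matrix.mul_assoc]
    have := congrFun (congrFun h1 d) c
    simpa using this
  · have h1 : e.transpose * ((e⁻¹).transpose * Matrix.of F * e⁻¹) * e = Matrix.of F := by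
      calc e.transpose * ((e⁻¹).transpose * Matrix.of F * e⁻¹) * e
          = (e.transpose * (e⁻¹).transpose) * Matrix.of F * (e⁻¹ * e) := by
            simp only [Matrix.mul_assoc]
        _ = _ := by
          rw [← Matrix.transpose_mul, Matrix.nonsing_inv_mul _ hu, Matrix.transpose_one,
            Matrix.one_mul, Matrix.mul_one]
    have := congrFun (congrFun h1 i) j
    rw [Matrix.of_apply] at this
    rw [← this]
    simp only [frameForm, Matrix.mul_apply (N := e), Matrix.mul_apply (M := e.transpose),
      sum_mul, Matrix.transpose_apply e]
    rw [sum_comm]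
    exact sum_congr rfl fun c _ => sum_congr rfl fun d _ => by ring

theorem eq_zero_of_sum_coframe {e : Matrix (Fin n) (Fin n) ℝ} (hd : e.det ≠ 0) {v : Fin n → ℝ}
    (h : ∀ k, ∑ b, v b * e b k = 0) (b : Fin n) : v b = 0 :=
  congrFun (Matrix.eq_zero_of_vecMul_eq_zero hd (funext h)) b

/-- The first Bianchi identity in a coframe. -/
theorem bianchi_frame {e : Matrix (Fin n) (Fin n) ℝ} (hd : e.det ≠ 0) {Γ : Conn n} {x : Pt n}
    {K : Fin n → Fin n → Fin n → Fin n → ℝ}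
    (hb : ∀ l i j k, curvature Γ x l k i j + curvature Γ x l i j k + curvature Γ x l j k i = 0)
    (h : ∀ a i j k, ∑ l, e a l * curvature Γ x l k i j
      = ∑ b, (∑ c, ∑ d, K a b c d * e c i * e d j) * e b k) (a b c d : Fin n) :
    K a b c d + K a c d b + K a d b c = 0 := by
  have h1 : ∀ i j k, ∑ b, (∑ c, (∑ d, (K a b c d + K a c d b + K a d b c) * e d j) * e c i) * e b k
      = 0 := by
    intro i j k
    have t : ∑ l, e a l * (curvature Γ x l k i j + curvature Γ x l i j k + curvature Γ x l j k i)
        = 0 := by simp [hb]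
    simp only [mul_add, sum_add_distrib, h, sum_mul] at t
    have e1 : ∑ x, ∑ y, ∑ z, K a x y z * e y j * e z k * e x i
        = ∑ b, ∑ c, ∑ d, K a c d b * e d j * e c i * e b k := by
      rw [Finset.sum_comm' (t' := Finset.univ) (s' := fun _ => Finset.univ) (by simp)]
      rw [sum_congr rfl fun y _ => sum_comm]
      rw [sum_comm]
      refine sum_congr rfl fun b _ => ?_
      rw [sum_comm]
      exact sum_congr rfl fun c _ => sum_congr rfl fun d _ => by ring
    have e2 : ∑ x, ∑ y, ∑ z, K a x y z * e y k * e z i * e x j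
        = ∑ b, ∑ c, ∑ d, K a d b c * e d j * e c i * e b k := by
      rw [sum_comm]
      refine sum_congr rfl fun b _ => ?_
      rw [sum_comm]
      exact sum_congr rfl fun c _ => sum_congr rfl fun d _ => by ring
    have e3 : ∑ x, ∑ y, ∑ z, K a x y z * e y i * e z j * e x k
        = ∑ b, ∑ c, ∑ d, K a b c d * e d j * e c i * e b k :=
      sum_congr rfl fun b _ => sum_congr rfl fun c _ =>
        sum_congr rfl fun d _ => by ring
    rw [e1, e2, e3] at t
    simp only [sum_mul, add_mul, sum_add_distrib]
    exact t
  exact eq_zero_of_sum_coframe hd (fun j => eq_zero_of_sum_coframe hd (fun i =>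
    eq_zero_of_sum_coframe hd (fun k => h1 i j k) b) c) d

/-- If the selfdual part of the connection of a Kähler metric has antiselfdual curvature, then the
metric is scalar-flat. -/
theorem scalarCurv_eq_zero {g : Metric 4} {S : Set (Pt 4)} {φ : Pt 4 → ℝ}
    {e : Pt 4 → Matrix (Fin 4) (Fin 4) ℝ} {x : Pt 4}
    (hc : IsConformalCoframe g φ e S) (hx : x ∈ S) {r₁ r₂ r₃ : ℝ}
    {M₁ M₂ M₃ : Fin 4 → Fin 4 → ℝ}
    (hb : ∀ l i j k, curvature (leviCivita g) x l k i j + curvature (leviCivita g) x l i j k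
      + curvature (leviCivita g) x l j k i = 0)
    (h₁ : ∀ i j, M₁ i j = -M₁ j i) (h₂ : ∀ i j, M₂ i j = -M₂ j i) (h₃ : ∀ i j, M₃ i j = -M₃ j i)
    (h : ∀ a i j k, ∑ l, e x a l * curvature (leviCivita g) x l k i j = ∑ b, splitMat 0 0
      (frameForm (e x) (splitMat 0 0 0 r₁ r₂ r₃) i j) (M₁ i j) (M₂ i j) (M₃ i j) a b * e x b k) :
    scalarCurv g x = 0 := by
  have hd := hc.det_ne x hx
  have hu : IsUnit (e x).det := isUnit_iff_ne_zero.mpr hd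
  obtain ⟨N₁, k₁, h₁⟩ := exists_frameForm hd M₁ h₁
  obtain ⟨N₂, k₂, h₂⟩ := exists_frameForm hd M₂ h₂
  obtain ⟨N₃, k₃, h₃⟩ := exists_frameForm hd M₃ h₃
  have h0 : ∀ i j, (0 : ℝ) = frameForm (e x) (0 : Matrix (Fin 4) (Fin 4) ℝ) i j := by
    intro i j; simp [frameForm]
  let K : Fin 4 → Fin 4 → Fin 4 → Fin 4 → ℝ := fun a b c d =>
    splitMat 0 0 (splitMat 0 0 0 r₁ r₂ r₃ c d) (N₁ c d) (N₂ c d) (N₃ c d) a b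
  have hK : ∀ a i j k, ∑ l, e x a l * curvature (leviCivita g) x l k i j
      = ∑ b, (∑ c, ∑ d, K a b c d * e x c i * e x d j) * e x b k := by
    intro a i j k
    rw [h]
    refine sum_congr rfl fun b _ => ?_
    rw [h₁, h₂, h₃]
    have := splitMat_frameForm (e := e x) 0 0 (splitMat 0 0 0 r₁ r₂ r₃) N₁ N₂ N₃ i j a b
    rw [← h0] at this
    rw [this]
    rfl
  have hB := bianchi_frame hd hb hK
  have htr : ∑ j, ∑ k, (g x)⁻¹ j k * ricci (leviCivita g) x j k
      = (φ x)⁻¹ * ∑ b, ∑ a, K a b a b := by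
    have hR : ∀ j k, ricci (leviCivita g) x j k
        = ((e x).transpose * (Matrix.of fun d b => ∑ a, K a b a d) * e x) j k := by
      intro j k
      rw [ricci_of_frame hd hK]
      simp only [Matrix.mul_apply (N := e x), Matrix.mul_apply (M := (e x).transpose),
        sum_mul, Matrix.transpose_apply (e x), Matrix.of_apply]
      refine sum_congr rfl fun c _ => sum_congr rfl fun d _ => ?_
      rw [← sum_mul, ← sum_mul]
      ring
    simp only [hR, hc.inv_metric hx]
    have t : ∀ A B : Matrix (Fin 4) (Fin 4) ℝ,
        ∑ p, ∑ q, A p q * B p q = Matrix.trace (A.transpose * B) := by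
      intro A B
      simp only [Matrix.trace, Matrix.diag, Matrix.mul_apply, Matrix.transpose_apply]
      exact sum_comm
    rw [t]
    simp only [Matrix.transpose_smul, Matrix.transpose_mul, Matrix.transpose_transpose,
      Matrix.smul_mul, Matrix.trace_smul, smul_eq_mul]
    congr 1
    set X := Matrix.of fun d b => ∑ a, K a b a d
    have e1 : (e x)⁻¹.transpose * (e x).transpose = 1 := by
      rw [← Matrix.transpose_mul, Matrix.mul_nonsing_inv _ hu, Matrix.transpose_one]
    calc ((e x)⁻¹ * (e x)⁻¹.transpose * ((e x).transpose * X * e x)).trace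
        = ((e x)⁻¹ * (((e x)⁻¹.transpose * (e x).transpose) * X * e x)).trace := by
          simp only [Matrix.mul_assoc]
      _ = X.trace := by
          rw [e1, Matrix.one_mul, Matrix.trace_mul_comm, Matrix.mul_assoc,
            Matrix.mul_nonsing_inv _ hu, Matrix.mul_one]
      _ = _ := rfl
  rw [scalarCurv, htr]
  have b1 := hB 0 1 2 3
  have b2 := hB 1 0 2 3
  have b3 := hB 2 0 1 3
  have b4 := hB 3 0 1 2
  simp [K, splitMat] at b1 b2 b3 b4
  have : ∑ b, ∑ a, K a b a b = 0 := by
    simp [K, splitMat, Fin.sum_univ_four]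
    have a1 := k₁ 3 0
    have a2 := k₁ 2 1
    have a3 := k₂ 2 0
    have a4 := k₂ 3 1
    have a5 := k₃ 1 0
    have a6 := k₃ 3 2
    linarith
  rw [this, mul_zero]

/-! ### The structure equations of the hyperCR Toda spaces -/

/-- The complex coordinate `x_{u} + i x_{v}`. -/
def planeCoord (u v : Fin n) (x : Pt n) : ℂ := ⟨x u, x v⟩

/-- The differential of the complex coordinate. -/
def dPlane (u v i : Fin n) : ℂ := ⟨if i = u then 1 else 0, if i = v then 1 else 0⟩

/-- The differential of a coordinate. -/
def dCoord (k : Fin n) : Field n := fun _ i => if i = k then 1 else 0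

/-- The square root of the conformal factor of the sphere. -/
def sphereScale (ζ : ℂ) : ℝ := 2 / (1 + Complex.normSq ζ)

/-- The connection form of the sphere. -/
def rotForm (u v : Fin n) : Field n := fun x i =>
  sphereScale (planeCoord u v x) * (x u * (dPlane u v i).im - x v * (dPlane u v i).re)

theorem sphereScale_pos (ζ : ℂ) : 0 < sphereScale ζ :=
  div_pos two_pos (by have := Complex.normSq_nonneg ζ; linarith)

theorem sphereFactor_eq (ζ : ℂ) : sphereFactor ζ = sphereScale ζ ^ 2 := by
  rw [sphereFactor, sphereScale, div_pow]; norm_num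

theorem hasD_planeCoord (u v : Fin n) (x : Pt n) :
    HasD (planeCoord u v) (fun i => dPlane u v i) x := by
  have := ((hasD_coord (x := x) u).ofReal).add
    (((hasD_coord (x := x) v).ofReal).mul (hasD_const Complex.I))
  have e : planeCoord u v = fun y : Pt n => ((y u : ℝ) : ℂ) + ((y v : ℝ) : ℂ) * Complex.I := by
    funext y; rw [planeCoord, Complex.mk_eq_add_mul_I]
  rw [e]
  refine this.congr_D fun i => ?_
  rw [dPlane, Complex.mk_eq_add_mul_I]
  simp

theorem hasD_sphereScale (u v : Fin n) (x : Pt n) :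
    HasD (fun y => sphereScale (planeCoord u v y)) (fun i => -sphereScale (planeCoord u v x) ^ 2
      * (x u * (dPlane u v i).re + x v * (dPlane u v i).im)) x := by
  have h0 : (1 : ℝ) + (x u * x u + x v * x v) ≠ 0 := by nlinarith [mul_self_nonneg (x u), mul_self_nonneg (x v)]
  have h1 := hasD_coord (x := x) u
  have h2 := hasD_coord (x := x) v
  have := (hasD_const (x := x) (2 : ℝ)).mul
    (((hasD_const (x := x) (1 : ℝ)).add ((h1.mul h1).add (h2.mul h2))).inv h0)
  refine this.congr_D fun i => ?_
  simp only [sphereScale, planeCoord, Complex.normSq_mk, dPlane]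
  field_simp
  ring

theorem contDiff_planeCoord (u v : Fin n) : ContDiff ℝ ∞ (planeCoord u v) := by
  have e : planeCoord u v = fun y : Pt n => ((y u : ℝ) : ℂ) + ((y v : ℝ) : ℂ) * Complex.I := by
    funext y; rw [planeCoord, Complex.mk_eq_add_mul_I]
  rw [e]
  exact (Complex.ofRealCLM.contDiff.comp (contDiff_apply ℝ ℝ u)).add
    ((Complex.ofRealCLM.contDiff.comp (contDiff_apply ℝ ℝ v)).mul contDiff_const)

theorem contDiff_sphereScale (u v : Fin n) :
    ContDiff ℝ ∞ (fun x : Pt n => sphereScale (planeCoord u v x)) := by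
  simp only [sphereScale, planeCoord, Complex.normSq_mk]
  refine contDiff_const.div (contDiff_const.add (((contDiff_apply ℝ ℝ u).mul
    (contDiff_apply ℝ ℝ u)).add ((contDiff_apply ℝ ℝ v).mul (contDiff_apply ℝ ℝ v)))) ?_
  intro x
  nlinarith [mul_self_nonneg (x u), mul_self_nonneg (x v)]

theorem contDiff_rotForm (u v i : Fin n) : ContDiff ℝ ∞ (fun x : Pt n => rotForm u v x i) :=
  (contDiff_sphereScale u v).mul (((contDiff_apply ℝ ℝ u).mul contDiff_const).sub
    ((contDiff_apply ℝ ℝ v).mul contDiff_const))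

theorem extDeriv₁_rotForm (u v : Fin n) (x : Pt n) (i j : Fin n) :
    extDeriv₁ (rotForm u v) x i j = sphereScale (planeCoord u v x) ^ 2
      * ((dPlane u v i).re * (dPlane u v j).im - (dPlane u v j).re * (dPlane u v i).im) := by
  have key : ∀ j, HasD (fun y => rotForm u v y j) _ x := fun j =>
    (hasD_sphereScale u v x).mul (((hasD_coord (x := x) u).mul (hasD_const (dPlane u v j).im)).sub
      ((hasD_coord (x := x) v).mul (hasD_const (dPlane u v j).re)))
  rw [extDeriv₁, (key j).pd, (key i).pd]
  have e : ∀ k : Fin n, (if k = u then (1 : ℝ) else 0) = (dPlane u v k).re := fun _ => rfl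
  have e' : ∀ k : Fin n, (if k = v then (1 : ℝ) else 0) = (dPlane u v k).im := fun _ => rfl
  simp only [e, e']
  generalize (dPlane u v i).re = a
  generalize (dPlane u v i).im = b
  generalize (dPlane u v j).re = c
  generalize (dPlane u v j).im = d
  have h0 : (1 : ℝ) + (x u * x u + x v * x v) ≠ 0 := by
    nlinarith [mul_self_nonneg (x u), mul_self_nonneg (x v)]
  simp only [sphereScale, planeCoord, Complex.normSq_mk]
  field_simp
  ring

/-- The points over `U` with `z + h ≠ 0`. -/
def todaSet (U : Set ℂ) (h : ℂ → ℂ) (u v w : Fin n) : Set (Pt n) :=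
  {x | planeCoord u v x ∈ U ∧ (x w : ℂ) + h (planeCoord u v x) ≠ 0}

section toda
variable (h : ℂ → ℂ) (u v w : Fin n)

/-- `1 / (z + h)`. -/
def todaInv (x : Pt n) : ℂ := ((x w : ℂ) + h (planeCoord u v x))⁻¹

/-- The form `2 (z + h) dζ / (1 + |ζ|²)`. -/
def todaE (x : Pt n) (i : Fin n) : ℂ :=
  ((x w : ℂ) + h (planeCoord u v x)) * sphereScale (planeCoord u v x) * dPlane u v i

/-- The function `C` with `d (1 / (z + h)) = - dz / (z + h)² - C E`. -/
def todaC (x : Pt n) : ℂ :=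
  todaInv h u v w x ^ 3 * deriv h (planeCoord u v x) / sphereScale (planeCoord u v x)

/-- The component of `dC` along `E`. -/
def todaR (x : Pt n) : ℂ :=
  todaInv h u v w x ^ 4 * deriv (deriv h) (planeCoord u v x) / sphereScale (planeCoord u v x) ^ 2
    - 3 * todaInv h u v w x ^ 5 * deriv h (planeCoord u v x) ^ 2
      / sphereScale (planeCoord u v x) ^ 2
    + todaInv h u v w x ^ 4 * deriv h (planeCoord u v x)
      * (starRingEnd ℂ) (planeCoord u v x) / sphereScale (planeCoord u v x)

/-- The real part of `1 / (z + h)`. -/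
def tp (x : Pt n) : ℝ := (todaInv h u v w x).re
/-- Minus the imaginary part of `1 / (z + h)`. -/
def tq (x : Pt n) : ℝ := -(todaInv h u v w x).im
/-- The real part of `C`. -/
def tc₁ (x : Pt n) : ℝ := (todaC h u v w x).re
/-- Minus the imaginary part of `C`. -/
def tc₂ (x : Pt n) : ℝ := -(todaC h u v w x).im
/-- The real part of `R`. -/
def tr₁ (x : Pt n) : ℝ := (todaR h u v w x).re
/-- Minus the imaginary part of `R`. -/
def tr₂ (x : Pt n) : ℝ := -(todaR h u v w x).im
/-- The real part of `E`. -/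
def te₁ : Field n := fun x i => (todaE h u v w x i).re
/-- The imaginary part of `E`. -/
def te₂ : Field n := fun x i => (todaE h u v w x i).im

variable {h u v w} {U : Set ℂ} {x : Pt n}

theorem isOpen_todaSet (hU : IsOpen U) (hh : DifferentiableOn ℂ h U) :
    IsOpen (todaSet U h u v w : Set (Pt n)) := by
  have hc : Continuous (planeCoord u v : Pt n → ℂ) := (contDiff_planeCoord u v).continuous
  have h1 : IsOpen ((planeCoord u v : Pt n → ℂ) ⁻¹' U) := hU.preimage hc
  have h2 : ContinuousOn (fun x : Pt n => (x w : ℂ) + h (planeCoord u v x))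
      ((planeCoord u v : Pt n → ℂ) ⁻¹' U) :=
    (Complex.continuous_ofReal.comp (continuous_apply w)).continuousOn.add
      (hh.continuousOn.comp hc.continuousOn fun x hx => hx)
  exact h2.isOpen_inter_preimage h1 isOpen_compl_singleton

theorem contDiffOn_holo (hU : IsOpen U) {k : ℂ → ℂ} (hk : DifferentiableOn ℂ k U) (u v : Fin n) :
    ContDiffOn ℝ ∞ (fun x : Pt n => k (planeCoord u v x)) {x | planeCoord u v x ∈ U} :=
  ((hk.contDiffOn (n := ∞) hU).restrict_scalars ℝ).comp
    (contDiff_planeCoord u v).contDiffOn fun x hx => hx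

theorem contDiffOn_todaInv (hU : IsOpen U) (hh : DifferentiableOn ℂ h U) :
    ContDiffOn ℝ ∞ (todaInv h u v w : Pt n → ℂ) (todaSet U h u v w) := by
  have h1 : ContDiffOn ℝ ∞ (fun x : Pt n => (x w : ℂ) + h (planeCoord u v x))
      (todaSet U h u v w) :=
    (Complex.ofRealCLM.contDiff.comp (contDiff_apply ℝ ℝ w)).contDiffOn.add
      ((contDiffOn_holo hU hh u v).mono fun x hx => hx.1)
  exact h1.inv fun x hx => hx.2

theorem contDiffOn_re {F : Pt n → ℂ} {S : Set (Pt n)} (hF : ContDiffOn ℝ ∞ F S) :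
    ContDiffOn ℝ ∞ (fun x => (F x).re) S := Complex.reCLM.contDiff.comp_contDiffOn hF

theorem contDiffOn_im {F : Pt n → ℂ} {S : Set (Pt n)} (hF : ContDiffOn ℝ ∞ F S) :
    ContDiffOn ℝ ∞ (fun x => (F x).im) S := Complex.imCLM.contDiff.comp_contDiffOn hF

theorem contDiffOn_todaE (hU : IsOpen U) (hh : DifferentiableOn ℂ h U) (i : Fin n) :
    ContDiffOn ℝ ∞ (fun x : Pt n => todaE h u v w x i) (todaSet U h u v w) :=
  (((Complex.ofRealCLM.contDiff.comp (contDiff_apply ℝ ℝ w)).contDiffOn.add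
    ((contDiffOn_holo hU hh u v).mono fun x hx => hx.1)).mul
    (Complex.ofRealCLM.contDiff.comp (contDiff_sphereScale u v)).contDiffOn).mul contDiffOn_const

theorem diffForm_te₁ (hU : IsOpen U) (hh : DifferentiableOn ℂ h U)
    (hx : x ∈ todaSet U h u v w) : DiffForm (te₁ h u v w) x := fun i =>
  ((contDiffOn_re (contDiffOn_todaE hU hh i)).contDiffAt
    ((isOpen_todaSet hU hh).mem_nhds hx)).differentiableAt (by simp)

theorem diffForm_te₂ (hU : IsOpen U) (hh : DifferentiableOn ℂ h U)
    (hx : x ∈ todaSet U h u v w) : DiffForm (te₂ h u v w) x := fun i =>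
  ((contDiffOn_im (contDiffOn_todaE hU hh i)).contDiffAt
    ((isOpen_todaSet hU hh).mem_nhds hx)).differentiableAt (by simp)

theorem diffForm_dCoord (k : Fin n) : DiffForm (dCoord k) x := fun _ => differentiableAt_const _

theorem extDeriv₁_dCoord (k i j : Fin n) : extDeriv₁ (dCoord k) x i j = 0 := by
  simp [extDeriv₁, dCoord, pd_const]

theorem hasD_coord' (k : Fin n) : HasD (fun y : Pt n => y k) (dCoord k x) x := hasD_coord k

theorem hasD_holo (hU : IsOpen U) (hx : planeCoord u v x ∈ U) {k : ℂ → ℂ}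
    (hk : DifferentiableOn ℂ k U) :
    HasD (fun y : Pt n => k (planeCoord u v y))
      (fun i => deriv k (planeCoord u v x) * dPlane u v i) x :=
  HasD.holo ((hk.differentiableAt (hU.mem_nhds hx)).hasDerivAt) (hasD_planeCoord u v x)

end toda

section toda_structure

variable {h : ℂ → ℂ} {u v w : Fin n} {U : Set ℂ} {x : Pt n}

theorem todaInv_mul_todaE (hx : x ∈ todaSet U h u v w) (i : Fin n) :
    todaInv h u v w x * todaE h u v w x i
      = sphereScale (planeCoord u v x) * dPlane u v i := by
  rw [todaInv, todaE, mul_assoc, ← mul_assoc, inv_mul_cancel₀ hx.2, one_mul]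

theorem hasD_todaInv (hU : IsOpen U) (hh : DifferentiableOn ℂ h U)
    (hx : x ∈ todaSet U h u v w) :
    HasD (todaInv h u v w) (fun i => -todaInv h u v w x ^ 2 * dCoord w x i
      - todaC h u v w x * todaE h u v w x i) x := by
  refine (((hasD_coord' w).ofReal.add (hasD_holo hU hx.1 hh)).cinv hx.2).congr_D fun i => ?_
  have hs : (sphereScale (planeCoord u v x) : ℂ) ≠ 0 :=
    Complex.ofReal_ne_zero.2 (sphereScale_pos _).ne'
  have key := todaInv_mul_todaE hx i
  have e : todaC h u v w x * todaE h u v w x i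
      = todaInv h u v w x ^ 2 * (deriv h (planeCoord u v x) * dPlane u v i) := by
    rw [todaC]
    field_simp
    linear_combination todaInv h u v w x ^ 2 * deriv h (planeCoord u v x) * key
  rw [e, todaInv]
  ring

theorem hasD_todaC (hU : IsOpen U) (hh : DifferentiableOn ℂ h U)
    (hx : x ∈ todaSet U h u v w) :
    HasD (todaC h u v w) (fun i => -3 * todaInv h u v w x * todaC h u v w x * dCoord w x i
      + todaR h u v w x * todaE h u v w x i
      - Complex.I * rotForm u v x i * todaC h u v w x) x := by
  have hs : (sphereScale (planeCoord u v x) : ℂ) ≠ 0 :=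
    Complex.ofReal_ne_zero.2 (sphereScale_pos _).ne'
  have := (((hasD_todaInv hU hh hx).pow 3).mul (hasD_holo hU hx.1 (hh.deriv hU))).mul
    ((hasD_sphereScale u v x).ofReal.cinv hs)
  have e : todaC h u v w = fun y : Pt n => todaInv h u v w y ^ 3 *
      deriv h (planeCoord u v y) * (sphereScale (planeCoord u v y) : ℂ)⁻¹ := by
    funext y; rw [todaC, div_eq_mul_inv]
  rw [e]
  refine this.congr_D fun i => ?_
  have key := todaInv_mul_todaE hx i
  have e1 : ((x u * (dPlane u v i).re + x v * (dPlane u v i).im : ℝ) : ℂ)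
      = (starRingEnd ℂ) (planeCoord u v x) * dPlane u v i
        - Complex.I * ((x u * (dPlane u v i).im - x v * (dPlane u v i).re : ℝ) : ℂ) := by
    apply Complex.ext <;> simp [planeCoord]
  have e2 : ((rotForm u v x i : ℝ) : ℂ) = sphereScale (planeCoord u v x)
      * ((x u * (dPlane u v i).im - x v * (dPlane u v i).re : ℝ) : ℂ) := by
    rw [rotForm]; push_cast; ring
  rw [Complex.ofReal_mul, e1, e2]
  simp only [todaC, todaR]
  generalize ((x u * (dPlane u v i).im - x v * (dPlane u v i).re : ℝ) : ℂ) = r at *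
  generalize todaInv h u v w x = f at *
  generalize todaE h u v w x i = E at *
  generalize planeCoord u v x = ζ at *
  generalize dPlane u v i = dζ at *
  push_cast
  have e3 : dζ = f * E * (sphereScale ζ : ℂ)⁻¹ := by
    rw [key]; field_simp
  rw [e3]
  generalize (sphereScale ζ : ℂ) = s at *
  field_simp
  ring

theorem hasD_todaE (hU : IsOpen U) (hh : DifferentiableOn ℂ h U)
    (hx : x ∈ todaSet U h u v w) (j : Fin n) :
    HasD (fun y => todaE h u v w y j) (fun i =>
      (dCoord w x i + deriv h (planeCoord u v x) * dPlane u v i)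
          * sphereScale (planeCoord u v x) * dPlane u v j
        + ((x w : ℂ) + h (planeCoord u v x)) * (-sphereScale (planeCoord u v x) ^ 2
          * (x u * (dPlane u v i).re + x v * (dPlane u v i).im) : ℝ) * dPlane u v j) x := by
  refine ((((hasD_coord' w).ofReal.add (hasD_holo hU hx.1 hh)).mul
    (hasD_sphereScale u v x).ofReal).mul (hasD_const (dPlane u v j))).congr_D fun i => ?_
  ring

theorem extDeriv_todaE (hU : IsOpen U) (hh : DifferentiableOn ℂ h U)
    (hx : x ∈ todaSet U h u v w) (i j : Fin n) :
    ((extDeriv₁ (te₁ h u v w) x i j : ℝ) : ℂ)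
        + (extDeriv₁ (te₂ h u v w) x i j : ℝ) * Complex.I
      = (todaInv h u v w x * dCoord w x i + Complex.I * rotForm u v x i)
          * todaE h u v w x j
        - (todaInv h u v w x * dCoord w x j + Complex.I * rotForm u v x j)
          * todaE h u v w x i := by
  have r : ∀ k l, pd k (fun y => te₁ h u v w y l) x = _ := fun k l =>
    (hasD_todaE hU hh hx l).re.pd k
  have r' : ∀ k l, pd k (fun y => te₂ h u v w y l) x = _ := fun k l =>
    (hasD_todaE hU hh hx l).im.pd k
  rw [extDeriv₁, extDeriv₁, r, r, r', r']
  have e0 : ∀ a b c d : ℂ, ((a.re - b.re : ℝ) : ℂ) + ((a.im - b.im : ℝ) : ℂ) * Complex.I = a - b := by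
    intro a b _ _
    apply Complex.ext <;> simp
  rw [e0 _ _ 0 0]
  have e1 : ∀ k, ((-sphereScale (planeCoord u v x) ^ 2
        * (x u * (dPlane u v k).re + x v * (dPlane u v k).im) : ℝ) : ℂ)
      = -sphereScale (planeCoord u v x) ^ 2 * (starRingEnd ℂ) (planeCoord u v x) * dPlane u v k
        + sphereScale (planeCoord u v x) * (Complex.I * rotForm u v x k) := by
    intro k
    rw [rotForm]
    push_cast
    apply Complex.ext <;> simp [planeCoord] <;> norm_cast <;> simp <;> ring
  rw [e1, e1]
  have hf : todaInv h u v w x * ((x w : ℂ) + h (planeCoord u v x)) = 1 := by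
    rw [todaInv]; exact inv_mul_cancel₀ hx.2
  simp only [todaE]
  linear_combination -((dCoord w x i : ℂ) * sphereScale (planeCoord u v x) * dPlane u v j
    - (dCoord w x j : ℂ) * sphereScale (planeCoord u v x) * dPlane u v i) * hf

section real_equations

theorem hasD_tp (hU : IsOpen U) (hh : DifferentiableOn ℂ h U) (hx : x ∈ todaSet U h u v w) :
    HasD (tp h u v w) (fun i => -(tp h u v w x ^ 2 - tq h u v w x ^ 2) * dCoord w x i
      - tc₁ h u v w x * te₁ h u v w x i - tc₂ h u v w x * te₂ h u v w x i) x := by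
  refine (hasD_todaInv hU hh hx).re.congr_D fun i => ?_
  simp [tp, tq, tc₁, tc₂, te₁, te₂, pow_two]
  ring

theorem hasD_tq (hU : IsOpen U) (hh : DifferentiableOn ℂ h U) (hx : x ∈ todaSet U h u v w) :
    HasD (tq h u v w) (fun i => -2 * tp h u v w x * tq h u v w x * dCoord w x i
      + tc₁ h u v w x * te₂ h u v w x i - tc₂ h u v w x * te₁ h u v w x i) x := by
  refine (hasD_todaInv hU hh hx).im.neg.congr_D fun i => ?_
  simp [tp, tq, tc₁, tc₂, te₁, te₂, pow_two]
  ring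

theorem hasD_tc₁ (hU : IsOpen U) (hh : DifferentiableOn ℂ h U) (hx : x ∈ todaSet U h u v w) :
    HasD (tc₁ h u v w) (fun i => -3 * (tp h u v w x * tc₁ h u v w x
        - tq h u v w x * tc₂ h u v w x) * dCoord w x i
      + tr₁ h u v w x * te₁ h u v w x i + tr₂ h u v w x * te₂ h u v w x i
      - tc₂ h u v w x * rotForm u v x i) x := by
  refine (hasD_todaC hU hh hx).re.congr_D fun i => ?_
  simp [tp, tq, tc₁, tc₂, te₁, te₂, tr₁, tr₂]
  ring

theorem hasD_tc₂ (hU : IsOpen U) (hh : DifferentiableOn ℂ h U) (hx : x ∈ todaSet U h u v w) :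
    HasD (tc₂ h u v w) (fun i => -3 * (tp h u v w x * tc₂ h u v w x
        + tq h u v w x * tc₁ h u v w x) * dCoord w x i
      + tr₂ h u v w x * te₁ h u v w x i - tr₁ h u v w x * te₂ h u v w x i
      + tc₁ h u v w x * rotForm u v x i) x := by
  refine (hasD_todaC hU hh hx).im.neg.congr_D fun i => ?_
  simp [tp, tq, tc₁, tc₂, te₁, te₂, tr₁, tr₂]
  ring

theorem extDeriv₁_te₁ (hU : IsOpen U) (hh : DifferentiableOn ℂ h U)
    (hx : x ∈ todaSet U h u v w) (i j : Fin n) :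
    extDeriv₁ (te₁ h u v w) x i j
      = tp h u v w x * wedge (dCoord w x) (te₁ h u v w x) i j
        - wedge (rotForm u v x) (te₂ h u v w x) i j
        + tq h u v w x * wedge (dCoord w x) (te₂ h u v w x) i j := by
  have := congrArg Complex.re (extDeriv_todaE hU hh hx i j)
  simp at this
  rw [this]
  simp [tp, tq, te₁, te₂, wedge]
  ring

theorem extDeriv₁_te₂ (hU : IsOpen U) (hh : DifferentiableOn ℂ h U)
    (hx : x ∈ todaSet U h u v w) (i j : Fin n) :
    extDeriv₁ (te₂ h u v w) x i j
      = tp h u v w x * wedge (dCoord w x) (te₂ h u v w x) i j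
        + wedge (rotForm u v x) (te₁ h u v w x) i j
        - tq h u v w x * wedge (dCoord w x) (te₁ h u v w x) i j := by
  have := congrArg Complex.im (extDeriv_todaE hU hh hx i j)
  simp at this
  rw [this]
  simp [tp, tq, te₁, te₂, wedge]
  ring

theorem todaE_normSq (hx : x ∈ todaSet U h u v w) (i j : Fin n) :
    (tp h u v w x ^ 2 + tq h u v w x ^ 2) * wedge (te₁ h u v w x) (te₂ h u v w x) i j
      = sphereScale (planeCoord u v x) ^ 2
      * ((dPlane u v i).re * (dPlane u v j).im - (dPlane u v j).re * (dPlane u v i).im) := by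
  have k1 := todaInv_mul_todaE hx i
  have k2 := todaInv_mul_todaE hx j
  have a1 := congrArg Complex.re k1
  have a2 := congrArg Complex.im k1
  have b1 := congrArg Complex.re k2
  have b2 := congrArg Complex.im k2
  simp at a1 a2 b1 b2
  simp only [tp, tq, wedge, te₁, te₂]
  generalize (dPlane u v i).re = a at *
  generalize (dPlane u v i).im = b at *
  generalize (dPlane u v j).re = c at *
  generalize (dPlane u v j).im = d at *
  generalize sphereScale (planeCoord u v x) = s at *
  have : s ^ 2 * (a * d - c * b) = (s * a) * (s * d) - (s * c) * (s * b) := by ring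
  rw [this, ← a1, ← a2, ← b1, ← b2]
  ring

theorem extDeriv₁_rotForm' (hx : x ∈ todaSet U h u v w) (i j : Fin n) :
    extDeriv₁ (rotForm u v) x i j = (tp h u v w x ^ 2 + tq h u v w x ^ 2)
      * wedge (te₁ h u v w x) (te₂ h u v w x) i j := by
  rw [todaE_normSq hx, extDeriv₁_rotForm]

end real_equations

end toda_structure

/-- The closed form `s dx` on the sphere, as a combination of `E`. -/
theorem te_sigma {h : ℂ → ℂ} {u v w : Fin n} {U : Set ℂ} {x : Pt n}
    (hx : x ∈ todaSet U h u v w) (i : Fin n) :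
    tp h u v w x * te₁ h u v w x i + tq h u v w x * te₂ h u v w x i
        = sphereScale (planeCoord u v x) * dCoord u x i ∧
      tp h u v w x * te₂ h u v w x i - tq h u v w x * te₁ h u v w x i
        = sphereScale (planeCoord u v x) * dCoord v x i := by
  have k1 := todaInv_mul_todaE hx i
  have a1 := congrArg Complex.re k1
  have a2 := congrArg Complex.im k1
  simp only [Complex.mul_re, Complex.mul_im, Complex.ofReal_re, Complex.ofReal_im, zero_mul,
    sub_zero, add_zero] at a1 a2
  change _ = _ * dCoord u x i at a1
  change _ = _ * dCoord v x i at a2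
  simp only [tp, tq, te₁, te₂]
  constructor <;> linarith

/-! ### The hyperCR Toda spaces -/

section smooth
variable {h : ℂ → ℂ} {u v w : Fin n} {U : Set ℂ} {x : Pt n}

theorem contDiffOn_tp (hU : IsOpen U) (hh : DifferentiableOn ℂ h U) :
    ContDiffOn ℝ ∞ (tp h u v w : Pt n → ℝ) (todaSet U h u v w) :=
  contDiffOn_re (contDiffOn_todaInv hU hh)

theorem contDiffOn_tq (hU : IsOpen U) (hh : DifferentiableOn ℂ h U) :
    ContDiffOn ℝ ∞ (tq h u v w : Pt n → ℝ) (todaSet U h u v w) :=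
  (contDiffOn_im (contDiffOn_todaInv hU hh)).neg

theorem diffForm_rot : DiffForm (rotForm u v) x := fun i =>
  (contDiff_rotForm u v i).contDiffAt.differentiableAt (by simp)

end smooth

section toda₃
variable {h : ℂ → ℂ} {U : Set ℂ} {q : Pt 3}

theorem modSq_pos (hq : q ∈ todaDomain U h) : 0 < modSq h q := Complex.normSq_pos.2 hq.2

theorem tp_eq : tp h 0 1 2 q = (q 2 + (h ⟨q 0, q 1⟩).re) / modSq h q := by
  simp [tp, todaInv, modSq, planeCoord]

theorem tq_eq : tq h 0 1 2 q = (h ⟨q 0, q 1⟩).im / modSq h q := by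
  simp [tq, todaInv, modSq, planeCoord]; ring

theorem kappa_eq : kappa h q = -tq h 0 1 2 q := by rw [tq_eq, kappa, neg_div]

theorem todaForm_eq (i : Fin 3) : todaForm h q i = -2 * tp h 0 1 2 q * dCoord 2 q i := by
  rw [tp_eq]
  fin_cases i <;> simp [todaForm, dCoord]
  ring

theorem monopole_eq (hq : q ∈ todaDomain U h) : monopole h q = 1 - q 2 * tp h 0 1 2 q := by
  have := modSq_pos hq
  rw [tp_eq, monopole]
  field_simp
  simp [numer, modSq, Complex.normSq_apply]
  ring

theorem tp_sq_add_eq (hq : q ∈ todaDomain U h) :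
    (tp h 0 1 2 q ^ 2 + tq h 0 1 2 q ^ 2) * modSq h q = 1 := by
  have := modSq_pos hq
  rw [tp_eq, tq_eq]
  field_simp
  simp [modSq, Complex.normSq_apply]
  ring

/-- The coframe of the hyperCR Toda space. -/
def todaFrame (h : ℂ → ℂ) : Pt 3 → Matrix (Fin 3) (Fin 3) ℝ :=
  coframe₃ (te₁ h 0 1 2) (te₂ h 0 1 2) (dCoord 2)

theorem te₁_apply (i : Fin 3) : te₁ h 0 1 2 q i = ![sphereScale ⟨q 0, q 1⟩ * (q 2 + (h ⟨q 0, q 1⟩).re),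
    -(sphereScale ⟨q 0, q 1⟩ * (h ⟨q 0, q 1⟩).im), 0] i := by
  fin_cases i <;> simp [te₁, todaE, dPlane, planeCoord] <;> ring

theorem te₂_apply (i : Fin 3) : te₂ h 0 1 2 q i = ![sphereScale ⟨q 0, q 1⟩ * (h ⟨q 0, q 1⟩).im,
    sphereScale ⟨q 0, q 1⟩ * (q 2 + (h ⟨q 0, q 1⟩).re), 0] i := by
  fin_cases i <;> simp [te₂, todaE, dPlane, planeCoord] <;> ring

theorem det_todaFrame : (todaFrame h q).det = sphereScale ⟨q 0, q 1⟩ ^ 2 * modSq h q := by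
  simp [todaFrame, Matrix.det_fin_three, coframe₃, te₁_apply, te₂_apply, dCoord, modSq,
    Complex.normSq_apply]
  ring

theorem det_todaFrame_pos (hq : q ∈ todaDomain U h) : 0 < (todaFrame h q).det := by
  rw [det_todaFrame]
  exact mul_pos (pow_pos (sphereScale_pos _) 2) (modSq_pos hq)

theorem isConformalCoframe_toda (hU : IsOpen U) (hh : DifferentiableOn ℂ h U) :
    IsConformalCoframe (todaMetric h) (fun _ => 1) (todaFrame h) (todaDomain U h) where
  isOpen := isOpen_todaSet hU hh
  smooth_factor := contDiffOn_const
  pos _ _ := one_pos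
  smooth := by
    intro a j
    fin_cases a
    · exact contDiffOn_re (contDiffOn_todaE hU hh j)
    · exact contDiffOn_im (contDiffOn_todaE hU hh j)
    · exact contDiffOn_const
  det_ne x hx := (det_todaFrame_pos hx).ne'
  eq x hx i j := by
    simp only [todaFrame, Fin.sum_univ_three, coframe₃_zero, coframe₃_one, coframe₃_two,
      te₁_apply, te₂_apply, todaMetric, sphereFactor_eq]
    fin_cases i <;> fin_cases j <;>
      simp [Matrix.diagonal, dCoord, modSq, Complex.normSq_apply] <;> ring

theorem isTorsionFree_toda (hU : IsOpen U) (hh : DifferentiableOn ℂ h U) :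
    IsTorsionFree (todaFrame h) (skew₃ (fun y i => rotForm 0 1 y i - tq h 0 1 2 y * dCoord 2 y i)
      (fun y i => -(tp h 0 1 2 y * te₁ h 0 1 2 y i)) (fun y i => -(tp h 0 1 2 y * te₂ h 0 1 2 y i)))
      (todaForm h) (todaDomain U h) := by
  refine isTorsionFree₃ ?_ ?_ ?_ <;> intro x hx i j
  · rw [extDeriv₁_te₁ hU hh hx]
    simp only [wedge, todaForm_eq]
    ring
  · rw [extDeriv₁_te₂ hU hh hx]
    simp only [wedge, todaForm_eq]
    ring
  · rw [extDeriv₁_dCoord]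
    simp only [wedge, todaForm_eq]
    ring

theorem isEinsteinWeylOn_toda (hU : IsOpen U) (hh : DifferentiableOn ℂ h U) :
    IsEinsteinWeylOn (todaMetric h) (todaForm h) (todaDomain U h) := by
  have dp : ∀ x ∈ todaDomain U h, DifferentiableAt ℝ (tp h 0 1 2) x := fun x hx =>
    (hasD_tp hU hh hx).diff
  have dq : ∀ x ∈ todaDomain U h, DifferentiableAt ℝ (tq h 0 1 2) x := fun x hx =>
    (hasD_tq hU hh hx).diff
  have fb : todaForm h = fun y i => (-2 * tp h 0 1 2 y) * dCoord 2 y i := by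
    funext y i; rw [todaForm_eq]
  have f1 : ∀ x ∈ todaDomain U h, DiffForm (fun y i => tq h 0 1 2 y * dCoord 2 y i) x :=
    fun x hx => DiffForm.smul (dq x hx) (diffForm_dCoord 2)
  have f2 : ∀ x ∈ todaDomain U h, DiffForm (fun y i => tp h 0 1 2 y * te₁ h 0 1 2 y i) x :=
    fun x hx => DiffForm.smul (dp x hx) (diffForm_te₁ hU hh hx)
  have f3 : ∀ x ∈ todaDomain U h, DiffForm (fun y i => tp h 0 1 2 y * te₂ h 0 1 2 y i) x :=
    fun x hx => DiffForm.smul (dp x hx) (diffForm_te₂ hU hh hx)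
  refine isEinsteinWeylOn₃ (isConformalCoframe_toda hU hh) ?_ ?_ (isTorsionFree_toda hU hh)
    (fun x hx => DiffForm.sub diffForm_rot (f1 x hx)) (fun x hx => (f2 x hx).neg)
    (fun x hx => (f3 x hx).neg) ?_ ?_
  · intro i
    rw [fb]
    exact (contDiffOn_const.mul (contDiffOn_tp hU hh)).mul contDiffOn_const
  · intro x _ i
    rw [pd_const]; ring
  · intro x hx
    rw [fb]
    exact DiffForm.smul ((hasD_const (-2 : ℝ)).mul (hasD_tp hU hh hx)).diff (diffForm_dCoord 2)
  · intro x hx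
    refine ⟨tq h 0 1 2 x ^ 2, tc₂ h 0 1 2 x, -tc₁ h 0 1 2 x, 0, 0, 2 * tc₁ h 0 1 2 x,
      2 * tc₂ h 0 1 2 x, fun i j => ⟨?_, ?_, ?_, ?_⟩⟩
    · rw [extDeriv₁_sub diffForm_rot (f1 x hx), extDeriv₁_rotForm' hx,
        extDeriv₁_smul (hasD_tq hU hh hx) (diffForm_dCoord 2), extDeriv₁_dCoord]
      simp only [wedge]
      ring
    · rw [extDeriv₁_neg (f2 x hx), extDeriv₁_smul (hasD_tp hU hh hx) (diffForm_te₁ hU hh hx),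
        extDeriv₁_te₁ hU hh hx]
      simp only [wedge]
      ring
    · rw [extDeriv₁_neg (f3 x hx), extDeriv₁_smul (hasD_tp hU hh hx) (diffForm_te₂ hU hh hx),
        extDeriv₁_te₂ hU hh hx]
      simp only [wedge]
      ring
    · rw [fb, extDeriv₁_smul ((hasD_const (-2 : ℝ)).mul (hasD_tp hU hh hx)) (diffForm_dCoord 2),
        extDeriv₁_dCoord]
      simp only [wedge]
      ring

theorem isTodaOn_toda (hU : IsOpen U) (hh : DifferentiableOn ℂ h U) :
    IsTodaOn (todaMetric h) (todaForm h) (todaDomain U h) := by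
  have := isShearFreeGeodesicOn₃ (X₁ := fun _ => 0) (X₂ := fun _ => 0) (X₃ := fun _ => 1)
    (τ := fun x => -tp h 0 1 2 x) (κ := fun _ => 0) (isConformalCoframe_toda hU hh)
    (isTorsionFree_toda hU hh) (fun x hx => det_todaFrame_pos hx) contDiffOn_const contDiffOn_const
    contDiffOn_const (fun _ _ => by norm_num) (fun x _ i => by rw [pd_const]; ring)
    (fun x _ i => by rw [pd_const]; ring) (fun x _ i => by rw [pd_const]; ring)
  obtain ⟨χ, hχ⟩ := this
  exact ⟨isEinsteinWeylOn_toda hU hh, χ, _, hχ⟩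

end toda₃

section sphere

/-- The components of the inverse stereographic projection. -/
def stereo₁ (u v : Fin n) (x : Pt n) : ℝ := sphereScale (planeCoord u v x) * x u
/-- The components of the inverse stereographic projection. -/
def stereo₂ (u v : Fin n) (x : Pt n) : ℝ := sphereScale (planeCoord u v x) * x v
/-- The components of the inverse stereographic projection. -/
def stereo₃ (u v : Fin n) (x : Pt n) : ℝ := sphereScale (planeCoord u v x) - 1

variable (u v : Fin n) (x : Pt n)

theorem stereo_unit : stereo₁ u v x ^ 2 + stereo₂ u v x ^ 2 + stereo₃ u v x ^ 2 = 1 := by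
  have h0 : (1 : ℝ) + (x u * x u + x v * x v) ≠ 0 := by
    nlinarith [mul_self_nonneg (x u), mul_self_nonneg (x v)]
  simp only [stereo₁, stereo₂, stereo₃, sphereScale, planeCoord, Complex.normSq_mk]
  field_simp
  ring

theorem hasD_stereo₁ : HasD (stereo₁ u v) (fun i => -rotForm u v x i * stereo₂ u v x
    + sphereScale (planeCoord u v x) * dCoord u x i * stereo₃ u v x) x := by
  refine ((hasD_sphereScale u v x).mul (hasD_coord' u)).congr_D fun i => ?_
  have h0 : (1 : ℝ) + (x u * x u + x v * x v) ≠ 0 := by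
    nlinarith [mul_self_nonneg (x u), mul_self_nonneg (x v)]
  have e : (dPlane u v i).re = dCoord u x i := rfl
  have e' : (dPlane u v i).im = dCoord v x i := rfl
  simp only [stereo₂, stereo₃, rotForm, sphereScale, planeCoord, Complex.normSq_mk, e, e']
  field_simp
  ring

theorem hasD_stereo₂ : HasD (stereo₂ u v) (fun i => rotForm u v x i * stereo₁ u v x
    + sphereScale (planeCoord u v x) * dCoord v x i * stereo₃ u v x) x := by
  refine ((hasD_sphereScale u v x).mul (hasD_coord' v)).congr_D fun i => ?_
  have h0 : (1 : ℝ) + (x u * x u + x v * x v) ≠ 0 := by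
    nlinarith [mul_self_nonneg (x u), mul_self_nonneg (x v)]
  have e : (dPlane u v i).re = dCoord u x i := rfl
  have e' : (dPlane u v i).im = dCoord v x i := rfl
  simp only [stereo₁, stereo₃, rotForm, sphereScale, planeCoord, Complex.normSq_mk, e, e']
  field_simp
  ring

theorem hasD_stereo₃ : HasD (stereo₃ u v) (fun i =>
    -(sphereScale (planeCoord u v x) * dCoord u x i * stereo₁ u v x)
    - sphereScale (planeCoord u v x) * dCoord v x i * stereo₂ u v x) x := by
  refine ((hasD_sphereScale u v x).sub (hasD_const 1)).congr_D fun i => ?_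
  have e : (dPlane u v i).re = dCoord u x i := rfl
  have e' : (dPlane u v i).im = dCoord v x i := rfl
  simp only [stereo₁, stereo₂, e, e']
  ring

theorem contDiff_stereo₁ : ContDiff ℝ ∞ (stereo₁ u v) :=
  (contDiff_sphereScale u v).mul (contDiff_apply ℝ ℝ u)

theorem contDiff_stereo₂ : ContDiff ℝ ∞ (stereo₂ u v) :=
  (contDiff_sphereScale u v).mul (contDiff_apply ℝ ℝ v)

theorem contDiff_stereo₃ : ContDiff ℝ ∞ (stereo₃ u v) :=
  (contDiff_sphereScale u v).sub contDiff_const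

end sphere

theorem isHyperCROn_toda {h : ℂ → ℂ} {U : Set ℂ} (hU : IsOpen U) (hh : DifferentiableOn ℂ h U) :
    IsHyperCROn (todaMetric h) (todaForm h) (todaDomain U h) := by
  have := isShearFreeGeodesicOn₃ (X₁ := stereo₁ 0 1) (X₂ := stereo₂ 0 1) (X₃ := stereo₃ 0 1)
    (τ := fun _ => 0) (κ := fun x => -tq h 0 1 2 x) (isConformalCoframe_toda hU hh)
    (isTorsionFree_toda hU hh) (fun x hx => det_todaFrame_pos hx) (contDiff_stereo₁ 0 1).contDiffOn
    (contDiff_stereo₂ 0 1).contDiffOn (contDiff_stereo₃ 0 1).contDiffOn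
    (fun x _ => stereo_unit 0 1 x)
    (fun x hx i => by
      rw [(hasD_stereo₁ 0 1 x).pd, ← (te_sigma hx i).1]; ring)
    (fun x hx i => by
      rw [(hasD_stereo₂ 0 1 x).pd, ← (te_sigma hx i).2]; ring)
    (fun x hx i => by
      rw [(hasD_stereo₃ 0 1 x).pd, ← (te_sigma hx i).1, ← (te_sigma hx i).2]; ring)
  obtain ⟨χ, hχ⟩ := this
  exact ⟨isEinsteinWeylOn_toda hU hh, χ, _, hχ⟩

/-! ### The monopole and its potential -/

section potential

variable {h : ℂ → ℂ} {u v w : Fin n} {U : Set ℂ} {x : Pt n} {θ : Field 2}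

/-- The projection to the plane. -/
def toPlane (u v : Fin n) : Pt n →L[ℝ] Pt 2 :=
  ContinuousLinearMap.pi ![ContinuousLinearMap.proj u, ContinuousLinearMap.proj v]

theorem toPlane_apply (y : Pt n) : toPlane u v y = ![y u, y v] := by
  ext i
  fin_cases i <;> simp [toPlane]

theorem hasD_comp_plane {F : Pt 2 → ℝ} (hF : DifferentiableAt ℝ F ![x u, x v]) :
    HasD (fun y : Pt n => F ![y u, y v]) (fun i => pd 0 F ![x u, x v] * dCoord u x i
      + pd 1 F ![x u, x v] * dCoord v x i) x := by
  rw [← toPlane_apply] at hF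
  have h1 := hF.hasFDerivAt.comp x (toPlane u v).hasFDerivAt
  have e : (F ∘ (toPlane u v)) = fun y : Pt n => F ![y u, y v] := by
    funext y; simp [toPlane_apply]
  rw [e] at h1
  refine (HasFDerivAt.hasD h1).congr_D fun i => ?_
  rw [ContinuousLinearMap.comp_apply]
  have e2 : toPlane u v (Pi.single i 1) = dCoord u x i • (Pi.single 0 1 : Pt 2)
      + dCoord v x i • (Pi.single 1 1 : Pt 2) := by
    rw [toPlane_apply]
    ext k
    fin_cases k <;> simp only [dCoord, Pi.single_apply, eq_comm (a := i)] <;> split_ifs <;> simp_all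
  rw [e2, map_add, map_smul, map_smul, toPlane_apply]
  simp [pd, mul_comm]

/-- The pullback of a 1-form on the plane. -/
def planePull (u v : Fin n) (θ : Field 2) : Field n := fun x i =>
  θ ![x u, x v] 0 * dCoord u x i + θ ![x u, x v] 1 * dCoord v x i

theorem planeSet_mem (hx : planeCoord u v x ∈ U) :
    (![x u, x v] : Pt 2) ∈ {q : Pt 2 | (⟨q 0, q 1⟩ : ℂ) ∈ U} := hx

theorem isOpen_planeSet (hU : IsOpen U) : IsOpen {q : Pt 2 | (⟨q 0, q 1⟩ : ℂ) ∈ U} :=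
  hU.preimage (contDiff_planeCoord 0 1).continuous

theorem contDiffOn_comp_plane {F : Pt 2 → ℝ} (hF : ContDiffOn ℝ ∞ F {q | (⟨q 0, q 1⟩ : ℂ) ∈ U}) :
    ContDiffOn ℝ ∞ (fun y : Pt n => F ![y u, y v]) {y | planeCoord u v y ∈ U} := by
  have e : (fun y : Pt n => F ![y u, y v]) = F ∘ (toPlane u v) := by
    funext y; simp [toPlane_apply]
  rw [e]
  refine hF.comp (toPlane u v).contDiff.contDiffOn fun y hy => ?_
  rw [toPlane_apply]
  exact hy

theorem contDiffOn_planePull (hθ : SmoothField θ {q | (⟨q 0, q 1⟩ : ℂ) ∈ U}) (i : Fin n) :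
    ContDiffOn ℝ ∞ (fun y : Pt n => planePull u v θ y i) {y | planeCoord u v y ∈ U} :=
  ((contDiffOn_comp_plane (hθ 0)).mul contDiffOn_const).add
    ((contDiffOn_comp_plane (hθ 1)).mul contDiffOn_const)

theorem diffForm_planePull (hU : IsOpen U) (hθ : SmoothField θ {q | (⟨q 0, q 1⟩ : ℂ) ∈ U})
    (hx : planeCoord u v x ∈ U) : DiffForm (planePull u v θ) x := fun i =>
  ((contDiffOn_planePull hθ i).contDiffAt ((hU.preimage
    (contDiff_planeCoord u v).continuous).mem_nhds hx)).differentiableAt (by simp)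

theorem extDeriv₁_planePull (hU : IsOpen U) (hθ : IsBetaPotential U h θ)
    (hx : planeCoord u v x ∈ U) (i j : Fin n) :
    extDeriv₁ (planePull u v θ) x i j = (h (planeCoord u v x)).re *
      sphereScale (planeCoord u v x) ^ 2 * wedge (dCoord u x) (dCoord v x) i j := by
  have hd : ∀ k, DifferentiableAt ℝ (fun q => θ q k) ![x u, x v] := fun k =>
    ((hθ.1 k).contDiffAt ((isOpen_planeSet hU).mem_nhds (planeSet_mem hx))).differentiableAt (by simp)
  have key : ∀ k, HasD (fun y : Pt n => planePull u v θ y k) _ x := fun k =>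
    ((hasD_comp_plane (hd 0)).mul (hasD_const (dCoord u x k))).add
      ((hasD_comp_plane (hd 1)).mul (hasD_const (dCoord v x k)))
  have := hθ.2 ![x u, x v] (planeSet_mem hx)
  rw [extDeriv₁] at this
  rw [extDeriv₁, (key i).pd, (key j).pd]
  rw [sphereFactor_eq] at this
  change _ = (h (planeCoord u v x)).re * sphereScale (planeCoord u v x) ^ 2 at this
  rw [← this]
  simp only [wedge]
  ring

/-- The form `θ - κ z dz`. -/
def potForm (h : ℂ → ℂ) (θ : Field 2) (u v w : Fin n) : Field n := fun x i =>
  planePull u v θ x i + x w * tq h u v w x * dCoord w x i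

theorem tp_eq_gen (x : Pt n) : tp h u v w x = (x w + (h (planeCoord u v x)).re)
    / Complex.normSq ((x w : ℂ) + h (planeCoord u v x)) := by
  simp [tp, todaInv]

theorem tq_eq_gen (x : Pt n) : tq h u v w x = (h (planeCoord u v x)).im
    / Complex.normSq ((x w : ℂ) + h (planeCoord u v x)) := by
  simp [tq, todaInv]; ring

theorem re_mul_normSq (hx : x ∈ todaSet U h u v w) :
    (h (planeCoord u v x)).re * (tp h u v w x ^ 2 + tq h u v w x ^ 2)
      = tp h u v w x - x w * (tp h u v w x ^ 2 + tq h u v w x ^ 2) := by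
  have := Complex.normSq_pos.2 hx.2
  rw [tp_eq_gen, tq_eq_gen]
  generalize hN : Complex.normSq ((x w : ℂ) + h (planeCoord u v x)) = N at *
  rw [Complex.normSq_apply] at hN
  simp at hN
  field_simp
  rw [← hN]
  ring

theorem diffForm_potForm (hU : IsOpen U) (hh : DifferentiableOn ℂ h U)
    (hθ : SmoothField θ {q | (⟨q 0, q 1⟩ : ℂ) ∈ U}) (hx : x ∈ todaSet U h u v w) :
    DiffForm (potForm h θ u v w) x :=
  (diffForm_planePull hU hθ hx.1).add
    (DiffForm.smul ((hasD_coord' w).mul (hasD_tq hU hh hx)).diff (diffForm_dCoord w))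

theorem contDiffOn_potForm (hU : IsOpen U) (hh : DifferentiableOn ℂ h U)
    (hθ : SmoothField θ {q | (⟨q 0, q 1⟩ : ℂ) ∈ U}) (i : Fin n) :
    ContDiffOn ℝ ∞ (fun x => potForm h θ u v w x i) (todaSet U h u v w) :=
  ((contDiffOn_planePull hθ i).mono fun _ hx => hx.1).add
    (((contDiff_apply ℝ ℝ w).contDiffOn.mul (contDiffOn_tq hU hh)).mul contDiffOn_const)

theorem extDeriv₁_potForm (hU : IsOpen U) (hh : DifferentiableOn ℂ h U)
    (hθ : IsBetaPotential U h θ) (hx : x ∈ todaSet U h u v w) (i j : Fin n) :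
    extDeriv₁ (potForm h θ u v w) x i j
      = x w * tc₁ h u v w x * wedge (te₂ h u v w x) (dCoord w x) i j
        + x w * tc₂ h u v w x * wedge (dCoord w x) (te₁ h u v w x) i j
        + (tp h u v w x - x w * (tp h u v w x ^ 2 + tq h u v w x ^ 2))
          * wedge (te₁ h u v w x) (te₂ h u v w x) i j := by
  have hd := (hasD_coord' w).mul (hasD_tq hU hh hx)
  have e0 := todaE_normSq hx i j
  change _ = sphereScale (planeCoord u v x) ^ 2 * (dCoord u x i * dCoord v x j
    - dCoord u x j * dCoord v x i) at e0
  have e1 := extDeriv₁_add (α := planePull u v θ)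
    (β := fun x i => x w * tq h u v w x * dCoord w x i) (diffForm_planePull hU hθ.1 hx.1)
    (DiffForm.smul hd.diff (diffForm_dCoord w)) i j
  have e2 : potForm h θ u v w = fun x i => planePull u v θ x i
    + x w * tq h u v w x * dCoord w x i := rfl
  rw [e2, e1, extDeriv₁_planePull hU hθ hx.1, extDeriv₁_smul hd (diffForm_dCoord w),
    extDeriv₁_dCoord, ← re_mul_normSq hx]
  simp only [wedge] at e0 ⊢
  linear_combination -(h (planeCoord u v x)).re * e0

end potential

section monopole
variable {h : ℂ → ℂ} {U : Set ℂ} {q : Pt 3} {θ : Field 2}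

theorem totalPotential_eq : totalPotential h θ = potForm h θ 0 1 2 := by
  funext y i
  fin_cases i <;> simp [totalPotential, potForm, planePull, dCoord, kappa_eq, mul_comm]

theorem hasD_monopole (hU : IsOpen U) (hh : DifferentiableOn ℂ h U) (hq : q ∈ todaDomain U h) :
    HasD (monopole h) (fun i => q 2 * tc₁ h 0 1 2 q * te₁ h 0 1 2 q i
      + q 2 * tc₂ h 0 1 2 q * te₂ h 0 1 2 q i
      + (-tp h 0 1 2 q + q 2 * (tp h 0 1 2 q ^ 2 - tq h 0 1 2 q ^ 2)) * dCoord 2 q i) q := by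
  have e : monopole h =ᶠ[nhds q] fun y => 1 - y 2 * tp h 0 1 2 y := by
    filter_upwards [(isOpen_todaSet (u := (0 : Fin 3)) (v := 1) (w := 2) hU hh).mem_nhds hq]
      with y hy
    exact monopole_eq hy
  refine (((hasD_const (1 : ℝ)).sub ((hasD_coord' 2).mul
    (hasD_tp hU hh hq))).congr_of_eventuallyEq e).congr_D fun i => ?_
  ring

theorem contDiffOn_monopole (hU : IsOpen U) (hh : DifferentiableOn ℂ h U) :
    ContDiffOn ℝ ∞ (monopole h) (todaDomain U h) := by
  have : ContDiffOn ℝ ∞ (fun y : Pt 3 => 1 - y 2 * tp h 0 1 2 y) (todaDomain U h) :=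
    contDiffOn_const.sub ((contDiff_apply ℝ ℝ (2 : Fin 3)).contDiffOn.mul (contDiffOn_tp hU hh))
  exact this.congr fun y hy => monopole_eq hy

theorem sqrt_det_toda : √((todaMetric h q).det) = modSq h q * sphereFactor ⟨q 0, q 1⟩ := by
  rw [todaMetric, Matrix.det_diagonal, Fin.prod_univ_three]
  simp only [Matrix.cons_val_zero, Matrix.cons_val_one, Matrix.cons_val, mul_one]
  refine Real.sqrt_mul_self (mul_nonneg (Complex.normSq_nonneg _) ?_)
  rw [sphereFactor_eq]; positivity

theorem monopoleFlux_eq (hU : IsOpen U) (hh : DifferentiableOn ℂ h U) (hθ : IsBetaPotential U h θ)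
    (hq : q ∈ todaDomain U h) (i j : Fin 3) :
    monopoleFlux (todaMetric h) (todaForm h) (monopole h) q i j
      = extDeriv₁ (totalPotential h θ) q i j := by
  rw [totalPotential_eq, extDeriv₁_potForm hU hh hθ hq]
  have hs := sphereScale_pos ⟨q 0, q 1⟩
  have hm := modSq_pos hq
  have hinv : (todaMetric h q)⁻¹ = Matrix.diagonal ![(modSq h q * sphereScale ⟨q 0, q 1⟩ ^ 2)⁻¹,
      (modSq h q * sphereScale ⟨q 0, q 1⟩ ^ 2)⁻¹, 1] := by
    refine Matrix.inv_eq_right_inv ?_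
    rw [todaMetric, Matrix.diagonal_mul_diagonal, ← Matrix.diagonal_one, sphereFactor_eq]
    congr 1
    funext k
    have := (mul_pos hm (pow_pos hs 2)).ne'
    fin_cases k <;> simp <;> field_simp
  have key := tp_sq_add_eq hq
  simp only [monopoleFlux, volForm, sqrt_det_toda, hinv, Fin.sum_univ_three,
    (hasD_monopole hU hh hq).pd, todaForm_eq, monopole_eq hq, sphereFactor_eq, wedge,
    te₁_apply, te₂_apply]
  have e : q 2 + (h ⟨q 0, q 1⟩).re = tp h 0 1 2 q * modSq h q := by
    rw [tp_eq]; field_simp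
  have e' : (h ⟨q 0, q 1⟩).im = tq h 0 1 2 q * modSq h q := by
    rw [tq_eq]; field_simp
  rw [e, e']
  generalize modSq h q = N, tp h 0 1 2 q = p, tq h 0 1 2 q = r at *
  generalize sphereScale ⟨q 0, q 1⟩ = s at *
  have hN : N ^ 2 * (p ^ 2 + r ^ 2) = N := by linear_combination N * key
  fin_cases i <;> fin_cases j <;>
    simp [altSymbol, Matrix.det_fin_three, dCoord, Matrix.diagonal] <;> (try field_simp) <;>
    (try first
      | ring1
      | linear_combination -(p - q 2 * (p ^ 2 + r ^ 2)) * key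
      | linear_combination (p - q 2 * (p ^ 2 + r ^ 2)) * key)

theorem isMonopolePotentialOn_toda (hU : IsOpen U) (hh : DifferentiableOn ℂ h U)
    (hθ : IsBetaPotential U h θ) :
    IsMonopolePotentialOn (todaMetric h) (todaForm h) (monopole h) (totalPotential h θ)
      (todaDomain U h) := by
  refine ⟨fun i => ?_, fun x hx i j => (monopoleFlux_eq hU hh hθ hx i j).symm⟩
  rw [totalPotential_eq]
  exact contDiffOn_potForm hU hh hθ.1 i

theorem isMonopoleOn_toda (hU : IsOpen U) (hh : DifferentiableOn ℂ h U)
    (hθ : IsBetaPotential U h θ) :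
    IsMonopoleOn (todaMetric h) (todaForm h) (monopole h) (todaDomain U h) := by
  refine ⟨contDiffOn_monopole hU hh, fun x hx i j k => ?_⟩
  have hS : todaDomain U h ∈ nhds x :=
    (isOpen_todaSet (u := (0 : Fin 3)) (v := 1) (w := 2) hU hh).mem_nhds hx
  have e : ∀ a b, (fun y => monopoleFlux (todaMetric h) (todaForm h) (monopole h) y a b)
      =ᶠ[nhds x] fun y => extDeriv₁ (totalPotential h θ) y a b := fun a b => by
    filter_upwards [hS] with y hy
    exact monopoleFlux_eq hU hh hθ hy a b
  have := extDeriv₂_extDeriv₁ (α := totalPotential h θ) (x := x) (fun i => by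
    rw [totalPotential_eq]
    exact ((contDiffOn_potForm hU hh hθ.1 i).contDiffAt hS).of_le two_le_infty) i j k
  rw [extDeriv₂] at this ⊢
  rw [pd_congr i (e j k), pd_congr j (e k i), pd_congr k (e i j), this]

end monopole

/-! ### The four-dimensional coframe -/

section frame₄

variable {h : ℂ → ℂ} {U : Set ℂ} {x : Pt 4} {θ : Field 2}

/-- The form `β - κ z dz`. -/
def etaForm (h : ℂ → ℂ) (θ : Field 2) : Field 4 := fun x i =>
  potForm h θ 0 1 2 x i + dCoord 3 x i

/-- The monopole as a function on the four-manifold. -/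
def tw (h : ℂ → ℂ) (x : Pt 4) : ℝ := 1 - x 2 * tp h 0 1 2 x

/-- The fourth form of the coframe. -/
def te₄ (h : ℂ → ℂ) (θ : Field 2) : Field 4 := fun x i => (tw h x)⁻¹ * etaForm h θ x i

/-- The points of the four-manifold at which the monopole is positive. -/
theorem mem_kahlerDomain : x ∈ kahlerDomain U h ↔ x ∈ todaSet U h 0 1 2 ∧ 0 < tw h x := by
  refine and_congr_right fun hx => ?_
  rw [monopole_eq (U := U) hx]
  rfl

theorem isOpen_kahlerDomain (hU : IsOpen U) (hh : DifferentiableOn ℂ h U) :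
    IsOpen (kahlerDomain U h) := by
  have e : kahlerDomain U h = todaSet U h 0 1 2 ∩ tw h ⁻¹' Set.Ioi 0 := by
    ext x; exact mem_kahlerDomain
  rw [e]
  have : ContinuousOn (tw h) (todaSet U h 0 1 2) :=
    continuousOn_const.sub ((continuous_apply (2 : Fin 4)).continuousOn.mul
      (contDiffOn_tp hU hh).continuousOn)
  exact this.isOpen_inter_preimage (isOpen_todaSet hU hh) isOpen_Ioi

theorem isOpen_einsteinDomain (hU : IsOpen U) (hh : DifferentiableOn ℂ h U) :
    IsOpen (einsteinDomain U h) :=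
  (isOpen_kahlerDomain hU hh).inter
    (isOpen_compl_singleton.preimage (continuous_apply (2 : Fin 4)) :
      IsOpen ((fun p : Pt 4 => p 2) ⁻¹' {0}ᶜ))

theorem hasD_tw (hU : IsOpen U) (hh : DifferentiableOn ℂ h U) (hx : x ∈ todaSet U h 0 1 2) :
    HasD (tw h) (fun i => x 2 * tc₁ h 0 1 2 x * te₁ h 0 1 2 x i
      + x 2 * tc₂ h 0 1 2 x * te₂ h 0 1 2 x i
      + (-tp h 0 1 2 x + x 2 * (tp h 0 1 2 x ^ 2 - tq h 0 1 2 x ^ 2)) * dCoord 2 x i) x := by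
  refine ((hasD_const (1 : ℝ)).sub ((hasD_coord' 2).mul (hasD_tp hU hh hx))).congr_D fun i => ?_
  ring

theorem contDiffOn_tw (hU : IsOpen U) (hh : DifferentiableOn ℂ h U) :
    ContDiffOn ℝ ∞ (tw h) (todaSet U h 0 1 2) :=
  contDiffOn_const.sub ((contDiff_apply ℝ ℝ (2 : Fin 4)).contDiffOn.mul (contDiffOn_tp hU hh))

theorem diffForm_etaForm (hU : IsOpen U) (hh : DifferentiableOn ℂ h U)
    (hθ : IsBetaPotential U h θ) (hx : x ∈ todaSet U h 0 1 2) : DiffForm (etaForm h θ) x :=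
  (diffForm_potForm hU hh hθ.1 hx).add (diffForm_dCoord 3)

theorem extDeriv₁_etaForm (hU : IsOpen U) (hh : DifferentiableOn ℂ h U)
    (hθ : IsBetaPotential U h θ) (hx : x ∈ todaSet U h 0 1 2) (i j : Fin 4) :
    extDeriv₁ (etaForm h θ) x i j
      = x 2 * tc₁ h 0 1 2 x * wedge (te₂ h 0 1 2 x) (dCoord 2 x) i j
        + x 2 * tc₂ h 0 1 2 x * wedge (dCoord 2 x) (te₁ h 0 1 2 x) i j
        + (tp h 0 1 2 x - x 2 * (tp h 0 1 2 x ^ 2 + tq h 0 1 2 x ^ 2))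
          * wedge (te₁ h 0 1 2 x) (te₂ h 0 1 2 x) i j := by
  have := extDeriv₁_add (diffForm_potForm hU hh hθ.1 hx) (diffForm_dCoord 3) i j
  rw [extDeriv₁_dCoord, add_zero, extDeriv₁_potForm hU hh hθ hx] at this
  exact this

/-- The form `r ρ + a e₁ + b e₂ + c e₃ + d η`. -/
def combForm (h : ℂ → ℂ) (θ : Field 2) (r : ℝ) (a b c d : Pt 4 → ℝ) : Field 4 := fun x i =>
  r * rotForm 0 1 x i + (a x * te₁ h 0 1 2 x i + (b x * te₂ h 0 1 2 x i
    + (c x * dCoord 2 x i + d x * etaForm h θ x i)))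

variable {a b c d : Pt 4 → ℝ} {a' b' c' d' : Fin 4 → ℝ} {r : ℝ}

theorem diffForm_combForm (hU : IsOpen U) (hh : DifferentiableOn ℂ h U)
    (hθ : IsBetaPotential U h θ) (hx : x ∈ todaSet U h 0 1 2)
    (ha : HasD a a' x) (hb : HasD b b' x) (hc : HasD c c' x) (hd : HasD d d' x) :
    DiffForm (combForm h θ r a b c d) x :=
  (DiffForm.smul (differentiableAt_const r) diffForm_rot).add
    ((DiffForm.smul ha.diff (diffForm_te₁ hU hh hx)).add
    ((DiffForm.smul hb.diff (diffForm_te₂ hU hh hx)).add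
    ((DiffForm.smul hc.diff (diffForm_dCoord 2)).add
    (DiffForm.smul hd.diff (diffForm_etaForm hU hh hθ hx)))))

theorem extDeriv₁_combForm (hU : IsOpen U) (hh : DifferentiableOn ℂ h U)
    (hθ : IsBetaPotential U h θ) (hx : x ∈ todaSet U h 0 1 2)
    (ha : HasD a a' x) (hb : HasD b b' x) (hc : HasD c c' x) (hd : HasD d d' x) (i j : Fin 4) :
    extDeriv₁ (combForm h θ r a b c d) x i j = r * extDeriv₁ (rotForm 0 1) x i j
      + (a' i * te₁ h 0 1 2 x j - a' j * te₁ h 0 1 2 x i + a x * extDeriv₁ (te₁ h 0 1 2) x i j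
      + (b' i * te₂ h 0 1 2 x j - b' j * te₂ h 0 1 2 x i + b x * extDeriv₁ (te₂ h 0 1 2) x i j
      + (c' i * dCoord 2 x j - c' j * dCoord 2 x i
      + (d' i * etaForm h θ x j - d' j * etaForm h θ x i
        + d x * extDeriv₁ (etaForm h θ) x i j)))) := by
  have f0 : DiffForm (fun y i => r * rotForm 0 1 y i) x :=
    DiffForm.smul (differentiableAt_const r) diffForm_rot
  have f1 := DiffForm.smul ha.diff (diffForm_te₁ hU hh hx)
  have f2 := DiffForm.smul hb.diff (diffForm_te₂ hU hh hx)
  have f3 := DiffForm.smul hc.diff (diffForm_dCoord (x := x) 2)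
  have f4 := DiffForm.smul hd.diff (diffForm_etaForm hU hh hθ hx)
  have e : combForm h θ r a b c d = fun y i => r * rotForm 0 1 y i + (a y * te₁ h 0 1 2 y i
    + (b y * te₂ h 0 1 2 y i + (c y * dCoord 2 y i + d y * etaForm h θ y i))) := rfl
  rw [e, extDeriv₁_add f0 (f1.add (f2.add (f3.add f4))), extDeriv₁_add f1 (f2.add (f3.add f4)),
    extDeriv₁_add f2 (f3.add f4), extDeriv₁_add f3 f4,
    extDeriv₁_smul (hasD_const r) diffForm_rot, extDeriv₁_smul ha (diffForm_te₁ hU hh hx),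
    extDeriv₁_smul hb (diffForm_te₂ hU hh hx), extDeriv₁_smul hc (diffForm_dCoord 2),
    extDeriv₁_smul hd (diffForm_etaForm hU hh hθ hx), extDeriv₁_dCoord]
  ring

/-- The coframe of the four-manifold. -/
def frame₄ (h : ℂ → ℂ) (θ : Field 2) : Pt 4 → Matrix (Fin 4) (Fin 4) ℝ :=
  coframe₄ (te₁ h 0 1 2) (te₂ h 0 1 2) (dCoord 2) (te₄ h θ)

theorem te₁_apply₄ (i : Fin 4) : te₁ h 0 1 2 x i
    = ![sphereScale ⟨x 0, x 1⟩ * (x 2 + (h ⟨x 0, x 1⟩).re),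
      -(sphereScale ⟨x 0, x 1⟩ * (h ⟨x 0, x 1⟩).im), 0, 0] i := by
  fin_cases i <;> simp [te₁, todaE, dPlane, planeCoord] <;> ring

theorem te₂_apply₄ (i : Fin 4) : te₂ h 0 1 2 x i = ![sphereScale ⟨x 0, x 1⟩ * (h ⟨x 0, x 1⟩).im,
    sphereScale ⟨x 0, x 1⟩ * (x 2 + (h ⟨x 0, x 1⟩).re), 0, 0] i := by
  fin_cases i <;> simp [te₂, todaE, dPlane, planeCoord] <;> ring

theorem etaForm_apply (i : Fin 4) : etaForm h θ x i
    = ![θ ![x 0, x 1] 0, θ ![x 0, x 1] 1, x 2 * tq h 0 1 2 x, 1] i := by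
  fin_cases i <;> simp [etaForm, potForm, planePull, dCoord]

theorem det_frame₄ : (frame₄ h θ x).det
    = (tw h x)⁻¹ * (sphereScale ⟨x 0, x 1⟩ ^ 2 * modSq h ![x 0, x 1, x 2]) := by
  rw [frame₄, coframe₄, Matrix.det_succ_row_zero]
  simp [Fin.sum_univ_four, Matrix.det_fin_three, te₁_apply₄, te₂_apply₄, te₄, etaForm_apply,
    dCoord, modSq, Complex.normSq_apply, Fin.succAbove, Matrix.submatrix]
  ring

theorem det_frame₄_pos (hx : x ∈ kahlerDomain U h) : 0 < (frame₄ h θ x).det := by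
  rw [det_frame₄]
  exact mul_pos (inv_pos.2 (mem_kahlerDomain.1 hx).2)
    (mul_pos (pow_pos (sphereScale_pos _) 2) (modSq_pos (U := U) hx.1))

theorem smooth_frame₄ (hU : IsOpen U) (hh : DifferentiableOn ℂ h U) (hθ : IsBetaPotential U h θ) :
    SmoothMatrix (frame₄ h θ) (kahlerDomain U h) := by
  have hs : kahlerDomain U h ⊆ todaSet U h 0 1 2 := fun x hx => hx.1
  intro a j
  fin_cases a
  · exact (contDiffOn_re (contDiffOn_todaE hU hh j)).mono hs
  · exact (contDiffOn_im (contDiffOn_todaE hU hh j)).mono hs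
  · exact contDiffOn_const
  · exact (((contDiffOn_tw hU hh).mono hs).inv fun x hx => (mem_kahlerDomain.1 hx).2.ne').mul
      (((contDiffOn_potForm hU hh hθ.1 j).mono hs).add contDiffOn_const)

theorem isConformalCoframe_kahler (hU : IsOpen U) (hh : DifferentiableOn ℂ h U)
    (hθ : IsBetaPotential U h θ) :
    IsConformalCoframe (kahlerMetric h θ) (tw h) (frame₄ h θ) (kahlerDomain U h) where
  isOpen := isOpen_kahlerDomain hU hh
  smooth_factor := (contDiffOn_tw hU hh).mono fun _ hx => hx.1
  pos _ hx := (mem_kahlerDomain.1 hx).2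
  smooth := smooth_frame₄ hU hh hθ
  det_ne x hx := (det_frame₄_pos hx).ne'
  eq x hx i j := by
    have hw := (mem_kahlerDomain.1 hx).2.ne'
    have hm : monopole h ![x 0, x 1, x 2] = tw h x := monopole_eq (U := U) hx.1
    have hk : kappa h ![x 0, x 1, x 2] = -tq h 0 1 2 x := kappa_eq
    simp only [frame₄, Fin.sum_univ_four, coframe₄_zero, coframe₄_one, coframe₄_two, coframe₄_three,
      te₁_apply₄, te₂_apply₄, te₄, etaForm_apply, kahlerMetric, monopoleMetric, todaMetric, hm,
      sphereFactor_eq, totalPotential, hk]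
    fin_cases i <;> fin_cases j <;>
      simp [Matrix.diagonal, dCoord, modSq, Complex.normSq_apply, Matrix.vecMulVec] <;>
      field_simp <;> ring

theorem einsteinMetric_eq (hx : x ∈ einsteinDomain U h) :
    einsteinMetric h θ x = (1 / x 2 ^ 2) • kahlerMetric h θ x := by
  have hm : modSq h ![x 0, x 1, x 2] ≠ 0 := (modSq_pos (U := U) hx.1.1).ne'
  have e : numer h ![x 0, x 1, x 2]
      = monopole h ![x 0, x 1, x 2] * modSq h ![x 0, x 1, x 2] := by
    rw [monopole]; field_simp
  rw [einsteinMetric, kahlerMetric, monopoleMetric, e]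
  generalize monopole h ![x 0, x 1, x 2] = w at *
  simp only [todaMetric, totalPotential]
  generalize modSq h ![x 0, x 1, x 2] = N at *
  congr 1
  ext i j
  have e2 : N / (w * N) = w⁻¹ := by
    rw [mul_comm, ← div_div, div_self hm, one_div]
  rw [e2]
  fin_cases i <;> fin_cases j <;>
    simp [Matrix.diagonal, Matrix.vecMulVec, hm] <;> ring

theorem isConformalCoframe_einstein (hU : IsOpen U) (hh : DifferentiableOn ℂ h U)
    (hθ : IsBetaPotential U h θ) :
    IsConformalCoframe (einsteinMetric h θ) (fun x => tw h x / x 2 ^ 2) (frame₄ h θ)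
      (einsteinDomain U h) := by
  have K := isConformalCoframe_kahler hU hh hθ
  have hs : einsteinDomain U h ⊆ kahlerDomain U h := fun x hx => hx.1
  exact
  { isOpen := isOpen_einsteinDomain hU hh
    smooth_factor := (K.smooth_factor.mono hs).div
      ((contDiff_apply ℝ ℝ (2 : Fin 4)).pow 2).contDiffOn fun x hx => pow_ne_zero 2 hx.2
    pos := fun x hx => div_pos (K.pos x hx.1) (pow_pos (abs_pos.2 hx.2) 2 |>.trans_eq (sq_abs _))
    smooth := fun i j => (K.smooth i j).mono hs
    det_ne := fun x hx => K.det_ne x hx.1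
    eq := fun x hx i j => by
      rw [einsteinMetric_eq hx, Matrix.smul_apply, K.eq x hx.1, smul_eq_mul]; ring }

end frame₄

section curvature₄

theorem extDeriv₁_trace {φ : Pt n → ℝ} {β : Field n} {S : Set (Pt n)} (hS : IsOpen S)
    (hφ : ContDiffOn ℝ ∞ φ S) (h0 : ∀ x ∈ S, φ x ≠ 0)
    (hβ : ∀ x ∈ S, ∀ i, pd i φ x = 2 * φ x * β x i) {x : Pt n} (hx : x ∈ S) (i j : Fin n) :
    extDeriv₁ β x i j = 0 := by
  have e : ∀ᶠ y in nhds x, ∀ i, β y i = (1 / 2) * (pd i φ y * (φ y)⁻¹) := by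
    filter_upwards [hS.mem_nhds hx] with y hy i
    have := h0 y hy
    rw [hβ y hy]
    field_simp
  have hφx := hφ.contDiffAt (hS.mem_nhds hx)
  have hd : HasD φ (fun i => pd i φ x) x := hasD_pd (hφx.differentiableAt (by simp))
  have hp : ∀ k, HasD (pd k φ) (fun i => pd i (pd k φ) x) x := fun k =>
    hasD_pd (((contDiffOn_pd hS hφ k).contDiffAt (hS.mem_nhds hx)).differentiableAt (by simp))
  have hb : ∀ k, HasD (fun y => (1 / 2) * (pd k φ y * (φ y)⁻¹)) _ x := fun k =>
    (hasD_const (1 / 2 : ℝ)).mul ((hp k).mul (hd.inv (h0 x hx)))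
  rw [extDeriv₁_congr e, extDeriv₁, (hb j).pd, (hb i).pd, pd_comm (hφx.of_le two_le_infty) i j]
  ring

theorem splitConn_skew {α₁ α₂ α₃ B₁ B₂ B₃ : Field 4} (x : Pt 4) (i a b : Fin 4) :
    splitConn α₁ α₂ α₃ B₁ B₂ B₃ x i a b = -splitConn α₁ α₂ α₃ B₁ B₂ B₃ x i b a :=
  splitMat_neg _ _ _ _ _ _ a b

theorem curvature_split {g : Metric 4} {φ : Pt 4 → ℝ} {e : Pt 4 → Matrix (Fin 4) (Fin 4) ℝ}
    {S : Set (Pt 4)} {α₁ α₂ α₃ B₁ B₂ B₃ β : Field 4} {x : Pt 4}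
    (h : IsConformalCoframe g φ e S) (hβ : ∀ x ∈ S, ∀ i, pd i φ x = 2 * φ x * β x i)
    (hT : IsTorsionFree e (splitConn α₁ α₂ α₃ B₁ B₂ B₃) β S)
    (h₁ : ∀ x ∈ S, DiffForm α₁ x) (h₂ : ∀ x ∈ S, DiffForm α₂ x) (h₃ : ∀ x ∈ S, DiffForm α₃ x)
    (k₁ : ∀ x ∈ S, DiffForm B₁ x) (k₂ : ∀ x ∈ S, DiffForm B₂ x) (k₃ : ∀ x ∈ S, DiffForm B₃ x)
    (hd : ∀ x ∈ S, DiffForm β x) (hx : x ∈ S) (a i j k : Fin 4) :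
    ∑ l, e x a l * curvature (leviCivita g) x l k i j = ∑ b, splitMat
        (extDeriv₁ α₁ x i j - wedge (α₃ x) (α₂ x) i j)
        (extDeriv₁ α₂ x i j + wedge (α₃ x) (α₁ x) i j)
        (extDeriv₁ α₃ x i j - wedge (α₂ x) (α₁ x) i j)
        (extDeriv₁ B₁ x i j + wedge (B₃ x) (B₂ x) i j)
        (extDeriv₁ B₂ x i j - wedge (B₃ x) (B₁ x) i j)
        (extDeriv₁ B₃ x i j + wedge (B₂ x) (B₁ x) i j) a b * e x b k := by
  have hF := h.leviCivita (fun x _ => splitConn_skew x) hβ hT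
  have hA : ∀ y ∈ S, ∀ i a b, DifferentiableAt ℝ
      (fun y => splitConn α₁ α₂ α₃ B₁ B₂ B₃ y i a b) y := fun y hy i a b =>
    differentiableAt_splitConn (h₁ y hy) (h₂ y hy) (h₃ y hy) (k₁ y hy) (k₂ y hy) (k₃ y hy) i a b
  rw [hF.curvature h.isOpen h.smooth (fun k i j y hy => ((contDiffOn_leviCivita h.isOpen
    h.smooth_metric (fun x hx => h.det_metric_ne hx) k i j).contDiffAt
      (h.isOpen.mem_nhds hy)).differentiableAt (by simp)) ?_ hx]
  · refine sum_congr rfl fun b _ => ?_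
    rw [curvMatrix_weylMatrix (hA x hx) (hd x hx), extDeriv₁_trace h.isOpen h.smooth_factor
      (fun x hx => (h.pos x hx).ne') hβ hx, ite_self, add_zero,
      curvMatrix_splitConn (h₁ x hx) (h₂ x hx) (h₃ x hx) (k₁ x hx) (k₂ x hx) (k₃ x hx)]
  · intro i a b y hy
    simp only [weylMatrix, Matrix.add_apply, Matrix.smul_apply, smul_eq_mul]
    exact (hA y hy i a b).add ((hd y hy i).mul_const _)

end curvature₄

section kahler

variable {h : ℂ → ℂ} {U : Set ℂ} {x : Pt 4} {θ : Field 2}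

/-- The derivative of the monopole in the direction of `e₃`. -/
def tw₃ (h : ℂ → ℂ) (x : Pt 4) : ℝ :=
  -tp h 0 1 2 x + x 2 * (tp h 0 1 2 x ^ 2 - tq h 0 1 2 x ^ 2)

theorem hasD_tw₃ (hU : IsOpen U) (hh : DifferentiableOn ℂ h U) (hx : x ∈ todaSet U h 0 1 2) :
    ∃ D, HasD (tw₃ h) D x :=
  ⟨_, (hasD_tp hU hh hx).neg.add ((hasD_coord' 2).mul
    (((hasD_tp hU hh hx).pow 2).sub ((hasD_tq hU hh hx).pow 2)))⟩

/-- The trace part of the connection of the Kähler metric. -/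
def kBeta (h : ℂ → ℂ) (θ : Field 2) : Field 4 := combForm h θ 0
  (fun x => x 2 * tc₁ h 0 1 2 x / (2 * tw h x)) (fun x => x 2 * tc₂ h 0 1 2 x / (2 * tw h x))
  (fun x => tw₃ h x / (2 * tw h x)) (fun _ => 0)

/-- The selfdual part of the connection of the Kähler metric. -/
def kAlpha₃ (h : ℂ → ℂ) (θ : Field 2) : Field 4 := combForm h θ 1 (fun _ => 0) (fun _ => 0)
  (fun x => -tq h 0 1 2 x) (fun x => -(tp h 0 1 2 x / tw h x))

/-- The antiselfdual part of the connection of the Kähler metric. -/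
def kB₁ (h : ℂ → ℂ) (θ : Field 2) : Field 4 := combForm h θ 0 (fun _ => 0)
  (fun x => -(2 * tp h 0 1 2 x + tw₃ h x / tw h x)) (fun x => x 2 * tc₂ h 0 1 2 x / tw h x)
  (fun x => x 2 * tc₁ h 0 1 2 x / tw h x ^ 2)

/-- The antiselfdual part of the connection of the Kähler metric. -/
def kB₂ (h : ℂ → ℂ) (θ : Field 2) : Field 4 := combForm h θ 0
  (fun x => 2 * tp h 0 1 2 x + tw₃ h x / tw h x) (fun _ => 0)
  (fun x => -(x 2 * tc₁ h 0 1 2 x / tw h x)) (fun x => x 2 * tc₂ h 0 1 2 x / tw h x ^ 2)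

/-- The antiselfdual part of the connection of the Kähler metric. -/
def kB₃ (h : ℂ → ℂ) (θ : Field 2) : Field 4 := combForm h θ 1
  (fun x => x 2 * tc₂ h 0 1 2 x / tw h x) (fun x => -(x 2 * tc₁ h 0 1 2 x / tw h x))
  (fun x => -tq h 0 1 2 x) (fun x => -((tw₃ h x / tw h x + tp h 0 1 2 x) / tw h x))

theorem extDeriv₁_te₄ (hU : IsOpen U) (hh : DifferentiableOn ℂ h U) (hθ : IsBetaPotential U h θ)
    (hx : x ∈ kahlerDomain U h) (i j : Fin 4) :
    extDeriv₁ (te₄ h θ) x i j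
      = -(tw h x)⁻¹ ^ 2 * wedge (fun i => x 2 * tc₁ h 0 1 2 x * te₁ h 0 1 2 x i
      + x 2 * tc₂ h 0 1 2 x * te₂ h 0 1 2 x i + tw₃ h x * dCoord 2 x i) (etaForm h θ x) i j
      + (tw h x)⁻¹ * (x 2 * tc₁ h 0 1 2 x * wedge (te₂ h 0 1 2 x) (dCoord 2 x) i j
        + x 2 * tc₂ h 0 1 2 x * wedge (dCoord 2 x) (te₁ h 0 1 2 x) i j
        + (tp h 0 1 2 x - x 2 * (tp h 0 1 2 x ^ 2 + tq h 0 1 2 x ^ 2))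
          * wedge (te₁ h 0 1 2 x) (te₂ h 0 1 2 x) i j) := by
  obtain ⟨hx', hw⟩ := mem_kahlerDomain.1 hx
  have e : te₄ h θ = fun y i => (tw h y)⁻¹ * etaForm h θ y i := rfl
  rw [e, extDeriv₁_smul ((hasD_tw hU hh hx').inv hw.ne') (diffForm_etaForm hU hh hθ hx'),
    extDeriv₁_etaForm hU hh hθ hx']
  simp only [wedge, tw₃]
  ring

theorem isTorsionFree_kahler (hU : IsOpen U) (hh : DifferentiableOn ℂ h U)
    (hθ : IsBetaPotential U h θ) :
    IsTorsionFree (frame₄ h θ) (splitConn (fun _ _ => 0) (fun _ _ => 0) (kAlpha₃ h θ) (kB₁ h θ)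
      (kB₂ h θ) (kB₃ h θ)) (kBeta h θ) (kahlerDomain U h) := by
  refine isTorsionFree₄ ?_ ?_ ?_ ?_ <;> intro x hx i j <;>
    obtain ⟨hx', hw⟩ := mem_kahlerDomain.1 hx <;> have hw' := hw.ne'
  · rw [extDeriv₁_te₁ hU hh hx']
    simp only [wedge, Pi.add_apply, kAlpha₃, kB₁, kB₂, kB₃, kBeta, combForm, te₄]
    field_simp
    ring
  · rw [extDeriv₁_te₂ hU hh hx']
    simp only [wedge, Pi.add_apply, Pi.sub_apply, kAlpha₃, kB₁, kB₂, kB₃, kBeta, combForm, te₄]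
    field_simp
    ring
  · rw [extDeriv₁_dCoord]
    simp only [wedge, Pi.add_apply, Pi.sub_apply, kAlpha₃, kB₁, kB₂, kB₃, kBeta, combForm, te₄]
    field_simp
    ring
  · rw [extDeriv₁_te₄ hU hh hθ hx]
    simp only [wedge, Pi.add_apply, Pi.sub_apply, kAlpha₃, kB₁, kB₂, kB₃, kBeta, combForm, te₄]
    have e : tp h 0 1 2 x - x 2 * (tp h 0 1 2 x ^ 2 + tq h 0 1 2 x ^ 2)
        = tw₃ h x + 2 * tp h 0 1 2 x * tw h x := by rw [tw₃, tw]; ring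
    rw [e]
    field_simp
    ring

theorem kahler_trace (hU : IsOpen U) (hh : DifferentiableOn ℂ h U) (hx : x ∈ kahlerDomain U h)
    (i : Fin 4) : pd i (tw h) x = 2 * tw h x * kBeta h θ x i := by
  obtain ⟨hx', hw⟩ := mem_kahlerDomain.1 hx
  rw [(hasD_tw hU hh hx').pd, kBeta, combForm, tw₃]
  field_simp
  ring

theorem kahler_parallel {S : Set (Pt 4)} {α₃ B₁ B₂ B₃ β : Field 4} :
    IsParallel (fun _ => splitMat 0 0 2 0 0 0)
      (weylMatrix (splitConn (fun _ _ => 0) (fun _ _ => 0) α₃ B₁ B₂ B₃) β) S := by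
  refine isParallel_weylMatrix fun x _ i a b => ?_
  rw [pd_const, splitConn, splitMat_commutator]
  simp only [mul_zero, zero_mul, sub_zero, zero_add]
  fin_cases a <;> fin_cases b <;> simp [splitMat]

theorem splitMat_square {p₁ p₂ p₃ : ℝ} (hp : p₁ ^ 2 + p₂ ^ 2 + p₃ ^ 2 = 4) :
    splitMat p₁ p₂ p₃ 0 0 0 * splitMat p₁ p₂ p₃ 0 0 0 = -1 := by
  ext a b
  fin_cases a <;> fin_cases b <;>
    simp [splitMat, Matrix.mul_apply, Fin.sum_univ_four] <;>
    first | ring1 | linear_combination (-1 / 4) * hp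

theorem splitMat_transpose (p₁ p₂ p₃ m₁ m₂ m₃ : ℝ) :
    (splitMat p₁ p₂ p₃ m₁ m₂ m₃).transpose = -splitMat p₁ p₂ p₃ m₁ m₂ m₃ := by
  ext a b
  exact splitMat_neg _ _ _ _ _ _ b a

/-- The complex structure of the Kähler metric. -/
def kahlerJ (h : ℂ → ℂ) (θ : Field 2) : EndField 4 :=
  frameEnd (frame₄ h θ) (fun _ => splitMat 0 0 2 0 0 0)

theorem isKahlerOn_kahler (hU : IsOpen U) (hh : DifferentiableOn ℂ h U)
    (hθ : IsBetaPotential U h θ) :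
    IsKahlerOn (kahlerMetric h θ) (kahlerJ h θ) (kahlerDomain U h) :=
  isKahlerOn_frameEnd (isConformalCoframe_kahler hU hh hθ) (fun x _ => splitConn_skew x)
    (fun _ hx => kahler_trace hU hh hx) (isTorsionFree_kahler hU hh hθ)
    (fun _ _ => contDiffOn_const) kahler_parallel (fun _ _ => splitMat_square (by norm_num))
    (fun _ _ => splitMat_transpose _ _ _ _ _ _)

theorem tq_add_single (c : ℝ) : tq h 0 1 2 (x + c • Pi.single 3 1) = tq h 0 1 2 x := by
  simp [tq, todaInv, planeCoord]

theorem tw_add_single (c : ℝ) : tw h (x + c • Pi.single 3 1) = tw h x := by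
  simp [tw, tp, todaInv, planeCoord]

theorem frame₄_add_single (c : ℝ) : frame₄ h θ (x + c • Pi.single 3 1) = frame₄ h θ x := by
  ext a j
  fin_cases a <;> simp [frame₄, coframe₄, te₁_apply₄, te₂_apply₄, te₄, etaForm_apply, dCoord,
    tw_add_single, tq_add_single]

theorem partialT_eq : partialT = fun _ => Pi.single 3 1 := by
  funext _ i
  fin_cases i <;> simp [partialT]

theorem lieEnd_kahlerJ (p : Pt 4) (k i : Fin 4) : lieEnd partialT (kahlerJ h θ) p k i = 0 := by
  rw [partialT_eq]
  refine lieEnd_const 3 (fun y c => ?_) p k i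
  simp only [kahlerJ, frameEnd, frame₄_add_single]

theorem kahlerMetric_add_single (c : ℝ) :
    kahlerMetric h θ (x + c • Pi.single 3 1) = kahlerMetric h θ x := by
  simp [kahlerMetric, monopoleMetric]

theorem einsteinMetric_add_single (c : ℝ) :
    einsteinMetric h θ (x + c • Pi.single 3 1) = einsteinMetric h θ x := by
  simp [einsteinMetric]

theorem smoothField_partialT (S : Set (Pt 4)) : SmoothField partialT S := fun _ => contDiffOn_const

theorem isKillingOn_kahler (S : Set (Pt 4)) : IsKillingOn (kahlerMetric h θ) partialT S := by
  refine ⟨smoothField_partialT S, fun x _ i j => ?_⟩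
  rw [partialT_eq]
  exact lieMetric_const 3 (fun y c => kahlerMetric_add_single c) x i j

theorem isKillingOn_einstein (S : Set (Pt 4)) : IsKillingOn (einsteinMetric h θ) partialT S := by
  refine ⟨smoothField_partialT S, fun x _ i j => ?_⟩
  rw [partialT_eq]
  exact lieMetric_const 3 (fun y c => einsteinMetric_add_single c) x i j

theorem extDeriv₁_kAlpha₃ (hU : IsOpen U) (hh : DifferentiableOn ℂ h U) (hθ : IsBetaPotential U h θ)
    (hx : x ∈ kahlerDomain U h) (i j : Fin 4) :
    extDeriv₁ (kAlpha₃ h θ) x i j = frameForm (frame₄ h θ x) (splitMat 0 0 0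
      (2 * tc₁ h 0 1 2 x / tw h x) (2 * tc₂ h 0 1 2 x / tw h x)
      (-2 * ((tp h 0 1 2 x ^ 2 - tq h 0 1 2 x ^ 2) + tp h 0 1 2 x * tw₃ h x / tw h x))) i j := by
  obtain ⟨hx', hw⟩ := mem_kahlerDomain.1 hx
  have hw' := hw.ne'
  have hp := hasD_tp hU hh hx'
  rw [kAlpha₃, extDeriv₁_combForm hU hh hθ hx' (hasD_const 0) (hasD_const 0)
    (hasD_tq hU hh hx').neg ((hasD_tp hU hh hx').div (hasD_tw hU hh hx') hw').neg,
    extDeriv₁_rotForm' hx', extDeriv₁_etaForm hU hh hθ hx']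
  simp only [frameForm, splitMat, Fin.sum_univ_four, frame₄, coframe₄_zero, coframe₄_one,
    coframe₄_two, coframe₄_three, te₄, wedge, Matrix.of_apply, Matrix.cons_val', Matrix.cons_val_zero,
    Matrix.cons_val_one, Matrix.cons_val]
  rw [tw₃]
  have e : tw h x = 1 - x 2 * tp h 0 1 2 x := rfl
  generalize tw h x = w, te₁ h 0 1 2 x i = a1, te₁ h 0 1 2 x j = a2, te₂ h 0 1 2 x i = b1,
    te₂ h 0 1 2 x j = b2, dCoord 2 x i = g1, dCoord 2 x j = g2, etaForm h θ x i = n1,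
    etaForm h θ x j = n2, tp h 0 1 2 x = p, tq h 0 1 2 x = q at *
  field_simp
  rw [e]
  ring

theorem scalarCurv_kahler (hU : IsOpen U) (hh : DifferentiableOn ℂ h U)
    (hθ : IsBetaPotential U h θ) (hx : x ∈ kahlerDomain U h) :
    scalarCurv (kahlerMetric h θ) x = 0 := by
  have hc := isConformalCoframe_kahler hU hh hθ
  have hT := isTorsionFree_kahler hU hh hθ
  have hβ : ∀ x ∈ kahlerDomain U h, ∀ i, pd i (tw h) x = 2 * tw h x * kBeta h θ x i :=
    fun x hx => kahler_trace hU hh hx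
  have z : ∀ x : Pt 4, HasD (fun _ : Pt 4 => (0 : ℝ)) (fun _ => 0) x := fun x => hasD_const 0
  have f0 : ∀ x ∈ kahlerDomain U h, DiffForm (fun (_ : Pt 4) (_ : Fin 4) => (0 : ℝ)) x :=
    fun x _ _ => differentiableAt_const _
  have hZ : ∀ x : Pt 4, HasD (fun y : Pt 4 => y 2) (dCoord 2 x) x := fun x => hasD_coord' 2
  have H : ∀ x ∈ kahlerDomain U h, DiffForm (kAlpha₃ h θ) x ∧ DiffForm (kB₁ h θ) x ∧
      DiffForm (kB₂ h θ) x ∧ DiffForm (kB₃ h θ) x ∧ DiffForm (kBeta h θ) x := by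
    intro x hx
    obtain ⟨hx', hw⟩ := mem_kahlerDomain.1 hx
    have hw' := hw.ne'
    have hp := hasD_tp hU hh hx'
    have hq := hasD_tq hU hh hx'
    have h1 := hasD_tc₁ hU hh hx'
    have h2 := hasD_tc₂ hU hh hx'
    have hW := hasD_tw hU hh hx'
    obtain ⟨D₃, h3⟩ := hasD_tw₃ hU hh hx'
    have h2w := (hasD_const (2 : ℝ)).mul hW
    have h2w' : 2 * tw h x ≠ 0 := mul_ne_zero two_ne_zero hw'
    have hW2 := hW.pow 2
    have hW2' : tw h x ^ 2 ≠ 0 := pow_ne_zero 2 hw'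
    refine ⟨?_, ?_, ?_, ?_, ?_⟩
    · exact diffForm_combForm hU hh hθ hx' (z x) (z x) hq.neg (hp.div hW hw').neg
    · exact diffForm_combForm hU hh hθ hx' (z x)
        (((hasD_const (2 : ℝ)).mul hp).add (h3.div hW hw')).neg
        (((hZ x).mul h2).div hW hw') (((hZ x).mul h1).div hW2 hW2')
    · exact diffForm_combForm hU hh hθ hx'
        (((hasD_const (2 : ℝ)).mul hp).add (h3.div hW hw')) (z x)
        (((hZ x).mul h1).div hW hw').neg (((hZ x).mul h2).div hW2 hW2')
    · exact diffForm_combForm hU hh hθ hx' (((hZ x).mul h2).div hW hw')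
        (((hZ x).mul h1).div hW hw').neg hq.neg (((h3.div hW hw').add hp).div hW hw').neg
    · exact diffForm_combForm hU hh hθ hx' (((hZ x).mul h1).div h2w h2w')
        (((hZ x).mul h2).div h2w h2w') (h3.div h2w h2w') (z x)
  have hK := curvature_split hc hβ hT f0 f0 (fun x hx => (H x hx).1) (fun x hx => (H x hx).2.1)
    (fun x hx => (H x hx).2.2.1) (fun x hx => (H x hx).2.2.2.1) (fun x hx => (H x hx).2.2.2.2) hx
  have hs : ∀ y ∈ kahlerDomain U h, ∀ k i j, leviCivita (kahlerMetric h θ) y k i j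
      = leviCivita (kahlerMetric h θ) y k j i := fun y hy k i j =>
    (hc.leviCivita (fun x _ => splitConn_skew x) hβ hT).symm hT hc.det_ne hy k i j
  refine scalarCurv_eq_zero hc hx (bianchi hc.isOpen hs hx)
    (r₁ := 2 * tc₁ h 0 1 2 x / tw h x) (r₂ := 2 * tc₂ h 0 1 2 x / tw h x)
    (r₃ := -2 * ((tp h 0 1 2 x ^ 2 - tq h 0 1 2 x ^ 2) + tp h 0 1 2 x * tw₃ h x / tw h x))
    (M₁ := fun i j => extDeriv₁ (kB₁ h θ) x i j + wedge (kB₃ h θ x) (kB₂ h θ x) i j)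
    (M₂ := fun i j => extDeriv₁ (kB₂ h θ) x i j - wedge (kB₃ h θ x) (kB₁ h θ x) i j)
    (M₃ := fun i j => extDeriv₁ (kB₃ h θ) x i j + wedge (kB₂ h θ x) (kB₁ h θ x) i j)
    ?_ ?_ ?_ ?_
  · intro i j; rw [extDeriv₁_swap]; simp only [wedge]; ring
  · intro i j; rw [extDeriv₁_swap]; simp only [wedge]; ring
  · intro i j; rw [extDeriv₁_swap]; simp only [wedge]; ring
  · intro a i j k
    rw [hK, ← extDeriv₁_kAlpha₃ hU hh hθ hx]
    have e : ∀ i j, extDeriv₁ (fun (_ : Pt 4) (_ : Fin 4) => (0 : ℝ)) x i j = 0 :=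
      fun i j => extDeriv₁_zero x i j
    simp only [e, wedge, mul_zero, sub_zero, add_zero]

end kahler

/-! ### The Einstein metric -/

section einstein

variable {h : ℂ → ℂ} {U : Set ℂ} {x : Pt 4} {θ : Field 2}

/-- The trace part of the connection of the Einstein metric. -/
def eBeta (h : ℂ → ℂ) (θ : Field 2) : Field 4 := combForm h θ 0
  (fun x => x 2 * tc₁ h 0 1 2 x / (2 * tw h x)) (fun x => x 2 * tc₂ h 0 1 2 x / (2 * tw h x))
  (fun x => tw₃ h x / (2 * tw h x) - (x 2)⁻¹) (fun _ => 0)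

/-- The selfdual part of the connection of the Einstein metric. -/
def eAlpha₁ (h : ℂ → ℂ) (θ : Field 2) : Field 4 := combForm h θ 0 (fun _ => 0)
  (fun x => -(x 2)⁻¹) (fun _ => 0) (fun _ => 0)

/-- The selfdual part of the connection of the Einstein metric. -/
def eAlpha₂ (h : ℂ → ℂ) (θ : Field 2) : Field 4 := combForm h θ 0
  (fun x => -(x 2)⁻¹) (fun _ => 0) (fun _ => 0) (fun _ => 0)

/-- The selfdual part of the connection of the Einstein metric. -/
def eAlpha₃ (h : ℂ → ℂ) (θ : Field 2) : Field 4 := combForm h θ 1 (fun _ => 0) (fun _ => 0)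
  (fun x => -tq h 0 1 2 x) (fun x => (x 2)⁻¹)

/-- The antiselfdual part of the connection of the Einstein metric. -/
def eB₁ (h : ℂ → ℂ) (θ : Field 2) : Field 4 := combForm h θ 0 (fun _ => 0)
  (fun x => (tw h x ^ 2 + (x 2 * tq h 0 1 2 x) ^ 2) / (x 2 * tw h x))
  (fun x => x 2 * tc₂ h 0 1 2 x / tw h x) (fun x => x 2 * tc₁ h 0 1 2 x / tw h x ^ 2)

/-- The antiselfdual part of the connection of the Einstein metric. -/
def eB₂ (h : ℂ → ℂ) (θ : Field 2) : Field 4 := combForm h θ 0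
  (fun x => -((tw h x ^ 2 + (x 2 * tq h 0 1 2 x) ^ 2) / (x 2 * tw h x))) (fun _ => 0)
  (fun x => -(x 2 * tc₁ h 0 1 2 x / tw h x)) (fun x => x 2 * tc₂ h 0 1 2 x / tw h x ^ 2)

/-- The antiselfdual part of the connection of the Einstein metric. -/
def eB₃ (h : ℂ → ℂ) (θ : Field 2) : Field 4 := combForm h θ 1
  (fun x => x 2 * tc₂ h 0 1 2 x / tw h x) (fun x => -(x 2 * tc₁ h 0 1 2 x / tw h x))
  (fun x => -tq h 0 1 2 x)
  (fun x => -((tw h x - (x 2 * tq h 0 1 2 x) ^ 2) / (x 2 * tw h x ^ 2)))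

theorem isTorsionFree_einstein (hU : IsOpen U) (hh : DifferentiableOn ℂ h U)
    (hθ : IsBetaPotential U h θ) :
    IsTorsionFree (frame₄ h θ) (splitConn (eAlpha₁ h θ) (eAlpha₂ h θ) (eAlpha₃ h θ) (eB₁ h θ)
      (eB₂ h θ) (eB₃ h θ)) (eBeta h θ) (einsteinDomain U h) := by
  refine isTorsionFree₄ ?_ ?_ ?_ ?_ <;> intro x hx i j <;>
    obtain ⟨hx', hw⟩ := mem_kahlerDomain.1 hx.1 <;> have hw' := hw.ne' <;>
    have hz : x 2 ≠ 0 := hx.2 <;> have e : tw h x = 1 - x 2 * tp h 0 1 2 x := rfl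
  · rw [extDeriv₁_te₁ hU hh hx']
    simp only [wedge, Pi.add_apply, eAlpha₁, eAlpha₂, eAlpha₃, eB₁, eB₂, eB₃, eBeta, combForm, te₄,
      tw₃]
    field_simp
    rw [e]
    ring
  · rw [extDeriv₁_te₂ hU hh hx']
    simp only [wedge, Pi.add_apply, Pi.sub_apply, eAlpha₁, eAlpha₂, eAlpha₃, eB₁, eB₂, eB₃, eBeta,
      combForm, te₄, tw₃]
    field_simp
    rw [e]
    ring
  · rw [extDeriv₁_dCoord]
    simp only [wedge, Pi.add_apply, Pi.sub_apply, eAlpha₁, eAlpha₂, eAlpha₃, eB₁, eB₂, eB₃, eBeta,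
      combForm, te₄, tw₃]
    field_simp
    rw [e]
    ring
  · rw [extDeriv₁_te₄ hU hh hθ hx.1]
    simp only [wedge, Pi.add_apply, Pi.sub_apply, eAlpha₁, eAlpha₂, eAlpha₃, eB₁, eB₂, eB₃, eBeta,
      combForm, te₄, tw₃]
    field_simp
    rw [e]
    ring

theorem einstein_trace (hU : IsOpen U) (hh : DifferentiableOn ℂ h U) (hx : x ∈ einsteinDomain U h)
    (i : Fin 4) : pd i (fun x => tw h x / x 2 ^ 2) x
      = 2 * (tw h x / x 2 ^ 2) * eBeta h θ x i := by
  obtain ⟨hx', hw⟩ := mem_kahlerDomain.1 hx.1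
  have hz : x 2 ≠ 0 := hx.2
  rw [((hasD_tw hU hh hx').div ((hasD_coord' 2).pow 2) (pow_ne_zero 2 hz)).pd, eBeta, combForm, tw₃]
  field_simp
  ring

theorem hasD_invZ (hz : x 2 ≠ 0) : HasD (fun y : Pt 4 => (y 2)⁻¹)
    (fun i => -dCoord 2 x i * (x 2)⁻¹ ^ 2) x := (hasD_coord' 2).inv hz

theorem diffForm_einstein (hU : IsOpen U) (hh : DifferentiableOn ℂ h U)
    (hθ : IsBetaPotential U h θ) (hx : x ∈ einsteinDomain U h) :
    DiffForm (eAlpha₁ h θ) x ∧ DiffForm (eAlpha₂ h θ) x ∧ DiffForm (eAlpha₃ h θ) x ∧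
      DiffForm (eB₁ h θ) x ∧ DiffForm (eB₂ h θ) x ∧ DiffForm (eB₃ h θ) x ∧
      DiffForm (eBeta h θ) x := by
  obtain ⟨hx', hw⟩ := mem_kahlerDomain.1 hx.1
  have hw' := hw.ne'
  have hz : x 2 ≠ 0 := hx.2
  have hZ : HasD (fun y : Pt 4 => y 2) (dCoord 2 x) x := hasD_coord' 2
  have hI := hasD_invZ hz
  have hp := hasD_tp hU hh hx'
  have hq := hasD_tq hU hh hx'
  have h1 := hasD_tc₁ hU hh hx'
  have h2 := hasD_tc₂ hU hh hx'
  have hW := hasD_tw hU hh hx'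
  obtain ⟨D₃, h3⟩ := hasD_tw₃ hU hh hx'
  have z : HasD (fun _ : Pt 4 => (0 : ℝ)) (fun _ => 0) x := hasD_const 0
  have h2w := (hasD_const (2 : ℝ)).mul hW
  have h2w' : 2 * tw h x ≠ 0 := mul_ne_zero two_ne_zero hw'
  have hW2 := hW.pow 2
  have hW2' : tw h x ^ 2 ≠ 0 := pow_ne_zero 2 hw'
  have hN := ((hW2.add ((hZ.mul hq).pow 2))).div (hZ.mul hW) (mul_ne_zero hz hw')
  refine ⟨?_, ?_, ?_, ?_, ?_, ?_, ?_⟩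
  · exact diffForm_combForm hU hh hθ hx' z hI.neg z z
  · exact diffForm_combForm hU hh hθ hx' hI.neg z z z
  · exact diffForm_combForm hU hh hθ hx' z z hq.neg hI
  · exact diffForm_combForm hU hh hθ hx' z hN ((hZ.mul h2).div hW hw') ((hZ.mul h1).div hW2 hW2')
  · exact diffForm_combForm hU hh hθ hx' hN.neg z ((hZ.mul h1).div hW hw').neg
      ((hZ.mul h2).div hW2 hW2')
  · exact diffForm_combForm hU hh hθ hx' ((hZ.mul h2).div hW hw') ((hZ.mul h1).div hW hw').neg
      hq.neg ((hW.sub ((hZ.mul hq).pow 2)).div (hZ.mul hW2) (mul_ne_zero hz hW2')).neg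
  · exact diffForm_combForm hU hh hθ hx' ((hZ.mul h1).div h2w h2w')
      ((hZ.mul h2).div h2w h2w') ((h3.div h2w h2w').sub hI) z

/-- The common part of the diagonal entries of the antiselfdual part of the curvature. -/
def eD (h : ℂ → ℂ) (x : Pt 4) : ℝ :=
  (-(x 2)⁻¹ + x 2 * tq h 0 1 2 x ^ 2 / tw h x)
    * ((tw h x ^ 2 + (x 2 * tq h 0 1 2 x) ^ 2) / (x 2 * tw h x))

/-- An entry of the antiselfdual part of the curvature. -/
def eM₁₃ (h : ℂ → ℂ) (x : Pt 4) : ℝ :=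
  -(tc₁ h 0 1 2 x / tw h x
    - 3 * x 2 * (tp h 0 1 2 x * tc₁ h 0 1 2 x - tq h 0 1 2 x * tc₂ h 0 1 2 x) / tw h x
    - 2 * x 2 * tc₁ h 0 1 2 x * tw₃ h x / tw h x ^ 2 - tq h 0 1 2 x * x 2 * tc₂ h 0 1 2 x / tw h x
    + (-(x 2)⁻¹ + x 2 * tq h 0 1 2 x ^ 2 / tw h x) * (x 2 * tc₁ h 0 1 2 x / tw h x))

/-- An entry of the antiselfdual part of the curvature. -/
def eM₂₃ (h : ℂ → ℂ) (x : Pt 4) : ℝ :=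
  -(tc₂ h 0 1 2 x / tw h x
    - 3 * x 2 * (tp h 0 1 2 x * tc₂ h 0 1 2 x + tq h 0 1 2 x * tc₁ h 0 1 2 x) / tw h x
    - 2 * x 2 * tc₂ h 0 1 2 x * tw₃ h x / tw h x ^ 2 + tq h 0 1 2 x * x 2 * tc₁ h 0 1 2 x / tw h x
    + (-(x 2)⁻¹ + x 2 * tq h 0 1 2 x ^ 2 / tw h x) * (x 2 * tc₂ h 0 1 2 x / tw h x))

/-- An entry of the antiselfdual part of the curvature. -/
def eM₁₂ (h : ℂ → ℂ) (x : Pt 4) : ℝ :=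
  x 2 * tr₂ h 0 1 2 x / tw h x - 3 * x 2 ^ 2 * tc₁ h 0 1 2 x * tc₂ h 0 1 2 x / tw h x ^ 2

/-- An entry of the antiselfdual part of the curvature. -/
def eM₁₁ (h : ℂ → ℂ) (x : Pt 4) : ℝ :=
  x 2 * tr₁ h 0 1 2 x / tw h x - 2 * x 2 ^ 2 * tc₁ h 0 1 2 x ^ 2 / tw h x ^ 2
    + x 2 ^ 2 * tc₂ h 0 1 2 x ^ 2 / tw h x ^ 2 + eD h x

/-- An entry of the antiselfdual part of the curvature. -/
def eM₂₂ (h : ℂ → ℂ) (x : Pt 4) : ℝ :=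
  -(x 2 * tr₁ h 0 1 2 x / tw h x) - 2 * x 2 ^ 2 * tc₂ h 0 1 2 x ^ 2 / tw h x ^ 2
    + x 2 ^ 2 * tc₁ h 0 1 2 x ^ 2 / tw h x ^ 2 + eD h x

/-- An entry of the antiselfdual part of the curvature. -/
def eM₃₃ (h : ℂ → ℂ) (x : Pt 4) : ℝ :=
  -((x 2)⁻¹ ^ 2 + tq h 0 1 2 x ^ 2 / tw h x
    - 4 * x 2 * tp h 0 1 2 x * tq h 0 1 2 x ^ 2 / tw h x
    - 2 * x 2 * tq h 0 1 2 x ^ 2 * tw₃ h x / tw h x ^ 2 + tw₃ h x / (x 2 * tw h x)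
    - x 2 ^ 2 * (tc₁ h 0 1 2 x ^ 2 + tc₂ h 0 1 2 x ^ 2) / tw h x ^ 2)

/-- The antiselfdual part of the curvature. -/
def eM (h : ℂ → ℂ) (x : Pt 4) : Matrix (Fin 3) (Fin 3) ℝ :=
  !![eM₁₁ h x, eM₁₂ h x, eM₁₃ h x; eM₁₂ h x, eM₂₂ h x, eM₂₃ h x; eM₁₃ h x, eM₂₃ h x, eM₃₃ h x]

theorem eM_trace (hw : tw h x ≠ 0) (hz : x 2 ≠ 0) :
    eM h x 0 0 + eM h x 1 1 + eM h x 2 2 = -3 * (tw h x / x 2 ^ 2) := by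
  have e : tw h x = 1 - x 2 * tp h 0 1 2 x := rfl
  simp only [eM, Matrix.of_apply, Matrix.cons_val', Matrix.cons_val_zero, Matrix.cons_val_one,
    Matrix.cons_val, eM₁₁, eM₂₂, eM₃₃, eD, tw₃]
  field_simp
  rw [e]
  ring

theorem frameForm_frame₄ (p₁ p₂ p₃ m₁ m₂ m₃ : ℝ) (i j : Fin 4) :
    frameForm (frame₄ h θ x) (splitMat p₁ p₂ p₃ m₁ m₂ m₃) i j
      = (p₃ + m₃) / 2 * wedge (te₁ h 0 1 2 x) (te₂ h 0 1 2 x) i j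
      + (p₂ + m₂) / 2 * wedge (te₁ h 0 1 2 x) (dCoord 2 x) i j
      + (p₁ + m₁) / 2 * wedge (te₁ h 0 1 2 x) (te₄ h θ x) i j
      + (p₁ - m₁) / 2 * wedge (te₂ h 0 1 2 x) (dCoord 2 x) i j
      + (m₂ - p₂) / 2 * wedge (te₂ h 0 1 2 x) (te₄ h θ x) i j
      + (p₃ - m₃) / 2 * wedge (dCoord 2 x) (te₄ h θ x) i j := by
  simp only [frameForm, splitMat, Fin.sum_univ_four, frame₄, coframe₄_zero, coframe₄_one,
    coframe₄_two, coframe₄_three, wedge, Matrix.of_apply, Matrix.cons_val', Matrix.cons_val_zero,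
    Matrix.cons_val_one, Matrix.cons_val]
  ring

end einstein

section einstein_curvature

variable {h : ℂ → ℂ} {U : Set ℂ} {x : Pt 4} {θ : Field 2}

theorem eAlpha_curvature (hU : IsOpen U) (hh : DifferentiableOn ℂ h U)
    (hθ : IsBetaPotential U h θ) (hx : x ∈ einsteinDomain U h) (i j : Fin 4) :
    extDeriv₁ (eAlpha₁ h θ) x i j - wedge (eAlpha₃ h θ x) (eAlpha₂ h θ x) i j
        = -(tw h x / x 2 ^ 2) * frameForm (frame₄ h θ x) (splitMat 2 0 0 0 0 0) i j ∧
      extDeriv₁ (eAlpha₂ h θ) x i j + wedge (eAlpha₃ h θ x) (eAlpha₁ h θ x) i j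
        = -(tw h x / x 2 ^ 2) * frameForm (frame₄ h θ x) (splitMat 0 2 0 0 0 0) i j ∧
      extDeriv₁ (eAlpha₃ h θ) x i j - wedge (eAlpha₂ h θ x) (eAlpha₁ h θ x) i j
        = -(tw h x / x 2 ^ 2) * frameForm (frame₄ h θ x) (splitMat 0 0 2 0 0 0) i j := by
  obtain ⟨hx', hw⟩ := mem_kahlerDomain.1 hx.1
  have hw' := hw.ne'
  have hz : x 2 ≠ 0 := hx.2
  have hI := hasD_invZ hz
  have hq := hasD_tq hU hh hx'
  have z : HasD (fun _ : Pt 4 => (0 : ℝ)) (fun _ => 0) x := hasD_const 0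
  have e : tw h x = 1 - x 2 * tp h 0 1 2 x := rfl
  refine ⟨?_, ?_, ?_⟩
  · rw [eAlpha₁, extDeriv₁_combForm hU hh hθ hx' z hI.neg z z, extDeriv₁_te₂ hU hh hx',
      frameForm_frame₄]
    simp only [wedge, eAlpha₂, eAlpha₃, combForm, te₄]
    field_simp
    rw [e]
    ring
  · rw [eAlpha₂, extDeriv₁_combForm hU hh hθ hx' hI.neg z z z, extDeriv₁_te₁ hU hh hx',
      frameForm_frame₄]
    simp only [wedge, eAlpha₁, eAlpha₃, combForm, te₄]
    field_simp
    rw [e]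
    ring
  · rw [eAlpha₃, extDeriv₁_combForm hU hh hθ hx' z z hq.neg hI, extDeriv₁_rotForm' hx',
      extDeriv₁_etaForm hU hh hθ hx', frameForm_frame₄]
    simp only [wedge, eAlpha₁, eAlpha₂, combForm, te₄]
    field_simp
    rw [e]
    ring

theorem eB₁_curvature (hU : IsOpen U) (hh : DifferentiableOn ℂ h U)
    (hθ : IsBetaPotential U h θ) (hx : x ∈ einsteinDomain U h) (i j : Fin 4) :
    extDeriv₁ (eB₁ h θ) x i j + wedge (eB₃ h θ x) (eB₂ h θ x) i j
      = frameForm (frame₄ h θ x) (splitMat 0 0 0 (2 * eM₁₁ h x) (2 * eM₁₂ h x) (2 * eM₁₃ h x))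
        i j := by
  obtain ⟨hx', hw⟩ := mem_kahlerDomain.1 hx.1
  have hw' := hw.ne'
  have hz : x 2 ≠ 0 := hx.2
  have hZ : HasD (fun y : Pt 4 => y 2) (dCoord 2 x) x := hasD_coord' 2
  have hq := hasD_tq hU hh hx'
  have h1 := hasD_tc₁ hU hh hx'
  have h2 := hasD_tc₂ hU hh hx'
  have hW := hasD_tw hU hh hx'
  have z : HasD (fun _ : Pt 4 => (0 : ℝ)) (fun _ => 0) x := hasD_const 0
  have hW2 := hW.pow 2
  have hW2' : tw h x ^ 2 ≠ 0 := pow_ne_zero 2 hw'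
  have hN := ((hW2.add ((hZ.mul hq).pow 2))).div (hZ.mul hW) (mul_ne_zero hz hw')
  have e : tw h x = 1 - x 2 * tp h 0 1 2 x := rfl
  rw [eB₁, extDeriv₁_combForm hU hh hθ hx' z hN ((hZ.mul h2).div hW hw')
    ((hZ.mul h1).div hW2 hW2'), extDeriv₁_te₂ hU hh hx', extDeriv₁_etaForm hU hh hθ hx',
    frameForm_frame₄]
  simp only [wedge, eB₂, eB₃, combForm, te₄, eM₁₁, eM₁₂, eM₁₃, eD, tw₃]
  generalize te₁ h 0 1 2 x i = a1, te₁ h 0 1 2 x j = a2, te₂ h 0 1 2 x i = b1,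
    te₂ h 0 1 2 x j = b2, dCoord 2 x i = g1, dCoord 2 x j = g2, etaForm h θ x i = n1,
    etaForm h θ x j = n2, rotForm 0 1 x i = m1, rotForm 0 1 x j = m2 at *
  have ep : tp h 0 1 2 x = (1 - tw h x) / x 2 := by rw [e]; field_simp; ring
  rw [ep]
  generalize tq h 0 1 2 x = q, tc₁ h 0 1 2 x = c1, tc₂ h 0 1 2 x = c2, tr₁ h 0 1 2 x = r1,
    tr₂ h 0 1 2 x = r2 at *
  clear hN hW2 h1 h2 hW hq hZ e ep
  generalize tw h x = w, x 2 = z at *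
  field_simp
  ring

theorem eB₂_curvature (hU : IsOpen U) (hh : DifferentiableOn ℂ h U)
    (hθ : IsBetaPotential U h θ) (hx : x ∈ einsteinDomain U h) (i j : Fin 4) :
    extDeriv₁ (eB₂ h θ) x i j - wedge (eB₃ h θ x) (eB₁ h θ x) i j
      = frameForm (frame₄ h θ x) (splitMat 0 0 0 (2 * eM₁₂ h x) (2 * eM₂₂ h x) (2 * eM₂₃ h x))
        i j := by
  obtain ⟨hx', hw⟩ := mem_kahlerDomain.1 hx.1
  have hw' := hw.ne'
  have hz : x 2 ≠ 0 := hx.2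
  have hZ : HasD (fun y : Pt 4 => y 2) (dCoord 2 x) x := hasD_coord' 2
  have hq := hasD_tq hU hh hx'
  have h1 := hasD_tc₁ hU hh hx'
  have h2 := hasD_tc₂ hU hh hx'
  have hW := hasD_tw hU hh hx'
  have z : HasD (fun _ : Pt 4 => (0 : ℝ)) (fun _ => 0) x := hasD_const 0
  have hW2 := hW.pow 2
  have hW2' : tw h x ^ 2 ≠ 0 := pow_ne_zero 2 hw'
  have hN := ((hW2.add ((hZ.mul hq).pow 2))).div (hZ.mul hW) (mul_ne_zero hz hw')
  have e : tw h x = 1 - x 2 * tp h 0 1 2 x := rfl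
  rw [eB₂, extDeriv₁_combForm hU hh hθ hx' hN.neg z ((hZ.mul h1).div hW hw').neg
    ((hZ.mul h2).div hW2 hW2'), extDeriv₁_te₁ hU hh hx', extDeriv₁_etaForm hU hh hθ hx',
    frameForm_frame₄]
  simp only [wedge, eB₁, eB₃, combForm, te₄, eM₂₂, eM₁₂, eM₂₃, eD, tw₃]
  generalize te₁ h 0 1 2 x i = a1, te₁ h 0 1 2 x j = a2, te₂ h 0 1 2 x i = b1,
    te₂ h 0 1 2 x j = b2, dCoord 2 x i = g1, dCoord 2 x j = g2, etaForm h θ x i = n1,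
    etaForm h θ x j = n2, rotForm 0 1 x i = m1, rotForm 0 1 x j = m2 at *
  have ep : tp h 0 1 2 x = (1 - tw h x) / x 2 := by rw [e]; field_simp; ring
  rw [ep]
  generalize tq h 0 1 2 x = q, tc₁ h 0 1 2 x = c1, tc₂ h 0 1 2 x = c2, tr₁ h 0 1 2 x = r1,
    tr₂ h 0 1 2 x = r2 at *
  clear hN hW2 h1 h2 hW hq hZ e ep
  generalize tw h x = w, x 2 = z at *
  field_simp
  ring

theorem eB₃_curvature (hU : IsOpen U) (hh : DifferentiableOn ℂ h U)
    (hθ : IsBetaPotential U h θ) (hx : x ∈ einsteinDomain U h) (i j : Fin 4) :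
    extDeriv₁ (eB₃ h θ) x i j + wedge (eB₂ h θ x) (eB₁ h θ x) i j
      = frameForm (frame₄ h θ x) (splitMat 0 0 0 (2 * eM₁₃ h x) (2 * eM₂₃ h x) (2 * eM₃₃ h x))
        i j := by
  obtain ⟨hx', hw⟩ := mem_kahlerDomain.1 hx.1
  have hw' := hw.ne'
  have hz : x 2 ≠ 0 := hx.2
  have hZ : HasD (fun y : Pt 4 => y 2) (dCoord 2 x) x := hasD_coord' 2
  have hq := hasD_tq hU hh hx'
  have h1 := hasD_tc₁ hU hh hx'
  have h2 := hasD_tc₂ hU hh hx'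
  have hW := hasD_tw hU hh hx'
  have z : HasD (fun _ : Pt 4 => (0 : ℝ)) (fun _ => 0) x := hasD_const 0
  have hW2 := hW.pow 2
  have hW2' : tw h x ^ 2 ≠ 0 := pow_ne_zero 2 hw'
  have hN := (hW.sub ((hZ.mul hq).pow 2)).div (hZ.mul hW2) (mul_ne_zero hz hW2')
  have e : tw h x = 1 - x 2 * tp h 0 1 2 x := rfl
  rw [eB₃, extDeriv₁_combForm hU hh hθ hx' ((hZ.mul h2).div hW hw') ((hZ.mul h1).div hW hw').neg
    hq.neg hN.neg, extDeriv₁_te₁ hU hh hx', extDeriv₁_te₂ hU hh hx', extDeriv₁_rotForm' hx',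
    extDeriv₁_etaForm hU hh hθ hx',
    frameForm_frame₄]
  simp only [wedge, eB₁, eB₂, combForm, te₄, eM₁₃, eM₂₃, eM₃₃, tw₃]
  generalize te₁ h 0 1 2 x i = a1, te₁ h 0 1 2 x j = a2, te₂ h 0 1 2 x i = b1,
    te₂ h 0 1 2 x j = b2, dCoord 2 x i = g1, dCoord 2 x j = g2, etaForm h θ x i = n1,
    etaForm h θ x j = n2, rotForm 0 1 x i = m1, rotForm 0 1 x j = m2 at *
  have ep : tp h 0 1 2 x = (1 - tw h x) / x 2 := by rw [e]; field_simp; ring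
  rw [ep]
  generalize tq h 0 1 2 x = q, tc₁ h 0 1 2 x = c1, tc₂ h 0 1 2 x = c2, tr₁ h 0 1 2 x = r1,
    tr₂ h 0 1 2 x = r2 at *
  clear hN hW2 h1 h2 hW hq hZ e ep
  generalize tw h x = w, x 2 = z at *
  field_simp
  ring

theorem hasSplitCurvature_einstein (hU : IsOpen U) (hh : DifferentiableOn ℂ h U)
    (hθ : IsBetaPotential U h θ) (hx : x ∈ einsteinDomain U h) :
    HasSplitCurvature (einsteinMetric h θ) (tw h x / x 2 ^ 2) (frame₄ h θ x) (eM h x) x := by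
  intro a i j k
  have hd : ∀ x ∈ einsteinDomain U h, _ := fun x hx => diffForm_einstein hU hh hθ hx
  rw [curvature_split (isConformalCoframe_einstein hU hh hθ) (fun x hx => einstein_trace hU hh hx)
    (isTorsionFree_einstein hU hh hθ) (fun x hx => (hd x hx).1) (fun x hx => (hd x hx).2.1)
    (fun x hx => (hd x hx).2.2.1) (fun x hx => (hd x hx).2.2.2.1)
    (fun x hx => (hd x hx).2.2.2.2.1) (fun x hx => (hd x hx).2.2.2.2.2.1)
    (fun x hx => (hd x hx).2.2.2.2.2.2) hx]
  obtain ⟨h1, h2, h3⟩ := eAlpha_curvature hU hh hθ hx i j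
  rw [h1, h2, h3, eB₁_curvature hU hh hθ hx, eB₂_curvature hU hh hθ hx, eB₃_curvature hU hh hθ hx]
  rfl

theorem eM_transpose : (eM h x).transpose = eM h x := by
  ext i j
  fin_cases i <;> fin_cases j <;> rfl

theorem eM_trace' (hx : x ∈ einsteinDomain U h) :
    eM h x 0 0 + eM h x 1 1 + eM h x 2 2 = -3 * (tw h x / x 2 ^ 2) :=
  eM_trace (mem_kahlerDomain.1 hx.1).2.ne' hx.2

theorem isEinsteinOn_einstein (hU : IsOpen U) (hh : DifferentiableOn ℂ h U)
    (hθ : IsBetaPotential U h θ) :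
    IsEinsteinOn (einsteinMetric h θ) (-3) (einsteinDomain U h) := by
  intro x hx j k
  have hc := isConformalCoframe_einstein hU hh hθ
  rw [hc.eq x hx, (hasSplitCurvature_einstein hU hh hθ hx).ricci (hc.det_ne x hx) eM_transpose
    (eM_trace' hx)]

theorem scalarCurv_einstein (hU : IsOpen U) (hh : DifferentiableOn ℂ h U)
    (hθ : IsBetaPotential U h θ) (hx : x ∈ einsteinDomain U h) :
    scalarCurv (einsteinMetric h θ) x = -12 := by
  rw [scalarCurv_of_einstein ((isConformalCoframe_einstein hU hh hθ).posDef hx)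
    (isEinsteinOn_einstein hU hh hθ x hx)]
  norm_num

theorem isSelfDualOn_einstein (hU : IsOpen U) (hh : DifferentiableOn ℂ h U)
    (hθ : IsBetaPotential U h θ) :
    IsSelfDualOn (einsteinMetric h θ) (-1) (einsteinDomain U h) := fun _ hx =>
  weyl_selfDual (isConformalCoframe_einstein hU hh hθ) hx (det_frame₄_pos hx.1)
    (hasSplitCurvature_einstein hU hh hθ hx) eM_transpose (eM_trace' hx)
    (scalarCurv_einstein hU hh hθ hx)

end einstein_curvature

/-! ### The hypercomplex structure -/

section hypercomplex

variable {h : ℂ → ℂ} {U : Set ℂ} {x : Pt 4} {θ : Field 2}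

/-- The trace part of the Obata connection. -/
def oBeta (h : ℂ → ℂ) (θ : Field 2) : Field 4 := combForm h θ 0
  (fun x => x 2 * tc₁ h 0 1 2 x / (2 * tw h x)) (fun x => x 2 * tc₂ h 0 1 2 x / (2 * tw h x))
  (fun x => tw₃ h x / (2 * tw h x) - tp h 0 1 2 x) (fun x => tq h 0 1 2 x / tw h x)

/-- The selfdual part of the Obata connection. -/
def oAlpha₁ (h : ℂ → ℂ) (θ : Field 2) : Field 4 := combForm h θ 0
  (fun x => tq h 0 1 2 x) (fun x => -tp h 0 1 2 x) (fun _ => 0) (fun _ => 0)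

/-- The selfdual part of the Obata connection. -/
def oAlpha₂ (h : ℂ → ℂ) (θ : Field 2) : Field 4 := combForm h θ 0
  (fun x => -tp h 0 1 2 x) (fun x => -tq h 0 1 2 x) (fun _ => 0) (fun _ => 0)

/-- The selfdual part of the Obata connection. -/
def oAlpha₃ (h : ℂ → ℂ) (θ : Field 2) : Field 4 := combForm h θ 1 (fun _ => 0) (fun _ => 0)
  (fun _ => 0) (fun _ => 0)

/-- The antiselfdual part of the Obata connection. -/
def oB₁ (h : ℂ → ℂ) (θ : Field 2) : Field 4 := combForm h θ 0 (fun x => tq h 0 1 2 x)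
  (fun x => -(tp h 0 1 2 x + tw₃ h x / tw h x)) (fun x => x 2 * tc₂ h 0 1 2 x / tw h x)
  (fun x => x 2 * tc₁ h 0 1 2 x / tw h x ^ 2)

/-- The antiselfdual part of the Obata connection. -/
def oB₂ (h : ℂ → ℂ) (θ : Field 2) : Field 4 := combForm h θ 0
  (fun x => tp h 0 1 2 x + tw₃ h x / tw h x) (fun x => tq h 0 1 2 x)
  (fun x => -(x 2 * tc₁ h 0 1 2 x / tw h x)) (fun x => x 2 * tc₂ h 0 1 2 x / tw h x ^ 2)

/-- The antiselfdual part of the Obata connection. -/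
def oB₃ (h : ℂ → ℂ) (θ : Field 2) : Field 4 := combForm h θ 1
  (fun x => x 2 * tc₂ h 0 1 2 x / tw h x) (fun x => -(x 2 * tc₁ h 0 1 2 x / tw h x))
  (fun x => -2 * tq h 0 1 2 x) (fun x => -((tw₃ h x / tw h x + 2 * tp h 0 1 2 x) / tw h x))

theorem isTorsionFree_obata (hU : IsOpen U) (hh : DifferentiableOn ℂ h U)
    (hθ : IsBetaPotential U h θ) :
    IsTorsionFree (frame₄ h θ) (splitConn (oAlpha₁ h θ) (oAlpha₂ h θ) (oAlpha₃ h θ) (oB₁ h θ)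
      (oB₂ h θ) (oB₃ h θ)) (oBeta h θ) (kahlerDomain U h) := by
  refine isTorsionFree₄ ?_ ?_ ?_ ?_ <;> intro x hx i j <;>
    obtain ⟨hx', hw⟩ := mem_kahlerDomain.1 hx <;> have hw' := hw.ne' <;>
    have e : tw h x = 1 - x 2 * tp h 0 1 2 x := rfl
  · rw [extDeriv₁_te₁ hU hh hx']
    simp only [wedge, Pi.add_apply, oAlpha₁, oAlpha₂, oAlpha₃, oB₁, oB₂, oB₃, oBeta, combForm, te₄,
      tw₃]
    field_simp
    rw [e]
    ring
  · rw [extDeriv₁_te₂ hU hh hx']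
    simp only [wedge, Pi.add_apply, Pi.sub_apply, oAlpha₁, oAlpha₂, oAlpha₃, oB₁, oB₂, oB₃, oBeta,
      combForm, te₄, tw₃]
    field_simp
    rw [e]
    ring
  · rw [extDeriv₁_dCoord]
    simp only [wedge, Pi.add_apply, Pi.sub_apply, oAlpha₁, oAlpha₂, oAlpha₃, oB₁, oB₂, oB₃, oBeta,
      combForm, te₄, tw₃]
    field_simp
    rw [e]
    ring
  · rw [extDeriv₁_te₄ hU hh hθ hx]
    simp only [wedge, Pi.add_apply, Pi.sub_apply, oAlpha₁, oAlpha₂, oAlpha₃, oB₁, oB₂, oB₃, oBeta,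
      combForm, te₄, tw₃]
    field_simp
    rw [e]
    ring

/-- A parallel section of the flat connection on the trivial bundle over the sphere. -/
structure IsSphereParallel (N₁ N₂ N₃ : Pt 4 → ℝ) : Prop where
  smooth₁ : ContDiff ℝ ∞ N₁
  smooth₂ : ContDiff ℝ ∞ N₂
  smooth₃ : ContDiff ℝ ∞ N₃
  hasD₁ : ∀ x, HasD N₁ (fun i => -rotForm 0 1 x i * N₂ x
    + sphereScale (planeCoord 0 1 x) * dCoord 0 x i * N₃ x) x
  hasD₂ : ∀ x, HasD N₂ (fun i => rotForm 0 1 x i * N₁ x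
    + sphereScale (planeCoord 0 1 x) * dCoord 1 x i * N₃ x) x
  hasD₃ : ∀ x, HasD N₃ (fun i => -(sphereScale (planeCoord 0 1 x) * dCoord 0 x i * N₁ x)
    - sphereScale (planeCoord 0 1 x) * dCoord 1 x i * N₂ x) x
  unit : ∀ x, N₁ x ^ 2 + N₂ x ^ 2 + N₃ x ^ 2 = 1
  invariant : ∀ x (c : ℝ), N₁ (x + c • Pi.single 3 1) = N₁ x ∧ N₂ (x + c • Pi.single 3 1) = N₂ x ∧
    N₃ (x + c • Pi.single 3 1) = N₃ x

/-- The selfdual matrix of a section. -/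
def quatMat (N₁ N₂ N₃ : Pt 4 → ℝ) (x : Pt 4) : Matrix (Fin 4) (Fin 4) ℝ :=
  splitMat (2 * N₁ x) (-2 * N₂ x) (2 * N₃ x) 0 0 0

variable {N₁ N₂ N₃ L₁ L₂ L₃ : Pt 4 → ℝ}

theorem isParallel_quatMat (hN : IsSphereParallel N₁ N₂ N₃) :
    IsParallel (quatMat N₁ N₂ N₃) (weylMatrix (splitConn (oAlpha₁ h θ) (oAlpha₂ h θ) (oAlpha₃ h θ)
      (oB₁ h θ) (oB₂ h θ) (oB₃ h θ)) (oBeta h θ)) (kahlerDomain U h) := by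
  refine isParallel_weylMatrix fun x hx i a b => ?_
  obtain ⟨s1, s2⟩ := te_sigma (mem_kahlerDomain.1 hx).1 i
  obtain ⟨A, B, C, key⟩ : ∃ A B C : ℝ, ∀ p₁ p₂ p₃, splitMat p₁ p₂ p₃ 0 0 0 a b
      = A * p₁ + B * p₂ + C * p₃ :=
    ⟨splitMat 1 0 0 0 0 0 a b, splitMat 0 1 0 0 0 0 a b, splitMat 0 0 1 0 0 0 a b,
      fun p₁ p₂ p₃ => by rw [splitMat_apply]; ring⟩
  have e : (fun y => quatMat N₁ N₂ N₃ y a b) = fun y => A * (2 * N₁ y) + B * (-2 * N₂ y)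
      + C * (2 * N₃ y) := by
    funext y
    rw [quatMat, key]
  have hd := (((hasD_const A).mul ((hasD_const (2 : ℝ)).mul (hN.hasD₁ x))).add
    ((hasD_const B).mul ((hasD_const (-2 : ℝ)).mul (hN.hasD₂ x)))).add
    ((hasD_const C).mul ((hasD_const (2 : ℝ)).mul (hN.hasD₃ x)))
  rw [e, hd.pd, splitConn, quatMat, splitMat_commutator]
  simp only [mul_zero, sub_zero]
  rw [key]
  simp only [oAlpha₁, oAlpha₂, oAlpha₃, combForm]
  rw [← s1, ← s2]
  ring

theorem quatMat_sq (hN : IsSphereParallel N₁ N₂ N₃) (x : Pt 4) :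
    quatMat N₁ N₂ N₃ x * quatMat N₁ N₂ N₃ x = -1 :=
  splitMat_square (by linear_combination 4 * hN.unit x)

theorem quatMat_mul {P₁ P₂ P₃ : Pt 4 → ℝ} (x : Pt 4)
    (h0 : N₁ x * L₁ x + N₂ x * L₂ x + N₃ x * L₃ x = 0)
    (h1 : N₂ x * L₃ x - N₃ x * L₂ x = -P₁ x) (h2 : N₃ x * L₁ x - N₁ x * L₃ x = -P₂ x)
    (h3 : N₁ x * L₂ x - N₂ x * L₁ x = -P₃ x) :
    quatMat N₁ N₂ N₃ x * quatMat L₁ L₂ L₃ x = quatMat P₁ P₂ P₃ x := by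
  ext a b
  fin_cases a <;> fin_cases b <;>
    simp [quatMat, splitMat, Matrix.mul_apply, Fin.sum_univ_four] <;>
    first
      | linear_combination h0
      | linear_combination -h0
      | linear_combination h1
      | linear_combination -h1
      | linear_combination h2
      | linear_combination -h2
      | linear_combination h3
      | linear_combination -h3

theorem smoothMatrix_quatMat (hN : IsSphereParallel N₁ N₂ N₃) (S : Set (Pt 4)) :
    SmoothMatrix (quatMat N₁ N₂ N₃) S := by
  intro a b
  have e : (fun y => quatMat N₁ N₂ N₃ y a b) = fun y => splitMat 1 0 0 0 0 0 a b * (2 * N₁ y)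
      + splitMat 0 1 0 0 0 0 a b * (-2 * N₂ y) + splitMat 0 0 1 0 0 0 a b * (2 * N₃ y) := by
    funext y
    rw [quatMat, splitMat_apply]
    ring
  rw [e]
  exact (((contDiff_const.mul (contDiff_const.mul hN.smooth₁)).add
    (contDiff_const.mul (contDiff_const.mul hN.smooth₂))).add
    (contDiff_const.mul (contDiff_const.mul hN.smooth₃))).contDiffOn

/-- The complex structure of a section. -/
def quatJ (h : ℂ → ℂ) (θ : Field 2) (N₁ N₂ N₃ : Pt 4 → ℝ) : EndField 4 :=
  frameEnd (frame₄ h θ) (quatMat N₁ N₂ N₃)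

theorem isComplexStructureOn_quatJ (hU : IsOpen U) (hh : DifferentiableOn ℂ h U)
    (hθ : IsBetaPotential U h θ) (hN : IsSphereParallel N₁ N₂ N₃) :
    IsComplexStructureOn (quatJ h θ N₁ N₂ N₃) (kahlerDomain U h) :=
  isComplexStructureOn_frameEnd (isOpen_kahlerDomain hU hh) (smooth_frame₄ hU hh hθ)
    (fun _ hx => (det_frame₄_pos hx).ne') (smoothMatrix_quatMat hN _)
    (isTorsionFree_obata hU hh hθ) (isParallel_quatMat hN) (fun x _ => quatMat_sq hN x)

theorem isOrthogonalOn_quatJ (hU : IsOpen U) (hh : DifferentiableOn ℂ h U)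
    (hθ : IsBetaPotential U h θ) (hN : IsSphereParallel N₁ N₂ N₃) :
    IsOrthogonalOn (einsteinMetric h θ) (quatJ h θ N₁ N₂ N₃) (einsteinDomain U h) := by
  refine isOrthogonalOn_frameEnd (isConformalCoframe_einstein hU hh hθ) fun x _ => ?_
  rw [quatMat, splitMat_transpose, ← quatMat, Matrix.neg_mul, quatMat_sq hN, neg_neg]

theorem lieEnd_quatJ (hN : IsSphereParallel N₁ N₂ N₃) (p : Pt 4) (k i : Fin 4) :
    lieEnd partialT (quatJ h θ N₁ N₂ N₃) p k i = 0 := by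
  rw [partialT_eq]
  refine lieEnd_const 3 (fun y c => ?_) p k i
  obtain ⟨h1, h2, h3⟩ := hN.invariant y c
  simp only [quatJ, frameEnd, frame₄_add_single, quatMat, h1, h2, h3]

theorem isSphereParallel_stereo : IsSphereParallel (stereo₁ 0 1) (stereo₂ 0 1) (stereo₃ 0 1) where
  smooth₁ := contDiff_stereo₁ 0 1
  smooth₂ := contDiff_stereo₂ 0 1
  smooth₃ := contDiff_stereo₃ 0 1
  hasD₁ := hasD_stereo₁ 0 1
  hasD₂ := hasD_stereo₂ 0 1
  hasD₃ := hasD_stereo₃ 0 1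
  unit := stereo_unit 0 1
  invariant x c := by simp [stereo₁, stereo₂, stereo₃, planeCoord]

theorem stereo_aux (x : Pt 4) : (1 : ℝ) + (x 0 * x 0 + x 1 * x 1) ≠ 0 := by
  nlinarith [mul_self_nonneg (x 0), mul_self_nonneg (x 1)]

theorem isSphereParallel_left : IsSphereParallel (fun x => stereo₁ 0 1 x * x 0 - 1)
    (fun x => stereo₁ 0 1 x * x 1) (stereo₁ 0 1) where
  smooth₁ := ((contDiff_stereo₁ 0 1).mul (contDiff_apply ℝ ℝ 0)).sub contDiff_const
  smooth₂ := (contDiff_stereo₁ 0 1).mul (contDiff_apply ℝ ℝ 1)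
  smooth₃ := contDiff_stereo₁ 0 1
  hasD₁ x := by
    refine (((hasD_stereo₁ 0 1 x).mul (hasD_coord' 0)).sub (hasD_const 1)).congr_D fun i => ?_
    have h0 := stereo_aux x
    have e : (dPlane 0 1 i).re = dCoord 0 x i := rfl
    have e' : (dPlane 0 1 i).im = dCoord 1 x i := rfl
    simp only [stereo₁, stereo₂, stereo₃, rotForm, sphereScale, planeCoord, Complex.normSq_mk, e, e']
    field_simp
    ring
  hasD₂ x := by
    refine ((hasD_stereo₁ 0 1 x).mul (hasD_coord' 1)).congr_D fun i => ?_
    have h0 := stereo_aux x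
    have e : (dPlane 0 1 i).re = dCoord 0 x i := rfl
    have e' : (dPlane 0 1 i).im = dCoord 1 x i := rfl
    simp only [stereo₁, stereo₂, stereo₃, rotForm, sphereScale, planeCoord, Complex.normSq_mk, e, e']
    field_simp
    ring
  hasD₃ x := by
    refine (hasD_stereo₁ 0 1 x).congr_D fun i => ?_
    have h0 := stereo_aux x
    have e : (dPlane 0 1 i).re = dCoord 0 x i := rfl
    have e' : (dPlane 0 1 i).im = dCoord 1 x i := rfl
    simp only [stereo₁, stereo₂, stereo₃, rotForm, sphereScale, planeCoord, Complex.normSq_mk, e, e']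
    field_simp
    ring
  unit x := by
    have h0 := stereo_aux x
    simp only [stereo₁, sphereScale, planeCoord, Complex.normSq_mk]
    field_simp
    ring
  invariant x c := by simp [stereo₁, planeCoord]

theorem isSphereParallel_right : IsSphereParallel (fun x => stereo₂ 0 1 x * x 0)
    (fun x => stereo₂ 0 1 x * x 1 - 1) (stereo₂ 0 1) where
  smooth₁ := (contDiff_stereo₂ 0 1).mul (contDiff_apply ℝ ℝ 0)
  smooth₂ := ((contDiff_stereo₂ 0 1).mul (contDiff_apply ℝ ℝ 1)).sub contDiff_const
  smooth₃ := contDiff_stereo₂ 0 1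
  hasD₁ x := by
    refine ((hasD_stereo₂ 0 1 x).mul (hasD_coord' 0)).congr_D fun i => ?_
    have h0 := stereo_aux x
    have e : (dPlane 0 1 i).re = dCoord 0 x i := rfl
    have e' : (dPlane 0 1 i).im = dCoord 1 x i := rfl
    simp only [stereo₁, stereo₂, stereo₃, rotForm, sphereScale, planeCoord, Complex.normSq_mk, e, e']
    field_simp
    ring
  hasD₂ x := by
    refine (((hasD_stereo₂ 0 1 x).mul (hasD_coord' 1)).sub (hasD_const 1)).congr_D fun i => ?_
    have h0 := stereo_aux x
    have e : (dPlane 0 1 i).re = dCoord 0 x i := rfl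
    have e' : (dPlane 0 1 i).im = dCoord 1 x i := rfl
    simp only [stereo₁, stereo₂, stereo₃, rotForm, sphereScale, planeCoord, Complex.normSq_mk, e, e']
    field_simp
    ring
  hasD₃ x := by
    refine (hasD_stereo₂ 0 1 x).congr_D fun i => ?_
    have h0 := stereo_aux x
    have e : (dPlane 0 1 i).re = dCoord 0 x i := rfl
    have e' : (dPlane 0 1 i).im = dCoord 1 x i := rfl
    simp only [stereo₁, stereo₂, stereo₃, rotForm, sphereScale, planeCoord, Complex.normSq_mk, e, e']
    field_simp
    ring
  unit x := by
    have h0 := stereo_aux x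
    simp only [stereo₂, sphereScale, planeCoord, Complex.normSq_mk]
    field_simp
    ring
  invariant x c := by simp [stereo₂, planeCoord]

theorem exists_hypercomplex (hU : IsOpen U) (hh : DifferentiableOn ℂ h U)
    (hθ : IsBetaPotential U h θ) : ∃ I₁ I₂ I₃,
      IsCompatibleHypercomplexOn (einsteinMetric h θ) I₁ I₂ I₃ (einsteinDomain U h) ∧
      ∀ p ∈ einsteinDomain U h, ∀ k i,
        lieEnd partialT I₁ p k i = 0 ∧ lieEnd partialT I₂ p k i = 0 ∧
          lieEnd partialT I₃ p k i = 0 := by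
  have hs : einsteinDomain U h ⊆ kahlerDomain U h := fun x hx => hx.1
  have mono : ∀ {J : EndField 4}, IsComplexStructureOn J (kahlerDomain U h) →
      IsComplexStructureOn J (einsteinDomain U h) := fun hJ =>
    ⟨fun i j => (hJ.1 i j).mono hs, fun x hx => hJ.2.1 x hx.1, fun x hx => hJ.2.2 x hx.1⟩
  have l := isSphereParallel_left
  have s := isSphereParallel_stereo
  have r := isSphereParallel_right
  refine ⟨_, _, _, ⟨mono (isComplexStructureOn_quatJ hU hh hθ l),
    mono (isComplexStructureOn_quatJ hU hh hθ s), mono (isComplexStructureOn_quatJ hU hh hθ r),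
    fun x hx => ?_, isOrthogonalOn_quatJ hU hh hθ l, isOrthogonalOn_quatJ hU hh hθ s,
    isOrthogonalOn_quatJ hU hh hθ r⟩, fun p _ k i =>
    ⟨lieEnd_quatJ l p k i, lieEnd_quatJ s p k i, lieEnd_quatJ r p k i⟩⟩
  rw [quatJ, quatJ, frameEnd_mul _ (det_frame₄_pos hx.1).ne', quatJ]
  have e : quatMat (fun x => stereo₁ 0 1 x * x 0 - 1) (fun x => stereo₁ 0 1 x * x 1) (stereo₁ 0 1) x
      * quatMat (stereo₁ 0 1) (stereo₂ 0 1) (stereo₃ 0 1) x = quatMat (fun x => stereo₂ 0 1 x * x 0)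
      (fun x => stereo₂ 0 1 x * x 1 - 1) (stereo₂ 0 1) x := by
    have h0 := stereo_aux x
    refine quatMat_mul x ?_ ?_ ?_ ?_ <;>
      simp only [stereo₁, stereo₂, stereo₃, sphereScale, planeCoord, Complex.normSq_mk] <;>
      field_simp <;> ring
  simp only [frameEnd, e]

end hypercomplex

/-! ### The conformal infinity -/

section infinity

variable {h : ℂ → ℂ} {U : Set ℂ} {θ : Field 2}

theorem pd_coord (k i : Fin n) (x : Pt n) : pd i (fun y => y k) x = if i = k then 1 else 0 :=
  (hasD_coord k).pd i

theorem boundaryMap_mem {b : Pt 3} (hb : b ∈ boundaryDomain U h) :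
    boundaryMap b ∈ kahlerDomain U h := by
  refine mem_kahlerDomain.2 ⟨⟨hb.1, ?_⟩, ?_⟩
  · simpa [boundaryMap, planeCoord] using hb.2
  · simp [tw, boundaryMap]

theorem pullback_boundaryMap (G : Metric 4) (b : Pt 3) (i j : Fin 3) :
    pullback boundaryMap G b i j = G (boundaryMap b) (![0, 1, 3] i) (![0, 1, 3] j) := by
  have e : ∀ (k : Fin 4) (i : Fin 3), pd i (fun y => boundaryMap y k) b
      = if k = ![0, 1, 3] i then 1 else 0 := by
    intro k i
    fin_cases k <;> fin_cases i <;> simp [boundaryMap, pd_coord, pd_const]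
  simp only [pullback, e]
  fin_cases i <;> fin_cases j <;> simp [Fin.sum_univ_four]

theorem hasConformalInfinity_einstein (hU : IsOpen U) (hh : DifferentiableOn ℂ h U)
    (hθ : IsBetaPotential U h θ) :
    HasConformalInfinity (einsteinMetric h θ) (einsteinDomain U h) (fun p => p 2)
        boundaryMap (boundaryMetric h θ) (boundaryDomain U h) := by
  refine ⟨kahlerDomain U h, kahlerMetric h θ, isOpen_kahlerDomain hU hh, fun p hp => hp, ?_, ?_, ?_,
    (contDiff_apply ℝ ℝ (2 : Fin 4)).contDiffOn, ?_,
    (isConformalCoframe_kahler hU hh hθ).isRiemannianOn, ?_, fun _ => 1, fun b hb => ⟨one_pos, ?_⟩⟩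
  · ext p
    constructor
    · rintro ⟨b, hb, rfl⟩
      exact ⟨boundaryMap_mem hb, rfl⟩
    · rintro ⟨hp, hz⟩
      refine ⟨![p 0, p 1, p 3], ⟨hp.1.1, ?_⟩, ?_⟩
      · have h2 := hp.1.2
        have hz' : p 2 = 0 := hz
        simpa [hz'] using h2
      · ext i
        fin_cases i <;> simp [boundaryMap]
        exact hz.symm
  · intro a _ b _ hab
    ext i
    fin_cases i
    · exact congrFun hab 0
    · exact congrFun hab 1
    · exact congrFun hab 3
  · refine contDiffOn_pi.2 fun i => ?_
    fin_cases i
    · exact (contDiff_apply ℝ ℝ (0 : Fin 3)).contDiffOn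
    · exact (contDiff_apply ℝ ℝ (1 : Fin 3)).contDiffOn
    · exact contDiffOn_const
    · exact (contDiff_apply ℝ ℝ (2 : Fin 3)).contDiffOn
  · intro p _ _ h0
    have := pd_coord 2 2 p
    rw [pd, h0] at this
    simp at this
  · intro p hp hz
    rw [einsteinMetric_eq ⟨hp, hz⟩, smul_smul]
    have : p 2 ^ 2 * (1 / p 2 ^ 2) = 1 := by
      have hz' : p 2 ≠ 0 := hz
      field_simp
    rw [this, one_smul]
  · have hN : Complex.normSq (h ⟨b 0, b 1⟩) ≠ 0 := (Complex.normSq_pos.2 hb.2).ne'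
    ext i j
    rw [pullback_boundaryMap]
    have hw : monopole h ![b 0, b 1, 0] = 1 := by
      simp [monopole, numer, modSq, hN]
    fin_cases i <;> fin_cases j <;>
      simp [kahlerMetric, monopoleMetric, boundaryMap, hw, boundaryMetric, beta, totalPotential,
        todaMetric, modSq, Matrix.diagonal, Matrix.vecHead, Matrix.vecTail]

end infinity

/-! ### The Einstein-Weyl structure of the boundary -/

section boundary

variable {h : ℂ → ℂ} {U : Set ℂ} {θ : Field 2} {b : Pt 3}

/-- The form `2 h dζ / (1 + |ζ|²)`. -/
def bE (h : ℂ → ℂ) (x : Pt 3) (i : Fin 3) : ℂ :=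
  h (planeCoord 0 1 x) * sphereScale (planeCoord 0 1 x) * dPlane 0 1 i

/-- The function `1 / h`. -/
def bH (h : ℂ → ℂ) (x : Pt 3) : ℂ := (h (planeCoord 0 1 x))⁻¹

/-- The component of `d (1 / h)`. -/
def bG (h : ℂ → ℂ) (x : Pt 3) : ℂ :=
  -deriv h (planeCoord 0 1 x) * bH h x ^ 3 / sphereScale (planeCoord 0 1 x)

/-- The real part of the coframe. -/
def be₁ (h : ℂ → ℂ) : Field 3 := fun x i => (bE h x i).re
/-- The imaginary part of the coframe. -/
def be₂ (h : ℂ → ℂ) : Field 3 := fun x i => (bE h x i).im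
/-- The real part of `1 / h`. -/
def bHre (h : ℂ → ℂ) (x : Pt 3) : ℝ := (bH h x).re
/-- The imaginary part of `1 / h`. -/
def bHim (h : ℂ → ℂ) (x : Pt 3) : ℝ := (bH h x).im

theorem bH_mul_bE (hb : b ∈ boundaryDomain U h) (i : Fin 3) :
    bH h b * bE h b i = sphereScale (planeCoord 0 1 b) * dPlane 0 1 i := by
  have h0 : h (planeCoord 0 1 b) ≠ 0 := hb.2
  rw [bH, bE, mul_assoc, ← mul_assoc, inv_mul_cancel₀ h0, one_mul]

theorem isOpen_boundaryDomain (hU : IsOpen U) (hh : DifferentiableOn ℂ h U) :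
    IsOpen (boundaryDomain U h) := by
  have hc : Continuous (planeCoord 0 1 : Pt 3 → ℂ) := (contDiff_planeCoord 0 1).continuous
  have h2 : ContinuousOn (fun x : Pt 3 => h (planeCoord 0 1 x))
      ((planeCoord 0 1 : Pt 3 → ℂ) ⁻¹' U) := hh.continuousOn.comp hc.continuousOn fun x hx => hx
  exact h2.isOpen_inter_preimage (hU.preimage hc) isOpen_compl_singleton

theorem hasD_bH (hU : IsOpen U) (hh : DifferentiableOn ℂ h U) (hb : b ∈ boundaryDomain U h) :
    HasD (bH h) (fun i => bG h b * bE h b i) b := by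
  refine ((hasD_holo hU hb.1 hh).cinv hb.2).congr_D fun i => ?_
  have hs : (sphereScale (planeCoord 0 1 b) : ℂ) ≠ 0 :=
    Complex.ofReal_ne_zero.2 (sphereScale_pos _).ne'
  have key := bH_mul_bE hb i
  rw [bG]
  change _ * bH h b ^ 2 = _
  field_simp
  linear_combination deriv h (planeCoord 0 1 b) * bH h b ^ 2 * key

theorem contDiffOn_bH (hU : IsOpen U) (hh : DifferentiableOn ℂ h U) :
    ContDiffOn ℝ ∞ (bH h) (boundaryDomain U h) :=
  ((contDiffOn_holo hU hh 0 1).mono fun _ hx => hx.1).inv fun _ hx => hx.2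

theorem contDiffOn_bE (hU : IsOpen U) (hh : DifferentiableOn ℂ h U) (i : Fin 3) :
    ContDiffOn ℝ ∞ (fun x => bE h x i) (boundaryDomain U h) :=
  (((contDiffOn_holo hU hh 0 1).mono fun _ hx => hx.1).mul
    (Complex.ofRealCLM.contDiff.comp (contDiff_sphereScale 0 1)).contDiffOn).mul contDiffOn_const

theorem extDeriv_bE (hU : IsOpen U) (hh : DifferentiableOn ℂ h U) (hb : b ∈ boundaryDomain U h)
    (i j : Fin 3) :
    ((extDeriv₁ (be₁ h) b i j : ℝ) : ℂ) + (extDeriv₁ (be₂ h) b i j : ℝ) * Complex.I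
      = Complex.I * (rotForm 0 1 b i * bE h b j - rotForm 0 1 b j * bE h b i) := by
  have hE : ∀ j, HasD (fun y => bE h y j) _ b := fun j =>
    (((hasD_holo hU hb.1 hh).mul (hasD_sphereScale 0 1 b).ofReal).mul (hasD_const (dPlane 0 1 j)))
  have r : ∀ k l, pd k (fun y => be₁ h y l) b = _ := fun k l => (hE l).re.pd k
  have r' : ∀ k l, pd k (fun y => be₂ h y l) b = _ := fun k l => (hE l).im.pd k
  rw [extDeriv₁, extDeriv₁, r, r, r', r']
  have e0 : ∀ a b : ℂ, ((a.re - b.re : ℝ) : ℂ) + ((a.im - b.im : ℝ) : ℂ) * Complex.I = a - b := by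
    intro a b
    apply Complex.ext <;> simp
  rw [e0]
  have e1 : ∀ k, ((-sphereScale (planeCoord 0 1 b) ^ 2
        * (b 0 * (dPlane 0 1 k).re + b 1 * (dPlane 0 1 k).im) : ℝ) : ℂ)
      = -sphereScale (planeCoord 0 1 b) ^ 2 * (starRingEnd ℂ) (planeCoord 0 1 b) * dPlane 0 1 k
        + sphereScale (planeCoord 0 1 b) * (Complex.I * rotForm 0 1 b k) := by
    intro k
    rw [rotForm]
    push_cast
    apply Complex.ext <;> simp [planeCoord] <;> norm_cast <;> simp <;> ring
  rw [e1, e1]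
  simp only [bE]
  ring

theorem extDeriv₁_be₁ (hU : IsOpen U) (hh : DifferentiableOn ℂ h U) (hb : b ∈ boundaryDomain U h)
    (i j : Fin 3) : extDeriv₁ (be₁ h) b i j = -wedge (rotForm 0 1 b) (be₂ h b) i j := by
  have := congrArg Complex.re (extDeriv_bE hU hh hb i j)
  simp at this
  rw [this]
  simp [be₂, wedge]

theorem extDeriv₁_be₂ (hU : IsOpen U) (hh : DifferentiableOn ℂ h U) (hb : b ∈ boundaryDomain U h)
    (i j : Fin 3) : extDeriv₁ (be₂ h) b i j = wedge (rotForm 0 1 b) (be₁ h b) i j := by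
  have := congrArg Complex.im (extDeriv_bE hU hh hb i j)
  simp at this
  rw [this]
  simp [be₁, wedge]

theorem hasD_bHre (hU : IsOpen U) (hh : DifferentiableOn ℂ h U) (hb : b ∈ boundaryDomain U h) :
    HasD (bHre h) (fun i => (bG h b).re * be₁ h b i - (bG h b).im * be₂ h b i) b := by
  refine (hasD_bH hU hh hb).re.congr_D fun i => ?_
  simp [be₁, be₂]

theorem hasD_bHim (hU : IsOpen U) (hh : DifferentiableOn ℂ h U) (hb : b ∈ boundaryDomain U h) :
    HasD (bHim h) (fun i => (bG h b).re * be₂ h b i + (bG h b).im * be₁ h b i) b := by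
  refine (hasD_bH hU hh hb).im.congr_D fun i => ?_
  simp [be₁, be₂]

theorem be_wedge (hb : b ∈ boundaryDomain U h) (i j : Fin 3) :
    (bHre h b ^ 2 + bHim h b ^ 2) * wedge (be₁ h b) (be₂ h b) i j
      = sphereScale (planeCoord 0 1 b) ^ 2 * wedge (dCoord 0 b) (dCoord 1 b) i j := by
  have a1 := congrArg Complex.re (bH_mul_bE hb i)
  have a2 := congrArg Complex.im (bH_mul_bE hb i)
  have b1 := congrArg Complex.re (bH_mul_bE hb j)
  have b2 := congrArg Complex.im (bH_mul_bE hb j)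
  simp only [Complex.mul_re, Complex.mul_im, Complex.ofReal_re, Complex.ofReal_im, zero_mul,
    sub_zero, add_zero] at a1 a2 b1 b2
  change _ = _ * dCoord 0 b i at a1
  change _ = _ * dCoord 1 b i at a2
  change _ = _ * dCoord 0 b j at b1
  change _ = _ * dCoord 1 b j at b2
  simp only [bHre, bHim, wedge, be₁, be₂]
  have : ∀ s a b c d : ℝ, s ^ 2 * (a * d - c * b) = (s * a) * (s * d) - (s * c) * (s * b) := by
    intros; ring
  rw [this, ← a1, ← a2, ← b1, ← b2]
  ring

theorem extDeriv₁_rotForm_boundary (hb : b ∈ boundaryDomain U h) (i j : Fin 3) :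
    extDeriv₁ (rotForm 0 1) b i j
      = (bHre h b ^ 2 + bHim h b ^ 2) * wedge (be₁ h b) (be₂ h b) i j := by
  rw [be_wedge hb, extDeriv₁_rotForm]
  rfl

theorem beta_eq : beta θ = fun x i => planePull 0 1 θ x i + dCoord 2 x i := by
  funext x i
  fin_cases i <;> simp [beta, planePull, dCoord]

theorem diffForm_beta (hU : IsOpen U) (hθ : IsBetaPotential U h θ) (hb : b ∈ boundaryDomain U h) :
    DiffForm (beta θ) b := by
  rw [beta_eq]
  exact (diffForm_planePull hU hθ.1 hb.1).add (diffForm_dCoord 2)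

theorem extDeriv₁_beta (hU : IsOpen U) (hθ : IsBetaPotential U h θ) (hb : b ∈ boundaryDomain U h)
    (i j : Fin 3) : extDeriv₁ (beta θ) b i j = bHre h b * wedge (be₁ h b) (be₂ h b) i j := by
  rw [beta_eq, extDeriv₁_add (diffForm_planePull hU hθ.1 hb.1) (diffForm_dCoord 2),
    extDeriv₁_dCoord, add_zero, extDeriv₁_planePull hU hθ hb.1, mul_assoc, ← be_wedge hb]
  have hN := (Complex.normSq_pos.2 hb.2).ne'
  have : (h (planeCoord 0 1 b)).re * (bHre h b ^ 2 + bHim h b ^ 2) = bHre h b := by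
    simp only [bHre, bHim, bH, Complex.inv_re, Complex.inv_im]
    change Complex.normSq (h (planeCoord 0 1 b)) ≠ 0 at hN
    generalize hM : Complex.normSq (h (planeCoord 0 1 b)) = N at *
    rw [Complex.normSq_apply] at hM
    field_simp
    rw [← hM]
    ring
  rw [← mul_assoc, this]

/-- The coframe of the boundary. -/
def boundaryFrame (h : ℂ → ℂ) (θ : Field 2) : Pt 3 → Matrix (Fin 3) (Fin 3) ℝ :=
  coframe₃ (be₁ h) (be₂ h) (beta θ)

theorem be₁_apply (i : Fin 3) : be₁ h b i = ![sphereScale ⟨b 0, b 1⟩ * (h ⟨b 0, b 1⟩).re,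
    -(sphereScale ⟨b 0, b 1⟩ * (h ⟨b 0, b 1⟩).im), 0] i := by
  fin_cases i <;> simp [be₁, bE, dPlane, planeCoord] <;> ring

theorem be₂_apply (i : Fin 3) : be₂ h b i = ![sphereScale ⟨b 0, b 1⟩ * (h ⟨b 0, b 1⟩).im,
    sphereScale ⟨b 0, b 1⟩ * (h ⟨b 0, b 1⟩).re, 0] i := by
  fin_cases i <;> simp [be₂, bE, dPlane, planeCoord] <;> ring

theorem boundaryForm_eq (i : Fin 3) : boundaryForm h θ b i = -bHim h b * beta θ b i := rfl

theorem isConformalCoframe_boundary (hU : IsOpen U) (hh : DifferentiableOn ℂ h U)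
    (hθ : IsBetaPotential U h θ) :
    IsConformalCoframe (boundaryMetric h θ) (fun _ => 1) (boundaryFrame h θ)
      (boundaryDomain U h) where
  isOpen := isOpen_boundaryDomain hU hh
  smooth_factor := contDiffOn_const
  pos _ _ := one_pos
  smooth := by
    intro a j
    fin_cases a
    · exact contDiffOn_re (contDiffOn_bE hU hh j)
    · exact contDiffOn_im (contDiffOn_bE hU hh j)
    · change ContDiffOn ℝ ∞ (fun x => beta θ x j) _
      rw [beta_eq]
      exact ((contDiffOn_planePull hθ.1 j).mono fun _ hx => hx.1).add contDiffOn_const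
  det_ne x hx := by
    have e : (boundaryFrame h θ x).det = sphereScale ⟨x 0, x 1⟩ ^ 2
        * Complex.normSq (h ⟨x 0, x 1⟩) := by
      simp [boundaryFrame, Matrix.det_fin_three, coframe₃, be₁_apply, be₂_apply, beta,
        Complex.normSq_apply]
      ring
    rw [e]
    exact mul_ne_zero (pow_ne_zero 2 (sphereScale_pos _).ne') (Complex.normSq_pos.2 hx.2).ne'
  eq x hx i j := by
    simp only [boundaryFrame, Fin.sum_univ_three, coframe₃_zero, coframe₃_one, coframe₃_two,
      be₁_apply, be₂_apply, boundaryMetric, sphereFactor_eq, Matrix.add_apply,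
      Matrix.vecMulVec_apply]
    fin_cases i <;> fin_cases j <;>
      simp [Matrix.diagonal, Complex.normSq_apply] <;> ring

theorem isTorsionFree_boundary (hU : IsOpen U) (hh : DifferentiableOn ℂ h U)
    (hθ : IsBetaPotential U h θ) :
    IsTorsionFree (boundaryFrame h θ)
      (skew₃ (fun y i => rotForm 0 1 y i - (1 / 2) * bHre h y * beta θ y i)
      (fun y i => -(bHim h y * be₁ h y i) - (1 / 2) * bHre h y * be₂ h y i)
      (fun y i => (1 / 2) * bHre h y * be₁ h y i - bHim h y * be₂ h y i))
      (boundaryForm h θ) (boundaryDomain U h) := by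
  refine isTorsionFree₃ ?_ ?_ ?_ <;> intro x hx i j
  · rw [extDeriv₁_be₁ hU hh hx]
    simp only [wedge, boundaryForm_eq]
    ring
  · rw [extDeriv₁_be₂ hU hh hx]
    simp only [wedge, boundaryForm_eq]
    ring
  · rw [extDeriv₁_beta hU hθ hx]
    simp only [wedge, boundaryForm_eq]
    ring

theorem isEinsteinWeylOn_boundary (hU : IsOpen U) (hh : DifferentiableOn ℂ h U)
    (hθ : IsBetaPotential U h θ) :
    IsEinsteinWeylOn (boundaryMetric h θ) (boundaryForm h θ) (boundaryDomain U h) := by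
  have hA : ∀ x ∈ boundaryDomain U h, HasD (fun y => (1 / 2) * bHre h y) _ x := fun x hx =>
    (hasD_const (1 / 2 : ℝ)).mul (hasD_bHre hU hh hx)
  have hB : ∀ x ∈ boundaryDomain U h, HasD (bHim h) _ x := fun x hx => hasD_bHim hU hh hx
  have d1 : ∀ x ∈ boundaryDomain U h, DiffForm (be₁ h) x := fun x hx i =>
    ((contDiffOn_re (contDiffOn_bE hU hh i)).contDiffAt
      ((isOpen_boundaryDomain hU hh).mem_nhds hx)).differentiableAt (by simp)
  have d2 : ∀ x ∈ boundaryDomain U h, DiffForm (be₂ h) x := fun x hx i =>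
    ((contDiffOn_im (contDiffOn_bE hU hh i)).contDiffAt
      ((isOpen_boundaryDomain hU hh).mem_nhds hx)).differentiableAt (by simp)
  have d3 : ∀ x ∈ boundaryDomain U h, DiffForm (beta θ) x := fun x hx => diffForm_beta hU hθ hx
  have fb : boundaryForm h θ = fun y i => (-bHim h y) * beta θ y i := rfl
  refine isEinsteinWeylOn₃ (isConformalCoframe_boundary hU hh hθ) ?_ ?_
    (isTorsionFree_boundary hU hh hθ)
    (fun x hx => DiffForm.sub diffForm_rot (DiffForm.smul (hA x hx).diff (d3 x hx)))
    (fun x hx => (DiffForm.smul (hB x hx).diff (d1 x hx)).neg.sub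
      (DiffForm.smul (hA x hx).diff (d2 x hx)))
    (fun x hx => (DiffForm.smul (hA x hx).diff (d1 x hx)).sub
      (DiffForm.smul (hB x hx).diff (d2 x hx))) ?_ ?_
  · intro i
    rw [fb]
    refine (contDiffOn_im (contDiffOn_bH hU hh)).neg.mul ?_
    rw [beta_eq]
    exact ((contDiffOn_planePull hθ.1 i).mono fun _ hx => hx.1).add contDiffOn_const
  · intro x _ i
    rw [pd_const]; ring
  · intro x hx
    rw [fb]
    exact DiffForm.smul (hB x hx).neg.diff (d3 x hx)
  · intro x hx
    refine ⟨(1 / 4) * bHre h x ^ 2, -(1 / 2) * (bG h x).re, (1 / 2) * (bG h x).im,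
      -(1 / 2) * bHre h x * bHim h x, -bHim h x * bHre h x, -(bG h x).im, -(bG h x).re,
      fun i j => ⟨?_, ?_, ?_, ?_⟩⟩
    · rw [extDeriv₁_sub diffForm_rot (DiffForm.smul (hA x hx).diff (d3 x hx)),
        extDeriv₁_rotForm_boundary hx, extDeriv₁_smul (hA x hx) (d3 x hx), extDeriv₁_beta hU hθ hx]
      simp only [wedge]
      ring
    · rw [extDeriv₁_sub (DiffForm.smul (hB x hx).diff (d1 x hx)).neg
          (DiffForm.smul (hA x hx).diff (d2 x hx)),
        extDeriv₁_neg (DiffForm.smul (hB x hx).diff (d1 x hx)), extDeriv₁_smul (hB x hx) (d1 x hx),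
        extDeriv₁_smul (hA x hx) (d2 x hx), extDeriv₁_be₁ hU hh hx, extDeriv₁_be₂ hU hh hx]
      simp only [wedge]
      ring
    · rw [extDeriv₁_sub (DiffForm.smul (hA x hx).diff (d1 x hx))
          (DiffForm.smul (hB x hx).diff (d2 x hx)),
        extDeriv₁_smul (hA x hx) (d1 x hx), extDeriv₁_smul (hB x hx) (d2 x hx),
        extDeriv₁_be₁ hU hh hx, extDeriv₁_be₂ hU hh hx]
      simp only [wedge]
      ring
    · rw [fb, extDeriv₁_smul (hB x hx).neg (d3 x hx), extDeriv₁_beta hU hθ hx]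
      simp only [wedge]
      ring

theorem boundaryPartialT_eq : boundaryPartialT = fun _ => Pi.single 2 1 := by
  funext _ i
  fin_cases i <;> simp [boundaryPartialT]

theorem isGeodesicSymmetryOn_boundary (hU : IsOpen U) (hh : DifferentiableOn ℂ h U)
    (hθ : IsBetaPotential U h θ) :
    IsGeodesicSymmetryOn (boundaryMetric h θ) (boundaryForm h θ) boundaryPartialT
        (boundaryDomain U h) := by
  have hg : ∀ (y : Pt 3) (c : ℝ), boundaryMetric h θ (y + c • Pi.single 2 1)
      = boundaryMetric h θ y := fun y c => by simp [boundaryMetric, beta]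
  have hα : ∀ (y : Pt 3) (c : ℝ), boundaryForm h θ (y + c • Pi.single 2 1)
      = boundaryForm h θ y := fun y c => by simp [boundaryForm, beta]
  rw [boundaryPartialT_eq]
  refine ⟨fun _ => contDiffOn_const, fun x _ h0 => ?_, fun x _ => ⟨0, fun i j => ?_⟩,
    fun x _ k i j => ?_, fun x hx => ⟨-bHim h x, ?_⟩⟩
  · have := congrFun h0 2
    simp at this
  · rw [lieMetric_const 2 hg, zero_mul]
  · exact lieConn_const 2 (fun y c => weylConn_translate (fun z => hg z c) (fun z => hα z c) y) x k i j
  · have hc := isConformalCoframe_boundary hU hh hθ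
    have hF : IsFrameConn _ _ (weylMatrix (skew₃ _ _ _) _) _ :=
      hc.weylConn (α := boundaryForm h θ) (fun x _ => skew₃_neg _ _ _ x) (fun x _ i => by rw [pd_const]; ring) (isTorsionFree_boundary hU hh hθ)
    have key : (fun k => weylConn (boundaryMetric h θ) (boundaryForm h θ) x k 2 2)
        = fun k => -bHim h x * (Pi.single 2 1 : Pt 3) k := by
      refine frame_ext (hc.det_ne x hx) fun a => ?_
      rw [hF x hx a 2 2]
      have h1 : pd 2 (fun y => boundaryFrame h θ y a 2) x = 0 := by
        refine pd_eq_zero_of_invariant 2 (fun y c => ?_) x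
        fin_cases a <;> simp [boundaryFrame, coframe₃, be₁_apply, be₂_apply, beta]
      rw [h1, weylMatrix_mul]
      fin_cases a <;> simp [boundaryFrame, coframe₃, be₁_apply, be₂_apply, beta, skew₃,
        Fin.sum_univ_three, boundaryForm_eq, rotForm, dPlane]
    intro k
    have := congrFun key k
    simp only [pd_const, zero_add]
    simp only [← this]
    simp [Pi.single_apply]

end boundary

/-! ### Explicit potentials -/

theorem isBetaPotential_standardTheta {h : ℂ → ℂ} {U : Set ℂ} (hU : IsOpen U)
    (hh : DifferentiableOn ℂ h U) (h0 : (0 : ℂ) ∉ U) : IsBetaPotential U h (standardTheta h) := by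
  have hk : DifferentiableOn ℂ (fun ζ => h ζ / ζ) U :=
    hh.div differentiableOn_id fun ζ hζ e => h0 (e ▸ hζ)
  have e0 : ∀ q, standardTheta h q 0
      = -(sphereScale (planeCoord 0 1 q) * (h (planeCoord 0 1 q) / planeCoord 0 1 q).im) := by
    intro q; simp [standardTheta, sphereScale, planeCoord]; ring
  have e1 : ∀ q, standardTheta h q 1
      = -(sphereScale (planeCoord 0 1 q) * (h (planeCoord 0 1 q) / planeCoord 0 1 q).re) := by
    intro q; simp [standardTheta, sphereScale, planeCoord]; ring
  refine ⟨fun i => ?_, fun q hq => ?_⟩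
  · fin_cases i
    · simp only [Fin.zero_eta, e0]
      exact ((contDiff_sphereScale 0 1).contDiffOn.mul
        (contDiffOn_im (contDiffOn_holo hU hk 0 1))).neg
    · simp only [Fin.mk_one, e1]
      exact ((contDiff_sphereScale 0 1).contDiffOn.mul
        (contDiffOn_re (contDiffOn_holo hU hk 0 1))).neg
  · have d0 := ((hasD_sphereScale 0 1 q).mul (hasD_holo (u := 0) (v := 1) (x := q) hU hq hk).im).neg
    have d1 := ((hasD_sphereScale 0 1 q).mul (hasD_holo (u := 0) (v := 1) (x := q) hU hq hk).re).neg
    simp only [extDeriv₁, e0, e1]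
    rw [d0.pd, d1.pd, sphereFactor_eq]
    have hζ : planeCoord 0 1 q ≠ 0 := fun e => h0 (by rw [← e]; exact hq)
    have hr : h (planeCoord 0 1 q) = h (planeCoord 0 1 q) / planeCoord 0 1 q * planeCoord 0 1 q := by
      field_simp
    have hre : (h ⟨q 0, q 1⟩).re = (h (planeCoord 0 1 q) / planeCoord 0 1 q).re * q 0
        - (h (planeCoord 0 1 q) / planeCoord 0 1 q).im * q 1 := by
      change (h (planeCoord 0 1 q)).re = _
      conv_lhs => rw [hr]
      rw [Complex.mul_re]
      rfl
    rw [hre]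
    change _ = _ * sphereScale (planeCoord 0 1 q) ^ 2
    simp [dPlane, Complex.mul_re, Complex.mul_im]
    ring

theorem isBetaPotential_eulerTheta {l : ℝ} {h : ℂ → ℂ} (hl : ∀ ζ, (h ζ).re = l) :
    IsBetaPotential {0}ᶜ h (eulerTheta l) := by
  have hr : ∀ q : Pt 2, (⟨q 0, q 1⟩ : ℂ) ∈ ({0}ᶜ : Set ℂ) → q 0 ^ 2 + q 1 ^ 2 ≠ 0 := by
    intro q hq h0
    apply hq
    have a : q 0 = 0 := by nlinarith [sq_nonneg (q 0), sq_nonneg (q 1)]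
    have b : q 1 = 0 := by nlinarith [sq_nonneg (q 0), sq_nonneg (q 1)]
    rw [a, b]; rfl
  have hr1 : ∀ q : Pt 2, q 0 ^ 2 + q 1 ^ 2 + 1 ≠ 0 := fun q => by positivity
  have c0 : ContDiff ℝ ∞ (fun q : Pt 2 => q 0) := contDiff_apply ℝ ℝ 0
  have c1 : ContDiff ℝ ∞ (fun q : Pt 2 => q 1) := contDiff_apply ℝ ℝ 1
  have cr : ContDiff ℝ ∞ (fun q : Pt 2 => q 0 ^ 2 + q 1 ^ 2) := (c0.pow 2).add (c1.pow 2)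
  have cF : ContDiffOn ℝ ∞ (fun q : Pt 2 => l * ((q 0 ^ 2 + q 1 ^ 2 - 1) / (q 0 ^ 2 + q 1 ^ 2 + 1)))
      {q | (⟨q 0, q 1⟩ : ℂ) ∈ ({0}ᶜ : Set ℂ)} :=
    contDiffOn_const.mul ((cr.sub contDiff_const).contDiffOn.div
      (cr.add contDiff_const).contDiffOn fun q _ => hr1 q)
  refine ⟨fun i => ?_, fun q hq => ?_⟩
  · fin_cases i
    · exact cF.mul (c1.neg.contDiffOn.div cr.contDiffOn hr)
    · exact cF.mul (c0.contDiffOn.div cr.contDiffOn hr)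
  · have h0 := hr q hq
    have h1 := hr1 q
    have x0 := hasD_coord (x := q) 0
    have x1 := hasD_coord (x := q) 1
    have dr := (x0.pow 2).add (x1.pow 2)
    have dF := (hasD_const (x := q) l).mul ((dr.sub (hasD_const 1)).div (dr.add (hasD_const 1)) h1)
    have d0 := dF.mul (x1.neg.div dr h0)
    have d1 := dF.mul (x0.div dr h0)
    have e0 : (fun y => eulerTheta l y 0) = fun q => l * ((q 0 ^ 2 + q 1 ^ 2 - 1)
      / (q 0 ^ 2 + q 1 ^ 2 + 1)) * (-q 1 / (q 0 ^ 2 + q 1 ^ 2)) := rfl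
    have e1 : (fun y => eulerTheta l y 1) = fun q => l * ((q 0 ^ 2 + q 1 ^ 2 - 1)
      / (q 0 ^ 2 + q 1 ^ 2 + 1)) * (q 0 / (q 0 ^ 2 + q 1 ^ 2)) := rfl
    rw [extDeriv₁, e0, e1, d0.pd, d1.pd, hl, sphereFactor, Complex.normSq_mk]
    have h2 : 1 + (q 0 * q 0 + q 1 * q 1) ≠ 0 := by
      intro h; apply h1; linarith
    simp
    field_simp
    ring

/-! ### Polar coordinates -/

theorem eulerZeta_re (a b : ℝ) :
    (eulerZeta a b).re = Real.cos (a / 2) / Real.sin (a / 2) * Real.cos b := by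
  rw [eulerZeta, Complex.re_ofReal_mul, Complex.exp_ofReal_mul_I_re]

theorem eulerZeta_im (a b : ℝ) :
    (eulerZeta a b).im = Real.cos (a / 2) / Real.sin (a / 2) * Real.sin b := by
  rw [eulerZeta, Complex.im_ofReal_mul, Complex.exp_ofReal_mul_I_im]

theorem half_angle_pos {a : ℝ} (h0 : 0 < a) (h1 : a < Real.pi) :
    0 < Real.cos (a / 2) ∧ 0 < Real.sin (a / 2) :=
  ⟨Real.cos_pos_of_mem_Ioo ⟨by linarith, by linarith⟩,
    Real.sin_pos_of_pos_of_lt_pi (by linarith) (by linarith)⟩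

theorem eulerZeta_ne_zero {a : ℝ} (b : ℝ) (h0 : 0 < a) (h1 : a < Real.pi) : eulerZeta a b ≠ 0 := by
  obtain ⟨hc, hs⟩ := half_angle_pos h0 h1
  exact mul_ne_zero (Complex.ofReal_ne_zero.2 (div_pos hc hs).ne') (Complex.exp_ne_zero _)

theorem exists_eulerZeta {ζ : ℂ} (hζ : ζ ≠ 0) :
    ∃ a b : ℝ, 0 < a ∧ a < Real.pi ∧ eulerZeta a b = ζ := by
  have hn : 0 < ‖ζ‖ := norm_pos_iff.2 hζ
  refine ⟨2 * Real.arctan ‖ζ‖⁻¹, ζ.arg, ?_, ?_, ?_⟩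
  · have := Real.arctan_pos.2 (inv_pos.2 hn)
    linarith
  · have := Real.arctan_lt_pi_div_two ‖ζ‖⁻¹
    linarith
  · have : Real.cos (2 * Real.arctan ‖ζ‖⁻¹ / 2) / Real.sin (2 * Real.arctan ‖ζ‖⁻¹ / 2) = ‖ζ‖ := by
      rw [mul_div_cancel_left₀ _ two_ne_zero, ← inv_div, ← Real.tan_eq_sin_div_cos,
        Real.tan_arctan, inv_inv]
    rw [eulerZeta, this]
    exact Complex.norm_mul_exp_arg_mul_I ζ

section euler
variable {x : Pt n} {j k : Fin n}

theorem hasD_cot (h0 : Real.sin (x j / 2) ≠ 0) :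
    HasD (fun y : Pt n => Real.cos (y j / 2) / Real.sin (y j / 2))
      (fun i => -dCoord j x i / (2 * Real.sin (x j / 2) ^ 2)) x := by
  have d := (hasD_coord' (x := x) j).mul (hasD_const (1 / 2 : ℝ))
  have e : (fun y : Pt n => Real.cos (y j / 2) / Real.sin (y j / 2))
      = fun y => Real.cos (y j * (1 / 2)) / Real.sin (y j * (1 / 2)) := by
    funext y; congr 2 <;> ring
  have e2 : x j / 2 = x j * (1 / 2) := by ring
  rw [e2] at h0 ⊢
  rw [e]
  refine ((HasD.real (Real.hasDerivAt_cos _) d).div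
    (HasD.real (Real.hasDerivAt_sin _) d) h0).congr_D fun i => ?_
  have := Real.sin_sq_add_cos_sq (x j * (1 / 2))
  generalize x j * (1 / 2) = a at h0 this ⊢
  field_simp
  linear_combination -dCoord j x i * this

theorem hasD_eulerZeta_re (h0 : Real.sin (x j / 2) ≠ 0) :
    HasD (fun y : Pt n => (eulerZeta (y j) (y k)).re) (fun i =>
      -dCoord j x i / (2 * Real.sin (x j / 2) ^ 2) * Real.cos (x k)
      + Real.cos (x j / 2) / Real.sin (x j / 2) * (-Real.sin (x k) * dCoord k x i)) x := by
  simp only [eulerZeta_re]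
  exact (hasD_cot h0).mul (HasD.real (Real.hasDerivAt_cos _) (hasD_coord' k))

theorem hasD_eulerZeta_im (h0 : Real.sin (x j / 2) ≠ 0) :
    HasD (fun y : Pt n => (eulerZeta (y j) (y k)).im) (fun i =>
      -dCoord j x i / (2 * Real.sin (x j / 2) ^ 2) * Real.sin (x k)
      + Real.cos (x j / 2) / Real.sin (x j / 2) * (Real.cos (x k) * dCoord k x i)) x := by
  simp only [eulerZeta_im]
  exact (hasD_cot h0).mul (HasD.real (Real.hasDerivAt_sin _) (hasD_coord' k))

/-- The pullback of the round metric and of the potential in polar coordinates. -/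
theorem euler_pullback (l : ℝ) {C S c s u v u' v' : ℝ} (hS : S ≠ 0) (h1 : S ^ 2 + C ^ 2 = 1)
    (h2 : s ^ 2 + c ^ 2 = 1) (hC : C ≠ 0) :
    sphereFactor ⟨C / S * c, C / S * s⟩
      * ((-u / (2 * S ^ 2) * c + C / S * (-s * v)) * (-u' / (2 * S ^ 2) * c + C / S * (-s * v'))
        + (-u / (2 * S ^ 2) * s + C / S * (c * v)) * (-u' / (2 * S ^ 2) * s + C / S * (c * v')))
      = u * u' + (2 * S * C) ^ 2 * (v * v') ∧
    eulerTheta l ![C / S * c, C / S * s] 0 * (-u / (2 * S ^ 2) * c + C / S * (-s * v))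
      + eulerTheta l ![C / S * c, C / S * s] 1 * (-u / (2 * S ^ 2) * s + C / S * (c * v))
      = l * (2 * C ^ 2 - 1) * v := by
  have hr : C / S * c * (C / S * c) + C / S * s * (C / S * s) = C ^ 2 / S ^ 2 := by
    field_simp; linear_combination h2
  have hr' : (C / S * c) ^ 2 + (C / S * s) ^ 2 = C ^ 2 / S ^ 2 := by
    field_simp; linear_combination h2
  have hs : sphereFactor ⟨C / S * c, C / S * s⟩ = 4 * S ^ 4 := by
    rw [sphereFactor, Complex.normSq_mk, hr]
    have : 1 + C ^ 2 / S ^ 2 = 1 / S ^ 2 := by field_simp; linarith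
    rw [this]
    field_simp
  have k1 : C ^ 2 / S ^ 2 + 1 = 1 / S ^ 2 := by field_simp; linarith
  have k2 : (C ^ 2 / S ^ 2 - 1) / (C ^ 2 / S ^ 2 + 1) = 2 * C ^ 2 - 1 := by
    rw [k1]; field_simp; linarith
  constructor
  · rw [hs]
    field_simp
    linear_combination 4 * (u * u' + 4 * C ^ 2 * S ^ 2 * v * v') * h2
  · simp only [eulerTheta, Matrix.cons_val_zero, Matrix.cons_val_one, hr', k2]
    field_simp
    linear_combination (2 * C ^ 2 - 1) * v * h2 * 2 * S * C * l

end euler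

/-! ### Pedersen metrics and Berger spheres -/

section pullback

theorem pullback_einstein {h : ℂ → ℂ} {θ : Field 2} {φ : Pt m → Pt 4} {p : Pt m}
    {X Y Z T : Fin m → ℝ} (hX : HasD (fun y => φ y 0) X p) (hY : HasD (fun y => φ y 1) Y p)
    (hZ : HasD (fun y => φ y 2) Z p) (hT : HasD (fun y => φ y 3) T p) (i j : Fin m) :
    pullback φ (einsteinMetric h θ) p i j
      = 1 / φ p 2 ^ 2 * (numer h ![φ p 0, φ p 1, φ p 2] * (sphereFactor ⟨φ p 0, φ p 1⟩
          * (X i * X j + Y i * Y j))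
        + numer h ![φ p 0, φ p 1, φ p 2] / modSq h ![φ p 0, φ p 1, φ p 2] * (Z i * Z j)
        + modSq h ![φ p 0, φ p 1, φ p 2] / numer h ![φ p 0, φ p 1, φ p 2]
          * ((θ ![φ p 0, φ p 1] 0 * X i + θ ![φ p 0, φ p 1] 1 * Y i
              - kappa h ![φ p 0, φ p 1, φ p 2] * φ p 2 * Z i + T i)
            * (θ ![φ p 0, φ p 1] 0 * X j + θ ![φ p 0, φ p 1] 1 * Y j
              - kappa h ![φ p 0, φ p 1, φ p 2] * φ p 2 * Z j + T j))) := by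
  simp only [pullback, Fin.sum_univ_four, hX.pd, hY.pd, hZ.pd, hT.pd, einsteinMetric,
    Matrix.smul_apply, Matrix.add_apply, Matrix.vecMulVec_apply, Matrix.diagonal_apply]
  simp
  ring

theorem pullback_boundary {h : ℂ → ℂ} {θ : Field 2} {φ : Pt m → Pt 3} {p : Pt m}
    {X Y T : Fin m → ℝ} (hX : HasD (fun y => φ y 0) X p) (hY : HasD (fun y => φ y 1) Y p)
    (hT : HasD (fun y => φ y 2) T p) (i j : Fin m) :
    pullback φ (boundaryMetric h θ) p i j
      = Complex.normSq (h ⟨φ p 0, φ p 1⟩) * (sphereFactor ⟨φ p 0, φ p 1⟩ * (X i * X j + Y i * Y j))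
        + (θ ![φ p 0, φ p 1] 0 * X i + θ ![φ p 0, φ p 1] 1 * Y i + T i)
            * (θ ![φ p 0, φ p 1] 0 * X j + θ ![φ p 0, φ p 1] 1 * Y j + T j) := by
  simp only [pullback, Fin.sum_univ_three, hX.pd, hY.pd, hT.pd, boundaryMetric, beta,
    Matrix.add_apply, Matrix.vecMulVec_apply, Matrix.diagonal_apply]
  simp
  ring

theorem cos_eq_half (a : ℝ) : Real.cos a = 2 * Real.cos (a / 2) ^ 2 - 1 := by
  rw [← Real.cos_two_mul, mul_div_cancel₀ _ two_ne_zero]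

theorem sin_eq_half (a : ℝ) : Real.sin a = 2 * Real.sin (a / 2) * Real.cos (a / 2) := by
  rw [← Real.sin_two_mul, mul_div_cancel₀ _ two_ne_zero]

variable {h : ℂ → ℂ} {l c : ℝ}

theorem numer_const (hh : ∀ ζ, h ζ = l * (1 + c * Complex.I)) (a b z : ℝ) :
    numer h ![a, b, z] = l * z + l ^ 2 * (1 + c ^ 2) := by
  simp [numer, hh, Complex.normSq_apply]
  ring

theorem modSq_const (hh : ∀ ζ, h ζ = l * (1 + c * Complex.I)) (a b z : ℝ) :
    modSq h ![a, b, z] = (z + l) ^ 2 + (l * c) ^ 2 := by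
  simp [modSq, hh, Complex.normSq_apply]
  ring

theorem kappa_const (hh : ∀ ζ, h ζ = l * (1 + c * Complex.I)) (a b z : ℝ) :
    kappa h ![a, b, z] = -(l * c) / ((z + l) ^ 2 + (l * c) ^ 2) := by
  rw [kappa, modSq_const hh]
  simp [hh]

theorem hasD_pedersen_t {p : Pt 4} (hp : 0 < p 0) :
    HasD (fun y => pedersenMap l c y 3) (fun i => l * dCoord 3 p i
      + 2 * l * c * (1 - p 0 ^ 2) * p 0 / (p 0 * p 0 * (1 + c ^ 2 * p 0 ^ 4)) * dCoord 0 p i) p := by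
  have h0 : p 0 ^ 2 ≠ 0 := (pow_pos hp 2).ne'
  have d0 := (((((hasD_coord' (x := p) 0).pow 2).inv h0).ofReal).add
    (hasD_const ((c : ℂ) * Complex.I)))
  have hslit : (((p 0 ^ 2)⁻¹ : ℝ) : ℂ) + c * Complex.I ∈ Complex.slitPlane := by
    left
    rw [Complex.add_re, Complex.ofReal_re, Complex.re_ofReal_mul, Complex.I_re, mul_zero, add_zero]
    positivity
  have d1 := HasD.holo (Complex.hasDerivAt_log hslit) d0
  have d2 := ((hasD_const l).mul (hasD_coord' (x := p) 3)).sub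
    ((hasD_const ((l : ℂ) * (1 + c * Complex.I))).mul d1).im
  have e : (fun y => pedersenMap l c y 3) = fun y : Pt 4 => l * y 3 - ((l : ℂ) * (1 + c * Complex.I) *
      Complex.log ((((y 0 ^ 2)⁻¹ : ℝ) : ℂ) + c * Complex.I)).im := rfl
  rw [e]
  refine d2.congr_D fun i => ?_
  have e1 : ∀ R d : ℝ, 0 < R → ((l : ℂ) * (1 + c * Complex.I) * (((R : ℂ) + c * Complex.I)⁻¹ * d)).im
      = l * d * c * (R - 1) / (R ^ 2 + c ^ 2) := by
    intro R d hR
    have hN : R * R + c * c ≠ 0 :=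
      (add_pos_of_pos_of_nonneg (mul_pos hR hR) (mul_self_nonneg c)).ne'
    simp [Complex.inv_re, Complex.inv_im, Complex.normSq_apply]
    field_simp
    ring
  rw [add_zero, zero_mul, zero_add, zero_mul, zero_add, e1 _ _ (inv_pos.2 (pow_pos hp 2))]
  have hB : (p 0 ^ 2)⁻¹ ^ 2 + c ^ 2 = (1 + c ^ 2 * p 0 ^ 4) / p 0 ^ 4 := by
    field_simp
  have hB' : 1 + c ^ 2 * p 0 ^ 4 ≠ 0 := by positivity
  rw [hB]
  push_cast
  field_simp
  ring

theorem pullback_pedersen (hh : ∀ ζ, h ζ = l * (1 + c * Complex.I)) (hl : l ≠ 0) {p : Pt 4}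
    (hp : p ∈ pedersenDomain) :
    pullback (pedersenMap l c) (einsteinMetric h (eulerTheta l)) p = (4 : ℝ) • pedersenMetric c p := by
  obtain ⟨h0, h1, h2, h3⟩ := hp
  obtain ⟨hC, hS⟩ := half_angle_pos h2 h3
  have dZ : HasD (fun y => pedersenMap l c y 2) (fun i => -2 * l / p 0 ^ 3 * dCoord 0 p i) p := by
    have d := (hasD_coord' (x := p) 0).pow 2
    refine ((hasD_const l).mul (((hasD_const 1).sub d).div d (pow_pos h0 2).ne')).congr_D fun i => ?_
    field_simp
    ring
  ext i j
  rw [pullback_einstein (hasD_eulerZeta_re hS.ne') (hasD_eulerZeta_im hS.ne') dZ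
    (hasD_pedersen_t h0)]
  have q0 : pedersenMap l c p 0 = Real.cos (p 1 / 2) / Real.sin (p 1 / 2) * Real.cos (p 2) :=
    eulerZeta_re _ _
  have q1 : pedersenMap l c p 1 = Real.cos (p 1 / 2) / Real.sin (p 1 / 2) * Real.sin (p 2) :=
    eulerZeta_im _ _
  have q2 : pedersenMap l c p 2 = l * ((1 - p 0 ^ 2) / p 0 ^ 2) := rfl
  rw [q0, q1, q2]
  have key := fun i j => (euler_pullback l (u := dCoord 1 p i) (v := dCoord 2 p i)
    (u' := dCoord 1 p j) (v' := dCoord 2 p j) hS.ne' (Real.sin_sq_add_cos_sq (p 1 / 2))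
    (Real.sin_sq_add_cos_sq (p 2)) hC.ne')
  rw [(key i j).1, (key i j).2, (key j i).2, numer_const hh, modSq_const hh, kappa_const hh,
    ← cos_eq_half]
  have es : (2 * Real.sin (p 1 / 2) * Real.cos (p 1 / 2)) ^ 2 = Real.sin (p 1) ^ 2 := by
    rw [← sin_eq_half]
  rw [es]
  have hA : 0 < 1 + c ^ 2 * p 0 ^ 2 := by positivity
  have hB : 0 < 1 + c ^ 2 * p 0 ^ 4 := by positivity
  have hz : 1 - p 0 ^ 2 ≠ 0 := by nlinarith
  have en : l * (l * ((1 - p 0 ^ 2) / p 0 ^ 2)) + l ^ 2 * (1 + c ^ 2)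
      = l ^ 2 * (1 + c ^ 2 * p 0 ^ 2) / p 0 ^ 2 := by
    field_simp; ring
  have em : (l * ((1 - p 0 ^ 2) / p 0 ^ 2) + l) ^ 2 + (l * c) ^ 2
      = l ^ 2 * (1 + c ^ 2 * p 0 ^ 4) / p 0 ^ 4 := by
    field_simp; ring
  have eN : ∀ i, l * Real.cos (p 1) * dCoord 2 p i - -(l * c) / (l ^ 2 * (1 + c ^ 2 * p 0 ^ 4)
      / p 0 ^ 4) * (l * ((1 - p 0 ^ 2) / p 0 ^ 2)) * (-2 * l / p 0 ^ 3 * dCoord 0 p i)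
      + (l * dCoord 3 p i + 2 * l * c * (1 - p 0 ^ 2) * p 0
        / (p 0 * p 0 * (1 + c ^ 2 * p 0 ^ 4)) * dCoord 0 p i)
      = l * (Real.cos (p 1) * dCoord 2 p i + dCoord 3 p i) := by
    intro i
    field_simp
    ring
  rw [en, em, eN, eN]
  have ps : ∀ i, (![0, 0, Real.cos (p 1), 1] : Fin 4 → ℝ) i
      = Real.cos (p 1) * dCoord 2 p i + dCoord 3 p i := by
    intro i; fin_cases i <;> simp [dCoord]
  have pd : ∀ a b c' d : ℝ, Matrix.diagonal (![a, b, c', d] : Fin 4 → ℝ) i j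
      = a * (dCoord 0 p i * dCoord 0 p j) + b * (dCoord 1 p i * dCoord 1 p j)
        + c' * (dCoord 2 p i * dCoord 2 p j) + d * (dCoord 3 p i * dCoord 3 p j) := by
    intro a b c' d
    fin_cases i <;> fin_cases j <;> simp [dCoord, Matrix.diagonal]
  simp only [pedersenMetric, Matrix.smul_apply, Matrix.add_apply, Matrix.vecMulVec_apply, pd, ps,
    smul_eq_mul]
  field_simp
  ring

theorem pullback_berger (hh : ∀ ζ, h ζ = l * (1 + c * Complex.I)) (hl : l ≠ 0) {b : Pt 3}
    (hb : b ∈ bergerDomain) :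
    pullback (bergerMap l) (boundaryMetric h (eulerTheta l)) b
        = (l ^ 2 * (1 + c ^ 2)) • bergerMetric (1 / (1 + c ^ 2)) b ∧
      pullbackForm (bergerMap l) (boundaryForm h (eulerTheta l)) b
        = (c / (1 + c ^ 2)) • sigma₃ b := by
  obtain ⟨h2, h3⟩ := hb
  obtain ⟨hC, hS⟩ := half_angle_pos h2 h3
  have dX := hasD_eulerZeta_re (x := b) (j := 0) (k := 1) hS.ne'
  have dY := hasD_eulerZeta_im (x := b) (j := 0) (k := 1) hS.ne'
  have dT : HasD (fun y => bergerMap l y 2) (fun i => l * dCoord 2 b i) b := by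
    refine ((hasD_const l).mul (hasD_coord' 2)).congr_D fun i => ?_
    ring
  have q0 : bergerMap l b 0 = Real.cos (b 0 / 2) / Real.sin (b 0 / 2) * Real.cos (b 1) :=
    eulerZeta_re _ _
  have q1 : bergerMap l b 1 = Real.cos (b 0 / 2) / Real.sin (b 0 / 2) * Real.sin (b 1) :=
    eulerZeta_im _ _
  have key := fun i j => (euler_pullback l (u := dCoord 0 b i) (v := dCoord 1 b i)
    (u' := dCoord 0 b j) (v' := dCoord 1 b j) hS.ne' (Real.sin_sq_add_cos_sq (b 0 / 2))
    (Real.sin_sq_add_cos_sq (b 1)) hC.ne')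
  have hc : 0 < 1 + c ^ 2 := by positivity
  have ps : ∀ i, sigma₃ b i = Real.cos (b 0) * dCoord 1 b i + dCoord 2 b i := by
    intro i; fin_cases i <;> simp [dCoord, sigma₃]
  have hN : Complex.normSq ((l : ℂ) * (1 + c * Complex.I)) = l ^ 2 * (1 + c ^ 2) := by
    simp [Complex.normSq_apply]
    ring
  constructor
  · ext i j
    rw [pullback_boundary dX dY dT, q0, q1, (key i j).1, (key i j).2, (key j i).2, hh, hN,
      ← cos_eq_half]
    have es : (2 * Real.sin (b 0 / 2) * Real.cos (b 0 / 2)) ^ 2 = Real.sin (b 0) ^ 2 := by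
      rw [← sin_eq_half]
    rw [es]
    have pd : ∀ a d e : ℝ, Matrix.diagonal (![a, d, e] : Fin 3 → ℝ) i j
        = a * (dCoord 0 b i * dCoord 0 b j) + d * (dCoord 1 b i * dCoord 1 b j)
          + e * (dCoord 2 b i * dCoord 2 b j) := by
      intro a d e
      fin_cases i <;> fin_cases j <;> simp [dCoord, Matrix.diagonal]
    simp only [bergerMetric, Matrix.smul_apply, Matrix.add_apply, Matrix.vecMulVec_apply, pd, ps,
      smul_eq_mul]
    field_simp
    ring
  · funext i
    have dX' : pd i (fun y => bergerMap l y 0) b = _ := dX.pd i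
    have dY' : pd i (fun y => bergerMap l y 1) b = _ := dY.pd i
    have hI : ((l : ℂ) * (1 + c * Complex.I))⁻¹.im = -c / (l * (1 + c ^ 2)) := by
      rw [Complex.inv_im, hN]
      simp
      field_simp
    simp only [pullbackForm, Fin.sum_univ_three, dX', dY', dT.pd, boundaryForm, beta, hh, hI,
      Pi.smul_apply, smul_eq_mul, ps, q0, q1]
    have k2 := (key i i).2
    rw [← cos_eq_half] at k2
    simp only [Matrix.cons_val_zero, Matrix.cons_val_one, Matrix.cons_val]
    have : ∀ A B C D E κ : ℝ, κ * A * B + κ * C * D + κ * 1 * E = κ * (A * B + C * D + E) := by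
      intros; ring
    rw [this, k2]
    field_simp

end pullback

section images
variable {h : ℂ → ℂ} {l c : ℝ}

theorem image_berger (hh : ∀ ζ, h ζ = l * (1 + c * Complex.I)) (hl : l ≠ 0) :
    bergerMap l '' bergerDomain = boundaryDomain {0}ᶜ h := by
  have hne : (l : ℂ) * (1 + c * Complex.I) ≠ 0 := by
    refine mul_ne_zero (Complex.ofReal_ne_zero.2 hl) fun e => ?_
    have := congrArg Complex.re e
    simp at this
  ext b
  constructor
  · rintro ⟨a, ⟨h0, h1⟩, rfl⟩
    exact ⟨eulerZeta_ne_zero _ h0 h1, by rw [hh]; exact hne⟩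
  · rintro ⟨h0, _⟩
    obtain ⟨u, v, hu, hu', e⟩ := exists_eulerZeta h0
    refine ⟨![u, v, b 2 / l], ⟨hu, hu'⟩, ?_⟩
    funext i
    have e1 := congrArg Complex.re e
    have e2 := congrArg Complex.im e
    fin_cases i
    · exact e1
    · exact e2
    · exact mul_div_cancel₀ _ hl

theorem image_pedersen (hh : ∀ ζ, h ζ = l * (1 + c * Complex.I)) (hl : l ≠ 0) :
    pedersenMap l c '' pedersenDomain = {p ∈ einsteinDomain {0}ᶜ h | 0 < l * p 2} := by
  have hl2 : 0 < l ^ 2 := by positivity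
  ext p
  constructor
  · rintro ⟨a, ⟨h0, h1, h2, h3⟩, rfl⟩
    have hz : 0 < (1 - a 0 ^ 2) / a 0 ^ 2 := div_pos (by nlinarith) (by positivity)
    have e : l * pedersenMap l c a 2 = l ^ 2 * ((1 - a 0 ^ 2) / a 0 ^ 2) := by
      change l * (l * _) = _; ring
    have hlz : 0 < l * pedersenMap l c a 2 := by rw [e]; exact mul_pos hl2 hz
    have hz0 : pedersenMap l c a 2 ≠ 0 := fun e0 => by rw [e0] at hlz; simp at hlz
    have hne : pedersenMap l c a 2 + l ≠ 0 := fun e0 => by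
      have : l * pedersenMap l c a 2 + l ^ 2 = 0 := by linear_combination l * e0
      linarith
    have hmod : 0 < (pedersenMap l c a 2 + l) ^ 2 + (l * c) ^ 2 := by positivity
    refine ⟨⟨⟨⟨eulerZeta_ne_zero _ h2 h3, fun e0 => ?_⟩, ?_⟩, hz0⟩, hlz⟩
    · have := congrArg Complex.re e0
      rw [hh] at this
      simp at this
      exact hne this
    · rw [monopole, numer_const hh, modSq_const hh]
      exact div_pos (by positivity) hmod
  · rintro ⟨⟨⟨⟨h0, _⟩, _⟩, _⟩, hlz⟩
    obtain ⟨u, v, hu, hu', e⟩ := exists_eulerZeta h0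
    have hq : 0 < l ^ 2 / (l ^ 2 + l * p 2) := by positivity
    have hsq := Real.sq_sqrt hq.le
    have hr := Real.sqrt_pos.2 hq
    have hlt : Real.sqrt (l ^ 2 / (l ^ 2 + l * p 2)) < 1 := by
      rw [Real.sqrt_lt' one_pos, one_pow, div_lt_one (by positivity)]
      linarith
    generalize Real.sqrt (l ^ 2 / (l ^ 2 + l * p 2)) = r at *
    refine ⟨![r, u, v, (p 3 + ((l : ℂ) * (1 + c * Complex.I) *
      Complex.log ((((r ^ 2)⁻¹ : ℝ) : ℂ) + c * Complex.I)).im) / l], ⟨hr, hlt, hu, hu'⟩, ?_⟩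
    funext i
    have e1 := congrArg Complex.re e
    have e2 := congrArg Complex.im e
    fin_cases i
    · exact e1
    · exact e2
    · change l * ((1 - r ^ 2) / r ^ 2) = p 2
      have : l ^ 2 + l * p 2 ≠ 0 := by positivity
      have h5 : l + p 2 ≠ 0 := fun e5 => this (by linear_combination l * e5)
      rw [hsq]
      field_simp
      ring
    · change l * (_ / l) - _ = p 3
      rw [mul_div_cancel₀ _ hl]
      exact add_sub_cancel_right _ _

end images

/-! ### Lie derivatives of differential forms -/

/-- Derivative of a function in the direction of a vector field. -/
def dirD (X : Field n) (f : Pt n → ℝ) (x : Pt n) : ℝ := ∑ m, X x m * pd m f x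

/-- Lie derivative of a 1-form. -/
def lieForm (X α : Field n) : Field n := fun x i =>
  dirD X (fun y => α y i) x + ∑ m, α x m * pd i (fun y => X y m) x

/-- Lie derivative of a 2-form. -/
def lieTwo (X : Field n) (F : Pt n → Fin n → Fin n → ℝ) (x : Pt n) (i j : Fin n) : ℝ :=
  dirD X (fun y => F y i j) x
    + ∑ m, (F x m j * pd i (fun y => X y m) x + F x i m * pd j (fun y => X y m) x)

section lie

variable {X α β : Field n} {x : Pt n} {f : Pt n → ℝ} {D : Fin n → ℝ} {S : Set (Pt n)}

theorem HasD.dirD (h : HasD f D x) : dirD X f x = ∑ m, X x m * D m :=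
  sum_congr rfl fun m _ => by rw [h.pd]

theorem dirD_congr {g : Pt n → ℝ} (e : f =ᶠ[nhds x] g) : dirD X f x = dirD X g x :=
  sum_congr rfl fun m _ => by rw [pd_congr m e]

theorem dirD_const (c : ℝ) : dirD X (fun _ => c) x = 0 := by
  simp [dirD, pd_const]

theorem dirD_add {g : Pt n → ℝ} (hf : DifferentiableAt ℝ f x) (hg : DifferentiableAt ℝ g x) :
    dirD X (fun y => f y + g y) x = dirD X f x + dirD X g x := by
  rw [((hasD_pd hf).add (hasD_pd hg)).dirD, dirD, dirD, ← sum_add_distrib]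
  exact sum_congr rfl fun m _ => by ring

theorem dirD_sub {g : Pt n → ℝ} (hf : DifferentiableAt ℝ f x) (hg : DifferentiableAt ℝ g x) :
    dirD X (fun y => f y - g y) x = dirD X f x - dirD X g x := by
  rw [((hasD_pd hf).sub (hasD_pd hg)).dirD, dirD, dirD, ← sum_sub_distrib]
  exact sum_congr rfl fun m _ => by ring

theorem dirD_mul {g : Pt n → ℝ} (hf : DifferentiableAt ℝ f x) (hg : DifferentiableAt ℝ g x) :
    dirD X (fun y => f y * g y) x = dirD X f x * g x + f x * dirD X g x := by
  rw [((hasD_pd hf).mul (hasD_pd hg)).dirD, dirD, dirD, sum_mul, mul_sum,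
    ← sum_add_distrib]
  exact sum_congr rfl fun m _ => by ring

theorem dirD_sum {ι : Type*} [Fintype ι] {f : ι → Pt n → ℝ}
    (hf : ∀ a, DifferentiableAt ℝ (f a) x) :
    dirD X (fun y => ∑ a, f a y) x = ∑ a, dirD X (f a) x := by
  rw [(HasD.sum fun a _ => hasD_pd (hf a)).dirD]
  simp only [dirD, mul_sum]
  exact sum_comm

theorem lieForm_sum_smul {ι : Type*} [Fintype ι] {f : ι → Pt n → ℝ} {α : ι → Field n}
    (hf : ∀ a, DifferentiableAt ℝ (f a) x) (hα : ∀ a, DiffForm (α a) x) (i : Fin n) :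
    lieForm X (fun y i => ∑ a, f a y * α a y i) x i
      = ∑ a, (dirD X (f a) x * α a x i + f a x * lieForm X (α a) x i) := by
  rw [lieForm, dirD_sum (f := fun a y => f a y * α a y i) fun a => (hf a).mul (hα a i)]
  simp only [dirD_mul (hf _) (hα _ i), lieForm, sum_mul, mul_add, sum_add_distrib,
    mul_sum]
  rw [sum_comm (f := fun m a => f a x * α a x m * _)]
  simp only [mul_assoc, add_assoc]

theorem extDeriv₁_sum_smul {ι : Type*} [Fintype ι] {f : ι → Pt n → ℝ} {α : ι → Field n}
    (hf : ∀ a, DifferentiableAt ℝ (f a) x) (hα : ∀ a, DiffForm (α a) x) (i j : Fin n) :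
    extDeriv₁ (fun y i => ∑ a, f a y * α a y i) x i j
      = ∑ a, (pd i (f a) x * α a x j - pd j (f a) x * α a x i + f a x * extDeriv₁ (α a) x i j) := by
  have h : ∀ k, HasD (fun y => ∑ a, f a y * α a y k) _ x := fun k =>
    HasD.sum fun a _ => (hasD_pd (hf a)).mul (hasD_pd (hα a k))
  rw [extDeriv₁, (h i).pd, (h j).pd, ← sum_sub_distrib]
  exact sum_congr rfl fun a _ => by rw [extDeriv₁]; ring

theorem lieTwo_congr {F G : Pt n → Fin n → Fin n → ℝ} (h : ∀ᶠ y in nhds x, F y = G y)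
    (i j : Fin n) : lieTwo X F x i j = lieTwo X G x i j := by
  rw [lieTwo, lieTwo, dirD_congr (h.mono fun y hy => by rw [hy]), h.self_of_nhds]

theorem lieTwo_add {F G : Pt n → Fin n → Fin n → ℝ}
    (hF : ∀ i j, DifferentiableAt ℝ (fun y => F y i j) x)
    (hG : ∀ i j, DifferentiableAt ℝ (fun y => G y i j) x) (i j : Fin n) :
    lieTwo X (fun y i j => F y i j + G y i j) x i j = lieTwo X F x i j + lieTwo X G x i j := by
  simp only [lieTwo, dirD_add (hF i j) (hG i j), add_mul, sum_add_distrib]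
  ring

theorem lieTwo_sum {ι : Type*} [Fintype ι] {F : ι → Pt n → Fin n → Fin n → ℝ}
    (hF : ∀ a i j, DifferentiableAt ℝ (fun y => F a y i j) x) (i j : Fin n) :
    lieTwo X (fun y i j => ∑ a, F a y i j) x i j = ∑ a, lieTwo X (F a) x i j := by
  simp only [lieTwo, dirD_sum (fun a => hF a i j), sum_mul, sum_add_distrib]
  rw [sum_comm (f := fun m a => F a x m j * _), sum_comm (f := fun m a => F a x i m * _)]

theorem lieTwo_wedge (hα : DiffForm α x) (hβ : DiffForm β x) (i j : Fin n) :
    lieTwo X (fun y i j => wedge (α y) (β y) i j) x i j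
      = wedge (lieForm X α x) (β x) i j + wedge (α x) (lieForm X β x) i j := by
  simp only [lieTwo, wedge, lieForm]
  rw [dirD_sub (f := fun y => α y i * β y j) (g := fun y => α y j * β y i) ((hα i).mul (hβ j))
    ((hα j).mul (hβ i)), dirD_mul (hα i) (hβ j),
    dirD_mul (hα j) (hβ i)]
  have e : ∑ m, ((α x m * β x j - α x j * β x m) * pd i (fun y => X y m) x
      + (α x i * β x m - α x m * β x i) * pd j (fun y => X y m) x)
      = (∑ m, α x m * pd i (fun y => X y m) x) * β x j
        - α x j * (∑ m, β x m * pd i (fun y => X y m) x)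
        + α x i * (∑ m, β x m * pd j (fun y => X y m) x)
        - (∑ m, α x m * pd j (fun y => X y m) x) * β x i := by
    rw [sum_mul, sum_mul, mul_sum, mul_sum, ← sum_sub_distrib,
      ← sum_add_distrib, ← sum_sub_distrib]
    exact sum_congr rfl fun m _ => by ring
  rw [e]
  ring

theorem SmoothField.diffForm (hα : SmoothField α S) (hS : IsOpen S) (hx : x ∈ S) : DiffForm α x :=
  fun i => ((hα i).contDiffAt (hS.mem_nhds hx)).differentiableAt (by simp)

theorem SmoothField.hasD_pd (hα : SmoothField α S) (hS : IsOpen S) (hx : x ∈ S) (m i : Fin n) :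
    HasD (pd m (fun y => α y i)) (fun k => pd k (pd m (fun y => α y i)) x) x :=
  HyperCRToda.hasD_pd (((contDiffOn_pd hS (hα i) m).contDiffAt
    (hS.mem_nhds hx)).differentiableAt (by simp))

theorem extDeriv₁_lieForm (hS : IsOpen S) (hX : SmoothField X S) (hα : SmoothField α S)
    (hx : x ∈ S) (i j : Fin n) :
    extDeriv₁ (lieForm X α) x i j = lieTwo X (extDeriv₁ α) x i j := by
  have dX := fun m => HyperCRToda.hasD_pd (hX.diffForm hS hx m)
  have dα := fun m => HyperCRToda.hasD_pd (hα.diffForm hS hx m)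
  have h : ∀ j, HasD (fun y => lieForm X α y j) _ x := fun j =>
    (HasD.sum fun m _ => (dX m).mul (hα.hasD_pd hS hx m j)).add
      (HasD.sum fun m _ => (dα m).mul (hX.hasD_pd hS hx j m))
  have cX : ∀ a b m, pd a (pd b (fun y => X y m)) x = pd b (pd a (fun y => X y m)) x :=
    fun a b m => pd_comm (((hX m).contDiffAt (hS.mem_nhds hx)).of_le two_le_infty) a b
  have cα : ∀ a b m, pd a (pd b (fun y => α y m)) x = pd b (pd a (fun y => α y m)) x :=
    fun a b m => pd_comm (((hα m).contDiffAt (hS.mem_nhds hx)).of_le two_le_infty) a b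
  have hd : ∀ i j, HasD (fun y => extDeriv₁ α y i j) _ x := fun i j =>
    (hα.hasD_pd hS hx i j).sub (hα.hasD_pd hS hx j i)
  rw [extDeriv₁, (h i).pd, (h j).pd, lieTwo, (hd i j).dirD]
  simp only [← sum_add_distrib, ← sum_sub_distrib]
  refine sum_congr rfl fun m _ => ?_
  rw [cX i j m, cα m i j, cα m j i, extDeriv₁, extDeriv₁]
  ring

theorem lieForm_pd (hS : IsOpen S) (hX : SmoothField X S) (hf : ContDiffOn ℝ ∞ f S) (hx : x ∈ S)
    (i : Fin n) : lieForm X (fun y i => pd i f y) x i = pd i (dirD X f) x := by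
  have dX := fun m => HyperCRToda.hasD_pd (hX.diffForm hS hx m)
  have hp : ∀ k, HasD (pd k f) (fun i => pd i (pd k f) x) x := fun k =>
    HyperCRToda.hasD_pd (((contDiffOn_pd hS hf k).contDiffAt
      (hS.mem_nhds hx)).differentiableAt (by simp))
  have h : HasD (dirD X f) _ x := HasD.sum fun m _ => (dX m).mul (hp m)
  rw [h.pd, lieForm, dirD, ← sum_add_distrib]
  refine sum_congr rfl fun m _ => ?_
  rw [pd_comm ((hf.contDiffAt (hS.mem_nhds hx)).of_le two_le_infty) m i]
  ring

end lie

/-! ### Killing fields and scalar invariants -/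

section killing

variable {X : Field n} {x : Pt n} {S : Set (Pt n)} {g : Metric n} {φ : Pt n → ℝ}
  {e : Pt n → Matrix (Fin n) (Fin n) ℝ} {A : Pt n → Fin n → Matrix (Fin n) (Fin n) ℝ} {β : Field n}

theorem contDiffOn_dirD (hS : IsOpen S) (hX : SmoothField X S) {f : Pt n → ℝ}
    (hf : ContDiffOn ℝ ∞ f S) : ContDiffOn ℝ ∞ (dirD X f) S :=
  ContDiffOn.sum fun m _ => (hX m).mul (contDiffOn_pd hS hf m)

theorem SmoothField.lieForm (hX : SmoothField X S) {α : Field n} (hS : IsOpen S)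
    (hα : SmoothField α S) : SmoothField (lieForm X α) S := fun i =>
  (contDiffOn_dirD hS hX (hα i)).add
    (ContDiffOn.sum fun m _ => (hα m).mul (contDiffOn_pd hS (hX m) i))

/-- The matrix `ν` with `L_X eₐ = ∑ b, ν a b e_b`. -/
def lieFrame (X : Field n) (e : Pt n → Matrix (Fin n) (Fin n) ℝ) :
    Pt n → Matrix (Fin n) (Fin n) ℝ := fun x =>
  Matrix.of (fun a => lieForm X (fun y => e y a) x) * (e x)⁻¹

theorem smoothMatrix_lieFrame (hS : IsOpen S) (hX : SmoothField X S) (he : SmoothMatrix e S)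
    (hd : ∀ x ∈ S, (e x).det ≠ 0) : SmoothMatrix (lieFrame X e) S :=
  SmoothMatrix.mul (fun a i => hX.lieForm hS (fun j => he a j) i) (he.inv hd)

theorem lieForm_frame (hd : (e x).det ≠ 0) (a i : Fin n) :
    lieForm X (fun y => e y a) x i = ∑ b, lieFrame X e x a b * e x b i := by
  have : lieFrame X e x * e x = Matrix.of fun a => lieForm X (fun y => e y a) x := by
    rw [lieFrame, Matrix.mul_assoc, Matrix.nonsing_inv_mul _ (isUnit_iff_ne_zero.2 hd),
      Matrix.mul_one]
  exact (congrFun (congrFun this a) i).symm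

theorem eq_zero_of_sum_coframe₂ {e : Matrix (Fin n) (Fin n) ℝ} (hd : e.det ≠ 0)
    {N : Fin n → Fin n → ℝ} (h : ∀ i j, ∑ b, ∑ c, N b c * e b i * e c j = 0) (b c : Fin n) :
    N b c = 0 := by
  refine eq_zero_of_sum_coframe hd (v := fun b => N b c) (fun i => ?_) b
  refine eq_zero_of_sum_coframe hd (v := fun c => ∑ b, N b c * e b i) (fun j => ?_) c
  rw [← h i j, sum_comm]
  exact sum_congr rfl fun c _ => sum_mul _ _ _

theorem lieMetric_frame (hc : IsConformalCoframe g (fun _ => 1) e S) (hx : x ∈ S) (i j : Fin n) :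
    lieMetric X g x i j = ∑ a, (lieForm X (fun y => e y a) x i * e x a j
      + e x a i * lieForm X (fun y => e y a) x j) := by
  simp only [lieMetric, (hc.hasD_metric hx i j).pd, pd_const, hc.eq x hx, lieForm, dirD, zero_mul,
    one_mul, add_mul, mul_add, mul_sum, sum_mul, sum_add_distrib]
  rw [sum_comm (f := fun k a => X x k * (pd k (fun y => e y a i) x * e x a j)),
    sum_comm (f := fun k a => X x k * (e x a i * pd k (fun y => e y a j) x)),
    sum_comm (f := fun k a => e x a k * e x a j * pd i (fun y => X y k) x),
    sum_comm (f := fun k a => e x a i * e x a k * pd j (fun y => X y k) x)]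
  simp only [← sum_add_distrib]
  exact sum_congr rfl fun a _ => sum_congr rfl fun k _ => by ring

theorem lieFrame_skew (hc : IsConformalCoframe g (fun _ => 1) e S) (hx : x ∈ S)
    (hX : ∀ i j, lieMetric X g x i j = 0) (a b : Fin n) :
    lieFrame X e x a b = -lieFrame X e x b a := by
  refine eq_neg_of_add_eq_zero_left (eq_zero_of_sum_coframe₂ (hc.det_ne x hx)
    (N := fun a b => lieFrame X e x a b + lieFrame X e x b a) (fun i j => ?_) a b)
  rw [← hX i j, lieMetric_frame hc hx]
  simp only [lieForm_frame (hc.det_ne x hx), sum_mul, mul_sum, add_mul,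
    sum_add_distrib]
  rw [sum_comm (f := fun a b => lieFrame X e x b a * e x a i * e x b j)]
  have h1 : ∑ a, ∑ b, lieFrame X e x a b * e x a i * e x b j
      = ∑ a, ∑ b, e x a i * (lieFrame X e x a b * e x b j) :=
    sum_congr rfl fun a _ => sum_congr rfl fun k _ => by ring
  rw [h1, add_comm]

theorem skew_eq_zero {e : Matrix (Fin n) (Fin n) ℝ} (hd : e.det ≠ 0)
    {μ : Fin n → Fin n → Fin n → ℝ} (hμ : ∀ a b i, μ a b i = -μ b a i)
    (h : ∀ a i j, ∑ b, wedge (μ a b) (e b) i j = 0) (a b i : Fin n) : μ a b i = 0 := by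
  have hi := Matrix.nonsing_inv_mul _ (isUnit_iff_ne_zero.2 hd)
  obtain ⟨N, hN, N1⟩ : ∃ N : Fin n → Fin n → Fin n → ℝ,
      (∀ a b i, μ a b i = ∑ c, N a b c * e c i) ∧ ∀ a b c, N a b c = -N b a c := by
    refine ⟨fun a b c => ∑ k, μ a b k * e⁻¹ k c, fun a b i => ?_, fun a b c => ?_⟩
    · have := congrFun (congrArg (Matrix.vecMul (μ a b)) hi) i
      rw [Matrix.vecMul_one, ← Matrix.vecMul_vecMul] at this
      exact this.symm
    · rw [← sum_neg_distrib]
      exact sum_congr rfl fun k _ => by rw [hμ a b, neg_mul]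
  have N2 : ∀ a b c, N a b c = N a c b := fun a b c => by
    refine (sub_eq_zero.1 (eq_zero_of_sum_coframe₂ hd (N := fun b c => N a b c - N a c b)
      (fun i j => ?_) b c))
    have := h a j i
    simp only [wedge, hN a, sum_sub_distrib, sum_mul] at this
    rw [sum_comm (f := fun b c => N a b c * e c i * e b j)] at this
    simp only [sub_mul, sum_sub_distrib]
    have h1 : ∀ i j, ∑ b, ∑ c, N a b c * e b i * e c j = ∑ b, ∑ c, N a b c * e c j * e b i :=
      fun i j => sum_congr rfl fun b _ => sum_congr rfl fun c _ => by ring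
    rw [h1, ← this]
  have N3 : ∀ a b c, N a b c = 0 := fun a b c => by
    have h1 := N1 a b c
    have h2 := N2 b a c
    have h3 := N1 b c a
    have h4 := N2 c b a
    have h5 := N1 c a b
    have h6 := N2 a c b
    linarith
  rw [hN]
  exact sum_eq_zero fun c _ => by rw [N3, zero_mul]

theorem ContDiffOn.diffAt {f : Pt n → ℝ} (hf : ContDiffOn ℝ ∞ f S) (hS : IsOpen S) (hx : x ∈ S) :
    DifferentiableAt ℝ f x := (hf.contDiffAt (hS.mem_nhds hx)).differentiableAt (by simp)

/-- The variation of a metric connection along a Killing field. -/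
theorem lieForm_connection (hc : IsConformalCoframe g (fun _ => 1) e S)
    (hA : ∀ a b, SmoothField (fun y i => A y i a b) S) (hs : ∀ x i a b, A x i a b = -A x i b a)
    (hT : IsTorsionFree e A (fun _ _ => 0) S) (hX : IsKillingOn g X S) (hx : x ∈ S)
    (i a b : Fin n) :
    lieForm X (fun y i => A y i a b) x i = -pd i (fun y => lieFrame X e y a b) x
      - (A x i * lieFrame X e x - lieFrame X e x * A x i) a b := by
  have hd := hc.det_ne x hx
  have hν := smoothMatrix_lieFrame hc.isOpen hX.1 hc.smooth hc.det_ne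
  have hν' := fun a b => ContDiffOn.diffAt (hν a b) hc.isOpen hx
  have he : ∀ a, SmoothField (fun y => e y a) S := fun a j => hc.smooth a j
  have hsν := lieFrame_skew hc hx (hX.2 x hx)
  set ν := lieFrame X e with hνd
  have hLs : ∀ a b i, lieForm X (fun y i => A y i a b) x i
      = -lieForm X (fun y i => A y i b a) x i := by
    intro a b i
    have := lieForm_sum_smul (X := X) (ι := Unit) (f := fun _ _ => -1)
      (α := fun _ y i => A y i b a) (x := x) (fun _ => differentiableAt_const _)
      (fun _ => (hA b a).diffForm hc.isOpen hx) i
    simp only [Finset.univ_unique, Finset.sum_singleton, dirD_const, zero_mul, zero_add,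
      neg_mul, one_mul, ← hs] at this
    simpa only [hs _ _ b a] using this
  have hsd : ∀ a b i, pd i (fun y => ν y a b) x = -pd i (fun y => ν y b a) x := by
    intro a b i
    rw [← (hasD_pd (hν' b a)).neg.pd i]
    refine pd_congr i ?_
    filter_upwards [hc.isOpen.mem_nhds hx] with y hy
    exact lieFrame_skew hc hy (hX.2 y hy) a b
  have hprod : ∀ a b i, (A x i * ν x - ν x * A x i) a b = -(A x i * ν x - ν x * A x i) b a := by
    intro a b i
    simp only [Matrix.sub_apply, Matrix.mul_apply, ← sum_sub_distrib,
      ← sum_neg_distrib]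
    exact sum_congr rfl fun c _ => by
      rw [hs x i a c, hs x i c b, hsν a c, hsν c b]; ring
  have key := skew_eq_zero hd (μ := fun a b i => lieForm X (fun y i => A y i a b) x i
    + pd i (fun y => ν y a b) x + (A x i * ν x - ν x * A x i) a b) (fun a b i => by
      rw [hLs a b, hsd a b, hprod a b]; ring) ?_ a b i
  · linarith
  intro a i j
  have t1 : ∀ y ∈ S, ∀ a i j, extDeriv₁ (fun y => e y a) y i j
      = ∑ b, wedge (fun i => -A y i a b) (e y b) i j := by
    intro y hy a i j
    have := hT y hy a i j
    simp only [zero_mul, sub_zero, add_zero] at this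
    rw [eq_neg_of_add_eq_zero_left this, ← sum_neg_distrib]
    exact sum_congr rfl fun b _ => by simp only [wedge]; ring
  have t2 := extDeriv₁_lieForm hc.isOpen hX.1 (he a) hx i j
  have hF : ∀ᶠ y in nhds x, extDeriv₁ (fun y => e y a) y
      = fun i j => ∑ b, wedge (fun i => -A y i a b) (e y b) i j := by
    filter_upwards [hc.isOpen.mem_nhds hx] with y hy
    funext i j
    exact t1 y hy a i j
  have dA : ∀ b, DiffForm (fun y i => -A y i a b) x := fun b i =>
    ((hA a b).diffForm hc.isOpen hx i).neg
  have de : ∀ b, DiffForm (fun y => e y b) x := fun b => (he b).diffForm hc.isOpen hx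
  have nA : ∀ b i, lieForm X (fun y i => -A y i a b) x i = -lieForm X (fun y i => A y i a b) x i := by
    intro b i
    rw [hLs a b, neg_neg]
    simp only [← hs _ _ b a]
  rw [lieTwo_congr hF, lieTwo_sum (F := fun b y i j => wedge (fun i => -A y i a b) (e y b) i j)
    fun b i j => (((dA b i).mul (de b j)).sub ((dA b j).mul (de b i)))] at t2
  simp only [fun b => lieTwo_wedge (X := X) (dA b) (de b) i j] at t2
  have t3 : extDeriv₁ (lieForm X (fun y => e y a)) x i j
      = extDeriv₁ (fun y i => ∑ b, ν y a b * e y b i) x i j := by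
    refine extDeriv₁_congr ?_ i j
    filter_upwards [hc.isOpen.mem_nhds hx] with y hy i
    exact lieForm_frame (hc.det_ne y hy) a i
  rw [t3, extDeriv₁_sum_smul (fun b => hν' a b) de] at t2
  simp only [t1 x hx, wedge, nA, lieForm_frame hd] at t2
  simp only [wedge, Matrix.sub_apply, Matrix.mul_apply]
  have s1 : ∀ i j, ∑ b, ν x a b * ∑ c, (-A x i b c * e x c j - -A x j b c * e x c i)
      = ∑ b, (-(∑ c, ν x a c * A x i c b) * e x b j + (∑ c, ν x a c * A x j c b) * e x b i) := by
    intro i j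
    simp only [mul_sum, sum_mul, ← sum_neg_distrib, ← sum_add_distrib]
    rw [sum_comm]
    exact sum_congr rfl fun b _ => sum_congr rfl fun c _ => by ring
  have s2 : ∀ i j, ∑ b, A x i a b * ∑ c, ν x b c * e x c j
      = ∑ b, (∑ c, A x i a c * ν x c b) * e x b j := by
    intro i j
    simp only [mul_sum, sum_mul]
    rw [sum_comm]
    exact sum_congr rfl fun b _ => sum_congr rfl fun c _ => by ring
  have s3 := s2 i j
  have s4 := s2 j i
  have s5 := s1 i j
  simp only [sum_add_distrib, sum_sub_distrib, neg_mul, add_mul, sub_mul,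
    sum_neg_distrib] at t2 s3 s4 s5 ⊢
  linarith

end killing

section invariants

variable {X : Field n} {x : Pt n} {S : Set (Pt n)} {g : Metric n} {φ : Pt n → ℝ}
  {e : Pt n → Matrix (Fin n) (Fin n) ℝ} {A : Pt n → Fin n → Matrix (Fin n) (Fin n) ℝ} {β : Field n}

/-- The variation of the curvature matrices of a metric connection along a Killing field. -/
theorem lieTwo_curvMatrix (hc : IsConformalCoframe g (fun _ => 1) e S)
    (hA : ∀ a b, SmoothField (fun y i => A y i a b) S) (hs : ∀ x i a b, A x i a b = -A x i b a)
    (hT : IsTorsionFree e A (fun _ _ => 0) S) (hX : IsKillingOn g X S) (hx : x ∈ S)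
    (i j a b : Fin n) :
    lieTwo X (fun y i j => curvMatrix A y i j a b) x i j
      = ∑ c, (lieFrame X e x a c * curvMatrix A x i j c b
        - curvMatrix A x i j a c * lieFrame X e x c b) := by
  have hν := smoothMatrix_lieFrame hc.isOpen hX.1 hc.smooth hc.det_ne
  have hν' := fun a b => hasD_pd (ContDiffOn.diffAt (hν a b) hc.isOpen hx)
  have hν'' := fun i a b => hasD_pd (ContDiffOn.diffAt (contDiffOn_pd hc.isOpen (hν a b) i)
    hc.isOpen hx)
  have hA' := fun a b => (hA a b).diffForm hc.isOpen hx
  have L := fun i a b => lieForm_connection hc hA hs hT hX hx i a b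
  set ν := lieFrame X e with hνd
  have hext : ∀ a b, extDeriv₁ (lieForm X fun y i => A y i a b) x i j
      = (-(Matrix.of (fun a b => pd i (fun y => A y j a b) x) * ν x
          + A x j * Matrix.of (fun a b => pd i (fun y => ν y a b) x)
          - (Matrix.of (fun a b => pd i (fun y => ν y a b) x) * A x j
            + ν x * Matrix.of (fun a b => pd i (fun y => A y j a b) x)))
        + (Matrix.of (fun a b => pd j (fun y => A y i a b) x) * ν x
          + A x i * Matrix.of (fun a b => pd j (fun y => ν y a b) x)
          - (Matrix.of (fun a b => pd j (fun y => ν y a b) x) * A x i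
            + ν x * Matrix.of (fun a b => pd j (fun y => A y i a b) x)))) a b := by
    intro a b
    have h1 : ∀ᶠ y in nhds x, ∀ i, lieForm X (fun y i => A y i a b) y i
        = -pd i (fun y => ν y a b) y - (∑ c, A y i a c * ν y c b - ∑ c, ν y a c * A y i c b) := by
      filter_upwards [hc.isOpen.mem_nhds hx] with y hy i
      exact lieForm_connection hc hA hs hT hX hy i a b
    rw [extDeriv₁_congr h1]
    have h2 : ∀ i, HasD (fun y => -pd i (fun y => ν y a b) y
        - (∑ c, A y i a c * ν y c b - ∑ c, ν y a c * A y i c b)) _ x := fun i =>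
      (hν'' i a b).neg.sub ((HasD.sum (s := Finset.univ) fun c _ =>
        (hasD_pd (hA' a c i)).mul (hν' c b)).sub (HasD.sum (s := Finset.univ) fun c _ =>
          (hν' a c).mul (hasD_pd (hA' c b i))))
    rw [extDeriv₁, (h2 i).pd, (h2 j).pd,
      pd_comm (((hν a b).contDiffAt (hc.isOpen.mem_nhds hx)).of_le two_le_infty) i j]
    simp only [Matrix.add_apply, Matrix.sub_apply, Matrix.neg_apply, Matrix.mul_apply,
      Matrix.of_apply, sum_add_distrib]
    ring
  have e1 : (fun y i j => curvMatrix A y i j a b) = fun y i j =>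
      extDeriv₁ (fun y i => A y i a b) y i j
        + ∑ c, wedge (fun i => A y i a c) (fun i => A y i c b) i j := rfl
  have d1 : ∀ i j, DifferentiableAt ℝ (fun y => extDeriv₁ (fun y i => A y i a b) y i j) x :=
    fun i j => ContDiffOn.diffAt ((contDiffOn_pd hc.isOpen (hA a b j) i).sub
      (contDiffOn_pd hc.isOpen (hA a b i) j)) hc.isOpen hx
  have d2 : ∀ c i j, DifferentiableAt ℝ
      (fun y => wedge (fun i => A y i a c) (fun i => A y i c b) i j) x := fun c i j =>
    ((hA' a c i).mul (hA' c b j)).sub ((hA' a c j).mul (hA' c b i))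
  rw [e1, lieTwo_add d1 (fun i j => DifferentiableAt.fun_sum fun c _ => d2 c i j),
    lieTwo_sum (F := fun c y i j => wedge (fun i => A y i a c) (fun i => A y i c b) i j) d2,
    ← extDeriv₁_lieForm hc.isOpen hX.1 (hA a b) hx, hext]
  rw [sum_congr rfl fun c _ => lieTwo_wedge (X := X) (hA' a c) (hA' c b) i j]
  simp only [wedge, L]
  have key : ∀ (Ai Aj v Ni Nj Dij Dji : Matrix (Fin n) (Fin n) ℝ),
      (-(Dij * v + Aj * Ni - (Ni * Aj + v * Dij)) + (Dji * v + Ai * Nj - (Nj * Ai + v * Dji)))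
      + ((-Ni - (Ai * v - v * Ai)) * Aj - (-Nj - (Aj * v - v * Aj)) * Ai
        + (Ai * (-Nj - (Aj * v - v * Aj)) - Aj * (-Ni - (Ai * v - v * Ai))))
      = v * (Dij - Dji + (Ai * Aj - Aj * Ai)) - (Dij - Dji + (Ai * Aj - Aj * Ai)) * v := by
    intros; noncomm_ring
  have := congrFun (congrFun (key (A x i) (A x j) (ν x)
    (Matrix.of (fun a b => pd i (fun y => ν y a b) x))
    (Matrix.of (fun a b => pd j (fun y => ν y a b) x))
    (Matrix.of (fun a b => pd i (fun y => A y j a b) x))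
    (Matrix.of (fun a b => pd j (fun y => A y i a b) x))) a) b
  rw [Matrix.add_apply] at this
  have hF : Matrix.of (curvMatrix A x i j) = Matrix.of (fun a b => pd i (fun y => A y j a b) x)
      - Matrix.of (fun a b => pd j (fun y => A y i a b) x) + (A x i * A x j - A x j * A x i) := by
    ext a b
    simp [curvMatrix, extDeriv₁, Matrix.mul_apply, sum_sub_distrib]
  rw [← hF] at this
  convert this using 1
  · congr 1
    simp only [Matrix.add_apply, Matrix.sub_apply (_ * _) (_ * _), Matrix.mul_apply (N := A x i),
      Matrix.mul_apply (N := A x j), Matrix.mul_apply (M := A x i), Matrix.mul_apply (M := A x j)]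
    simp only [Matrix.sub_apply, Matrix.neg_apply, Matrix.of_apply, Matrix.mul_apply,
      ← sum_sub_distrib, ← sum_add_distrib]
  · rw [Matrix.sub_apply, Matrix.mul_apply, Matrix.mul_apply, ← sum_sub_distrib]
    rfl

theorem sum_skew_mul_eq_zero {ι : Type*} [Fintype ι] {ν G : ι → ι → ℝ}
    (hν : ∀ a b, ν a b = -ν b a) (hG : ∀ a b, G a b = G b a) : ∑ a, ∑ b, ν a b * G a b = 0 := by
  have h : ∑ a, ∑ b, ν a b * G a b = -∑ a, ∑ b, ν a b * G a b := by
    conv_lhs => rw [sum_comm]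
    simp only [← sum_neg_distrib]
    exact sum_congr rfl fun a _ => sum_congr rfl fun b _ => by
      rw [hν b a, hG b a, neg_mul]
  linarith

/-- The squared length of the differential of an invariant function is invariant. -/
theorem dirD_gradient_eq_zero (hc : IsConformalCoframe g (fun _ => 1) e S)
    (hX : IsKillingOn g X S) {f : Pt n → ℝ} (hf : ContDiffOn ℝ ∞ f S)
    (h0 : ∀ x ∈ S, dirD X f x = 0) {F : Fin n → Pt n → ℝ}
    (hF : ∀ x ∈ S, ∀ i, pd i f x = ∑ a, F a x * e x a i) (hx : x ∈ S) :
    dirD X (fun y => ∑ a, F a y ^ 2) x = 0 := by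
  have hi := hc.smooth.inv hc.det_ne
  have hFe : ∀ y ∈ S, ∀ a, F a y = ∑ i, pd i f y * (e y)⁻¹ i a := by
    intro y hy a
    have h1 := Matrix.mul_nonsing_inv _ (isUnit_iff_ne_zero.2 (hc.det_ne y hy))
    have := congrFun (congrArg (Matrix.vecMul (fun a => F a y)) h1) a
    rw [Matrix.vecMul_one, ← Matrix.vecMul_vecMul] at this
    rw [← this]
    simp only [hF y hy]
    rfl
  have hFs : ∀ a, DifferentiableAt ℝ (F a) x := fun a => ContDiffOn.diffAt
    ((ContDiffOn.sum fun i _ => (contDiffOn_pd hc.isOpen hf i).mul (hi i a)).congr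
      fun y hy => hFe y hy a) hc.isOpen hx
  have he : ∀ a, DiffForm (fun y => e y a) x := fun a j =>
    ContDiffOn.diffAt (hc.smooth a j) hc.isOpen hx
  have hF2 : ∀ b, dirD X (F b) x = -∑ a, F a x * lieFrame X e x a b := by
    refine fun b => eq_neg_of_add_eq_zero_left (eq_zero_of_sum_coframe (hc.det_ne x hx)
      (v := fun b => dirD X (F b) x + ∑ a, F a x * lieFrame X e x a b) (fun i => ?_) b)
    have h1 := lieForm_pd hc.isOpen hX.1 hf hx i
    have h2 : lieForm X (fun y i => pd i f y) x i
        = lieForm X (fun y i => ∑ a, F a y * e y a i) x i := by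
      rw [lieForm, lieForm, dirD_congr (g := fun y => ∑ a, F a y * e y a i)]
      · exact congrArg₂ _ rfl (sum_congr rfl fun m _ => by rw [hF x hx])
      · filter_upwards [hc.isOpen.mem_nhds hx] with y hy using hF y hy i
    have h3 : pd i (dirD X f) x = 0 := by
      rw [pd_congr (g := fun _ => 0) i, pd_const]
      filter_upwards [hc.isOpen.mem_nhds hx] with y hy using h0 y hy
    rw [h3, h2, lieForm_sum_smul hFs he] at h1
    rw [← h1]
    simp only [lieForm_frame (hc.det_ne x hx), add_mul, sum_add_distrib, mul_sum,
      sum_mul]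
    rw [sum_comm (f := fun b a => F a x * lieFrame X e x a b * e x b i)]
    simp only [mul_assoc]
  rw [dirD_sum (f := fun a y => F a y ^ 2) fun a => (hFs a).pow 2]
  have h4 : ∀ b, dirD X (fun y => F b y ^ 2) x
      = ∑ a, lieFrame X e x a b * (-2 * (F a x * F b x)) := by
    intro b
    have : (fun y => F b y ^ 2) = fun y => F b y * F b y := funext fun y => sq _
    rw [this, dirD_mul (hFs b) (hFs b), hF2]
    simp only [neg_mul, mul_neg, sum_mul, mul_sum, ← sum_neg_distrib,
      ← sum_add_distrib]
    exact sum_congr rfl fun a _ => by ring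
  simp only [h4]
  rw [sum_comm]
  exact sum_skew_mul_eq_zero (lieFrame_skew hc hx (hX.2 x hx)) fun a b => by ring

/-- The squared length of the curvature operator is invariant. -/
theorem dirD_curvature_eq_zero (hc : IsConformalCoframe g (fun _ => 1) e S)
    (hA : ∀ a b, SmoothField (fun y i => A y i a b) S) (hs : ∀ x i a b, A x i a b = -A x i b a)
    (hT : IsTorsionFree e A (fun _ _ => 0) S) (hX : IsKillingOn g X S)
    {K : Fin n → Fin n → Fin n → Fin n → Pt n → ℝ}
    (hK : ∀ x ∈ S, ∀ i j a b, curvMatrix A x i j a b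
      = ∑ c, ∑ d, K a b c d x * e x c i * e x d j)
    (hx : x ∈ S) :
    dirD X (fun y => ∑ a, ∑ b, ∑ c, ∑ d, K a b c d y ^ 2) x = 0 := by
  have hi := hc.smooth.inv hc.det_ne
  have hKe : ∀ y ∈ S, ∀ a b c d, K a b c d y
      = ∑ i, ∑ j, curvMatrix A y i j a b * (e y)⁻¹ i c * (e y)⁻¹ j d := by
    intro y hy a b c d
    have h1 := Matrix.mul_nonsing_inv _ (isUnit_iff_ne_zero.2 (hc.det_ne y hy))
    have h2 : Matrix.of (fun i j => curvMatrix A y i j a b)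
        = (e y).transpose * Matrix.of (fun c d => K a b c d y) * e y := by
      ext i j
      rw [Matrix.of_apply, hK y hy, Matrix.mul_apply]
      simp only [Matrix.mul_apply, sum_mul, Matrix.transpose_apply, Matrix.of_apply]
      rw [sum_comm]
      exact sum_congr rfl fun c _ => sum_congr rfl fun d _ => by ring
    have h3 : Matrix.of (fun c d => K a b c d y) = ((e y)⁻¹).transpose
        * Matrix.of (fun i j => curvMatrix A y i j a b) * (e y)⁻¹ := by
      rw [h2, Matrix.mul_assoc, Matrix.mul_assoc, Matrix.mul_assoc, h1, Matrix.mul_one,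
        ← Matrix.mul_assoc, ← Matrix.transpose_mul, h1, Matrix.transpose_one, Matrix.one_mul]
    have h4 := congrFun (congrFun h3 c) d
    rw [Matrix.of_apply, Matrix.mul_apply] at h4
    rw [h4]
    simp only [Matrix.mul_apply, sum_mul, Matrix.transpose_apply, Matrix.of_apply]
    rw [sum_comm]
    exact sum_congr rfl fun c _ => sum_congr rfl fun d _ => by ring
  have hcurv : ∀ i j a b, ContDiffOn ℝ ∞ (fun y => curvMatrix A y i j a b) S := fun i j a b =>
    ((contDiffOn_pd hc.isOpen (hA a b j) i).sub (contDiffOn_pd hc.isOpen (hA a b i) j)).add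
      (ContDiffOn.sum fun c _ => ((hA a c i).mul (hA c b j)).sub ((hA a c j).mul (hA c b i)))
  have hKs : ∀ a b c d, DifferentiableAt ℝ (K a b c d) x := fun a b c d => ContDiffOn.diffAt
    ((ContDiffOn.sum fun i _ => ContDiffOn.sum fun j _ =>
      ((hcurv i j a b).mul (hi i c)).mul (hi j d)).congr fun y hy => hKe y hy a b c d) hc.isOpen hx
  have he : ∀ a, DiffForm (fun y => e y a) x := fun a j =>
    ContDiffOn.diffAt (hc.smooth a j) hc.isOpen hx
  have hd := hc.det_ne x hx
  have hsν := lieFrame_skew hc hx (hX.2 x hx)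
  set ν := lieFrame X e with hνd
  have hK2 : ∀ a b c d, dirD X (K a b c d) x
      = ∑ f, (ν x a f * K f b c d x + ν x b f * K a f c d x + ν x c f * K a b f d x
        + ν x d f * K a b c f x) := by
    intro a b c d
    refine sub_eq_zero.1 (eq_zero_of_sum_coframe₂ hd (N := fun c d => dirD X (K a b c d) x
      - ∑ f, (ν x a f * K f b c d x + ν x b f * K a f c d x + ν x c f * K a b f d x
        + ν x d f * K a b c f x)) (fun i j => ?_) c d)
    have h1 := lieTwo_curvMatrix hc hA hs hT hX hx i j a b
    have h2 : lieTwo X (fun y i j => curvMatrix A y i j a b) x i j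
        = ∑ c, ∑ d, (dirD X (K a b c d) x * (e x c i * e x d j)
          + K a b c d x * ((∑ f, ν x c f * e x f i) * e x d j
            + e x c i * ∑ f, ν x d f * e x f j)) := by
      have ev : ∀ᶠ y in nhds x, (fun i j => curvMatrix A y i j a b)
          = fun i j => ∑ c, ∑ d, K a b c d y * e y c i * e y d j := by
        filter_upwards [hc.isOpen.mem_nhds hx] with y hy
        funext i j
        exact hK y hy i j a b
      rw [lieTwo_congr ev]
      have hdd : ∀ c d i j, DifferentiableAt ℝ (fun y => K a b c d y * e y c i * e y d j) x :=
        fun c d i j => ((hKs a b c d).mul (he c i)).mul (he d j)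
      rw [lieTwo_sum (F := fun c y i j => ∑ d, K a b c d y * e y c i * e y d j)
        fun c i j => DifferentiableAt.fun_sum fun d _ => hdd c d i j]
      refine sum_congr rfl fun c _ => ?_
      rw [lieTwo_sum (F := fun d y i j => K a b c d y * e y c i * e y d j) fun d i j => hdd c d i j]
      refine sum_congr rfl fun d _ => ?_
      rw [← lieForm_frame hd, ← lieForm_frame hd]
      simp only [lieTwo, lieForm]
      rw [dirD_mul (f := fun y => K a b c d y * e y c i) ((hKs a b c d).mul (he c i)) (he d j),
        dirD_mul (hKs a b c d) (he c i)]
      simp only [add_mul, mul_add, sum_mul, mul_sum, sum_add_distrib]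
      ring_nf
    rw [h2] at h1
    simp only [hK x hx] at h1
    have t1 : ∑ f, ν x a f * ∑ c, ∑ d, K f b c d x * e x c i * e x d j
        = ∑ c, ∑ d, (∑ f, ν x a f * K f b c d x) * (e x c i * e x d j) := by
      simp only [mul_sum, sum_mul]
      rw [sum_comm]
      refine sum_congr rfl fun c _ => ?_
      rw [sum_comm]
      exact sum_congr rfl fun d _ => sum_congr rfl fun f _ => by ring
    have t2 : ∑ f, (∑ c, ∑ d, K a f c d x * e x c i * e x d j) * ν x f b
        = -∑ c, ∑ d, (∑ f, ν x b f * K a f c d x) * (e x c i * e x d j) := by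
      simp only [sum_mul, ← sum_neg_distrib]
      rw [sum_comm]
      refine sum_congr rfl fun c _ => ?_
      rw [sum_comm]
      exact sum_congr rfl fun d _ => sum_congr rfl fun f _ => by rw [hsν f b]; ring
    have t3 : ∑ c, ∑ d, K a b c d x * ((∑ f, ν x c f * e x f i) * e x d j)
        = -∑ c, ∑ d, (∑ f, ν x c f * K a b f d x) * (e x c i * e x d j) := by
      simp only [mul_sum, sum_mul, ← sum_neg_distrib]
      rw [sum_comm, sum_comm (f := fun c d => ∑ f, -_)]
      refine sum_congr rfl fun d _ => ?_
      rw [sum_comm]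
      exact sum_congr rfl fun c _ => sum_congr rfl fun f _ => by rw [hsν f c]; ring
    have t4 : ∑ c, ∑ d, K a b c d x * (e x c i * ∑ f, ν x d f * e x f j)
        = -∑ c, ∑ d, (∑ f, ν x d f * K a b c f x) * (e x c i * e x d j) := by
      simp only [mul_sum, sum_mul, ← sum_neg_distrib]
      refine sum_congr rfl fun c _ => ?_
      rw [sum_comm]
      exact sum_congr rfl fun d _ => sum_congr rfl fun f _ => by rw [hsν f d]; ring
    simp only [mul_add, sum_add_distrib, sum_sub_distrib, t3, t4] at h1
    simp only [mul_assoc, sum_add_distrib, sum_sub_distrib, sub_mul, add_mul]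
    linarith
  have hsq : ∀ a b c d, dirD X (fun y => K a b c d y ^ 2) x
      = 2 * K a b c d x * dirD X (K a b c d) x := by
    intro a b c d
    have : (fun y => K a b c d y ^ 2) = fun y => K a b c d y * K a b c d y := funext fun y => sq _
    rw [this, dirD_mul (hKs a b c d) (hKs a b c d)]
    ring
  have z4 : ∑ a, ∑ b, ∑ c, ∑ d, ∑ f, ν x d f * (K a b c d x * K a b c f x) = 0 :=
    sum_eq_zero fun a _ => sum_eq_zero fun b _ => sum_eq_zero fun c _ =>
      sum_skew_mul_eq_zero hsν fun _ _ => mul_comm _ _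
  have z3 : ∑ a, ∑ b, ∑ c, ∑ d, ∑ f, ν x c f * (K a b c d x * K a b f d x) = 0 := by
    refine sum_eq_zero fun a _ => sum_eq_zero fun b _ => ?_
    rw [sum_comm]
    exact sum_eq_zero fun d _ => sum_skew_mul_eq_zero hsν fun _ _ => mul_comm _ _
  have z2 : ∑ a, ∑ b, ∑ c, ∑ d, ∑ f, ν x b f * (K a b c d x * K a f c d x) = 0 := by
    refine sum_eq_zero fun a _ => ?_
    rw [sum_comm]
    refine sum_eq_zero fun c _ => ?_
    rw [sum_comm]
    exact sum_eq_zero fun d _ => sum_skew_mul_eq_zero hsν fun _ _ => mul_comm _ _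
  have z1 : ∑ a, ∑ b, ∑ c, ∑ d, ∑ f, ν x a f * (K a b c d x * K f b c d x) = 0 := by
    rw [sum_comm]
    refine sum_eq_zero fun b _ => ?_
    rw [sum_comm]
    refine sum_eq_zero fun c _ => ?_
    rw [sum_comm]
    exact sum_eq_zero fun d _ => sum_skew_mul_eq_zero hsν fun _ _ => mul_comm _ _
  have hd2 : ∀ a b c d, DifferentiableAt ℝ (fun y => K a b c d y ^ 2) x :=
    fun a b c d => (hKs a b c d).pow 2
  have hd3 : ∀ a b c, DifferentiableAt ℝ (fun y => ∑ d, K a b c d y ^ 2) x :=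
    fun a b c => DifferentiableAt.fun_sum fun d _ => hd2 a b c d
  have hd4 : ∀ a b, DifferentiableAt ℝ (fun y => ∑ c, ∑ d, K a b c d y ^ 2) x :=
    fun a b => DifferentiableAt.fun_sum fun c _ => hd3 a b c
  rw [dirD_sum (f := fun a y => ∑ b, ∑ c, ∑ d, K a b c d y ^ 2)
    fun a => DifferentiableAt.fun_sum fun b _ => hd4 a b]
  have e1 : ∀ a b c d, 2 * K a b c d x * (∑ f, (ν x a f * K f b c d x + ν x b f * K a f c d x
      + ν x c f * K a b f d x + ν x d f * K a b c f x))
      = 2 * ((∑ f, ν x a f * (K a b c d x * K f b c d x))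
        + (∑ f, ν x b f * (K a b c d x * K a f c d x))
        + (∑ f, ν x c f * (K a b c d x * K a b f d x))
        + ∑ f, ν x d f * (K a b c d x * K a b c f x)) := by
    intro a b c d
    simp only [← sum_add_distrib, mul_sum]
    exact sum_congr rfl fun f _ => by ring
  have e2 : ∀ a, dirD X (fun y => ∑ b, ∑ c, ∑ d, K a b c d y ^ 2) x = ∑ b, ∑ c, ∑ d,
      2 * ((∑ f, ν x a f * (K a b c d x * K f b c d x))
        + (∑ f, ν x b f * (K a b c d x * K a f c d x))
        + (∑ f, ν x c f * (K a b c d x * K a b f d x))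
        + ∑ f, ν x d f * (K a b c d x * K a b c f x)) := by
    intro a
    rw [dirD_sum (f := fun b y => ∑ c, ∑ d, K a b c d y ^ 2) (hd4 a)]
    refine sum_congr rfl fun b _ => ?_
    rw [dirD_sum (f := fun c y => ∑ d, K a b c d y ^ 2) (hd3 a b)]
    refine sum_congr rfl fun c _ => ?_
    rw [dirD_sum (f := fun d y => K a b c d y ^ 2) (hd2 a b c)]
    exact sum_congr rfl fun d _ => by rw [hsq, hK2, e1]
  simp only [e2, ← mul_sum, sum_add_distrib, z1, z2, z3, z4]
  norm_num

end invariants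

section rescale

variable {X : Field n} {x : Pt n} {S : Set (Pt n)} {g : Metric n} {φ : Pt n → ℝ}
  {e : Pt n → Matrix (Fin n) (Fin n) ℝ} {A : Pt n → Fin n → Matrix (Fin n) (Fin n) ℝ} {β : Field n}

/-- The orthonormal coframe of a conformal coframe. -/
def orthoFrame (φ : Pt n → ℝ) (e : Pt n → Matrix (Fin n) (Fin n) ℝ) :
    Pt n → Matrix (Fin n) (Fin n) ℝ := fun x => Matrix.of fun a j => √(φ x) * e x a j

theorem IsConformalCoframe.orthonormal (hc : IsConformalCoframe g φ e S) :
    IsConformalCoframe g (fun _ => 1) (orthoFrame φ e) S where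
  isOpen := hc.isOpen
  smooth_factor := contDiffOn_const
  pos _ _ := one_pos
  smooth a j := (hc.smooth_factor.sqrt fun x hx => (hc.pos x hx).ne').mul (hc.smooth a j)
  det_ne x hx := by
    have : orthoFrame φ e x = √(φ x) • e x := rfl
    rw [this, Matrix.det_smul]
    exact mul_ne_zero (pow_ne_zero _ (Real.sqrt_pos.2 (hc.pos x hx)).ne') (hc.det_ne x hx)
  eq x hx i j := by
    rw [hc.eq x hx, one_mul, mul_sum]
    refine sum_congr rfl fun a _ => ?_
    simp only [orthoFrame, Matrix.of_apply]
    linear_combination (-(e x a i * e x a j)) * Real.sq_sqrt (hc.pos x hx).le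

theorem IsTorsionFree.orthonormal (hc : IsConformalCoframe g φ e S)
    (hβ : ∀ x ∈ S, ∀ i, pd i φ x = 2 * φ x * β x i) (hT : IsTorsionFree e A β S) :
    IsTorsionFree (orthoFrame φ e) A (fun _ _ => 0) S := by
  intro x hx a i j
  have hp := hc.pos x hx
  have hφ := ContDiffOn.diffAt hc.smooth_factor hc.isOpen hx
  have hsq : HasD (fun y => √(φ y)) (fun i => √(φ x) * β x i) x := by
    have h1 : HasFDerivAt (fun y => √(φ y)) ((1 / (2 * √(φ x))) • fderiv ℝ φ x) x :=
      hφ.hasFDerivAt.sqrt hp.ne'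
    refine ⟨h1.differentiableAt, fun i => ?_⟩
    rw [h1.fderiv, smul_apply, smul_eq_mul]
    change _ * pd i φ x = _
    have h2 := Real.sqrt_pos.2 hp
    rw [hβ x hx]
    field_simp
    rw [Real.sq_sqrt hp.le]
  have h1 := extDeriv₁_smul hsq (fun j => ContDiffOn.diffAt (hc.smooth a j) hc.isOpen hx) i j
  have h2 : extDeriv₁ (fun y => orthoFrame φ e y a) x i j
      = extDeriv₁ (fun y j => √(φ y) * e y a j) x i j := rfl
  have h3 := hT x hx a i j
  have h4 : ∑ b, (A x i a b * orthoFrame φ e x b j - A x j a b * orthoFrame φ e x b i)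
      = √(φ x) * ∑ b, (A x i a b * e x b j - A x j a b * e x b i) := by
    rw [mul_sum]
    exact sum_congr rfl fun b _ => by simp only [orthoFrame, Matrix.of_apply]; ring
  rw [h2, h1, h4]
  linear_combination √(φ x) * h3

theorem dirD_gradient_eq_zero' (hc : IsConformalCoframe g φ e S)
    (hX : IsKillingOn g X S) {f : Pt n → ℝ} (hf : ContDiffOn ℝ ∞ f S)
    (h0 : ∀ x ∈ S, dirD X f x = 0) {F : Fin n → Pt n → ℝ}
    (hF : ∀ x ∈ S, ∀ i, pd i f x = ∑ a, F a x * e x a i) (hx : x ∈ S) :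
    dirD X (fun y => (φ y)⁻¹ * ∑ a, F a y ^ 2) x = 0 := by
  rw [← dirD_gradient_eq_zero hc.orthonormal hX hf h0 (F := fun a y => (√(φ y))⁻¹ * F a y) ?_ hx]
  · refine dirD_congr ?_
    filter_upwards [hc.isOpen.mem_nhds hx] with y hy
    simp only [mul_pow, ← mul_sum, inv_pow, Real.sq_sqrt (hc.pos y hy).le]
  · intro y hy i
    have h2 := (Real.sqrt_pos.2 (hc.pos y hy)).ne'
    rw [hF y hy]
    refine sum_congr rfl fun a _ => ?_
    simp only [orthoFrame, Matrix.of_apply]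
    field_simp

theorem dirD_curvature_eq_zero' (hc : IsConformalCoframe g φ e S)
    (hβ : ∀ x ∈ S, ∀ i, pd i φ x = 2 * φ x * β x i)
    (hA : ∀ a b, SmoothField (fun y i => A y i a b) S) (hs : ∀ x i a b, A x i a b = -A x i b a)
    (hT : IsTorsionFree e A β S) (hX : IsKillingOn g X S)
    {K : Fin n → Fin n → Fin n → Fin n → Pt n → ℝ}
    (hK : ∀ x ∈ S, ∀ i j a b, curvMatrix A x i j a b
      = ∑ c, ∑ d, K a b c d x * e x c i * e x d j)
    (hx : x ∈ S) :
    dirD X (fun y => ∑ a, ∑ b, ∑ c, ∑ d, ((φ y)⁻¹ * K a b c d y) ^ 2) x = 0 := by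
  refine dirD_curvature_eq_zero hc.orthonormal hA hs (hT.orthonormal hc hβ) hX
    (fun y hy i j a b => ?_) hx
  rw [hK y hy]
  refine sum_congr rfl fun c _ => sum_congr rfl fun d _ => ?_
  simp only [orthoFrame, Matrix.of_apply]
  have h2 := hc.pos y hy
  have h3 := Real.sq_sqrt h2.le
  field_simp
  rw [h3]

end rescale

theorem IsConformalCoframe.mono {g : Metric n} {φ : Pt n → ℝ}
    {e : Pt n → Matrix (Fin n) (Fin n) ℝ} {S V : Set (Pt n)} (hc : IsConformalCoframe g φ e S)
    (hV : IsOpen V) (h : V ⊆ S) : IsConformalCoframe g φ e V where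
  isOpen := hV
  smooth_factor := hc.smooth_factor.mono h
  pos x hx := hc.pos x (h hx)
  smooth a j := (hc.smooth a j).mono h
  det_ne x hx := hc.det_ne x (h hx)
  eq x hx := hc.eq x (h hx)

theorem sum_splitMat_sq (p₁ p₂ p₃ m₁ m₂ m₃ : ℝ) :
    ∑ a, ∑ b, splitMat p₁ p₂ p₃ m₁ m₂ m₃ a b ^ 2
      = p₁ ^ 2 + p₂ ^ 2 + p₃ ^ 2 + m₁ ^ 2 + m₂ ^ 2 + m₃ ^ 2 := by
  simp [splitMat, Fin.sum_univ_four]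
  ring

theorem sum_splitK_sq (φ : ℝ) (M : Matrix (Fin 3) (Fin 3) ℝ) :
    ∑ a, ∑ b, ∑ c, ∑ d, splitK φ M a b c d ^ 2 = 12 * φ ^ 2 + 4 * ∑ k, ∑ l, M k l ^ 2 := by
  have h : ∑ a, ∑ b, ∑ c, ∑ d, splitK φ M a b c d ^ 2
      = ∑ c, ∑ d, ∑ a, ∑ b, splitK φ M a b c d ^ 2 := by
    have h1 : ∀ a, ∑ b, ∑ c, ∑ d, splitK φ M a b c d ^ 2
        = ∑ c, ∑ d, ∑ b, splitK φ M a b c d ^ 2 := fun a => by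
      rw [sum_comm]
      exact sum_congr rfl fun c _ => sum_comm
    simp only [h1]
    rw [sum_comm]
    exact sum_congr rfl fun c _ => sum_comm
  rw [h]
  simp only [splitK, sum_splitMat_sq, sum_add_distrib]
  simp only [Fin.sum_univ_three]
  ring

section einstein

variable {h : ℂ → ℂ} {U : Set ℂ} {x : Pt 4} {θ : Field 2} {X : Field 4} {V : Set (Pt 4)}

theorem contDiffOn_todaC (hU : IsOpen U) (hh : DifferentiableOn ℂ h U) :
    ContDiffOn ℝ ∞ (todaC h (0 : Fin 4) 1 2) (todaSet U h 0 1 2) :=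
  ((((contDiffOn_todaInv hU hh).pow 3).mul
    ((contDiffOn_holo hU (hh.deriv hU) 0 1).mono fun _ hx => hx.1)).mul
    ((Complex.ofRealCLM.contDiff.comp (contDiff_sphereScale 0 1)).contDiffOn.inv
    fun _ _ => Complex.ofReal_ne_zero.2 (sphereScale_pos _).ne')).congr
    fun x _ => div_eq_mul_inv _ _

theorem contDiffOn_combForm {S : Set (Pt 4)} (hS : S ⊆ einsteinDomain U h) (hU : IsOpen U)
    (hh : DifferentiableOn ℂ h U)
    (hθ : IsBetaPotential U h θ) {r : ℝ} {a b c d : Pt 4 → ℝ} (ha : ContDiffOn ℝ ∞ a S)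
    (hb : ContDiffOn ℝ ∞ b S) (hc : ContDiffOn ℝ ∞ c S) (hd : ContDiffOn ℝ ∞ d S) :
    SmoothField (combForm h θ r a b c d) S := fun i =>
  (contDiffOn_const.mul (contDiff_rotForm 0 1 i).contDiffOn).add
    ((ha.mul ((contDiffOn_re (contDiffOn_todaE hU hh i)).mono fun x hx => (hS hx).1.1)).add
    ((hb.mul ((contDiffOn_im (contDiffOn_todaE hU hh i)).mono fun x hx => (hS hx).1.1)).add
    ((hc.mul contDiffOn_const).add
    (hd.mul (((contDiffOn_potForm hU hh hθ.1 i).mono fun x hx => (hS hx).1.1).add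
      contDiffOn_const)))))

theorem smoothField_einstein (hU : IsOpen U) (hh : DifferentiableOn ℂ h U)
    (hθ : IsBetaPotential U h θ) (a b : Fin 4) :
    SmoothField (fun y i => splitConn (eAlpha₁ h θ) (eAlpha₂ h θ) (eAlpha₃ h θ) (eB₁ h θ)
      (eB₂ h θ) (eB₃ h θ) y i a b) (einsteinDomain U h) := by
  have hs : einsteinDomain U h ⊆ todaSet U h 0 1 2 := fun x hx => hx.1.1
  have hC := (contDiffOn_todaC hU hh).mono hs
  have h1 : ContDiffOn ℝ ∞ (tc₁ h 0 1 2) (einsteinDomain U h) := contDiffOn_re hC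
  have h2 : ContDiffOn ℝ ∞ (tc₂ h 0 1 2) (einsteinDomain U h) := (contDiffOn_im hC).neg
  have hq := (contDiffOn_tq (u := 0) (v := 1) (w := 2) hU hh).mono hs
  have hW := (contDiffOn_tw hU hh).mono hs
  have hw : ∀ x ∈ einsteinDomain U h, tw h x ≠ 0 := fun x hx => (mem_kahlerDomain.1 hx.1).2.ne'
  have hz : ∀ x ∈ einsteinDomain U h, x 2 ≠ 0 := fun x hx => hx.2
  have hZ : ContDiffOn ℝ ∞ (fun x : Pt 4 => x 2) (einsteinDomain U h) :=
    (contDiff_apply ℝ ℝ (2 : Fin 4)).contDiffOn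
  have hI := hZ.inv hz
  have z : ContDiffOn ℝ ∞ (fun _ : Pt 4 => (0 : ℝ)) (einsteinDomain U h) := contDiffOn_const
  have hN := (((hW.pow 2).add ((hZ.mul hq).pow 2))).div (hZ.mul hW)
    fun x hx => mul_ne_zero (hz x hx) (hw x hx)
  have hw2 : ∀ x ∈ einsteinDomain U h, tw h x ^ 2 ≠ 0 := fun x hx => pow_ne_zero 2 (hw x hx)
  have c := @contDiffOn_combForm h U θ _ (subset_refl _) hU hh hθ
  have a1 : SmoothField (eAlpha₁ h θ) (einsteinDomain U h) := c z hI.neg z z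
  have a2 : SmoothField (eAlpha₂ h θ) (einsteinDomain U h) := c hI.neg z z z
  have a3 : SmoothField (eAlpha₃ h θ) (einsteinDomain U h) := c z z hq.neg hI
  have b1 : SmoothField (eB₁ h θ) (einsteinDomain U h) :=
    c z hN ((hZ.mul h2).div hW hw) ((hZ.mul h1).div (hW.pow 2) hw2)
  have b2 : SmoothField (eB₂ h θ) (einsteinDomain U h) :=
    c hN.neg z ((hZ.mul h1).div hW hw).neg ((hZ.mul h2).div (hW.pow 2) hw2)
  have b3 : SmoothField (eB₃ h θ) (einsteinDomain U h) :=
    c ((hZ.mul h2).div hW hw) ((hZ.mul h1).div hW hw).neg hq.neg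
      ((hW.sub ((hZ.mul hq).pow 2)).div (hZ.mul (hW.pow 2))
        fun x hx => mul_ne_zero (hz x hx) (hw2 x hx)).neg
  intro i
  simp only [splitConn, fun y => splitMat_apply (eAlpha₁ h θ y i) (eAlpha₂ h θ y i)
    (eAlpha₃ h θ y i) (eB₁ h θ y i) (eB₂ h θ y i) (eB₃ h θ y i) a b]
  exact (((((contDiffOn_const.mul (a1 i)).add (contDiffOn_const.mul (a2 i))).add
    (contDiffOn_const.mul (a3 i))).add (contDiffOn_const.mul (b1 i))).add
    (contDiffOn_const.mul (b2 i))).add (contDiffOn_const.mul (b3 i))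

/-- The squared length of the antiselfdual part of the curvature. -/
def curvInv (h : ℂ → ℂ) (x : Pt 4) : ℝ :=
  (x 2 ^ 2 / tw h x) ^ 2 * ∑ k, ∑ l, eM h x k l ^ 2

/-- A Killing field of the Einstein metric preserves the length of the curvature. -/
theorem dirD_curvInv (hU : IsOpen U) (hh : DifferentiableOn ℂ h U) (hθ : IsBetaPotential U h θ)
    (hVo : IsOpen V) (hV : V ⊆ einsteinDomain U h) (hX : IsKillingOn (einsteinMetric h θ) X V)
    (hx : x ∈ V) : dirD X (curvInv h) x = 0 := by
  have hd : ∀ x ∈ einsteinDomain U h, _ := fun x hx => diffForm_einstein hU hh hθ hx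
  have hK : ∀ x ∈ V, ∀ i j a b, curvMatrix (splitConn (eAlpha₁ h θ) (eAlpha₂ h θ) (eAlpha₃ h θ)
      (eB₁ h θ) (eB₂ h θ) (eB₃ h θ)) x i j a b = ∑ c, ∑ d,
        splitK (tw h x / x 2 ^ 2) (eM h x) a b c d * frame₄ h θ x c i * frame₄ h θ x d j := by
    intro x hx i j a b
    have hx' := hV hx
    obtain ⟨g1, g2, g3, g4, g5, g6, -⟩ := hd x hx'
    rw [curvMatrix_splitConn g1 g2 g3 g4 g5 g6]
    obtain ⟨h1, h2, h3⟩ := eAlpha_curvature hU hh hθ hx' i j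
    rw [h1, h2, h3, eB₁_curvature hU hh hθ hx', eB₂_curvature hU hh hθ hx',
      eB₃_curvature hU hh hθ hx', frameForm_smul, frameForm_smul, frameForm_smul,
      splitMat_frameForm]
    simp only [smul_splitMat, mul_zero]
    simp only [splitK, mul_comm (-(tw h x / x 2 ^ 2)) 2, mul_neg]
    rfl
  have key := dirD_curvature_eq_zero' ((isConformalCoframe_einstein hU hh hθ).mono hVo hV)
    (fun x hx i => einstein_trace hU hh (hV hx) i)
    (fun a b i => (smoothField_einstein hU hh hθ a b i).mono hV) (fun x => splitConn_skew x)
    (fun x hx => isTorsionFree_einstein hU hh hθ x (hV hx)) hX (K := fun a b c d x =>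
      splitK (tw h x / x 2 ^ 2) (eM h x) a b c d) hK hx
  have e : ∀ y ∈ V, ∑ a, ∑ b, ∑ c, ∑ d, ((tw h y / y 2 ^ 2)⁻¹
      * splitK (tw h y / y 2 ^ 2) (eM h y) a b c d) ^ 2 = 12 + 4 * curvInv h y := by
    intro y hy
    have hw := (mem_kahlerDomain.1 (hV hy).1).2.ne'
    have hz : y 2 ≠ 0 := (hV hy).2
    simp only [mul_pow, ← mul_sum, sum_splitK_sq]
    rw [curvInv]
    field_simp
  have ev : (fun y => ∑ a, ∑ b, ∑ c, ∑ d, ((tw h y / y 2 ^ 2)⁻¹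
      * splitK (tw h y / y 2 ^ 2) (eM h y) a b c d) ^ 2)
        =ᶠ[nhds x] fun y => 12 + 4 * curvInv h y := by
    filter_upwards [hVo.mem_nhds hx] with y hy using e y hy
  rw [dirD_congr ev] at key
  have : ∀ m, pd m (fun y => 12 + 4 * curvInv h y) x = 4 * pd m (curvInv h) x := fun m => by
    have : (fun y => 4 * curvInv h y) = (4 : ℝ) • curvInv h := rfl
    rw [pd, fderiv_const_add, this, fderiv_const_smul_field]
    rfl
  simp only [dirD, this, mul_left_comm _ (4 : ℝ), ← mul_sum] at key
  simpa [dirD] using key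

/-- The squared length of the differential of a function independent of `t`. -/
def gradInv (h : ℂ → ℂ) (f : Pt 4 → ℝ) (x : Pt 4) : ℝ :=
  x 2 ^ 2 / tw h x * ((tp h 0 1 2 x ^ 2 + tq h 0 1 2 x ^ 2)
    * (pd 0 f x ^ 2 + pd 1 f x ^ 2) / sphereScale (planeCoord 0 1 x) ^ 2 + pd 2 f x ^ 2)

theorem dirD_gradInv (hU : IsOpen U) (hh : DifferentiableOn ℂ h U) (hθ : IsBetaPotential U h θ)
    (hVo : IsOpen V) (hV : V ⊆ einsteinDomain U h) (hX : IsKillingOn (einsteinMetric h θ) X V)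
    {f : Pt 4 → ℝ} (hf : ContDiffOn ℝ ∞ f V) (h0 : ∀ x ∈ V, dirD X f x = 0)
    (ht : ∀ x ∈ V, pd 3 f x = 0) (hx : x ∈ V) : dirD X (gradInv h f) x = 0 := by
  have key := dirD_gradient_eq_zero' ((isConformalCoframe_einstein hU hh hθ).mono hVo hV) hX hf h0
    (F := ![fun y => (tp h 0 1 2 y * pd 0 f y - tq h 0 1 2 y * pd 1 f y)
        / sphereScale (planeCoord 0 1 y),
      fun y => (tq h 0 1 2 y * pd 0 f y + tp h 0 1 2 y * pd 1 f y)
        / sphereScale (planeCoord 0 1 y), pd 2 f, fun _ => 0]) ?_ hx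
  · rw [← key]
    refine dirD_congr ?_
    filter_upwards with y
    simp only [Fin.sum_univ_four, gradInv, Matrix.cons_val]
    rw [inv_div]
    ring
  · intro y hy i
    obtain ⟨s1, s2⟩ := te_sigma (mem_kahlerDomain.1 (hV hy).1).1 i
    have hs := (sphereScale_pos (planeCoord 0 1 y)).ne'
    have e : pd i f y = pd 0 f y * dCoord 0 y i + pd 1 f y * dCoord 1 y i
        + pd 2 f y * dCoord 2 y i := by
      fin_cases i <;> simp [dCoord]
      exact ht y hy
    simp only [Fin.sum_univ_four, Matrix.cons_val, frame₄, coframe₄_zero, coframe₄_one,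
      coframe₄_two, zero_mul, add_zero]
    rw [e]
    field_simp
    linear_combination (-pd 0 f y) * s1 - pd 1 f y * s2

end einstein

/-! ### Formal jets of holomorphic functions -/

/-- `F` is differentiable at `x`, with derivative `D` in the direction `v`. -/
def HasDir {E : Type*} [NormedAddCommGroup E] [NormedSpace ℝ E] (F : E → ℝ) (D : ℝ) (x v : E) :
    Prop := DifferentiableAt ℝ F x ∧ fderiv ℝ F x v = D

theorem hasDir_eval {E σ : Type*} [NormedAddCommGroup E] [NormedSpace ℝ E] {c : E → σ → ℝ}
    {f : σ → MvPolynomial σ ℝ} {x v : E}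
    (h : ∀ s, HasDir (fun y => c y s) (MvPolynomial.eval (c x) (f s)) x v) (P : MvPolynomial σ ℝ) :
    HasDir (fun y => MvPolynomial.eval (c y) P)
      (MvPolynomial.eval (c x) (MvPolynomial.mkDerivation ℝ f P)) x v := by
  induction P using MvPolynomial.induction_on with
  | C a =>
    simp only [MvPolynomial.eval_C, MvPolynomial.derivation_C, map_zero]
    exact ⟨differentiableAt_const a, by rw [fderiv_fun_const]; rfl⟩
  | add p q hp hq =>
    simp only [map_add]
    refine ⟨hp.1.add hq.1, ?_⟩
    rw [fderiv_fun_add hp.1 hq.1, add_apply, hp.2, hq.2]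
  | mul_X p i hp =>
    simp only [map_mul, MvPolynomial.eval_X, Derivation.leibniz, MvPolynomial.mkDerivation_X,
      smul_eq_mul, map_add]
    refine ⟨hp.1.mul (h i).1, ?_⟩
    rw [fderiv_fun_mul hp.1 (h i).1]
    simp [hp.2, (h i).2]

/-- The coordinates on the space of jets: the base point, and the derivatives of a holomorphic
function. -/
inductive JetVar
  | x
  | y
  | z
  | re (k : ℕ)
  | im (k : ℕ)

/-- Polynomials in the jet coordinates and in the inverse of the product of the functions
`z`, `½ (h + h̄) z + h h̄` and `(z + h)(z + h̄)`. -/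
abbrev JetRing := MvPolynomial (Option JetVar) ℝ

/-- A jet coordinate as an element of the ring. -/
def jv (v : JetVar) : JetRing := MvPolynomial.X (some v)

/-- The inverse of the product of the denominators. -/
def jinv : JetRing := MvPolynomial.X none

/-- The product of the denominators. -/
def denom {A : Type*} [CommRing A] (z a b : A) : A :=
  z * (a * z + (a ^ 2 + b ^ 2)) * ((z + a) ^ 2 + b ^ 2)

/-- The product of the denominators as an element of the ring. -/
def jden : JetRing := denom (jv .z) (jv (.re 0)) (jv (.im 0))

/-- The product of the denominators at a jet. -/
def jetDen (j : JetVar → ℝ) : ℝ := denom (j .z) (j (.re 0)) (j (.im 0))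

/-- The values of the generators of the ring at a jet. -/
def jetExt (j : JetVar → ℝ) (o : Option JetVar) : ℝ := o.elim (jetDen j)⁻¹ j

/-- Evaluation at a jet. -/
def jev (j : JetVar → ℝ) : JetRing →+* ℝ := MvPolynomial.eval (jetExt j)

theorem jev_jv (j : JetVar → ℝ) (v : JetVar) : jev j (jv v) = j v := MvPolynomial.eval_X _

theorem jev_jinv (j : JetVar → ℝ) : jev j jinv = (jetDen j)⁻¹ := MvPolynomial.eval_X _

/-- The derivation with given values on the jet coordinates. -/
def jetDer (f : JetVar → JetRing) : Derivation ℝ JetRing JetRing :=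
  MvPolynomial.mkDerivation ℝ fun o => o.elim
    (-jinv ^ 2 * MvPolynomial.mkDerivation ℝ (fun o => o.elim 0 f) jden) f

variable {f f' g : JetVar → JetRing}

theorem jetDer_jv (v : JetVar) : jetDer f (jv v) = f v := MvPolynomial.mkDerivation_X _ _ _

theorem derivation_denom (D : Derivation ℝ JetRing JetRing) (z a b : JetRing) :
    D (denom z a b) = (a * z + (a ^ 2 + b ^ 2)) * ((z + a) ^ 2 + b ^ 2) * D z
      + z * ((a * D z + z * D a + (2 * a * D a + 2 * b * D b)) * ((z + a) ^ 2 + b ^ 2)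
        + (a * z + (a ^ 2 + b ^ 2)) * (2 * (z + a) * (D z + D a) + 2 * b * D b)) := by
  simp only [denom, sq, Derivation.leibniz, map_add, smul_eq_mul]
  ring

theorem derivation_jden_congr {D D' : Derivation ℝ JetRing JetRing}
    (h : ∀ v, D (jv v) = D' (jv v)) : D jden = D' jden := by
  rw [jden, derivation_denom, derivation_denom, h, h, h]

theorem jetDer_jinv : jetDer f jinv = -jinv ^ 2 * jetDer f jden := by
  have h : jetDer f jinv
      = -jinv ^ 2 * MvPolynomial.mkDerivation ℝ (fun o => o.elim 0 f) jden :=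
    MvPolynomial.mkDerivation_X _ _ _
  rw [h]
  congr 1
  refine derivation_jden_congr fun v => ?_
  rw [jetDer_jv]
  exact MvPolynomial.mkDerivation_X _ _ _

theorem jetDer_commutator (h : ∀ v, jetDer f (f' v) - jetDer f' (f v) = g v) (P : JetRing) :
    jetDer f (jetDer f' P) - jetDer f' (jetDer f P) = jetDer g P := by
  have h1 : ∀ v, ⁅jetDer f, jetDer f'⁆ (jv v) = jetDer g (jv v) := fun v => by
    rw [Derivation.commutator_apply, jetDer_jv, jetDer_jv, jetDer_jv, h]
  suffices h2 : ⁅jetDer f, jetDer f'⁆ = jetDer g by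
    rw [← Derivation.commutator_apply, h2]
  refine MvPolynomial.derivation_ext fun o => ?_
  rcases o with _ | v
  · change ⁅jetDer f, jetDer f'⁆ jinv = jetDer g jinv
    have h3 : ⁅jetDer f, jetDer f'⁆ jden = jetDer g jden := derivation_jden_congr h1
    rw [Derivation.commutator_apply] at h3
    rw [Derivation.commutator_apply, jetDer_jinv, jetDer_jinv, jetDer_jinv, ← h3]
    simp only [sq, Derivation.leibniz, map_neg, smul_eq_mul, jetDer_jinv]
    ring
  · exact h1 v

theorem hasDir_jev {E : Type*} [NormedAddCommGroup E] [NormedSpace ℝ E] {c : E → JetVar → ℝ}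
    {x v : E} (hd : jetDen (c x) ≠ 0) (h : ∀ s, HasDir (fun y => c y s) (jev (c x) (f s)) x v)
    (P : JetRing) : HasDir (fun y => jev (c y) P) (jev (c x) (jetDer f P)) x v := by
  have h1 := hasDir_eval (c := fun y o => o.elim (jetDen (c x))⁻¹ (c y))
    (f := fun o : Option JetVar => o.elim 0 f) (x := x) (v := v) (fun o => by
      rcases o with _ | s
      · exact ⟨differentiableAt_const _, by simp⟩
      · exact h s) jden
  have h2 : (fun y => MvPolynomial.eval (fun o : Option JetVar => o.elim (jetDen (c x))⁻¹ (c y)) jden)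
      = fun y => jetDen (c y) := by
    funext y
    simp [jden, denom, jv, jetDen]
  rw [h2] at h1
  refine hasDir_eval (c := fun y => jetExt (c y)) (fun o => ?_) P
  rcases o with _ | s
  · have h3 : HasFDerivAt (fun y => (jetDen (c y))⁻¹)
        (-(jetDen (c x) ^ 2)⁻¹ • fderiv ℝ (fun y => jetDen (c y)) x) x :=
      (hasDerivAt_inv hd).comp_hasFDerivAt x h1.1.hasFDerivAt
    refine ⟨h3.differentiableAt, ?_⟩
    change fderiv ℝ (fun y => (jetDen (c y))⁻¹) x v = _
    rw [h3.fderiv, smul_apply, h1.2]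
    change _ = jev (c x) (-jinv ^ 2 * _)
    rw [map_mul, map_neg, map_pow, jev_jinv, inv_pow, smul_eq_mul]
    rfl
  · exact h s

/-- `F` vanishes at all jets at which it is defined. -/
def Vanishes (F : JetRing) : Prop := ∀ j, jetDen j ≠ 0 → jev j F = 0

theorem exists_numerator (F : JetRing) : ∃ (s : ℕ) (N : MvPolynomial JetVar ℝ),
    ∀ j, jetDen j ≠ 0 → jev j F * jetDen j ^ s = MvPolynomial.eval j N := by
  have hD : ∃ D : MvPolynomial JetVar ℝ, ∀ j, jetDen j = MvPolynomial.eval j D :=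
    ⟨denom (.X .z) (.X (.re 0)) (.X (.im 0)), fun j => by simp [jetDen, denom]⟩
  obtain ⟨D, hD⟩ := hD
  induction F using MvPolynomial.induction_on with
  | C a => exact ⟨0, .C a, fun j _ => by simp [jev]⟩
  | add p q hp hq =>
    obtain ⟨s, M, hM⟩ := hp
    obtain ⟨t, N, hN⟩ := hq
    refine ⟨s + t, M * D ^ t + N * D ^ s, fun j hj => ?_⟩
    rw [map_add, map_add, map_mul, map_mul, map_pow, map_pow, ← hM j hj, ← hN j hj, ← hD]
    ring
  | mul_X p o hp =>
    obtain ⟨s, M, hM⟩ := hp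
    rcases o with _ | v
    · refine ⟨s + 1, M, fun j hj => ?_⟩
      have : jev j (MvPolynomial.X none) = (jetDen j)⁻¹ := jev_jinv j
      rw [map_mul, ← hM j hj, this, pow_succ]
      field_simp
    · refine ⟨s, M * .X v, fun j hj => ?_⟩
      have : jev j (MvPolynomial.X (some v)) = j v := jev_jv j v
      rw [map_mul, map_mul, ← hM j hj, this, MvPolynomial.eval_X]
      ring

theorem Vanishes.of_mul {F G : JetRing} (h : Vanishes (F * G)) : Vanishes F ∨ Vanishes G := by
  obtain ⟨s, M, hM⟩ := exists_numerator F
  obtain ⟨t, N, hN⟩ := exists_numerator G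
  set D : MvPolynomial JetVar ℝ := denom (.X .z) (.X (.re 0)) (.X (.im 0)) with hDd
  have hD : ∀ j, jetDen j = MvPolynomial.eval j D := fun j => by simp [hDd, jetDen, denom]
  have h0 : M * N * D = 0 := MvPolynomial.funext fun j => by
    rw [map_mul, map_mul, map_zero, ← hD]
    by_cases hj : jetDen j = 0
    · rw [hj, mul_zero]
    · have := h j hj
      rw [map_mul] at this
      rw [← hM j hj, ← hN j hj]
      linear_combination jetDen j ^ s * jetDen j ^ t * jetDen j * this
  have hD0 : D ≠ 0 := fun h0 => by
    have h1 := hD fun v => match v with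
      | .z => 1
      | .re _ => 1
      | _ => 0
    rw [h0, map_zero] at h1
    norm_num [jetDen, denom] at h1
  rcases mul_eq_zero.1 ((mul_eq_zero.1 h0).resolve_right hD0) with h1 | h1
  · refine .inl fun j hj => ?_
    have := hM j hj
    rw [h1, map_zero] at this
    exact (mul_eq_zero.1 this).resolve_right (pow_ne_zero s hj)
  · refine .inr fun j hj => ?_
    have := hN j hj
    rw [h1, map_zero] at this
    exact (mul_eq_zero.1 this).resolve_right (pow_ne_zero t hj)

/-- The derivative by one of the jet coordinates. -/
def jetPartial (v : JetVar) : Derivation ℝ JetRing JetRing :=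
  jetDer fun u => open Classical in if u = v then 1 else 0

theorem Vanishes.jetPartial {F : JetRing} (h : Vanishes F) (v : JetVar) :
    Vanishes (jetPartial v F) := by
  classical
  intro j hj
  have hc : HasDir (fun s : ℝ => jev (fun u => j u + s * if u = v then 1 else 0) F) _ 0 1 :=
    hasDir_jev (f := fun u => open Classical in if u = v then 1 else 0) (by simpa using hj)
      (fun u => ⟨by fun_prop, by
        split_ifs <;> simp⟩) F
  have h2 := hc.2
  simp only [zero_mul, add_zero] at h2
  rw [HyperCRToda.jetPartial, ← h2]
  have h3 : (fun s : ℝ => jev (fun u => j u + s * if u = v then 1 else 0) F) =ᶠ[nhds 0]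
      fun _ => 0 := by
    have hcont : ContinuousAt (fun s : ℝ => jetDen (fun u => j u + s * if u = v then 1 else 0)) 0 := by
      unfold jetDen denom
      fun_prop
    filter_upwards [hcont.eventually_ne (by simpa using hj)] with s hs using h _ hs
  rw [h3.fderiv_eq]
  simp

/-- The total derivative by the real part of the base point. -/
def totalX : Derivation ℝ JetRing JetRing := jetDer fun v => match v with
  | .x => 1
  | .re k => jv (.re (k + 1))
  | .im k => jv (.im (k + 1))
  | _ => 0

/-- The total derivative by the imaginary part of the base point. -/
def totalY : Derivation ℝ JetRing JetRing := jetDer fun v => match v with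
  | .y => 1
  | .re k => -jv (.im (k + 1))
  | .im k => jv (.re (k + 1))
  | _ => 0

/-- The total derivative by `z`. -/
def totalZ : Derivation ℝ JetRing JetRing := jetDer fun v => match v with
  | .z => 1
  | _ => 0

theorem jetDer_zero (P : JetRing) : jetDer (fun _ => 0) P = 0 := by
  have h : ∀ v, jetDer (fun _ => 0) (jv v) = (0 : Derivation ℝ JetRing JetRing) (jv v) :=
    fun v => jetDer_jv v
  suffices h2 : jetDer (fun _ => 0) = 0 by rw [h2]; rfl
  refine MvPolynomial.derivation_ext fun o => ?_
  rcases o with _ | v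
  · change jetDer (fun _ => 0) jinv = 0
    rw [jetDer_jinv, derivation_jden_congr h]
    exact mul_zero _
  · exact h v

theorem jetPartial_jv (u v : JetVar) [Decidable (v = u)] :
    jetPartial u (jv v) = if v = u then 1 else 0 := by
  rw [jetPartial, jetDer_jv]
  congr

theorem jetPartial_totalX_re (k : ℕ) (F : JetRing) : jetPartial (.re (k + 1)) (totalX F)
    = totalX (jetPartial (.re (k + 1)) F) + jetPartial (.re k) F := by
  classical
  refine eq_add_of_sub_eq' (jetDer_commutator (fun v => ?_) F)
  rcases v <;> simp [← jetPartial.eq_1, jetPartial_jv, apply_ite, ← totalX.eq_1]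

theorem jetPartial_totalX_im (k : ℕ) (F : JetRing) : jetPartial (.im (k + 1)) (totalX F)
    = totalX (jetPartial (.im (k + 1)) F) + jetPartial (.im k) F := by
  classical
  refine eq_add_of_sub_eq' (jetDer_commutator (fun v => ?_) F)
  rcases v <;> simp [← jetPartial.eq_1, jetPartial_jv, apply_ite, ← totalX.eq_1]

theorem jetPartial_totalY_re (k : ℕ) (F : JetRing) : jetPartial (.re (k + 1)) (totalY F)
    = totalY (jetPartial (.re (k + 1)) F) + jetPartial (.im k) F := by
  classical
  refine eq_add_of_sub_eq' (jetDer_commutator (fun v => ?_) F)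
  rcases v <;> simp [← jetPartial.eq_1, jetPartial_jv, apply_ite, ← totalY.eq_1]

theorem jetPartial_totalY_im (k : ℕ) (F : JetRing) : jetPartial (.im (k + 1)) (totalY F)
    = totalY (jetPartial (.im (k + 1)) F) - jetPartial (.re k) F := by
  classical
  have h : totalY (jetPartial (.im (k + 1)) F) - jetPartial (.im (k + 1)) (totalY F)
      = jetPartial (.re k) F := by
    refine jetDer_commutator (fun v => ?_) F
    rcases v <;> simp [← jetPartial.eq_1, jetPartial_jv, apply_ite, ← totalY.eq_1]
  rw [← h]
  ring

theorem jetPartial_totalZ_re (k : ℕ) (F : JetRing) :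
    jetPartial (.re k) (totalZ F) = totalZ (jetPartial (.re k) F) := by
  classical
  refine sub_eq_zero.1 ((jetDer_commutator (g := fun _ => 0) (fun v => ?_) F).trans (jetDer_zero F))
  rcases v <;> simp [apply_ite]

theorem jetPartial_totalZ_im (k : ℕ) (F : JetRing) :
    jetPartial (.im k) (totalZ F) = totalZ (jetPartial (.im k) F) := by
  classical
  refine sub_eq_zero.1 ((jetDer_commutator (g := fun _ => 0) (fun v => ?_) F).trans (jetDer_zero F))
  rcases v <;> simp [apply_ite]

/-- The elements of the ring which depend only on the derivatives of order at most `k`. -/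
def jetLevel (k : ℕ) : Subalgebra ℝ JetRing where
  carrier := {F | ∀ m, k < m → jetPartial (.re m) F = 0 ∧ jetPartial (.im m) F = 0}
  mul_mem' ha hb m hm := by
    simp [Derivation.leibniz, ha m hm, hb m hm]
  add_mem' ha hb m hm := by
    simp [ha m hm, hb m hm]
  algebraMap_mem' r m _ := ⟨Derivation.map_algebraMap _ r, Derivation.map_algebraMap _ r⟩

theorem jetLevel_mono {k l : ℕ} (h : k ≤ l) {F : JetRing} (hF : F ∈ jetLevel k) :
    F ∈ jetLevel l := fun m hm => hF m (h.trans_lt hm)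

theorem totalX_mem {k : ℕ} {F : JetRing} (hF : F ∈ jetLevel k) : totalX F ∈ jetLevel (k + 1) := by
  intro m hm
  obtain ⟨m, rfl⟩ : ∃ m', m = m' + 1 := ⟨m - 1, by omega⟩
  rw [jetPartial_totalX_re, jetPartial_totalX_im, (hF _ (by omega)).1, (hF _ (by omega)).2,
    (hF m (by omega)).1, (hF m (by omega)).2]
  simp

theorem totalY_mem {k : ℕ} {F : JetRing} (hF : F ∈ jetLevel k) : totalY F ∈ jetLevel (k + 1) := by
  intro m hm
  obtain ⟨m, rfl⟩ : ∃ m', m = m' + 1 := ⟨m - 1, by omega⟩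
  rw [jetPartial_totalY_re, jetPartial_totalY_im, (hF m (by omega)).1, (hF m (by omega)).2,
    (hF (m + 1) (by omega)).1, (hF (m + 1) (by omega)).2]
  simp

theorem totalZ_mem {k : ℕ} {F : JetRing} (hF : F ∈ jetLevel k) : totalZ F ∈ jetLevel k := by
  intro m hm
  rw [jetPartial_totalZ_re, jetPartial_totalZ_im, (hF m hm).1, (hF m hm).2]
  simp

theorem Vanishes.mul_left {F : JetRing} (h : Vanishes F) (G : JetRing) : Vanishes (G * F) :=
  fun j hj => by rw [map_mul, h j hj, mul_zero]

theorem Vanishes.add {F G : JetRing} (hF : Vanishes F) (hG : Vanishes G) : Vanishes (F + G) :=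
  fun j hj => by rw [map_add, hF j hj, hG j hj, add_zero]

theorem Vanishes.of_add_sq {F G : JetRing} (h : Vanishes (F ^ 2 + G ^ 2)) :
    Vanishes F ∧ Vanishes G := by
  have key : ∀ a b : ℝ, a ^ 2 + b ^ 2 = 0 → a = 0 ∧ b = 0 := fun a b h =>
    ⟨by nlinarith, by nlinarith⟩
  have h1 : ∀ j, jetDen j ≠ 0 → jev j F ^ 2 + jev j G ^ 2 = 0 := fun j hj => by
    rw [← map_pow, ← map_pow, ← map_add, h j hj]
  exact ⟨fun j hj => (key _ _ (h1 j hj)).1, fun j hj => (key _ _ (h1 j hj)).2⟩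

theorem Vanishes.of_sq {F : JetRing} (h : Vanishes (F ^ 2)) : Vanishes F :=
  (Vanishes.of_mul (sq F ▸ h)).elim id id

/-- The formal squared length of the differential. -/
def formalGrad (A B F : JetRing) : JetRing :=
  A * (totalX F ^ 2 + totalY F ^ 2) + B * totalZ F ^ 2

/-- The squared length of the derivative by the coefficient of order `k`. -/
def symbolSq (k : ℕ) (F : JetRing) : JetRing :=
  jetPartial (.re k) F ^ 2 + jetPartial (.im k) F ^ 2

section

variable {A B F : JetRing} {k : ℕ}

theorem formalGrad_mem (hA : A ∈ jetLevel 0) (hB : B ∈ jetLevel 0) (hF : F ∈ jetLevel k) :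
    formalGrad A B F ∈ jetLevel (k + 1) :=
  add_mem (mul_mem (jetLevel_mono (Nat.zero_le _) hA)
    (add_mem (pow_mem (totalX_mem hF) 2) (pow_mem (totalY_mem hF) 2)))
    (mul_mem (jetLevel_mono (Nat.zero_le _) hB)
      (pow_mem (jetLevel_mono (Nat.le_succ k) (totalZ_mem hF)) 2))

theorem top_re_totalX (hF : F ∈ jetLevel k) :
    jetPartial (.re (k + 1)) (totalX F) = jetPartial (.re k) F := by
  rw [jetPartial_totalX_re, (hF _ (Nat.lt_succ_self k)).1, map_zero, zero_add]

theorem top_im_totalX (hF : F ∈ jetLevel k) :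
    jetPartial (.im (k + 1)) (totalX F) = jetPartial (.im k) F := by
  rw [jetPartial_totalX_im, (hF _ (Nat.lt_succ_self k)).2, map_zero, zero_add]

theorem top_re_totalY (hF : F ∈ jetLevel k) :
    jetPartial (.re (k + 1)) (totalY F) = jetPartial (.im k) F := by
  rw [jetPartial_totalY_re, (hF _ (Nat.lt_succ_self k)).1, map_zero, zero_add]

theorem top_im_totalY (hF : F ∈ jetLevel k) :
    jetPartial (.im (k + 1)) (totalY F) = -jetPartial (.re k) F := by
  rw [jetPartial_totalY_im, (hF _ (Nat.lt_succ_self k)).2, map_zero, zero_sub]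

theorem symbolSq_formalGrad (hA : A ∈ jetLevel 0) (hB : B ∈ jetLevel 0) (hF : F ∈ jetLevel k) :
    symbolSq (k + 1) (formalGrad A B F)
      = (4 * A ^ 2) * ((totalX F ^ 2 + totalY F ^ 2) * symbolSq k F) := by
  obtain ⟨a1, a2⟩ := hA _ (Nat.succ_pos k)
  obtain ⟨b1, b2⟩ := hB _ (Nat.succ_pos k)
  obtain ⟨z1, z2⟩ := totalZ_mem hF _ (Nat.lt_succ_self k)
  rw [Nat.succ_eq_add_one] at a1 a2 b1 b2 z1 z2
  rw [symbolSq, symbolSq, formalGrad]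
  simp only [map_add, Derivation.leibniz, Derivation.leibniz_pow, top_re_totalX hF,
    top_im_totalX hF, top_re_totalY hF, top_im_totalY hF, a1, a2, b1, b2, z1, z2, smul_eq_mul]
  simp
  ring

theorem not_vanishes_grad (hF : F ∈ jetLevel k) (h : ¬Vanishes (symbolSq k F)) :
    ¬Vanishes (totalX F ^ 2 + totalY F ^ 2) := fun h0 => h <| by
  have h1 := h0.of_add_sq.1
  have h2 := h1.jetPartial (.re (k + 1))
  have h3 := h1.jetPartial (.im (k + 1))
  rw [top_re_totalX hF] at h2
  rw [top_im_totalX hF] at h3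
  rw [symbolSq, sq, sq]
  exact (h2.mul_left _).add (h3.mul_left _)

theorem not_vanishes_symbolSq (hA : A ∈ jetLevel 0) (hB : B ∈ jetLevel 0) (hA0 : ¬Vanishes A)
    (hF : F ∈ jetLevel k) (h : ¬Vanishes (symbolSq k F)) :
    ¬Vanishes (symbolSq (k + 1) (formalGrad A B F)) := fun h0 => by
  rw [symbolSq_formalGrad hA hB hF] at h0
  rcases h0.of_mul with h1 | h1
  · have : Vanishes (A ^ 2) := fun j hj => by
      have := h1 j hj
      rw [map_mul, map_ofNat] at this
      linarith
    exact hA0 this.of_sq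
  · exact h1.of_mul.elim (not_vanishes_grad hF h) h

/-- The formal Jacobian determinant of three functions. -/
def formalJac (F G H : JetRing) : JetRing :=
  totalX H * (totalY F * totalZ G - totalZ F * totalY G)
    + totalY H * (totalZ F * totalX G - totalX F * totalZ G)
    + totalZ H * (totalX F * totalY G - totalY F * totalX G)

/-- Generically the iterated squared lengths of the differential are functionally independent. -/
theorem not_vanishes_formalJac (hA : A ∈ jetLevel 0) (hB : B ∈ jetLevel 0) (hA0 : ¬Vanishes A)
    (hF : F ∈ jetLevel k) (h : ¬Vanishes (symbolSq k F)) (hz : ¬Vanishes (totalZ F)) :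
    ¬Vanishes (formalJac F (formalGrad A B F) (formalGrad A B (formalGrad A B F))) := by
  intro h0
  have hG := formalGrad_mem hA hB hF
  have gG := not_vanishes_symbolSq hA hB hA0 hF h
  have hH := formalGrad_mem hA hB hG
  have gH := not_vanishes_symbolSq hA hB hA0 hG gG
  set G := formalGrad A B F with hGd
  set H := formalGrad A B G with hHd
  obtain ⟨f1, f2⟩ := jetLevel_mono (Nat.le_succ _) (totalX_mem hF) (k + 3) (by omega)
  obtain ⟨f3, f4⟩ := jetLevel_mono (Nat.le_succ _) (totalY_mem hF) (k + 3) (by omega)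
  obtain ⟨f5, f6⟩ := totalZ_mem hF (k + 3) (by omega)
  obtain ⟨g1, g2⟩ := totalX_mem hG (k + 3) (by omega)
  obtain ⟨g3, g4⟩ := totalY_mem hG (k + 3) (by omega)
  obtain ⟨g5, g6⟩ := totalZ_mem hG (k + 3) (by omega)
  obtain ⟨z1, z2⟩ := totalZ_mem hH (k + 3) (by omega)
  have e1 := h0.jetPartial (.re (k + 3))
  have e2 := h0.jetPartial (.im (k + 3))
  simp only [formalJac, map_add, map_sub, Derivation.leibniz, smul_eq_mul, top_re_totalX hH,
    top_re_totalY hH, top_im_totalX hH, top_im_totalY hH, f1, f2, f3, f4, f5, f6, g1, g2, g3, g4,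
    g5, g6, z1, z2, mul_zero, add_zero, zero_add, sub_self] at e1 e2
  have e3 : Vanishes (symbolSq (k + 2) H
      * ((totalY F * totalZ G - totalZ F * totalY G) ^ 2
        + (totalZ F * totalX G - totalX F * totalZ G) ^ 2)) := by
    intro j hj
    have q1 := e1 j hj
    have q2 := e2 j hj
    simp only [symbolSq, map_add, map_mul, map_sub, map_neg, map_pow] at q1 q2 ⊢
    linear_combination (jev j (jetPartial (.re (k + 2)) H)
      * (jev j (totalY F) * jev j (totalZ G) - jev j (totalZ F) * jev j (totalY G))
      + jev j (jetPartial (.im (k + 2)) H)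
      * (jev j (totalZ F) * jev j (totalX G) - jev j (totalX F) * jev j (totalZ G))) * q1
      + (jev j (jetPartial (.im (k + 2)) H)
      * (jev j (totalY F) * jev j (totalZ G) - jev j (totalZ F) * jev j (totalY G))
      - jev j (jetPartial (.re (k + 2)) H)
      * (jev j (totalZ F) * jev j (totalX G) - jev j (totalX F) * jev j (totalZ G))) * q2
  obtain ⟨a0, b0⟩ := (e3.of_mul.resolve_left gH).of_add_sq
  obtain ⟨f1, f2⟩ := totalX_mem hF (k + 2) (by omega)
  obtain ⟨f3, f4⟩ := totalY_mem hF (k + 2) (by omega)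
  obtain ⟨f5, f6⟩ := totalZ_mem hF (k + 2) (by omega)
  obtain ⟨g5, g6⟩ := totalZ_mem hG (k + 2) (by omega)
  have a1 := a0.jetPartial (.re (k + 2))
  have b1 := b0.jetPartial (.re (k + 2))
  simp only [map_sub, Derivation.leibniz, smul_eq_mul, top_re_totalX hG, top_re_totalY hG,
    f1, f3, f5, g5, mul_zero, add_zero, zero_sub, sub_zero] at a1 b1
  have e4 : Vanishes (totalZ F ^ 2 * symbolSq (k + 1) G) := by
    intro j hj
    have q1 := a1 j hj
    have q2 := b1 j hj
    simp only [symbolSq, map_add, map_mul, map_neg, map_pow] at q1 q2 ⊢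
    linear_combination (-jev j (totalZ F) * jev j (jetPartial (.im (k + 1)) G)) * q1
      + (jev j (totalZ F) * jev j (jetPartial (.re (k + 1)) G)) * q2
  rcases e4.of_mul with h1 | h1
  · exact hz h1.of_sq
  · exact gG h1

end

/-! ### The curvature invariant as a function of jets -/

section generic

variable {A : Type*} [CommRing A]

/-- The real part of the third derivative term. -/
def genC₁ (r p q a b : A) : A := r * ((p ^ 3 - 3 * p * q ^ 2) * a + (3 * p ^ 2 * q - q ^ 3) * b)

/-- Minus the imaginary part of the third derivative term. -/
def genC₂ (r p q a b : A) : A := r * ((3 * p ^ 2 * q - q ^ 3) * a - (p ^ 3 - 3 * p * q ^ 2) * b)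

/-- The real part of the second derivative term. -/
def genR₁ (x y r p q a b c d : A) : A :=
  r ^ 2 * ((p ^ 4 - 6 * p ^ 2 * q ^ 2 + q ^ 4) * c + (4 * p ^ 3 * q - 4 * p * q ^ 3) * d)
  - 3 * r ^ 2 * ((p ^ 5 - 10 * p ^ 3 * q ^ 2 + 5 * p * q ^ 4) * (a ^ 2 - b ^ 2)
    + (5 * p ^ 4 * q - 10 * p ^ 2 * q ^ 3 + q ^ 5) * (2 * a * b))
  + r * ((p ^ 4 - 6 * p ^ 2 * q ^ 2 + q ^ 4) * (a * x + b * y)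
    + (4 * p ^ 3 * q - 4 * p * q ^ 3) * (b * x - a * y))

/-- Minus the imaginary part of the second derivative term. -/
def genR₂ (x y r p q a b c d : A) : A :=
  r ^ 2 * ((4 * p ^ 3 * q - 4 * p * q ^ 3) * c - (p ^ 4 - 6 * p ^ 2 * q ^ 2 + q ^ 4) * d)
  - 3 * r ^ 2 * ((5 * p ^ 4 * q - 10 * p ^ 2 * q ^ 3 + q ^ 5) * (a ^ 2 - b ^ 2)
    - (p ^ 5 - 10 * p ^ 3 * q ^ 2 + 5 * p * q ^ 4) * (2 * a * b))
  + r * ((4 * p ^ 3 * q - 4 * p * q ^ 3) * (a * x + b * y)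
    - (p ^ 4 - 6 * p ^ 2 * q ^ 2 + q ^ 4) * (b * x - a * y))

/-- The invariant of the curvature in terms of `z`, its inverse, the inverse of the monopole, and
the derivatives of `1 / (z + h)`. -/
def genI (z zi wi p q c₁ c₂ r₁ r₂ : A) : A :=
  let t := -p + z * (p ^ 2 - q ^ 2)
  let e := -zi + z * q ^ 2 * wi
  let D := e * (((1 - z * p) ^ 2 + (z * q) ^ 2) * (zi * wi))
  (z ^ 2 * wi) ^ 2 * (
    (z * r₁ * wi - 2 * z ^ 2 * c₁ ^ 2 * wi ^ 2 + z ^ 2 * c₂ ^ 2 * wi ^ 2 + D) ^ 2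
    + (-(z * r₁ * wi) - 2 * z ^ 2 * c₂ ^ 2 * wi ^ 2 + z ^ 2 * c₁ ^ 2 * wi ^ 2 + D) ^ 2
    + (zi ^ 2 + q ^ 2 * wi - 4 * z * p * q ^ 2 * wi - 2 * z * q ^ 2 * t * wi ^ 2 + t * (zi * wi)
      - z ^ 2 * (c₁ ^ 2 + c₂ ^ 2) * wi ^ 2) ^ 2
    + 2 * ((z * r₂ * wi - 3 * z ^ 2 * c₁ * c₂ * wi ^ 2) ^ 2
      + (c₁ * wi - 3 * z * (p * c₁ - q * c₂) * wi - 2 * z * c₁ * t * wi ^ 2 - q * z * c₂ * wi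
        + e * (z * c₁ * wi)) ^ 2
      + (c₂ * wi - 3 * z * (p * c₂ + q * c₁) * wi - 2 * z * c₂ * t * wi ^ 2 + q * z * c₁ * wi
        + e * (z * c₂ * wi)) ^ 2))

end generic

section membership

variable {A : Type*} [CommRing A] [Algebra ℝ A] {S : Subalgebra ℝ A}
  {x y z zi wi r p q a b c d c₁ c₂ r₁ r₂ : A}

theorem gen_mem (hx : x ∈ S) (hy : y ∈ S) (hr : r ∈ S) (hp : p ∈ S) (hq : q ∈ S) (ha : a ∈ S)
    (hb : b ∈ S) (hc : c ∈ S) (hd : d ∈ S) : genC₁ r p q a b ∈ S ∧ genC₂ r p q a b ∈ S ∧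
      genR₁ x y r p q a b c d ∈ S ∧ genR₂ x y r p q a b c d ∈ S := by
  unfold genC₁ genC₂ genR₁ genR₂
  refine ⟨?_, ?_, ?_, ?_⟩
  all_goals repeat' first
    | assumption | exact ofNat_mem _ _ | apply add_mem | apply sub_mem | apply mul_mem
    | apply pow_mem

theorem genI_mem (hz : z ∈ S) (hzi : zi ∈ S) (hwi : wi ∈ S) (hp : p ∈ S) (hq : q ∈ S)
    (h1 : c₁ ∈ S) (h2 : c₂ ∈ S) (h3 : r₁ ∈ S) (h4 : r₂ ∈ S) :
    genI z zi wi p q c₁ c₂ r₁ r₂ ∈ S := by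
  unfold genI
  extract_lets t e D
  have hte : t ∈ S ∧ e ∈ S := by
    unfold t e
    constructor
    all_goals repeat' first
      | assumption | apply add_mem | apply sub_mem | apply mul_mem | apply pow_mem | apply neg_mem
  obtain ⟨ht, he⟩ := hte
  have hD : D ∈ S := mul_mem he (mul_mem (add_mem (pow_mem (sub_mem (one_mem S) (mul_mem hz hp)) 2)
    (pow_mem (mul_mem hz hq) 2)) (mul_mem hzi hwi))
  clear_value t e D
  repeat' first
    | assumption | exact ofNat_mem _ _ | apply add_mem | apply sub_mem | apply mul_mem
    | apply pow_mem | apply neg_mem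

end membership

/-- The function `½ (h + h̄) z + h h̄`. -/
def jnum : JetRing := jv (.re 0) * jv .z + (jv (.re 0) ^ 2 + jv (.im 0) ^ 2)
/-- The function `(z + h) (z + h̄)`. -/
def jmod : JetRing := (jv .z + jv (.re 0)) ^ 2 + jv (.im 0) ^ 2
/-- The inverse of `z`. -/
def jzi : JetRing := jinv * (jnum * jmod)
/-- The inverse of the monopole. -/
def jwi : JetRing := jmod * (jinv * (jv .z * jmod))
/-- The real part of `1 / (z + h)`. -/
def jp : JetRing := (jv .z + jv (.re 0)) * (jinv * (jv .z * jnum))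
/-- Minus the imaginary part of `1 / (z + h)`. -/
def jq : JetRing := jv (.im 0) * (jinv * (jv .z * jnum))
/-- The inverse of the scale of the sphere. -/
def jr : JetRing := MvPolynomial.C (1 / 2) * (1 + (jv .x ^ 2 + jv .y ^ 2))
/-- The curvature invariant. -/
def jI : JetRing := genI (jv .z) jzi jwi jp jq (genC₁ jr jp jq (jv (.re 1)) (jv (.im 1)))
  (genC₂ jr jp jq (jv (.re 1)) (jv (.im 1)))
  (genR₁ (jv .x) (jv .y) jr jp jq (jv (.re 1)) (jv (.im 1)) (jv (.re 2)) (jv (.im 2)))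
  (genR₂ (jv .x) (jv .y) jr jp jq (jv (.re 1)) (jv (.im 1)) (jv (.re 2)) (jv (.im 2)))
/-- The inverse metric in the direction of `z`. -/
def jB : JetRing := jv .z ^ 2 * jwi
/-- The inverse metric in the directions of the sphere. -/
def jA : JetRing := jB * ((jp ^ 2 + jq ^ 2) * jr ^ 2)

theorem jv_mem {k : ℕ} {v : JetVar} (h : match v with | .re i => i ≤ k | .im i => i ≤ k | _ => True) :
    jv v ∈ jetLevel k := by
  classical
  intro m hm
  rw [jetPartial_jv, jetPartial_jv]
  rcases v with _ | _ | _ | i | i <;> simp at h ⊢ <;> omega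

theorem jinv_mem : jinv ∈ jetLevel 0 := by
  intro m hm
  have hz : (jv .z : JetRing) ∈ jetLevel 0 := jv_mem trivial
  have ha : (jv (.re 0) : JetRing) ∈ jetLevel 0 := jv_mem le_rfl
  have hb : (jv (.im 0) : JetRing) ∈ jetLevel 0 := jv_mem le_rfl
  constructor <;> rw [jetPartial, jetDer_jinv, ← jetPartial, jden, derivation_denom] <;>
    simp [hz m hm, ha m hm, hb m hm]

theorem jnum_mem : jnum ∈ jetLevel 0 :=
  add_mem (mul_mem (jv_mem le_rfl) (jv_mem trivial))
    (add_mem (pow_mem (jv_mem le_rfl) 2) (pow_mem (jv_mem le_rfl) 2))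

theorem jmod_mem : jmod ∈ jetLevel 0 :=
  add_mem (pow_mem (add_mem (jv_mem trivial) (jv_mem le_rfl)) 2) (pow_mem (jv_mem le_rfl) 2)

theorem jzi_mem : jzi ∈ jetLevel 0 := mul_mem jinv_mem (mul_mem jnum_mem jmod_mem)

theorem jwi_mem : jwi ∈ jetLevel 0 :=
  mul_mem jmod_mem (mul_mem jinv_mem (mul_mem (jv_mem trivial) jmod_mem))

theorem jp_mem : jp ∈ jetLevel 0 := mul_mem (add_mem (jv_mem trivial) (jv_mem le_rfl))
  (mul_mem jinv_mem (mul_mem (jv_mem trivial) jnum_mem))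

theorem jq_mem : jq ∈ jetLevel 0 :=
  mul_mem (jv_mem le_rfl) (mul_mem jinv_mem (mul_mem (jv_mem trivial) jnum_mem))

theorem jr_mem : jr ∈ jetLevel 0 :=
  mul_mem (Subalgebra.algebraMap_mem _ _) (add_mem (one_mem _)
    (add_mem (pow_mem (jv_mem trivial) 2) (pow_mem (jv_mem trivial) 2)))

theorem jB_mem : jB ∈ jetLevel 0 := mul_mem (pow_mem (jv_mem trivial) 2) jwi_mem

theorem jA_mem : jA ∈ jetLevel 0 :=
  mul_mem jB_mem (mul_mem (add_mem (pow_mem jp_mem 2) (pow_mem jq_mem 2)) (pow_mem jr_mem 2))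

theorem jI_mem : jI ∈ jetLevel 2 := by
  have hx : (jv .x : JetRing) ∈ jetLevel 2 := jv_mem trivial
  have hy : (jv .y : JetRing) ∈ jetLevel 2 := jv_mem trivial
  have hz : (jv .z : JetRing) ∈ jetLevel 2 := jv_mem trivial
  have h1 : (jv (.re 1) : JetRing) ∈ jetLevel 2 := jv_mem one_le_two
  have h2 : (jv (.im 1) : JetRing) ∈ jetLevel 2 := jv_mem one_le_two
  have h3 : (jv (.re 2) : JetRing) ∈ jetLevel 2 := jv_mem le_rfl
  have h4 : (jv (.im 2) : JetRing) ∈ jetLevel 2 := jv_mem le_rfl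
  have hp := jetLevel_mono (Nat.zero_le 2) jp_mem
  have hq := jetLevel_mono (Nat.zero_le 2) jq_mem
  have hr := jetLevel_mono (Nat.zero_le 2) jr_mem
  have hzi := jetLevel_mono (Nat.zero_le 2) jzi_mem
  have hwi := jetLevel_mono (Nat.zero_le 2) jwi_mem
  obtain ⟨g1, g2, g3, g4⟩ := gen_mem hx hy hr hp hq h1 h2 h3 h4
  exact genI_mem hz hzi hwi hp hq g1 g2 g3 g4

/-- The jet of a holomorphic function. -/
def hJet (h : ℂ → ℂ) (ζ : ℂ) (z : ℝ) (v : JetVar) : ℝ := match v with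
  | .x => ζ.re
  | .y => ζ.im
  | .z => z
  | .re k => (iteratedDeriv k h ζ).re
  | .im k => (iteratedDeriv k h ζ).im

/-- The jet at a point of the four-manifold. -/
def ptJet (h : ℂ → ℂ) (x : Pt 4) : JetVar → ℝ := hJet h (planeCoord 0 1 x) (x 2)

section values

variable {j : JetVar → ℝ}

theorem denom_factors (hj : jetDen j ≠ 0) : j .z ≠ 0 ∧
    j (.re 0) * j .z + (j (.re 0) ^ 2 + j (.im 0) ^ 2) ≠ 0 ∧
    j .z * j (.re 0) + (j (.re 0) ^ 2 + j (.im 0) ^ 2) ≠ 0 ∧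
    (j .z + j (.re 0)) ^ 2 + j (.im 0) ^ 2 ≠ 0 := by
  rw [jetDen, denom, mul_assoc] at hj
  exact ⟨left_ne_zero_of_mul hj, left_ne_zero_of_mul (right_ne_zero_of_mul hj),
    mul_comm (j (.re 0)) _ ▸ left_ne_zero_of_mul (right_ne_zero_of_mul hj),
    right_ne_zero_of_mul (right_ne_zero_of_mul hj)⟩

theorem jev_jzi (hj : jetDen j ≠ 0) : jev j jzi = (j .z)⁻¹ := by
  obtain ⟨h1, h2, h2', h3⟩ := denom_factors hj
  simp only [jzi, jnum, jmod, map_mul, map_add, map_pow, jev_jinv, jev_jv, jetDen, denom]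
  field_simp

theorem jev_jwi (hj : jetDen j ≠ 0) : jev j jwi = ((j .z + j (.re 0)) ^ 2 + j (.im 0) ^ 2)
    / (j (.re 0) * j .z + (j (.re 0) ^ 2 + j (.im 0) ^ 2)) := by
  obtain ⟨h1, h2, h2', h3⟩ := denom_factors hj
  simp only [jwi, jmod, map_mul, map_add, map_pow, jev_jinv, jev_jv, jetDen, denom]
  field_simp

theorem jev_jp (hj : jetDen j ≠ 0) :
    jev j jp = (j .z + j (.re 0)) / ((j .z + j (.re 0)) ^ 2 + j (.im 0) ^ 2) := by
  obtain ⟨h1, h2, h2', h3⟩ := denom_factors hj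
  simp only [jp, jnum, map_mul, map_add, map_pow, jev_jinv, jev_jv, jetDen, denom]
  field_simp

theorem jev_jq (hj : jetDen j ≠ 0) :
    jev j jq = j (.im 0) / ((j .z + j (.re 0)) ^ 2 + j (.im 0) ^ 2) := by
  obtain ⟨h1, h2, h2', h3⟩ := denom_factors hj
  simp only [jq, jnum, map_mul, map_add, map_pow, jev_jinv, jev_jv, jetDen, denom]
  field_simp

theorem jev_jr : jev j jr = (1 + (j .x ^ 2 + j .y ^ 2)) / 2 := by
  simp only [jr, map_mul, map_add, map_pow, jev_jv, map_one]
  have : jev j (MvPolynomial.C (1 / 2)) = 1 / 2 := MvPolynomial.eval_C _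
  rw [this]
  ring

end values

section ring_hom

variable {A B : Type*} [CommRing A] [CommRing B] (f : A →+* B)

theorem map_genC₁ (r p q a b : A) : f (genC₁ r p q a b) = genC₁ (f r) (f p) (f q) (f a) (f b) := by
  simp [genC₁, map_ofNat]

theorem map_genC₂ (r p q a b : A) : f (genC₂ r p q a b) = genC₂ (f r) (f p) (f q) (f a) (f b) := by
  simp [genC₂, map_ofNat]

theorem map_genR₁ (x y r p q a b c d : A) : f (genR₁ x y r p q a b c d)
    = genR₁ (f x) (f y) (f r) (f p) (f q) (f a) (f b) (f c) (f d) := by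
  simp [genR₁, map_ofNat]

theorem map_genR₂ (x y r p q a b c d : A) : f (genR₂ x y r p q a b c d)
    = genR₂ (f x) (f y) (f r) (f p) (f q) (f a) (f b) (f c) (f d) := by
  simp [genR₂, map_ofNat]

theorem map_genI (z zi wi p q c₁ c₂ r₁ r₂ : A) : f (genI z zi wi p q c₁ c₂ r₁ r₂)
    = genI (f z) (f zi) (f wi) (f p) (f q) (f c₁) (f c₂) (f r₁) (f r₂) := by
  simp [genI, map_ofNat]

end ring_hom

/-- The jet with `ζ = 0`, `h = 1`, `h' = 0` and `h'' = k`. -/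
def baseJet (z k : ℝ) (v : JetVar) : ℝ := match v with
  | .z => z
  | .re 0 => 1
  | .re 2 => k
  | _ => 0

theorem jetDen_baseJet {z : ℝ} (hz : 0 < z) (k : ℝ) : jetDen (baseJet z k) ≠ 0 := by
  simp only [jetDen, denom, baseJet]
  positivity

theorem jev_baseJet {z : ℝ} (hz : 0 < z) (k : ℝ) :
    jev (baseJet z k) jI = 3 + z ^ 6 * k ^ 2 / (8 * (1 + z) ^ 4) := by
  have hd := jetDen_baseJet hz k
  have h1 : 1 + z ≠ 0 := by positivity
  have h1' : z + 1 ≠ 0 := by positivity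
  rw [jI, map_genI, map_genC₁, map_genC₂, map_genR₁, map_genR₂, jev_jzi hd, jev_jwi hd, jev_jp hd,
    jev_jq hd, jev_jr]
  simp only [jev_jv, baseJet, genI, genC₁, genC₂, genR₁, genR₂]
  field_simp
  ring

theorem not_vanishes_jA : ¬Vanishes jA := fun h => by
  have hd := jetDen_baseJet one_pos 0
  have := h _ hd
  rw [jA, jB, map_mul, map_mul, map_mul, map_add, map_pow, map_pow, map_pow, map_pow, jev_jv,
    jev_jwi hd, jev_jp hd, jev_jq hd, jev_jr] at this
  norm_num [baseJet] at this

theorem not_vanishes_symbolSq_jI : ¬Vanishes (symbolSq 2 jI) := fun h => by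
  classical
  have h1 := h.of_add_sq.1
  have hdir : ∀ s : ℝ, HasDir (fun s : ℝ => jev (baseJet 1 s) jI) 0 s 1 := by
    intro s
    have := hasDir_jev (c := fun s : ℝ => baseJet 1 s) (x := s) (v := 1)
      (f := fun u => open Classical in if u = .re 2 then 1 else 0)
      (jetDen_baseJet one_pos s) (fun v => ?_) jI
    · rwa [← jetPartial, h1 _ (jetDen_baseJet one_pos s)] at this
    · rcases v with _ | _ | _ | k | k
      any_goals exact ⟨differentiableAt_const _, by simp [baseJet]⟩
      match k with
      | 2 => exact ⟨differentiableAt_id, by simp [baseJet]⟩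
      | 0 => exact ⟨differentiableAt_const _, by simp [baseJet]⟩
      | 1 => exact ⟨differentiableAt_const _, by simp [baseJet]⟩
      | k + 3 => exact ⟨differentiableAt_const _, by simp [baseJet]⟩
  have h2 := is_const_of_deriv_eq_zero (fun s => (hdir s).1) (fun s => (hdir s).2) 0 1
  simp only [jev_baseJet one_pos] at h2
  norm_num at h2

theorem not_vanishes_totalZ_jI : ¬Vanishes (totalZ jI) := fun h => by
  have hdir : ∀ s ∈ Set.Ioi (0 : ℝ), HasDir (fun s : ℝ => jev (baseJet s 1) jI) 0 s 1 := by
    intro s hs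
    have := hasDir_jev (c := fun s : ℝ => baseJet s 1) (x := s) (v := 1)
      (f := fun v => match v with
        | .z => 1
        | _ => 0) (jetDen_baseJet hs 1) (fun v => ?_) jI
    · exact ⟨this.1, this.2.trans (h _ (jetDen_baseJet hs 1))⟩
    · rcases v with _ | _ | _ | k | k
      any_goals exact ⟨differentiableAt_const _, by simp [baseJet]⟩
      · exact ⟨differentiableAt_id, by simp [baseJet]⟩
      match k with
      | 2 => exact ⟨differentiableAt_const _, by simp [baseJet]⟩
      | 0 => exact ⟨differentiableAt_const _, by simp [baseJet]⟩
      | 1 => exact ⟨differentiableAt_const _, by simp [baseJet]⟩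
      | k + 3 => exact ⟨differentiableAt_const _, by simp [baseJet]⟩
  have h2 := isOpen_Ioi.is_const_of_deriv_eq_zero isPreconnected_Ioi
    (fun s hs => (hdir s hs).1.differentiableWithinAt) (fun s hs => (hdir s hs).2)
    (Set.mem_Ioi.2 one_pos) (Set.mem_Ioi.2 two_pos)
  simp only [jev_baseJet one_pos, jev_baseJet two_pos] at h2
  norm_num at h2

/-- The numerator of the Jacobian determinant of the invariants. -/
theorem exists_jacobian_numerator : ∃ (s : ℕ) (N : MvPolynomial JetVar ℝ), N ≠ 0 ∧
    ∀ j, jetDen j ≠ 0 → jev j (formalJac jI (formalGrad jA jB jI)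
      (formalGrad jA jB (formalGrad jA jB jI))) * jetDen j ^ s = MvPolynomial.eval j N := by
  obtain ⟨s, N, hN⟩ := exists_numerator (formalJac jI (formalGrad jA jB jI)
    (formalGrad jA jB (formalGrad jA jB jI)))
  refine ⟨s, N, fun h0 => ?_, hN⟩
  refine not_vanishes_formalJac jA_mem jB_mem not_vanishes_jA jI_mem not_vanishes_symbolSq_jI
    not_vanishes_totalZ_jI fun j hj => ?_
  have := hN j hj
  rw [h0, map_zero] at this
  exact (mul_eq_zero.1 this).resolve_right (pow_ne_zero s hj)

section ptJet

variable {h : ℂ → ℂ} {U : Set ℂ} {x : Pt 4} {θ : Field 2}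

theorem todaInv_eq_mk {u v w : Fin n} (x : Pt n) :
    todaInv h u v w x = ⟨tp h u v w x, -tq h u v w x⟩ :=
  Complex.ext rfl (neg_neg _).symm

theorem todaC_eq_gen {u v w : Fin n} (x : Pt n) : todaC h u v w x =
    ⟨genC₁ (sphereScale (planeCoord u v x))⁻¹ (tp h u v w x) (tq h u v w x)
      (deriv h (planeCoord u v x)).re (deriv h (planeCoord u v x)).im,
    -genC₂ (sphereScale (planeCoord u v x))⁻¹ (tp h u v w x) (tq h u v w x)
      (deriv h (planeCoord u v x)).re (deriv h (planeCoord u v x)).im⟩ := by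
  rw [todaC, todaInv_eq_mk, div_eq_mul_inv, ← Complex.ofReal_inv]
  generalize tp h u v w x = p
  generalize tq h u v w x = q
  generalize (sphereScale (planeCoord u v x))⁻¹ = r
  generalize deriv h (planeCoord u v x) = a
  apply Complex.ext <;> simp [pow_succ, genC₁, genC₂] <;> ring

theorem todaR_eq_gen {u v w : Fin n} (x : Pt n) : todaR h u v w x =
    ⟨genR₁ (x u) (x v) (sphereScale (planeCoord u v x))⁻¹ (tp h u v w x)
      (tq h u v w x) (deriv h (planeCoord u v x)).re (deriv h (planeCoord u v x)).im
      (deriv (deriv h) (planeCoord u v x)).re (deriv (deriv h) (planeCoord u v x)).im,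
    -genR₂ (x u) (x v) (sphereScale (planeCoord u v x))⁻¹ (tp h u v w x)
      (tq h u v w x) (deriv h (planeCoord u v x)).re (deriv h (planeCoord u v x)).im
      (deriv (deriv h) (planeCoord u v x)).re (deriv (deriv h) (planeCoord u v x)).im⟩ := by
  have e1 : (planeCoord u v x).re = x u := rfl
  have e2 : (planeCoord u v x).im = x v := rfl
  rw [todaR, todaInv_eq_mk, div_eq_mul_inv, div_eq_mul_inv, div_eq_mul_inv, ← Complex.ofReal_pow,
    ← Complex.ofReal_inv, ← Complex.ofReal_inv, ← inv_pow, ← e1, ← e2]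
  generalize tp h u v w x = p
  generalize tq h u v w x = q
  generalize (sphereScale (planeCoord u v x))⁻¹ = r
  generalize deriv (deriv h) (planeCoord u v x) = b
  generalize deriv h (planeCoord u v x) = a
  generalize planeCoord u v x = ζ
  rw [Complex.ofReal_pow]
  apply Complex.ext <;> simp [pow_succ, genR₁, genR₂] <;> ring

theorem normSq_ptJet : Complex.normSq ((x 2 : ℂ) + h (planeCoord 0 1 x))
    = (ptJet h x .z + ptJet h x (.re 0)) ^ 2 + ptJet h x (.im 0) ^ 2 := by
  simp [Complex.normSq_apply, ptJet, hJet]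
  ring

theorem normSq_ptJet_ne (hx : x ∈ einsteinDomain U h) :
    (ptJet h x .z + ptJet h x (.re 0)) ^ 2 + ptJet h x (.im 0) ^ 2 ≠ 0 := by
  rw [← normSq_ptJet]
  exact (Complex.normSq_pos.2 (mem_kahlerDomain.1 hx.1).1.2).ne'

theorem tp_eq_ptJet : tp h 0 1 2 x = (ptJet h x .z + ptJet h x (.re 0))
    / ((ptJet h x .z + ptJet h x (.re 0)) ^ 2 + ptJet h x (.im 0) ^ 2) := by
  rw [tp_eq_gen, normSq_ptJet]
  simp [ptJet, hJet]

theorem tq_eq_ptJet : tq h 0 1 2 x = ptJet h x (.im 0)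
    / ((ptJet h x .z + ptJet h x (.re 0)) ^ 2 + ptJet h x (.im 0) ^ 2) := by
  rw [tq_eq_gen, normSq_ptJet]
  simp [ptJet, hJet]

theorem tw_eq_ptJet (hx : x ∈ einsteinDomain U h) : tw h x =
    (ptJet h x (.re 0) * ptJet h x .z + (ptJet h x (.re 0) ^ 2 + ptJet h x (.im 0) ^ 2))
    / ((ptJet h x .z + ptJet h x (.re 0)) ^ 2 + ptJet h x (.im 0) ^ 2) := by
  have e : x 2 = ptJet h x .z := rfl
  have h0 := normSq_ptJet_ne hx
  rw [tw, tp_eq_ptJet, e]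
  field_simp
  ring

theorem jetDen_ptJet (hx : x ∈ einsteinDomain U h) : jetDen (ptJet h x) ≠ 0 := by
  have h1 := (mem_kahlerDomain.1 hx.1).2.ne'
  rw [tw_eq_ptJet hx] at h1
  have hz : ptJet h x .z ≠ 0 := hx.2
  exact mul_ne_zero (mul_ne_zero hz (div_ne_zero_iff.1 h1).1) (normSq_ptJet_ne hx)

theorem jev_ptJet_jp (hx : x ∈ einsteinDomain U h) : jev (ptJet h x) jp = tp h 0 1 2 x := by
  rw [jev_jp (jetDen_ptJet hx), tp_eq_ptJet]

theorem jev_ptJet_jq (hx : x ∈ einsteinDomain U h) : jev (ptJet h x) jq = tq h 0 1 2 x := by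
  rw [jev_jq (jetDen_ptJet hx), tq_eq_ptJet]

theorem jev_ptJet_jwi (hx : x ∈ einsteinDomain U h) : jev (ptJet h x) jwi = (tw h x)⁻¹ := by
  rw [jev_jwi (jetDen_ptJet hx), tw_eq_ptJet hx, inv_div]

theorem jev_ptJet_jr : jev (ptJet h x) jr = (sphereScale (planeCoord 0 1 x))⁻¹ := by
  rw [jev_jr, sphereScale, inv_div, Complex.normSq_apply]
  simp only [ptJet, hJet, sq]

theorem jev_ptJet_jI (hx : x ∈ einsteinDomain U h) : jev (ptJet h x) jI = curvInv h x := by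
  have hw := (mem_kahlerDomain.1 hx.1).2.ne'
  have hz : x 2 ≠ 0 := hx.2
  have e0 : ptJet h x .x = x 0 := rfl
  have e1 : ptJet h x .y = x 1 := rfl
  have e2 : ptJet h x .z = x 2 := rfl
  have e3 : ptJet h x (.re 1) = (deriv h (planeCoord 0 1 x)).re := by
    simp [ptJet, hJet]
  have e4 : ptJet h x (.im 1) = (deriv h (planeCoord 0 1 x)).im := by
    simp [ptJet, hJet]
  have e5 : ptJet h x (.re 2) = (deriv (deriv h) (planeCoord 0 1 x)).re := by
    simp [ptJet, hJet, iteratedDeriv_succ]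
  have e6 : ptJet h x (.im 2) = (deriv (deriv h) (planeCoord 0 1 x)).im := by
    simp [ptJet, hJet, iteratedDeriv_succ]
  have c1 : tc₁ h 0 1 2 x = _ := congrArg Complex.re (todaC_eq_gen x)
  have c2 : -tc₂ h 0 1 2 x = _ := (neg_neg _).trans (congrArg Complex.im (todaC_eq_gen x))
  have r1 : tr₁ h 0 1 2 x = _ := congrArg Complex.re (todaR_eq_gen x)
  have r2 : -tr₂ h 0 1 2 x = _ := (neg_neg _).trans (congrArg Complex.im (todaR_eq_gen x))
  dsimp only at c1 c2 r1 r2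
  rw [jI, map_genI, map_genC₁, map_genC₂, map_genR₁, map_genR₂, jev_jzi (jetDen_ptJet hx),
    jev_ptJet_jwi hx, jev_ptJet_jp hx, jev_ptJet_jq hx, jev_ptJet_jr]
  simp only [jev_jv, e0, e1, e2, e3, e4, e5, e6]
  rw [← c1, ← neg_inj.1 c2, ← r1, ← neg_inj.1 r2]
  have e : tw h x = 1 - x 2 * tp h 0 1 2 x := rfl
  simp only [genI, curvInv, Fin.sum_univ_three, eM, Matrix.of_apply, Matrix.cons_val',
    Matrix.cons_val_zero, Matrix.cons_val_one, Matrix.cons_val, eM₁₁, eM₂₂, eM₁₂, eM₁₃, eM₂₃, eM₃₃,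
    eD, tw₃, ← e, neg_sq, div_eq_mul_inv, mul_inv, inv_pow]
  ring

/-- The action of the coordinate fields on functions of the jet. -/
def totalCoord : Fin 4 → Derivation ℝ JetRing JetRing := ![totalX, totalY, totalZ, 0]

theorem differentiableOn_iteratedDeriv (hU : IsOpen U) (hh : DifferentiableOn ℂ h U) (k : ℕ) :
    DifferentiableOn ℂ (iteratedDeriv k h) U := by
  induction k with
  | zero => rwa [iteratedDeriv_zero]
  | succ k ih =>
    rw [iteratedDeriv_succ]
    exact ih.deriv hU

theorem hasDir_ptJet (hU : IsOpen U) (hh : DifferentiableOn ℂ h U) (hx : planeCoord 0 1 x ∈ U)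
    (i : Fin 4) (v : JetVar) :
    HasDir (fun y => ptJet h y v) (jev (ptJet h x) (totalCoord i (jv v))) x (Pi.single i 1) := by
  have hc : ∀ k, HasDir (fun y : Pt 4 => y k) (if i = k then 1 else 0) x (Pi.single i 1) :=
    fun k => ⟨(hasD_coord k).1, (hasD_coord k).2 i⟩
  have hk : ∀ k, HasD (fun y : Pt 4 => iteratedDeriv k h (planeCoord 0 1 y))
      (fun i => iteratedDeriv (k + 1) h (planeCoord 0 1 x) * dPlane 0 1 i) x := fun k => by
    rw [iteratedDeriv_succ]
    exact hasD_holo hU hx (differentiableOn_iteratedDeriv hU hh k)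
  rcases v with _ | _ | _ | k | k
  · refine ⟨(hc 0).1, (hc 0).2.trans ?_⟩
    fin_cases i <;> simp [totalCoord, totalX, totalY, totalZ, jetDer_jv]
  · refine ⟨(hc 1).1, (hc 1).2.trans ?_⟩
    fin_cases i <;> simp [totalCoord, totalX, totalY, totalZ, jetDer_jv]
  · refine ⟨(hc 2).1, (hc 2).2.trans ?_⟩
    fin_cases i <;> simp [totalCoord, totalX, totalY, totalZ, jetDer_jv]
  · refine ⟨(hk k).re.1, ((hk k).re.2 i).trans ?_⟩
    fin_cases i <;>
      simp [totalCoord, totalX, totalY, totalZ, jetDer_jv, dPlane, jev_jv, ptJet, hJet]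
  · refine ⟨(hk k).im.1, ((hk k).im.2 i).trans ?_⟩
    fin_cases i <;>
      simp [totalCoord, totalX, totalY, totalZ, jetDer_jv, dPlane, jev_jv, ptJet, hJet]

theorem jetDer_coord (f : JetVar → JetRing) : jetDer (fun v => jetDer f (jv v)) = jetDer f := by
  simp only [jetDer_jv]

theorem hasDir_jev_ptJet (hU : IsOpen U) (hh : DifferentiableOn ℂ h U)
    (hx : x ∈ einsteinDomain U h) (i : Fin 4) (F : JetRing) :
    HasDir (fun y => jev (ptJet h y) F) (jev (ptJet h x) (totalCoord i F)) x (Pi.single i 1) := by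
  have key : totalCoord i F = jetDer (fun v => totalCoord i (jv v)) F := by
    fin_cases i
    · change totalX F = jetDer (fun v => totalX (jv v)) F
      rw [totalX, jetDer_coord]
    · change totalY F = jetDer (fun v => totalY (jv v)) F
      rw [totalY, jetDer_coord]
    · change totalZ F = jetDer (fun v => totalZ (jv v)) F
      rw [totalZ, jetDer_coord]
    · exact (jetDer_zero F).symm
  rw [key]
  exact hasDir_jev (jetDen_ptJet hx) (hasDir_ptJet hU hh hx.1.1.1 i) F

theorem pd_jev_ptJet (hU : IsOpen U) (hh : DifferentiableOn ℂ h U)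
    (hx : x ∈ einsteinDomain U h) (i : Fin 4) (F : JetRing) :
    pd i (fun y => jev (ptJet h y) F) x = jev (ptJet h x) (totalCoord i F) :=
  (hasDir_jev_ptJet hU hh hx i F).2

theorem contDiffOn_jev_ptJet (hU : IsOpen U) (hh : DifferentiableOn ℂ h U) (F : JetRing) :
    ContDiffOn ℝ ∞ (fun y => jev (ptJet h y) F) (einsteinDomain U h) := by
  have hv : ∀ v, ContDiffOn ℝ ∞ (fun y => ptJet h y v) (einsteinDomain U h) := by
    have hk : ∀ k, ContDiffOn ℝ ∞ (fun y : Pt 4 => iteratedDeriv k h (planeCoord 0 1 y))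
        (einsteinDomain U h) := fun k =>
      (contDiffOn_holo hU (differentiableOn_iteratedDeriv hU hh k) 0 1).mono fun y hy => hy.1.1.1
    rintro (_ | _ | _ | k | k)
    · exact (contDiff_apply ℝ ℝ (0 : Fin 4)).contDiffOn
    · exact (contDiff_apply ℝ ℝ (1 : Fin 4)).contDiffOn
    · exact (contDiff_apply ℝ ℝ (2 : Fin 4)).contDiffOn
    · exact contDiffOn_re (hk k)
    · exact contDiffOn_im (hk k)
  induction F using MvPolynomial.induction_on with
  | C a => exact contDiffOn_const.congr fun y _ => MvPolynomial.eval_C a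
  | add p q hp hq => exact (hp.add hq).congr fun y _ => map_add _ _ _
  | mul_X p o hp =>
    refine (hp.mul ?_).congr fun y _ => map_mul _ _ _
    rcases o with _ | v
    · refine (ContDiffOn.inv (f := fun y => jetDen (ptJet h y)) ?_ fun y hy => jetDen_ptJet hy).congr
        fun y _ => jev_jinv _
      exact ((hv .z).mul (((hv (.re 0)).mul (hv .z)).add
        (((hv (.re 0)).pow 2).add ((hv (.im 0)).pow 2)))).mul
        ((((hv .z).add (hv (.re 0))).pow 2).add ((hv (.im 0)).pow 2))
    · exact (hv v).congr fun y _ => jev_jv _ _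

theorem gradInv_jev_ptJet (hU : IsOpen U) (hh : DifferentiableOn ℂ h U)
    (hx : x ∈ einsteinDomain U h) (F : JetRing) : gradInv h (fun y => jev (ptJet h y) F) x
      = jev (ptJet h x) (formalGrad jA jB F) := by
  have hz : jev (ptJet h x) (jv .z) = x 2 := jev_jv _ _
  rw [gradInv, pd_jev_ptJet hU hh hx, pd_jev_ptJet hU hh hx, pd_jev_ptJet hU hh hx]
  simp only [formalGrad, jA, jB, map_add, map_mul, map_pow, hz, jev_ptJet_jwi hx, jev_ptJet_jp hx,
    jev_ptJet_jq hx, jev_ptJet_jr]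
  simp only [totalCoord, Matrix.cons_val_zero, Matrix.cons_val_one, Matrix.cons_val, div_eq_mul_inv,
    inv_pow]
  ring

section killing

variable {X : Field 4} {V : Set (Pt 4)}

theorem dirD_jI (hU : IsOpen U) (hh : DifferentiableOn ℂ h U) (hθ : IsBetaPotential U h θ)
    (hVo : IsOpen V) (hV : V ⊆ einsteinDomain U h) (hX : IsKillingOn (einsteinMetric h θ) X V)
    (hx : x ∈ V) : dirD X (fun y => jev (ptJet h y) jI) x = 0 := by
  rw [← dirD_curvInv hU hh hθ hVo hV hX hx]
  refine dirD_congr ?_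
  filter_upwards [hVo.mem_nhds hx] with y hy using jev_ptJet_jI (hV hy)

theorem dirD_formalGrad (hU : IsOpen U) (hh : DifferentiableOn ℂ h U) (hθ : IsBetaPotential U h θ)
    (hVo : IsOpen V) (hV : V ⊆ einsteinDomain U h) (hX : IsKillingOn (einsteinMetric h θ) X V)
    {F : JetRing} (h0 : ∀ x ∈ V, dirD X (fun y => jev (ptJet h y) F) x = 0)
    (hx : x ∈ V) : dirD X (fun y => jev (ptJet h y) (formalGrad jA jB F)) x = 0 := by
  rw [← dirD_gradInv hU hh hθ hVo hV hX ((contDiffOn_jev_ptJet hU hh F).mono hV) h0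
    (fun y hy => (pd_jev_ptJet hU hh (hV hy) 3 F).trans (map_zero _)) hx]
  refine dirD_congr ?_
  filter_upwards [hVo.mem_nhds hx] with y hy using (gradInv_jev_ptJet hU hh (hV hy) F).symm

/-- A Killing field is vertical where the Jacobian determinant of the invariants is not zero. -/
theorem killing_vertical (hU : IsOpen U) (hh : DifferentiableOn ℂ h U) (hθ : IsBetaPotential U h θ)
    (hVo : IsOpen V) (hV : V ⊆ einsteinDomain U h) (hX : IsKillingOn (einsteinMetric h θ) X V)
    (hx : x ∈ V) (hJ : jev (ptJet h x) (formalJac jI (formalGrad jA jB jI)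
      (formalGrad jA jB (formalGrad jA jB jI))) ≠ 0) : X x 0 = 0 ∧ X x 1 = 0 ∧ X x 2 = 0 := by
  have e1 : ∀ x ∈ V, _ := fun x hx => dirD_jI hU hh hθ hVo hV hX hx
  have e2 : ∀ x ∈ V, _ := fun x hx => dirD_formalGrad hU hh hθ hVo hV hX e1 hx
  have e3 := dirD_formalGrad hU hh hθ hVo hV hX e2 hx
  replace e1 := e1 x hx
  replace e2 := e2 x hx
  generalize formalGrad jA jB (formalGrad jA jB jI) = H at *
  generalize formalGrad jA jB jI = G at *
  generalize jI = F at *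
  simp only [dirD, Fin.sum_univ_four, pd_jev_ptJet hU hh (hV hx), totalCoord, Matrix.cons_val_zero,
    Matrix.cons_val_one, Matrix.cons_val, Derivation.coe_zero, Pi.zero_apply, map_zero, mul_zero,
    add_zero] at e1 e2 e3
  simp only [formalJac, map_add, map_mul, map_sub] at hJ
  generalize jev (ptJet h x) (totalX F) = f₁, jev (ptJet h x) (totalY F) = f₂,
    jev (ptJet h x) (totalZ F) = f₃, jev (ptJet h x) (totalX G) = g₁,
    jev (ptJet h x) (totalY G) = g₂, jev (ptJet h x) (totalZ G) = g₃,
    jev (ptJet h x) (totalX H) = h₁, jev (ptJet h x) (totalY H) = h₂,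
    jev (ptJet h x) (totalZ H) = h₃ at *
  refine ⟨(mul_eq_zero.1 ?_).resolve_right hJ, (mul_eq_zero.1 ?_).resolve_right hJ,
    (mul_eq_zero.1 ?_).resolve_right hJ⟩
  · linear_combination (g₂ * h₃ - g₃ * h₂) * e1 + (h₂ * f₃ - h₃ * f₂) * e2
      + (f₂ * g₃ - f₃ * g₂) * e3
  · linear_combination (g₃ * h₁ - g₁ * h₃) * e1 + (h₃ * f₁ - h₁ * f₃) * e2
      + (f₃ * g₁ - f₁ * g₃) * e3
  · linear_combination (g₁ * h₂ - g₂ * h₁) * e1 + (h₁ * f₂ - h₂ * f₁) * e2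
      + (f₁ * g₂ - f₂ * g₁) * e3

end killing

end ptJet

/-! ### Generic holomorphic functions -/

section generic

variable {h : ℂ → ℂ} {U : Set ℂ} {N : MvPolynomial JetVar ℝ}

theorem contDiffAt_holo (hU : IsOpen U) (hh : DifferentiableOn ℂ h U) {ζ : ℂ} (hζ : ζ ∈ U) {k : ℕ} :
    ContDiffAt ℂ k h ζ := (hh.analyticAt (hU.mem_nhds hζ)).contDiffAt

theorem exists_iteratedDeriv_eq (ζ : ℂ) (c : ℕ → ℂ) (n : ℕ) :
    ∃ q : ℂ → ℂ, Differentiable ℂ q ∧ ∀ k < n, iteratedDeriv k q ζ = c k := by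
  induction n with
  | zero => exact ⟨0, differentiable_const 0, fun k hk => absurd hk (Nat.not_lt_zero k)⟩
  | succ n ih =>
    obtain ⟨q, hq, h1⟩ := ih
    set a : ℂ := (c n - iteratedDeriv n q ζ) / n.factorial
    have hd : Differentiable ℂ fun w : ℂ => (w - ζ) ^ n := by fun_prop
    have hp : ∀ k, iteratedDeriv k (fun w : ℂ => (w - ζ) ^ n) ζ
        = if k = n then (n.factorial : ℂ) else 0 := fun k => by
      have := congrFun (iteratedDeriv_comp_sub_const k (fun w : ℂ => w ^ n) ζ) ζ
      rw [this, sub_self, iteratedDeriv_fun_pow_zero]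
      split_ifs <;> simp
    refine ⟨q + a • fun w : ℂ => (w - ζ) ^ n, hq.add (hd.const_smul a), fun k hk => ?_⟩
    rw [iteratedDeriv_add hq.contDiff.contDiffAt (hd.const_smul a).contDiff.contDiffAt,
      iteratedDeriv_const_smul hd.contDiff.contDiffAt, hp]
    split_ifs with hkn
    · subst hkn
      have : (k.factorial : ℂ) ≠ 0 := Nat.cast_ne_zero.2 k.factorial_ne_zero
      simp only [a, smul_eq_mul]
      field_simp
      ring
    · rw [smul_zero, add_zero, h1 k (by omega)]

/-- The holomorphic functions whose jets are not all zeros of `N`. -/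
def genericSet (U : Set ℂ) (N : MvPolynomial JetVar ℝ) : Set (ℂ → ℂ) :=
  {h | DifferentiableOn ℂ h U ∧ ∃ ζ ∈ U, ∃ z : ℝ, MvPolynomial.eval (hJet h ζ z) N ≠ 0}

theorem genericSet_isOpen (hU : IsOpen U) (hh : h ∈ genericSet U N) :
    ∃ K ⊆ U, IsCompact K ∧ ∃ ε > 0, ∀ f : ℂ → ℂ, DifferentiableOn ℂ f U →
      (∀ ζ ∈ K, ‖f ζ - h ζ‖ < ε) → f ∈ genericSet U N := by
  obtain ⟨hd, ζ, hζ, z, hN⟩ := hh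
  obtain ⟨r, hr, hrU⟩ := Metric.nhds_basis_closedBall.mem_iff.1 (hU.mem_nhds hζ)
  have hO : IsOpen {j : JetVar → ℝ | MvPolynomial.eval j N ≠ 0} :=
    isOpen_compl_singleton.preimage (MvPolynomial.continuous_eval N)
  obtain ⟨I, u, hu, hI⟩ := isOpen_pi_iff.1 hO _ hN
  have key : ∀ i ∈ I, ∀ᶠ ε in nhdsWithin (0 : ℝ) (Set.Ioi 0), ∀ f : ℂ → ℂ, DifferentiableOn ℂ f U →
      (∀ ζ' ∈ Metric.closedBall ζ r, ‖f ζ' - h ζ'‖ < ε) → hJet f ζ z i ∈ u i := by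
    intro i hi
    obtain ⟨δ, hδ, hb⟩ := Metric.isOpen_iff.1 (hu i hi).1 _ (hu i hi).2
    have bound : ∀ k, ∀ᶠ ε in nhdsWithin (0 : ℝ) (Set.Ioi 0), ∀ f : ℂ → ℂ, DifferentiableOn ℂ f U →
        (∀ ζ' ∈ Metric.closedBall ζ r, ‖f ζ' - h ζ'‖ < ε) →
          ‖iteratedDeriv k f ζ - iteratedDeriv k h ζ‖ < δ := fun k => by
      have hc : Filter.Tendsto (fun ε : ℝ => k.factorial * ε / r ^ k) (nhds 0) (nhds 0) := by
        have : Continuous fun ε : ℝ => k.factorial * ε / r ^ k := by fun_prop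
        simpa using this.tendsto 0
      filter_upwards [(hc.mono_left nhdsWithin_le_nhds).eventually_lt_const hδ] with ε hε f hf hfh
      rw [← iteratedDeriv_sub (contDiffAt_holo hU hf hζ) (contDiffAt_holo hU hd hζ)]
      refine (Complex.norm_iteratedDeriv_le_of_forall_mem_sphere_norm_le k hr
        (DifferentiableOn.diffContOnCl ?_) fun w hw =>
          (hfh w (Metric.sphere_subset_closedBall hw)).le).trans_lt hε
      rw [closure_ball ζ hr.ne']
      exact (hf.sub hd).mono hrU
    rcases i with _ | _ | _ | k | k
    · exact .of_forall fun ε f _ _ => hb (Metric.mem_ball_self hδ)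
    · exact .of_forall fun ε f _ _ => hb (Metric.mem_ball_self hδ)
    · exact .of_forall fun ε f _ _ => hb (Metric.mem_ball_self hδ)
    · filter_upwards [bound k] with ε hε f hf hfh
      refine hb (lt_of_le_of_lt ?_ (hε f hf hfh))
      exact Complex.abs_re_le_norm (iteratedDeriv k f ζ - iteratedDeriv k h ζ)
    · filter_upwards [bound k] with ε hε f hf hfh
      refine hb (lt_of_le_of_lt ?_ (hε f hf hfh))
      exact Complex.abs_im_le_norm (iteratedDeriv k f ζ - iteratedDeriv k h ζ)
  obtain ⟨ε, h1, h2⟩ := (((Filter.eventually_all_finset I).2 key).and self_mem_nhdsWithin).exists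
  exact ⟨_, hrU, isCompact_closedBall ζ r, ε, h2, fun f hf hfh =>
    ⟨hf, ζ, hζ, z, hI fun i hi => h1 i hi f hf hfh⟩⟩

theorem exists_jet_ne_zero (hU : IsOpen U) (hU0 : U.Nonempty) (hN : N ≠ 0) :
    ∃ j : JetVar → ℝ, (⟨j .x, j .y⟩ : ℂ) ∈ U ∧ MvPolynomial.eval j N ≠ 0 := by
  obtain ⟨ζ, hζ⟩ := hU0
  have hopen : IsOpen {p : ℝ × ℝ | (⟨p.1, p.2⟩ : ℂ) ∈ U} :=
    hU.preimage Complex.equivRealProdCLM.symm.continuous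
  obtain ⟨A, B, hA, hB, hζA, hζB, hAB⟩ := isOpen_prod_iff.1 hopen ζ.re ζ.im hζ
  by_contra! hcon
  refine hN (MvPolynomial.funext_set (fun v => match v with
    | .x => A
    | .y => B
    | _ => Set.univ) (fun v => ?_) fun j hj => ?_)
  · rcases v with _ | _ | _ | _ | _
    · exact infinite_of_mem_nhds ζ.re (hA.mem_nhds hζA)
    · exact infinite_of_mem_nhds ζ.im (hB.mem_nhds hζB)
    all_goals exact Set.infinite_univ
  · rw [map_zero]
    have h1 : (j .x, j .y) ∈ {p : ℝ × ℝ | (⟨p.1, p.2⟩ : ℂ) ∈ U} :=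
      hAB ⟨hj .x trivial, hj .y trivial⟩
    exact hcon j h1

theorem exists_order_bound (N : MvPolynomial JetVar ℝ) : ∃ n : ℕ, ∀ v ∈ N.vars, match v with
    | .re k => k < n
    | .im k => k < n
    | _ => True := by
  classical
  let o : JetVar → ℕ := fun v => match v with
    | .re k => k
    | .im k => k
    | _ => 0
  refine ⟨N.vars.sup o + 1, fun v hv => ?_⟩
  have h1 : o v ≤ N.vars.sup o := Finset.le_sup hv
  rcases v with _ | _ | _ | k | k
  · trivial
  · trivial
  · trivial
  · exact Nat.lt_succ_of_le h1
  · exact Nat.lt_succ_of_le h1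

theorem genericSet_dense (hU : IsOpen U) (hU0 : U.Nonempty) (hN : N ≠ 0)
    (hh : DifferentiableOn ℂ h U) {K : Set ℂ} (hK : IsCompact K) {ε : ℝ} (hε : 0 < ε) :
    ∃ f ∈ genericSet U N, ∀ ζ ∈ K, ‖f ζ - h ζ‖ < ε := by
  obtain ⟨j, hj, hjN⟩ := exists_jet_ne_zero hU hU0 hN
  obtain ⟨n, hn⟩ := exists_order_bound N
  set ζ : ℂ := ⟨j .x, j .y⟩
  obtain ⟨q, hq, hqd⟩ := exists_iteratedDeriv_eq ζ
    (fun k => ⟨j (.re k), j (.im k)⟩ - iteratedDeriv k h ζ) n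
  obtain ⟨C, hC⟩ := hK.exists_bound_of_continuousOn hq.continuous.continuousOn
  set j₀ := hJet h ζ (j .z)
  set P : Polynomial ℝ := MvPolynomial.aeval
    (fun v => Polynomial.C (j₀ v) + Polynomial.X * Polynomial.C (j v - j₀ v)) N
  have hP : ∀ s : ℝ, P.eval s = MvPolynomial.eval (fun v => j₀ v + s * (j v - j₀ v)) N := fun s => by
    have h1 : P.eval s = (Polynomial.evalRingHom s) P := rfl
    rw [h1]
    refine MvPolynomial.hom_congr_vars (f₁ := (Polynomial.evalRingHom s).comp
      (MvPolynomial.aeval _).toRingHom) (f₂ := MvPolynomial.eval _) ?_ (fun v _ _ => ?_) rfl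
    · ext a
      simp
    · simp
  have hP0 : P ≠ 0 := fun h0 => hjN <| by
    have := hP 1
    simpa [h0] using this.symm
  have hs0 : 0 < ε / (|C| + 1) := div_pos hε (by positivity)
  obtain ⟨s, hs, hsP⟩ := (Set.Ioo_infinite hs0).exists_notMem_finset P.roots.toFinset
  have hs1 : P.eval s ≠ 0 := fun h0 => hsP <| by
    rw [Multiset.mem_toFinset, Polynomial.mem_roots hP0]
    exact h0
  have hsq : Differentiable ℂ ((s : ℂ) • q) := hq.const_smul _
  refine ⟨h + (s : ℂ) • q, ⟨hh.add hsq.differentiableOn, ζ, hj, j .z, ?_⟩, fun w hw => ?_⟩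
  · rw [hP s] at hs1
    refine fun h0 => hs1 (h0 ▸ ?_)
    refine MvPolynomial.hom_congr_vars (by ext; simp) (fun v hv _ => ?_) rfl
    simp only [MvPolynomial.eval_X]
    have hk : ∀ k < n, iteratedDeriv k (h + (s : ℂ) • q) ζ = iteratedDeriv k h ζ
        + s * (⟨j (.re k), j (.im k)⟩ - iteratedDeriv k h ζ) := fun k hk => by
      rw [iteratedDeriv_add (contDiffAt_holo hU hh hj) hsq.contDiff.contDiffAt,
        iteratedDeriv_const_smul hq.contDiff.contDiffAt, hqd k hk, smul_eq_mul]
    have hv' := hn v hv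
    rcases v with _ | _ | _ | k | k
    · simp [j₀, hJet, ζ]
    · simp [j₀, hJet, ζ]
    · simp [j₀, hJet]
    · refine Eq.trans ?_ (congrArg Complex.re (hk k hv')).symm
      simp [j₀, hJet]
    · refine Eq.trans ?_ (congrArg Complex.im (hk k hv')).symm
      simp [j₀, hJet]
  · have e : (h + (s : ℂ) • q) w - h w = s * q w := by simp
    rw [e, norm_mul, Complex.norm_real, Real.norm_of_nonneg hs.1.le]
    have h1 : ‖q w‖ < |C| + 1 := ((hC w hw).trans (le_abs_self C)).trans_lt (lt_add_one _)
    calc s * ‖q w‖ ≤ s * (|C| + 1) := mul_le_mul_of_nonneg_left h1.le hs.1.le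
      _ < ε := (lt_div_iff₀ (by positivity)).1 hs.2

theorem isOpenDenseHolomorphic_genericSet (hU : IsOpen U) (hU0 : U.Nonempty) (hN : N ≠ 0) :
    IsOpenDenseHolomorphic U (genericSet U N) :=
  ⟨fun _ hh => hh.1, fun _ hh => genericSet_isOpen hU hh,
    fun _ hh _ _ hK _ hε => genericSet_dense hU hU0 hN hh hK hε⟩

theorem analyticOnNhd_eval_hJet (hU : IsOpen U) (hh : DifferentiableOn ℂ h U) :
    AnalyticOnNhd ℝ (fun p : ℂ × ℝ => MvPolynomial.eval (hJet h p.1 p.2) N) (U ×ˢ Set.univ) := by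
  have hk : ∀ k, AnalyticOnNhd ℝ (fun p : ℂ × ℝ => iteratedDeriv k h p.1) (U ×ˢ Set.univ) :=
    fun k p hp => (((differentiableOn_iteratedDeriv hU hh k).analyticAt
      (hU.mem_nhds hp.1)).restrictScalars (𝕜 := ℝ)).comp analyticAt_fst
  have hv : ∀ v, AnalyticOnNhd ℝ (fun p : ℂ × ℝ => hJet h p.1 p.2 v) (U ×ˢ Set.univ) := by
    rintro (_ | _ | _ | k | k) p hp
    · exact (Complex.reCLM.analyticAt _).comp analyticAt_fst
    · exact (Complex.imCLM.analyticAt _).comp analyticAt_fst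
    · exact analyticAt_snd
    · exact (Complex.reCLM.analyticAt _).comp (hk k p hp)
    · exact (Complex.imCLM.analyticAt _).comp (hk k p hp)
  have := AnalyticOnNhd.aeval_mvPolynomial hv N
  simpa only [MvPolynomial.aeval_eq_eval] using this

theorem eventually_mem_of_planeCoord {W : Set (Pt 4)} (hW : IsOpen W) {x : Pt 4} (hx : x ∈ W) :
    ∀ᶠ p : ℂ × ℝ in nhds (planeCoord 0 1 x, x 2), (![p.1.re, p.1.im, p.2, x 3] : Pt 4) ∈ W := by
  have hc : Continuous fun p : ℂ × ℝ => (![p.1.re, p.1.im, p.2, x 3] : Pt 4) := by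
    refine continuous_pi fun i => ?_
    fin_cases i
    · exact Complex.continuous_re.comp continuous_fst
    · exact Complex.continuous_im.comp continuous_fst
    · exact continuous_snd
    · exact continuous_const
  have hx' : (![(planeCoord 0 1 x).re, (planeCoord 0 1 x).im, x 2, x 3] : Pt 4) = x := by
    funext i; fin_cases i <;> rfl
  exact hc.tendsto _ (by dsimp only; rw [hx']; exact hW.mem_nhds hx)

theorem exists_ptJet_ne_zero (hU : IsOpen U) (hUc : IsPreconnected U) (hh : h ∈ genericSet U N)
    {W : Set (Pt 4)} (hW : IsOpen W) {x : Pt 4} (hx : x ∈ W) (hxU : planeCoord 0 1 x ∈ U) :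
    ∃ y ∈ W, MvPolynomial.eval (ptJet h y) N ≠ 0 := by
  by_contra! hcon
  obtain ⟨hd, ζ, hζ, z, hN⟩ := hh
  have e : ∀ p : ℂ × ℝ, ptJet h ![p.1.re, p.1.im, p.2, x 3] = hJet h p.1 p.2 := fun p => by
    simp [ptJet, planeCoord]
  have hzero : (fun p : ℂ × ℝ => MvPolynomial.eval (hJet h p.1 p.2) N)
      =ᶠ[nhds (planeCoord 0 1 x, x 2)] 0 :=
    (eventually_mem_of_planeCoord hW hx).mono fun p hp => (e p ▸ hcon _ hp :)
  have key := (analyticOnNhd_eval_hJet (N := N) hU hd).eqOn_zero_of_preconnected_of_eventuallyEq_zero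
    (hUc.prod isPreconnected_univ) (Set.mk_mem_prod hxU (Set.mem_univ _)) hzero
  have h0 := @key (ζ, z) (Set.mk_mem_prod hζ (Set.mem_univ z))
  rw [Pi.zero_apply] at h0
  exact hN h0

end generic

/-! ### Killing fields for generic holomorphic functions -/

theorem fderiv_eq_zero_of_pd {f : Pt n → ℝ} {x : Pt n} (h : ∀ i, pd i f x = 0) :
    fderiv ℝ f x = 0 := by
  apply ContinuousLinearMap.coe_injective
  refine LinearMap.pi_ext' fun i => LinearMap.ext_ring ?_
  simpa [pd] using h i

section killing

variable {h : ℂ → ℂ} {U : Set ℂ} {x : Pt 4} {θ : Field 2} {X : Field 4} {V : Set (Pt 4)}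

/-- A vertical Killing field is a constant multiple of the coordinate field. -/
theorem killing_eq_of_vertical (hU : IsOpen U) (hh : DifferentiableOn ℂ h U)
    (hθ : IsBetaPotential U h θ) (hVo : IsOpen V) (hVc : IsConnected V)
    (hV : V ⊆ einsteinDomain U h) (hX : IsKillingOn (einsteinMetric h θ) X V)
    (h0 : ∀ x ∈ V, X x 0 = 0 ∧ X x 1 = 0 ∧ X x 2 = 0) :
    ∃ a : ℝ, ∀ p ∈ V, X p = a • partialT p := by
  have hpd : ∀ x ∈ V, ∀ i, pd i (fun y => X y 3) x = 0 := by
    intro x hx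
    have hz : ∀ k : Fin 4, (∀ y ∈ V, X y k = 0) → ∀ i, pd i (fun y => X y k) x = 0 := by
      intro k hk i
      have : (fun y => X y k) =ᶠ[nhds x] fun _ => 0 := by
        filter_upwards [hVo.mem_nhds hx] with y hy using hk y hy
      rw [pd, this.fderiv_eq]
      simp
    have z0 := hz 0 fun y hy => (h0 y hy).1
    have z1 := hz 1 fun y hy => (h0 y hy).2.1
    have z2 := hz 2 fun y hy => (h0 y hy).2.2
    obtain ⟨x0, x1, x2⟩ := h0 x hx
    have ht : ∀ i j, pd 3 (fun y => einsteinMetric h θ y i j) x = 0 := fun i j => by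
      have := (isKillingOn_einstein (h := h) (θ := θ) V).2 x hx i j
      simpa [lieMetric, partialT, Fin.sum_univ_four, pd] using this
    have hg : 0 < einsteinMetric h θ x 3 3 :=
      ((isConformalCoframe_einstein hU hh hθ).isRiemannianOn.2 x (hV hx)).diag_pos
    have hk : ∀ i, einsteinMetric h θ x 3 3 * pd i (fun y => X y 3) x
        + einsteinMetric h θ x i 3 * pd 3 (fun y => X y 3) x = 0 := fun i => by
      have := hX.2 x hx i 3
      simpa [lieMetric, Fin.sum_univ_four, x0, x1, x2, z0, z1, z2, ht] using this
    have h3 : pd 3 (fun y => X y 3) x = 0 := by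
      have : 2 * einsteinMetric h θ x 3 3 * pd 3 (fun y => X y 3) x = 0 := by
        linear_combination hk 3
      exact (mul_eq_zero.1 this).resolve_left (by positivity)
    intro i
    have := hk i
    rw [h3, mul_zero, add_zero] at this
    exact (mul_eq_zero.1 this).resolve_left hg.ne'
  obtain ⟨x₀, hx₀⟩ := hVc.nonempty
  refine ⟨X x₀ 3, fun p hp => ?_⟩
  have hc : X p 3 = X x₀ 3 := hVo.is_const_of_fderiv_eq_zero hVc.isPreconnected
    (fun y hy => (ContDiffOn.diffAt (hX.1 3) hVo hy).differentiableWithinAt)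
    (fun y hy => fderiv_eq_zero_of_pd (hpd y hy)) hp hx₀
  funext i
  obtain ⟨p0, p1, p2⟩ := h0 p hp
  fin_cases i
  · simpa [partialT] using p0
  · simpa [partialT] using p1
  · simpa [partialT] using p2
  · simpa [partialT] using hc

theorem exists_generic_killing (hU : IsOpen U) (hUc : IsConnected U) :
    ∃ 𝒪, IsOpenDenseHolomorphic U 𝒪 ∧ ∀ h ∈ 𝒪, ∀ θ, IsBetaPotential U h θ →
      ∀ V ⊆ einsteinDomain U h, IsOpen V → IsConnected V →
        ∀ X, IsKillingOn (einsteinMetric h θ) X V → ∃ a : ℝ, ∀ p ∈ V, X p = a • partialT p := by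
  obtain ⟨s, N, hN, hJ⟩ := exists_jacobian_numerator
  refine ⟨genericSet U N, isOpenDenseHolomorphic_genericSet hU hUc.nonempty hN, ?_⟩
  intro h hh θ hθ V hV hVo hVc X hX
  have hv : ∀ y ∈ V, MvPolynomial.eval (ptJet h y) N ≠ 0 → X y 0 = 0 ∧ X y 1 = 0 ∧ X y 2 = 0 :=
    fun y hy hy0 => killing_vertical hU hh.1 hθ hVo hV hX hy fun h0 => hy0 <| by
      rw [← hJ _ (jetDen_ptJet (hV hy)), h0, zero_mul]
  have hdense : ∀ k : Fin 4, (∀ y ∈ V, MvPolynomial.eval (ptJet h y) N ≠ 0 → X y k = 0) →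
      ∀ x ∈ V, X x k = 0 := by
    intro k hk x hx
    by_contra hne
    obtain ⟨y, hy, hyN⟩ := exists_ptJet_ne_zero hU hUc.isPreconnected hh
      ((hX.1 k).continuousOn.isOpen_inter_preimage hVo isOpen_compl_singleton)
      (x := x) ⟨hx, hne⟩ (hV hx).1.1.1
    exact hy.2 (hk y hy.1 hyN)
  exact killing_eq_of_vertical hU hh.1 hθ hVo hVc hV hX fun x hx =>
    ⟨hdense 0 (fun y hy hn => (hv y hy hn).1) x hx, hdense 1 (fun y hy hn => (hv y hy hn).2.1) x hx,
      hdense 2 (fun y hy hn => (hv y hy hn).2.2) x hx⟩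

end killing

end HyperCRToda

end

open HyperCRToda in
theorem mainTheorem2 :
    (∀ (U : Set ℂ) (h : ℂ → ℂ) (θ : Field 2), IsOpen U → DifferentiableOn ℂ h U →
      IsBetaPotential U h θ →
      -- the hyperCR Toda space, and the monopole on it
      (IsTodaOn (todaMetric h) (todaForm h) (todaDomain U h) ∧
        IsHyperCROn (todaMetric h) (todaForm h) (todaDomain U h)) ∧
      (IsMonopoleOn (todaMetric h) (todaForm h) (monopole h) (todaDomain U h) ∧
        IsMonopolePotentialOn (todaMetric h) (todaForm h) (monopole h) (totalPotential h θ)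
          (todaDomain U h)) ∧
      -- the scalar-flat Kähler metric
      (∃ J, IsKahlerOn (kahlerMetric h θ) J (kahlerDomain U h) ∧
        ∀ p ∈ kahlerDomain U h, ∀ k i, lieEnd partialT J p k i = 0) ∧
      IsKillingOn (kahlerMetric h θ) partialT (kahlerDomain U h) ∧
      (∀ p ∈ kahlerDomain U h, scalarCurv (kahlerMetric h θ) p = 0) ∧
      -- the selfdual Einstein metric of negative scalar curvature
      (∀ p ∈ einsteinDomain U h, einsteinMetric h θ p = (1 / p 2 ^ 2) • kahlerMetric h θ p) ∧
      IsRiemannianOn (einsteinMetric h θ) (einsteinDomain U h) ∧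
      IsEinsteinOn (einsteinMetric h θ) (-3) (einsteinDomain U h) ∧
      (∀ p ∈ einsteinDomain U h, scalarCurv (einsteinMetric h θ) p = -12) ∧
      IsSelfDualOn (einsteinMetric h θ) (-1) (einsteinDomain U h) ∧
      -- the symmetry and the hypercomplex structure
      IsKillingOn (einsteinMetric h θ) partialT (einsteinDomain U h) ∧
      (∃ I₁ I₂ I₃,
        IsCompatibleHypercomplexOn (einsteinMetric h θ) I₁ I₂ I₃ (einsteinDomain U h) ∧
        ∀ p ∈ einsteinDomain U h, ∀ k i,
          lieEnd partialT I₁ p k i = 0 ∧ lieEnd partialT I₂ p k i = 0 ∧ lieEnd partialT I₃ p k i = 0) ∧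
      -- the conformal infinity
      HasConformalInfinity (einsteinMetric h θ) (einsteinDomain U h) (fun p => p 2)
        boundaryMap (boundaryMetric h θ) (boundaryDomain U h) ∧
      IsEinsteinWeylOn (boundaryMetric h θ) (boundaryForm h θ) (boundaryDomain U h) ∧
      IsGeodesicSymmetryOn (boundaryMetric h θ) (boundaryForm h θ) boundaryPartialT
        (boundaryDomain U h)) ∧
    -- the explicit choice of `β`
    (∀ (U : Set ℂ) (h : ℂ → ℂ), IsOpen U → DifferentiableOn ℂ h U → (0 : ℂ) ∉ U →
      IsBetaPotential U h (standardTheta h)) ∧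
    -- for generic `h` the symmetry group is one-dimensional
    (∀ U : Set ℂ, IsOpen U → IsConnected U → ∃ 𝒪, IsOpenDenseHolomorphic U 𝒪 ∧
      ∀ h ∈ 𝒪, ∀ θ, IsBetaPotential U h θ → ∀ V ⊆ einsteinDomain U h, IsOpen V →
        IsConnected V → ∀ X, IsKillingOn (einsteinMetric h θ) X V →
          ∃ a : ℝ, ∀ p ∈ V, X p = a • partialT p) ∧
    -- for constant `h` these are the Pedersen metrics and the Berger spheres
    (∀ l m : ℝ, l ≠ 0 → ∀ h : ℂ → ℂ, (∀ ζ, h ζ = l * (1 + m * Complex.I)) →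
      IsBetaPotential {0}ᶜ h (eulerTheta l) ∧
      pedersenMap l m '' pedersenDomain
        = {p ∈ einsteinDomain {0}ᶜ h | 0 < l * p 2} ∧
      (∀ p ∈ pedersenDomain,
        pullback (pedersenMap l m) (einsteinMetric h (eulerTheta l)) p
          = (4 : ℝ) • pedersenMetric m p) ∧
      bergerMap l '' bergerDomain = boundaryDomain {0}ᶜ h ∧
      ∀ b ∈ bergerDomain,
        pullback (bergerMap l) (boundaryMetric h (eulerTheta l)) b
          = (l ^ 2 * (1 + m ^ 2)) • bergerMetric (1 / (1 + m ^ 2)) b ∧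
        pullbackForm (bergerMap l) (boundaryForm h (eulerTheta l)) b
          = (m / (1 + m ^ 2)) • sigma₃ b) := by
  refine ⟨fun U h θ hU hh hθ => ?_, fun U h hU hh h0 => isBetaPotential_standardTheta hU hh h0, ?_,
    fun l m hl h hh => ⟨isBetaPotential_eulerTheta (fun ζ => by rw [hh]; simp),
      image_pedersen hh hl, fun p hp => pullback_pedersen hh hl hp, image_berger hh hl,
      fun b hb => pullback_berger hh hl hb⟩⟩
  · exact ⟨⟨isTodaOn_toda hU hh, isHyperCROn_toda hU hh⟩,
      ⟨isMonopoleOn_toda hU hh hθ, isMonopolePotentialOn_toda hU hh hθ⟩,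
      ⟨_, isKahlerOn_kahler hU hh hθ, fun p _ k i => lieEnd_kahlerJ p k i⟩, isKillingOn_kahler _,
      fun p hp => scalarCurv_kahler hU hh hθ hp, fun p hp => einsteinMetric_eq hp,
      (isConformalCoframe_einstein hU hh hθ).isRiemannianOn, isEinsteinOn_einstein hU hh hθ,
      fun p hp => scalarCurv_einstein hU hh hθ hp, isSelfDualOn_einstein hU hh hθ,
      isKillingOn_einstein _, exists_hypercomplex hU hh hθ, hasConformalInfinity_einstein hU hh hθ,
      isEinsteinWeylOn_boundary hU hh hθ, isGeodesicSymmetryOn_boundary hU hh hθ⟩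
  · exact fun U hU hUc => exists_generic_killing hU hUc
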